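/- Setting. Let $\mathbb T=\mathbb R/2\pi\mathbb Z$. For functions on $\mathbb T\times\mathbb R$ with frequencies $(k,\xi)\in\mathbb Z\times\mathbb R$ and for $s\in\mathbb R$, $t\ge 0$, let $\Lambda_t^s$ be the Fourier multiplier with symbol $(1+k^2+(\xi+tk)^2)^{s/2}$ and $\langle\partial_x\rangle$ the one with symbol $(1+k^2)^{1/2}$. Write $f_0=P_0f=\frac1{2\pi}\int_{\mathbb T}f\,dx$ and $f_{\neq}=f-f_0$. The velocity $u=(u^1,u^2)$ of a vorticity $\omega$ is the vector field in $L^2(\mathbb T\times\mathbb R)$ with $\operatorname{div}u=0$ and $\partial_xu^2-\partial_yu^1=\omega$. For $\nu>0$ let $(\omega^{\mathrm i},\theta^{\mathrm i})$, with velocity $u^{\mathrm i}$, be a solution on $[0,\nu^{-1/6}]$ of $$\begin{cases}\partial_t\omega^{\mathrm i}+y\partial_x\omega^{\mathrm i}-\nu\Delta\omega^{\mathrm i}+u^{\mathrm i}\cdot\nabla\omega^{\mathrm i}=\partial_x\theta^{\mathrm i},\\ \partial_t\theta^{\mathrm i}+y\partial_x\theta^{\mathrm i}+u_0^{\mathrm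 i,1}\partial_x\theta^{\mathrm i}-\nu\Delta\theta^{\mathrm i}=0,\\ \omega^{\mathrm i}(0)=\omega_{\mathrm{in}},\quad\theta^{\mathrm i}(0)=\theta_{\mathrm{in}},\end{cases}$$ with arbitrary initial data $(\omega_{\mathrm{in}},\theta_{\mathrm{in}})$, and let $(\omega^{\mathrm e},\theta^{\mathrm e})$, with velocity $u^{\mathrm e}$, be a solution on $[0,\nu^{-1/6}]$ of $$\begin{cases}\partial_t\omega^{\mathrm e}+y\partial_x\omega^{\mathrm e}-\nu\Delta\omega^{\mathrm e}+u^{\mathrm i}\cdot\nabla\omega^{\mathrm e}+u^{\mathrm e}\cdot\nabla\omega^{\mathrm i}+u^{\mathrm e}\cdot\nabla\omega^{\mathrm e}=\partial_x\theta^{\mathrm e},\\ \partial_t\theta^{\mathrm e}+y\partial_x\theta^{\mathrm e}-\nu\Delta\theta^{\mathrm e}+u^{\mathrm i}_{\neq}\cdot\nabla\theta^{\mathrm i}+u^{\mathrm i}\cdot\nabla\theta^{\mathrm e}+u^{\mathrm e}\cdot\nabla\theta^{\mathrm e}+u^{\mathrm e}\cdot\nabla\theta^{\mathrm i}=0,\\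 \omega^{\mathrm e}(0)=0,\quad\theta^{\mathrm e}(0)=0.\end{cases}$$ The equations hold in the sense of distributions, with $\omega^{\mathrm i},\theta^{\mathrm i},u^{\mathrm i},u^{\mathrm e}\in C([0,\nu^{-1/6}];L^2)$ and $\omega^{\mathrm e},\theta^{\mathrm e}\in C([0,\nu^{-1/6}];H^n)$, where $n$ is as below. Proposition. Let $m,n$ be real numbers with $m-3>n>2$. There is $\delta_0>0$, depending only on $m$ and $n$ (in particular independent of $\nu$), such that the following holds for every $\delta\in(0,\delta_0]$, every $0<\nu\le1$ and all solutions as above. If $$\|\Lambda_t^m\omega^{\mathrm i}(t)\|_{L^2}\le\delta\nu^{1/3}\quad\text{and}\quad\|\langle\partial_x\rangle\Lambda_t^m\theta^{\mathrm i}(t)\|_{L^2}\le\delta\nu^{2/3}\qquad\text{for all }t\in[0,\nu^{-1/6}],$$ then for all $0\le t\le\nu^{-1/6}$ $$\|\Lambda_t^n\omega^{\mathrm e}(t)\|_{L^2}\le\delta\nu^{2/3},\qquad \nu^{1/6}\|\partial_x\Lambda_t^n\theta^{\mathrm e}(t)\|_{L^2}+\|\Lambda_t^n\theta^{\mathrm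 e}(t)\|_{L^2}\le\delta\nu .$$ -/

import Mathlib

open MeasureTheory Set Filter Topology
open scoped FourierTransform ENNReal

noncomputable section

namespace Couette

instance two_pi_pos_fact : Fact ((0 : ℝ) < 2 * Real.pi) := ⟨Real.two_pi_pos⟩

/-- The cylinder `𝕋 × ℝ` with `𝕋 = ℝ / 2πℤ`. Its `volume` is Lebesgue measure `dx dy`, so that `𝕋`
has total mass `2π`. -/
abbrev Cyl : Type := AddCircle (2 * Real.pi) × ℝ

/-- Real scalar fields on `𝕋 × ℝ`. -/
abbrev Field : Type := Cyl → ℝ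

/-- Vector fields on `𝕋 × ℝ`, given by their two components `(v¹, v²)`. -/
abbrev VField : Type := (Cyl → ℝ) × (Cyl → ℝ)

/-! ### Fourier transform and the norms `‖σ(D) f‖` in `L²` -/

/-- The `k`-th Fourier coefficient in `x`: `f_k(y) = (2π)⁻¹ ∫_𝕋 f(x,y) e^{-ikx} dx`. -/
def modeX (f : Field) (k : ℤ) : ℝ → ℂ :=
  fun y => fourierCoeff (fun x : AddCircle (2 * Real.pi) => (f (x, y) : ℂ)) k

/-- The Fourier transform in `y` (Plancherel extension to `L²(ℝ)`) of the `k`-th mode of `f`, with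
Mathlib's normalization: for integrable `f_k` it is `ζ ↦ ∫ f_k(y) e^{-2πi y ζ} dy`. Thus
the frequency dual to `y` in the convention `e^{i y ξ}` is `ξ = 2π ζ`. -/
def hat (f : Field) (k : ℤ) : ℝ → ℂ :=
  open Classical in
  if h : MemLp (modeX f k) 2 (volume : Measure ℝ) then
    ((𝓕 (h.toLp (modeX f k)) : Lp (α := ℝ) ℂ 2 volume) : ℝ → ℂ)
  else 0

/-- `‖σ(D_x, D_y) f‖_{L²(𝕋 × ℝ)}` for the Fourier multiplier with symbol `σ(k, ξ)`, with values in
`[0, ∞]` (it is `∞` if `f` is not in `L²`). By Plancherel its square is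
`2π ∑_k ∫ σ(k, 2πζ)² |f̂_k(ζ)|² dζ`. -/
def multNorm (σ : ℤ → ℝ → ℝ) (f : Field) : ℝ≥0∞ :=
  open Classical in
  if MemLp f 2 (volume : Measure Cyl) then
    (ENNReal.ofReal (2 * Real.pi) *
      ∑' k : ℤ, ∫⁻ ζ : ℝ, ‖σ k (2 * Real.pi * ζ)‖ₑ ^ 2 * ‖hat f k ζ‖ₑ ^ 2) ^ (1 / 2 : ℝ)
  else ⊤

/-- The symbol `(1 + k² + (ξ + t k)²)^{s/2}` of `Λ_t^s`. -/
def symΛ (s t : ℝ) (k : ℤ) (ξ : ℝ) : ℝ :=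
  (1 + (k : ℝ) ^ 2 + (ξ + t * k) ^ 2) ^ (s / 2)

/-- `‖Λ_t^s f‖_{L²}`; for `t = 0` this is the Sobolev norm `‖f‖_{H^s}`. -/
def normΛ (s t : ℝ) (f : Field) : ℝ≥0∞ := multNorm (symΛ s t) f

/-- `‖∂_x Λ_t^s f‖_{L²}`. -/
def normDxΛ (s t : ℝ) (f : Field) : ℝ≥0∞ := multNorm (fun k ξ => |(k : ℝ)| * symΛ s t k ξ) f

/-- `‖⟨∂_x⟩ Λ_t^s f‖_{L²}`, where `⟨k⟩ = (1 + k²)^{1/2}`. -/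
def normJxΛ (s t : ℝ) (f : Field) : ℝ≥0∞ :=
  multNorm (fun k ξ => Real.sqrt (1 + (k : ℝ) ^ 2) * symΛ s t k ξ) f

/-- `f ∈ C([0,T]; L²)`. -/
def ContL2 (T : ℝ) (f : ℝ → Field) : Prop :=
  (∀ t ∈ Icc 0 T, MemLp (f t) 2 (volume : Measure Cyl)) ∧
  ∀ t ∈ Icc 0 T,
    Tendsto (fun r => eLpNorm (f r - f t) 2 (volume : Measure Cyl)) (𝓝[Icc 0 T] t) (𝓝 0)

/-- `f ∈ C([0,T]; H^s)`. -/
def ContSobolev (s T : ℝ) (f : ℝ → Field) : Prop :=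
  (∀ t ∈ Icc 0 T, normΛ s 0 (f t) < ⊤) ∧
  ∀ t ∈ Icc 0 T, Tendsto (fun r => normΛ s 0 (f r - f t)) (𝓝[Icc 0 T] t) (𝓝 0)

/-! ### Test functions and weak formulations -/

/-- `∂_x φ`. -/
def dx (φ : Field) : Field := fun z => deriv (fun h : ℝ => φ (z.1 + (h : AddCircle _), z.2)) 0

/-- `∂_y φ`. -/
def dy (φ : Field) : Field := fun z => deriv (fun h : ℝ => φ (z.1, z.2 + h)) 0

/-- `Δ φ`. -/
def lap (φ : Field) : Field := fun z => dx (dx φ) z + dy (dy φ) z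

/-- `φ ∈ C_c^∞(𝕋 × ℝ)`: smooth as a function on the universal cover `ℝ × ℝ`, compactly supported. -/
def IsTest (φ : Field) : Prop :=
  ContDiff ℝ (⊤ : ℕ∞) (fun p : ℝ × ℝ => φ ((p.1 : AddCircle _), p.2)) ∧ HasCompactSupport φ

/-- `⟨f, φ⟩ = ∫ f φ dx dy`. -/
def pair (f φ : Field) : ℝ := ∫ z : Cyl, f z * φ z

/-- Weak form of `- y ∂_x f + ν Δ f` against `φ`. -/
def shearDiffusion (ν : ℝ) (f φ : Field) : ℝ :=
  ∫ z : Cyl, f z * (z.2 * dx φ z + ν * lap φ z)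

/-- Weak form of `- v · ∇ g` against `φ`, for divergence free `v`: `∫ g v · ∇φ dx dy`. -/
def transport (v : VField) (g φ : Field) : ℝ :=
  ∫ z : Cyl, g z * (v.1 z * dx φ z + v.2 z * dy φ z)

/-- `u` is the velocity field in `L²` with vorticity `ω`: in the sense of distributions
`div u = 0` and `ω = ∂_x u² - ∂_y u¹`. (There is at most one such `u` up to null sets; it is
`∇^⊥ ψ = (-∂_y ψ, ∂_x ψ)` with `Δ ψ = ω`.) -/
structure IsVelocity (u : VField) (ω : Field) : Prop where
  memLp_fst : MemLp u.1 2 (volume : Measure Cyl)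
  memLp_snd : MemLp u.2 2 (volume : Measure Cyl)
  div_free : ∀ φ, IsTest φ → pair u.1 (dx φ) + pair u.2 (dy φ) = 0
  curl_eq : ∀ φ, IsTest φ → pair ω φ = pair u.1 (dy φ) - pair u.2 (dx φ)

/-- The zero mode `P_0 f(x, y) = (2π)⁻¹ ∫_𝕋 f(x', y) dx'`. -/
def zeroMode (f : Field) : Field :=
  fun z => (2 * Real.pi)⁻¹ * ∫ x : AddCircle (2 * Real.pi), f (x, z.2)

/-- The zero mode `(u_0^1, 0)` of a velocity field. -/
def velZero (u : VField) : VField := (zeroMode u.1, 0)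

/-- The nonzero modes `u_≠ = u - P_0 u` of a velocity field. -/
def velNe (u : VField) : VField := (u.1 - zeroMode u.1, u.2 - zeroMode u.2)

/-- `(ω, θ)`, with velocity `u`, is a (distributional) solution on `[0, T]` of the ideal system
* `∂_t ω + y ∂_x ω - ν Δ ω + u · ∇ ω = ∂_x θ`,
* `∂_t θ + y ∂_x θ + u_0^1 ∂_x θ - ν Δ θ = 0`,
* `ω(0) = ω_in`, `θ(0) = θ_in`.

The zero mode `u_0^1` is that of the velocity in `L²` of `ω`; its evolution equation
`∂_t u_0^1 - ν ∂_y² u_0^1 = - P_0(u_≠ · ∇ u_≠^1)` is the `y`-antiderivative of the zero mode of the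
equation for `ω`, so it is not listed separately. -/
structure IsIdealSolution (ν T : ℝ) (ωin θin : Field) (ω θ : ℝ → Field) (u : ℝ → VField) :
    Prop where
  cont_ω : ContL2 T ω
  cont_θ : ContL2 T θ
  cont_u₁ : ContL2 T (fun t => (u t).1)
  cont_u₂ : ContL2 T (fun t => (u t).2)
  velocity : ∀ t ∈ Icc 0 T, IsVelocity (u t) (ω t)
  init_ω : ω 0 =ᵐ[volume] ωin
  init_θ : θ 0 =ᵐ[volume] θin
  eq_ω : ∀ φ, IsTest φ → ∀ t ∈ Icc 0 T,
    pair (ω t) φ = pair ωin φ + ∫ s in (0 : ℝ)..t,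
      (shearDiffusion ν (ω s) φ + transport (u s) (ω s) φ - pair (θ s) (dx φ))
  eq_θ : ∀ φ, IsTest φ → ∀ t ∈ Icc 0 T,
    pair (θ t) φ = pair θin φ + ∫ s in (0 : ℝ)..t,
      (shearDiffusion ν (θ s) φ + transport (velZero (u s)) (θ s) φ)

/-- `(ωe, θe)`, with velocity `ue`, is a (distributional) solution in `C([0, T]; H^n)` of the error
system around `(ωi, θi)` with velocity `ui`:
* `∂_t ωe + y ∂_x ωe - ν Δ ωe + ui · ∇ ωe + ue · ∇ ωi + ue · ∇ ωe = ∂_x θe`,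
* `∂_t θe + y ∂_x θe - ν Δ θe + ui_≠ · ∇ θi + ui · ∇ θe + ue · ∇ θe + ue · ∇ θi = 0`,
* `ωe(0) = 0`, `θe(0) = 0`. -/
structure IsErrorSolution (ν n T : ℝ) (ωi θi : ℝ → Field) (ui : ℝ → VField)
    (ωe θe : ℝ → Field) (ue : ℝ → VField) : Prop where
  cont_ω : ContSobolev n T ωe
  cont_θ : ContSobolev n T θe
  cont_u₁ : ContL2 T (fun t => (ue t).1)
  cont_u₂ : ContL2 T (fun t => (ue t).2)
  velocity : ∀ t ∈ Icc 0 T, IsVelocity (ue t) (ωe t)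
  init_ω : ωe 0 =ᵐ[volume] 0
  init_θ : θe 0 =ᵐ[volume] 0
  eq_ω : ∀ φ, IsTest φ → ∀ t ∈ Icc 0 T,
    pair (ωe t) φ = ∫ s in (0 : ℝ)..t,
      (shearDiffusion ν (ωe s) φ + transport (ui s) (ωe s) φ + transport (ue s) (ωi s) φ
        + transport (ue s) (ωe s) φ - pair (θe s) (dx φ))
  eq_θ : ∀ φ, IsTest φ → ∀ t ∈ Icc 0 T,
    pair (θe t) φ = ∫ s in (0 : ℝ)..t,
      (shearDiffusion ν (θe s) φ + transport (velNe (ui s)) (θi s) φ + transport (ui s) (θe s) φ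
        + transport (ue s) (θe s) φ + transport (ue s) (θi s) φ)

end Couette

end

/-!
The proof is an energy estimate on the Fourier side, in the frame that moves with the shear flow
`y ∂_x`. At time `t` a point `p = (k, ζ)` of this frame stands for the frequency `(k, ξ)` with
`ξ = 2πζ - t k`. The symbol of `Λ_t^s` becomes the weight `⟨p⟩ˢ`, which does not depend on time, and
that of `-Δ` becomes `k² + ξ²`, which for `k ≠ 0` grows like `t²`.

**From weak solutions to ordinary differential equations.** Plane waves moving with the shear are
limits of test functions. Testing the weak equations against cut-off moving waves and removing the
cut-off shows that the spectrum of a solution has a representative, continuous in time and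
frequency, given by Duhamel's formula (`IsTransport.hasAmp`). At each frequency it solves
`∂_t W = -ν (k² + ξ²) W + B` (`IsEvol`), where `B` consists of convolutions. `IsErrorSpec` collects
these equations for the error and `exists_isErrorSpec` derives them. Weighted energies obey an exact
balance, in which half of the dissipation is available to absorb terms in divergence form
(`IsEvol.energy_le`, `integral_re_le`).

**The terms.** By the Biot–Savart law (`IsVelocity.isVelSpec`) the symbol of `u · ∇` is the vorticity
times a cross product of frequencies divided by `k² + ξ²`; the cross product does not see the shear.

* `u^i · ∇f` for an error `f` costs no derivative: the part of the pairing with a symmetric weight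
  vanishes because `u^i` is real and divergence free, and the difference of the weights gains a
  derivative (`IsVelSpec.energy_adv_le`).
* `u^i_≠ · ∇θ^i` decays like `(1 + t)^{-2}` by inviscid damping, so it is integrable in time
  (`IsVelSpec.enorm_adv_neMode_le_decay`).
* `u^e · ∇` of an ideal quantity is estimated directly; the gradient costs a factor
  `1 + t ≲ ν^{-1/6}`.
* `u^e · ∇` of an error is a divergence and is absorbed in the dissipation, at the cost of `ν^{-1}`
  and a square.
* For `∂_x θ^e` the Leibniz rule adds `∂_x u · ∇θ^e`, which is absorbed in the dissipation too;
  `∂_x u^i` decays like `(1 + t)^{-1}`, and `∂_x u^e` is bounded by the vorticity.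

The Biot–Savart law does not bound `u^e` by `ω^e` in `L²` at low frequencies with `k = 0`. There
the zero mode of the vorticity equation bounds `u^e` by the time integral of the vorticity flux
(`IsErrorSpec.sob_speed_le`).

**The bootstrap.** With `κ = ν^{1/6}` the time interval is `[0, κ⁻¹]`, and for data of size `e κ²` and
`e κ⁴` the energies of `ω^e`, `θ^e`, `∂_x θ^e` are propagated at the sizes `e κ⁴`, `e κ⁶ / 2`,
`e κ⁵ / 8` (`IsErrorSpec.energy_ω_le`, `IsErrorSpec.energy_θ_le`, `IsErrorSpec.energy_mulK_θ_le`).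
No estimate loses a power of `κ`: the linear term `∂_x θ^e` is made small by the factor `1 / 8`, and
all other terms carry an additional factor `e`. Hence smallness of `e` alone, uniformly in `ν`, closes
the argument (`IsErrorSpec.bootstrap`).
-/


open MeasureTheory Set Filter Topology
open scoped FourierTransform ENNReal

noncomputable section

namespace Couette

/-! ### Frequency space and weighted `L²` estimates for convolutions -/

/-- The measure `count ⊗ Lebesgue` on the frequency space `ℤ × ℝ`. A point `(k, ζ)` stands for the
frequency `(k, 2πζ)`, so that Plancherel's theorem and the convolution theorem carry no constants
in the second variable. -/
def freqVol : Measure (ℤ × ℝ) := Measure.count.prod volume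

instance : SigmaFinite freqVol := by unfold freqVol; infer_instance

instance : freqVol.IsAddLeftInvariant := by unfold freqVol; infer_instance

instance : freqVol.IsNegInvariant := by
  refine ⟨?_⟩
  have h := (Measure.measurePreserving_neg (Measure.count : Measure ℤ)).prod
    (Measure.measurePreserving_neg (volume : Measure ℝ))
  exact h.map_eq

lemma lintegral_freqVol {F : ℤ × ℝ → ℝ≥0∞} (hF : Measurable F) :
    ∫⁻ p, F p ∂freqVol = ∑' k : ℤ, ∫⁻ ζ : ℝ, F (k, ζ) := by
  rw [freqVol, lintegral_prod _ hF.aemeasurable, lintegral_count]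

lemma ae_freqVol {P : ℤ × ℝ → Prop} (h : ∀ k : ℤ, ∀ᵐ ζ : ℝ, P (k, ζ)) :
    ∀ᵐ p ∂freqVol, P p := by
  choose s hs using fun k => (ae_iff.1 (h k)) ▸ exists_measurable_superset (volume : Measure ℝ) _
  have hm : MeasurableSet {p : ℤ × ℝ | p.2 ∈ s p.1} := by
    have : {p : ℤ × ℝ | p.2 ∈ s p.1} = ⋃ k : ℤ, ({k} ×ˢ s k) := by
      ext ⟨k, z⟩; simp
    rw [this]
    exact MeasurableSet.iUnion fun k => (measurableSet_singleton k).prod (hs k).2.1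
  refine measure_mono_null (t := {p : ℤ × ℝ | p.2 ∈ s p.1}) (fun p hp => (hs p.1).1 hp) ?_
  rw [freqVol, Measure.measure_prod_null hm]
  refine Eventually.of_forall fun k => ?_
  exact (hs k).2.2

/-- The Japanese bracket `⟨p⟩ = (1 + k² + (2πζ)²)^{1/2}` of a frequency `p = (k, ζ)`. -/
def jb (p : ℤ × ℝ) : ℝ := Real.sqrt (1 + (p.1 : ℝ) ^ 2 + (2 * Real.pi * p.2) ^ 2)

/-- The homogeneous length `(k² + (2πζ)²)^{1/2}` of a frequency `p = (k, ζ)`. -/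
def nm (p : ℤ × ℝ) : ℝ := Real.sqrt ((p.1 : ℝ) ^ 2 + (2 * Real.pi * p.2) ^ 2)

lemma jb_sq (p : ℤ × ℝ) : jb p ^ 2 = 1 + (p.1 : ℝ) ^ 2 + (2 * Real.pi * p.2) ^ 2 :=
  Real.sq_sqrt (by positivity)

lemma nm_sq (p : ℤ × ℝ) : nm p ^ 2 = (p.1 : ℝ) ^ 2 + (2 * Real.pi * p.2) ^ 2 :=
  Real.sq_sqrt (by positivity)

lemma nm_nonneg (p : ℤ × ℝ) : 0 ≤ nm p := Real.sqrt_nonneg _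

lemma one_le_jb (p : ℤ × ℝ) : 1 ≤ jb p :=
  Real.one_le_sqrt.2 (by nlinarith [sq_nonneg (p.1 : ℝ), sq_nonneg (2 * Real.pi * p.2)])

lemma jb_pos (p : ℤ × ℝ) : 0 < jb p := zero_lt_one.trans_le (one_le_jb p)

lemma nm_le_jb (p : ℤ × ℝ) : nm p ≤ jb p :=
  Real.sqrt_le_sqrt (by linarith)

lemma abs_fst_le_nm (p : ℤ × ℝ) : |(p.1 : ℝ)| ≤ nm p :=
  Real.abs_le_sqrt (by nlinarith [sq_nonneg (2 * Real.pi * p.2)])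

lemma abs_snd_le_nm (p : ℤ × ℝ) : |2 * Real.pi * p.2| ≤ nm p :=
  Real.abs_le_sqrt (by nlinarith [sq_nonneg (p.1 : ℝ)])

lemma continuous_jb_snd (k : ℤ) : Continuous fun ζ : ℝ => jb (k, ζ) := by
  unfold jb; fun_prop

lemma measurable_jb : Measurable jb :=
  measurable_from_prod_countable_right fun k => (continuous_jb_snd k).measurable

lemma nm_neg (p : ℤ × ℝ) : nm (-p) = nm p := by simp [nm]

/-- By Cauchy–Schwarz, adding a frequency `p` increases the bracket by at most its homogeneous
length. -/
lemma jb_add_le_nm (p q : ℤ × ℝ) : jb (p + q) ≤ nm p + jb q := by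
  have hb : (p.1 : ℝ) * q.1 + (2 * Real.pi * p.2) * (2 * Real.pi * q.2) ≤ nm p * jb q := by
    refine (abs_le_of_sq_le_sq' ?_ (mul_nonneg (nm_nonneg p) (jb_pos q).le)).2
    rw [mul_pow, nm_sq, jb_sq]
    nlinarith [sq_nonneg ((p.1 : ℝ) * (2 * Real.pi * q.2) - (2 * Real.pi * p.2) * q.1),
      sq_nonneg (p.1 : ℝ), sq_nonneg (2 * Real.pi * p.2)]
  refine Real.sqrt_le_iff.2 ⟨add_nonneg (nm_nonneg p) (jb_pos q).le, ?_⟩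
  have h1 := nm_sq p
  have h2 := jb_sq q
  simp only [Prod.fst_add, Prod.snd_add, Int.cast_add]
  nlinarith

lemma abs_jb_sub_le (p q : ℤ × ℝ) : |jb (p + q) - jb q| ≤ nm p := by
  rw [abs_le]
  have h1 := jb_add_le_nm p q
  have h2 := jb_add_le_nm (-p) (p + q)
  rw [nm_neg, neg_add_cancel_left] at h2
  constructor <;> linarith

lemma jb_add_le (p q : ℤ × ℝ) : jb (p + q) ≤ jb p + jb q :=
  (jb_add_le_nm p q).trans (by linarith [nm_le_jb p])

lemma jb_add_le_mul (p q : ℤ × ℝ) : jb (p + q) ≤ 2 * jb p * jb q := by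
  nlinarith [jb_add_le p q, one_le_jb p, one_le_jb q,
    mul_nonneg (sub_nonneg.2 (one_le_jb p)) (sub_nonneg.2 (one_le_jb q)),
    mul_pos (jb_pos p) (jb_pos q)]

/-- Bernoulli's inequality in the form of a mean value estimate. -/
lemma rpow_sub_rpow_le {a b n : ℝ} (hb : 0 < b) (hab : b ≤ a) (hn : 1 ≤ n) :
    a ^ n - b ^ n ≤ n * a ^ (n - 1) * (a - b) := by
  have ha : 0 < a := hb.trans_le hab
  have h := one_add_mul_self_le_rpow_one_add (s := b / a - 1)
    (by linarith [div_pos hb ha]) hn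
  rw [add_sub_cancel, Real.div_rpow hb.le ha.le] at h
  have han : 0 < a ^ n := Real.rpow_pos_of_pos ha n
  rw [le_div_iff₀ han] at h
  have h2 : a ^ n = a ^ (n - 1) * a := by
    rw [← Real.rpow_add_one ha.ne', sub_add_cancel]
  have h3 : (1 + n * (b / a - 1)) * a ^ n = a ^ n + n * a ^ (n - 1) * (b - a) := by
    rw [h2]; field_simp
  linarith

/-- The commutator bound for the weights: transferring `⟨·⟩ⁿ` from `q` to `p + q` gains the
homogeneous length of `p`. -/
lemma abs_jb_rpow_sub_le {n : ℝ} (hn : 1 ≤ n) (p q : ℤ × ℝ) :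
    |jb (p + q) ^ n - jb q ^ n| ≤ n * 2 ^ (n - 1) * (nm p * (jb p ^ (n - 1) * jb q ^ (n - 1))) := by
  have hd := abs_le.1 (abs_jb_sub_le p q)
  have hn1 : 0 ≤ n - 1 := by linarith
  have h1 : jb (p + q) ^ (n - 1) ≤ 2 ^ (n - 1) * (jb p ^ (n - 1) * jb q ^ (n - 1)) := by
    rw [← Real.mul_rpow (jb_pos p).le (jb_pos q).le, ← Real.mul_rpow (by norm_num)
      (mul_pos (jb_pos p) (jb_pos q)).le, ← mul_assoc]
    exact Real.rpow_le_rpow (jb_pos _).le (jb_add_le_mul p q) hn1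
  have h2 : jb q ^ (n - 1) ≤ 2 ^ (n - 1) * (jb p ^ (n - 1) * jb q ^ (n - 1)) := by
    rw [← Real.mul_rpow (jb_pos p).le (jb_pos q).le, ← Real.mul_rpow (by norm_num)
      (mul_pos (jb_pos p) (jb_pos q)).le]
    refine Real.rpow_le_rpow (jb_pos _).le ?_ hn1
    nlinarith [one_le_jb p, jb_pos q]
  have key : ∀ a b : ℝ, 0 < b → b ≤ a → a - b ≤ nm p →
      a ^ (n - 1) ≤ 2 ^ (n - 1) * (jb p ^ (n - 1) * jb q ^ (n - 1)) →
      a ^ n - b ^ n ≤ n * 2 ^ (n - 1) * (nm p * (jb p ^ (n - 1) * jb q ^ (n - 1))) := by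
    intro a b hb hab hd ha
    calc a ^ n - b ^ n ≤ n * a ^ (n - 1) * (a - b) := rpow_sub_rpow_le hb hab hn
      _ ≤ n * (2 ^ (n - 1) * (jb p ^ (n - 1) * jb q ^ (n - 1))) * nm p := by
          gcongr
          have := jb_pos p
          have := jb_pos q
          positivity
      _ = _ := by ring
  rw [abs_le]
  rcases le_total (jb q) (jb (p + q)) with h | h
  · have h3 := key _ _ (jb_pos q) h hd.2 h1
    have h4 : jb q ^ n ≤ jb (p + q) ^ n := Real.rpow_le_rpow (jb_pos q).le h (by linarith)
    constructor <;> linarith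
  · have h3 := key _ _ (jb_pos _) h (by linarith) h2
    have h4 : jb (p + q) ^ n ≤ jb q ^ n := Real.rpow_le_rpow (jb_pos _).le h (by linarith)
    constructor <;> linarith

/-- The weight `⟨p⟩ˢ` with values in `[0, ∞]`. -/
def wt (s : ℝ) (p : ℤ × ℝ) : ℝ≥0∞ := ENNReal.ofReal (jb p ^ s)

lemma measurable_wt (s : ℝ) : Measurable (wt s) :=
  (measurable_jb.pow_const s).ennreal_ofReal

lemma wt_mul (s t : ℝ) (p : ℤ × ℝ) : wt s p * wt t p = wt (s + t) p := by
  rw [wt, wt, wt, Real.rpow_add (jb_pos p), ENNReal.ofReal_mul (Real.rpow_pos_of_pos (jb_pos p) s).le]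

lemma wt_zero (p : ℤ × ℝ) : wt 0 p = 1 := by simp [wt]

lemma wt_mono {s t : ℝ} (h : s ≤ t) (p : ℤ × ℝ) : wt s p ≤ wt t p :=
  ENNReal.ofReal_le_ofReal (Real.rpow_le_rpow_of_exponent_le (one_le_jb p) h)

lemma one_le_wt {s : ℝ} (h : 0 ≤ s) (p : ℤ × ℝ) : 1 ≤ wt s p := by
  rw [← wt_zero p]; exact wt_mono h p

lemma wt_add_le {s : ℝ} (h : 0 ≤ s) (p q : ℤ × ℝ) :
    wt s (p + q) ≤ ENNReal.ofReal (2 ^ s) * (wt s p + wt s q) := by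
  unfold wt
  have hp := Real.rpow_pos_of_pos (jb_pos p) s
  have hq := Real.rpow_pos_of_pos (jb_pos q) s
  rw [← ENNReal.ofReal_add hp.le hq.le, ← ENNReal.ofReal_mul (by positivity)]
  refine ENNReal.ofReal_le_ofReal ?_
  have h1 : jb (p + q) ≤ 2 * max (jb p) (jb q) :=
    (jb_add_le p q).trans (by linarith [le_max_left (jb p) (jb q), le_max_right (jb p) (jb q)])
  refine (Real.rpow_le_rpow (jb_pos _).le h1 h).trans ?_
  rw [Real.mul_rpow (by norm_num) ((jb_pos p).le.trans (le_max_left _ _))]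
  gcongr
  rcases le_total (jb p) (jb q) with h2 | h2
  · rw [max_eq_right h2]; linarith
  · rw [max_eq_left h2]; linarith

/-- The `L²` norm over frequency space of a function with values in `[0, ∞]`. -/
def l2 (F : ℤ × ℝ → ℝ≥0∞) : ℝ≥0∞ := (∫⁻ p, F p ^ 2 ∂freqVol) ^ (1 / 2 : ℝ)

lemma l2_sq (F : ℤ × ℝ → ℝ≥0∞) : l2 F ^ 2 = ∫⁻ p, F p ^ 2 ∂freqVol := by
  rw [l2, ← ENNReal.rpow_natCast, ← ENNReal.rpow_mul]; norm_num

lemma l2_mono_ae {F H : ℤ × ℝ → ℝ≥0∞} (h : ∀ᵐ p ∂freqVol, F p ≤ H p) : l2 F ≤ l2 H := by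
  unfold l2
  gcongr ?_ ^ _
  refine lintegral_mono_ae ?_
  filter_upwards [h] with p hp
  gcongr

lemma l2_mono {F H : ℤ × ℝ → ℝ≥0∞} (h : ∀ p, F p ≤ H p) : l2 F ≤ l2 H :=
  l2_mono_ae (Eventually.of_forall h)

lemma l2_congr_ae {F H : ℤ × ℝ → ℝ≥0∞} (h : ∀ᵐ p ∂freqVol, F p = H p) : l2 F = l2 H :=
  le_antisymm (l2_mono_ae (h.mono fun _ hp => hp.le)) (l2_mono_ae (h.mono fun _ hp => hp.ge))

lemma l2_add_le {F H : ℤ × ℝ → ℝ≥0∞} (hF : Measurable F) (hH : Measurable H) :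
    l2 (fun p => F p + H p) ≤ l2 F + l2 H := by
  have h := ENNReal.lintegral_Lp_add_le (μ := freqVol) (p := 2) hF.aemeasurable hH.aemeasurable
    (by norm_num)
  simpa [l2] using h

lemma l2_const_mul (c : ℝ≥0∞) {F : ℤ × ℝ → ℝ≥0∞} (hF : Measurable F) :
    l2 (fun p => c * F p) = c * l2 F := by
  unfold l2
  simp_rw [mul_pow]
  rw [lintegral_const_mul _ (hF.pow_const 2), ENNReal.mul_rpow_of_nonneg _ _ (by norm_num),
    ← ENNReal.rpow_natCast, ← ENNReal.rpow_mul]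
  norm_num

lemma lintegral_mul_le_l2 {F H : ℤ × ℝ → ℝ≥0∞} (hF : Measurable F) (hH : Measurable H) :
    ∫⁻ p, F p * H p ∂freqVol ≤ l2 F * l2 H := by
  have h := ENNReal.lintegral_mul_le_Lp_mul_Lq freqVol (p := 2) (q := 2)
    (by constructor <;> norm_num) hF.aemeasurable hH.aemeasurable
  simpa [l2] using h

/-- Convolution on frequency space, for functions with values in `[0, ∞]`. -/
def conv (F H : ℤ × ℝ → ℝ≥0∞) (r : ℤ × ℝ) : ℝ≥0∞ := ∫⁻ p, F p * H (r - p) ∂freqVol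

lemma measurable_conv {F H : ℤ × ℝ → ℝ≥0∞} (hF : Measurable F) (hH : Measurable H) :
    Measurable (conv F H) := by
  have : Measurable fun z : (ℤ × ℝ) × (ℤ × ℝ) => F z.2 * H (z.1 - z.2) :=
    (hF.comp measurable_snd).mul (hH.comp (measurable_fst.sub measurable_snd))
  exact this.lintegral_prod_right'

lemma conv_comm (F H : ℤ × ℝ → ℝ≥0∞) (r : ℤ × ℝ) : conv F H r = conv H F r := by
  unfold conv
  rw [← lintegral_sub_left_eq_self _ r]
  simp [mul_comm]

lemma conv_mono {F F' H H' : ℤ × ℝ → ℝ≥0∞} (h : ∀ p, F p ≤ F' p) (h' : ∀ p, H p ≤ H' p)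
    (r : ℤ × ℝ) : conv F H r ≤ conv F' H' r :=
  lintegral_mono fun p => mul_le_mul' (h p) (h' _)

/-- Young's inequality `‖F * H‖_{L²} ≤ ‖F‖_{L¹} ‖H‖_{L²}`. -/
lemma l2_conv_le {F H : ℤ × ℝ → ℝ≥0∞} (hF : Measurable F) (hH : Measurable H) :
    l2 (conv F H) ≤ (∫⁻ p, F p ∂freqVol) * l2 H := by
  set S := ∫⁻ p, F p ∂freqVol with hS
  have hpt : ∀ r, conv F H r ^ 2 ≤ S * ∫⁻ p, F p * H (r - p) ^ 2 ∂freqVol := by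
    intro r
    have hHr : Measurable fun p => H (r - p) := hH.comp (measurable_const.sub measurable_id)
    have hF2 : ∀ p, (F p ^ (1 / 2 : ℝ)) ^ 2 = F p := fun p => by
      rw [← ENNReal.rpow_natCast, ← ENNReal.rpow_mul]; norm_num
    have h := lintegral_mul_le_l2 (F := fun p => F p ^ (1 / 2 : ℝ))
      (H := fun p => F p ^ (1 / 2 : ℝ) * H (r - p)) (hF.pow_const _) ((hF.pow_const _).mul hHr)
    have h2 : conv F H r ≤ l2 (fun p => F p ^ (1 / 2 : ℝ)) *
        l2 (fun p => F p ^ (1 / 2 : ℝ) * H (r - p)) := by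
      refine le_trans (le_of_eq ?_) h
      refine lintegral_congr fun p => ?_
      rw [← mul_assoc, ← pow_two, hF2]
    calc conv F H r ^ 2 ≤ _ := pow_le_pow_left' h2 2
      _ = _ := by
        rw [mul_pow, l2_sq, l2_sq]
        simp_rw [mul_pow, hF2, ← hS]
  have hmeas : Measurable fun z : (ℤ × ℝ) × (ℤ × ℝ) => F z.2 * H (z.1 - z.2) ^ 2 :=
    (hF.comp measurable_snd).mul ((hH.comp (measurable_fst.sub measurable_snd)).pow_const 2)
  have hint : ∫⁻ r, conv F H r ^ 2 ∂freqVol ≤ S ^ 2 * l2 H ^ 2 := by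
    calc ∫⁻ r, conv F H r ^ 2 ∂freqVol
        ≤ ∫⁻ r, S * ∫⁻ p, F p * H (r - p) ^ 2 ∂freqVol ∂freqVol := lintegral_mono hpt
      _ = S * ∫⁻ r, ∫⁻ p, F p * H (r - p) ^ 2 ∂freqVol ∂freqVol :=
          lintegral_const_mul _ hmeas.lintegral_prod_right'
      _ = S * ∫⁻ p, ∫⁻ r, F p * H (r - p) ^ 2 ∂freqVol ∂freqVol := by
          rw [lintegral_lintegral_swap]
          exact hmeas.aemeasurable
      _ = S * ∫⁻ p, F p * l2 H ^ 2 ∂freqVol := by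
          congr 1
          refine lintegral_congr fun p => ?_
          have hm : Measurable fun r => H (r - p) ^ 2 :=
            (hH.comp (measurable_id.sub measurable_const)).pow_const 2
          rw [lintegral_const_mul _ hm,
            lintegral_sub_right_eq_self (fun r => H r ^ 2) p, l2_sq]
      _ = S ^ 2 * l2 H ^ 2 := by
          rw [lintegral_mul_const _ hF, ← hS]; ring
  calc l2 (conv F H) ≤ (S ^ 2 * l2 H ^ 2) ^ (1 / 2 : ℝ) := by unfold l2 at hint ⊢; gcongr
    _ = S * l2 H := by
      rw [← mul_pow, ← ENNReal.rpow_natCast, ← ENNReal.rpow_mul]; norm_num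

lemma l2_conv_le' {F H : ℤ × ℝ → ℝ≥0∞} (hF : Measurable F) (hH : Measurable H) :
    l2 (conv F H) ≤ l2 F * ∫⁻ p, H p ∂freqVol := by
  rw [mul_comm, l2_congr_ae (Eventually.of_forall (conv_comm F H))]
  exact l2_conv_le hH hF

/-- `⟨p⟩^{-n}` is square integrable over frequency space for `n > 1`. -/
lemma l2_wt_neg_lt_top {n : ℝ} (hn : 1 < n) : l2 (wt (-n)) < ∞ := by
  have hpt : ∀ p : ℤ × ℝ, wt (-n) p ^ 2 ≤
      ENNReal.ofReal ((1 + (p.1 : ℝ) ^ 2) ^ (-n / 2)) *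
        ENNReal.ofReal ((1 + ‖p.2‖ ^ 2) ^ (-n / 2)) := by
    intro p
    unfold wt
    rw [← ENNReal.ofReal_mul (by positivity), ← Real.mul_rpow (by positivity) (by positivity),
      ← ENNReal.ofReal_pow (Real.rpow_pos_of_pos (jb_pos p) _).le]
    refine ENNReal.ofReal_le_ofReal ?_
    have h1 : (jb p ^ (-n)) ^ 2 = ((jb p ^ 2) ^ 2) ^ (-n / 2) := by
      rw [← Real.rpow_natCast, ← Real.rpow_natCast, ← Real.rpow_natCast,
        ← Real.rpow_mul (jb_pos p).le, ← Real.rpow_mul (jb_pos p).le, ← Real.rpow_mul (jb_pos p).le]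
      congr 1
      push_cast; ring
    rw [h1]
    refine Real.rpow_le_rpow_of_nonpos (by positivity) ?_ (by linarith)
    rw [jb_sq]
    have h3 : p.2 ^ 2 ≤ (2 * Real.pi * p.2) ^ 2 := by
      rw [mul_pow]
      have : (1 : ℝ) ≤ (2 * Real.pi) ^ 2 := by nlinarith [Real.pi_gt_three]
      nlinarith [sq_nonneg p.2]
    have h4 : ‖p.2‖ ^ 2 = p.2 ^ 2 := by rw [Real.norm_eq_abs, sq_abs]
    rw [h4]
    nlinarith [sq_nonneg (p.1 : ℝ), sq_nonneg p.2]
  have hs : Summable fun k : ℤ => (1 + (k : ℝ) ^ 2) ^ (-n / 2) := by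
    have h1 : Summable fun k : ℤ => |(k : ℝ)| ^ (-n) + if k = 0 then (1 : ℝ) else 0 :=
      (Real.summable_abs_int_rpow hn).add (hasSum_ite_eq 0 1).summable
    refine Summable.of_nonneg_of_le (fun k => by positivity) (fun k => ?_) h1
    by_cases hk : k = 0
    · simp [hk, Real.zero_rpow (by linarith : -n ≠ 0)]
    · have hk' : (0 : ℝ) < |(k : ℝ)| := abs_pos.2 (by exact_mod_cast hk)
      simp only [hk, if_false, add_zero]
      have : |(k : ℝ)| ^ (-n) = ((k : ℝ) ^ 2) ^ (-n / 2) := by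
        rw [← sq_abs, ← Real.rpow_natCast, ← Real.rpow_mul (abs_nonneg _)]
        congr 1; push_cast; ring
      rw [this]
      exact Real.rpow_le_rpow_of_nonpos (by positivity) (by linarith) (by linarith)
  have hi : Integrable fun z : ℝ => (1 + ‖z‖ ^ 2) ^ (-n / 2) :=
    integrable_rpow_neg_one_add_norm_sq (by simpa using hn)
  have hfin : ∫⁻ p, wt (-n) p ^ 2 ∂freqVol < ∞ := by
    refine (lintegral_mono hpt).trans_lt ?_
    rw [lintegral_freqVol (by fun_prop)]
    simp only
    have h2 : ∀ k : ℤ, ∫⁻ ζ : ℝ, ENNReal.ofReal ((1 + (k : ℝ) ^ 2) ^ (-n / 2)) *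
        ENNReal.ofReal ((1 + ‖ζ‖ ^ 2) ^ (-n / 2)) = ENNReal.ofReal ((1 + (k : ℝ) ^ 2) ^ (-n / 2)) *
        ∫⁻ ζ : ℝ, ENNReal.ofReal ((1 + ‖ζ‖ ^ 2) ^ (-n / 2)) := fun k =>
      lintegral_const_mul _ (by fun_prop)
    simp_rw [h2]
    rw [ENNReal.tsum_mul_right]
    refine ENNReal.mul_lt_top ?_ ?_
    · exact hs.tsum_ofReal_lt_top
    · exact hi.lintegral_lt_top
  exact ENNReal.rpow_lt_top_of_nonneg (by norm_num) hfin.ne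

/-- Weighted `L²` embeds into `L¹` on the frequency side. -/
lemma lintegral_le_l2_wt (n : ℝ) {F : ℤ × ℝ → ℝ≥0∞} (hF : Measurable F) :
    ∫⁻ p, F p ∂freqVol ≤ l2 (wt (-n)) * l2 (fun p => wt n p * F p) := by
  refine le_trans (le_of_eq ?_) (lintegral_mul_le_l2 (measurable_wt _) ((measurable_wt n).mul hF))
  refine lintegral_congr fun p => ?_
  rw [← mul_assoc, wt_mul, neg_add_cancel, wt_zero, one_mul]

lemma wt_mul_conv_le {n : ℝ} (hn : 0 ≤ n) {F H : ℤ × ℝ → ℝ≥0∞} (hF : Measurable F)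
    (hH : Measurable H) (r : ℤ × ℝ) :
    wt n r * conv F H r ≤ ENNReal.ofReal (2 ^ n) *
      (conv (fun p => wt n p * F p) H r + conv F (fun p => wt n p * H p) r) := by
  have hHr : Measurable fun p => H (r - p) := hH.comp (measurable_const.sub measurable_id)
  have hwr : Measurable fun p => wt n (r - p) :=
    (measurable_wt n).comp (measurable_const.sub measurable_id)
  unfold conv
  have hw := measurable_wt n
  rw [← lintegral_add_left (by fun_prop), ← lintegral_const_mul _ (by fun_prop),
    ← lintegral_const_mul _ (by fun_prop)]
  refine lintegral_mono fun p => ?_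
  have h := wt_add_le hn p (r - p)
  rw [add_sub_cancel] at h
  calc wt n r * (F p * H (r - p))
      ≤ ENNReal.ofReal (2 ^ n) * (wt n p + wt n (r - p)) * (F p * H (r - p)) := by gcongr
    _ = _ := by ring

/-- The constant of the algebra property of `H^n(𝕋 × ℝ)`, on the Fourier side. -/
def algC (n : ℝ) : ℝ≥0∞ := ENNReal.ofReal (2 ^ n) * (2 * l2 (wt (-n)))

lemma algC_lt_top {n : ℝ} (hn : 1 < n) : algC n < ∞ :=
  ENNReal.mul_lt_top ENNReal.ofReal_lt_top (ENNReal.mul_lt_top (by simp) (l2_wt_neg_lt_top hn))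

/-- The algebra property of `H^n(𝕋 × ℝ)`, on the Fourier side. -/
lemma l2_wt_conv_le {n : ℝ} (hn : 0 ≤ n) {F H : ℤ × ℝ → ℝ≥0∞} (hF : Measurable F)
    (hH : Measurable H) :
    l2 (fun r => wt n r * conv F H r) ≤
      algC n * l2 (fun p => wt n p * F p) * l2 (fun p => wt n p * H p) := by
  have hwF : Measurable fun p => wt n p * F p := (measurable_wt n).mul hF
  have hwH : Measurable fun p => wt n p * H p := (measurable_wt n).mul hH
  calc l2 (fun r => wt n r * conv F H r)
      ≤ l2 (fun r => ENNReal.ofReal (2 ^ n) *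
          (conv (fun p => wt n p * F p) H r + conv F (fun p => wt n p * H p) r)) :=
        l2_mono (wt_mul_conv_le hn hF hH)
    _ = ENNReal.ofReal (2 ^ n) * l2 (fun r => conv (fun p => wt n p * F p) H r +
          conv F (fun p => wt n p * H p) r) :=
        l2_const_mul _ ((measurable_conv hwF hH).add (measurable_conv hF hwH))
    _ ≤ ENNReal.ofReal (2 ^ n) * (l2 (fun p => wt n p * F p) * (l2 (wt (-n)) *
          l2 (fun p => wt n p * H p)) + l2 (wt (-n)) * l2 (fun p => wt n p * F p) *
          l2 (fun p => wt n p * H p)) := by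
        gcongr
        refine (l2_add_le (measurable_conv hwF hH) (measurable_conv hF hwH)).trans ?_
        refine add_le_add ((l2_conv_le' hwF hH).trans ?_) ((l2_conv_le hF hwH).trans ?_)
        · gcongr; exact lintegral_le_l2_wt n hH
        · gcongr; exact lintegral_le_l2_wt n hF
    _ = _ := by unfold algC; ring

/-! ### The Fourier transform on `L²(ℝ)` -/

/-- The Plancherel transform of a function on `ℝ`, extended by `0` outside `L²`. -/
def planch (a : ℝ → ℂ) : ℝ → ℂ :=
  open Classical in
  if h : MemLp a 2 (volume : Measure ℝ) then
    ((𝓕 (h.toLp a) : Lp (α := ℝ) ℂ 2 volume) : ℝ → ℂ)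
  else 0

lemma planch_eq {a : ℝ → ℂ} (h : MemLp a 2 (volume : Measure ℝ)) :
    planch a = ((𝓕 (h.toLp a) : Lp (α := ℝ) ℂ 2 volume) : ℝ → ℂ) := dif_pos h

lemma measurable_planch (a : ℝ → ℂ) : Measurable (planch a) := by
  unfold planch
  split_ifs with h
  · exact (Lp.stronglyMeasurable _).measurable
  · exact measurable_const

lemma memLp_planch {a : ℝ → ℂ} (h : MemLp a 2 (volume : Measure ℝ)) :
    MemLp (planch a) 2 (volume : Measure ℝ) := by
  rw [planch_eq h]; exact Lp.memLp _

lemma eLpNorm_planch {a : ℝ → ℂ} (h : MemLp a 2 (volume : Measure ℝ)) :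
    eLpNorm (planch a) 2 volume = eLpNorm a 2 volume := by
  have h1 := Lp.norm_fourier_eq (h.toLp a)
  rw [Lp.norm_def, Lp.norm_def, ENNReal.toReal_eq_toReal_iff' (Lp.eLpNorm_ne_top _)
    (Lp.eLpNorm_ne_top _), eLpNorm_congr_ae h.coeFn_toLp] at h1
  rw [planch_eq h, h1]

lemma lintegral_enorm_sq_eq {α : Type*} [MeasurableSpace α] {μ : Measure α} (a : α → ℂ) :
    ∫⁻ y, ‖a y‖ₑ ^ 2 ∂μ = eLpNorm a 2 μ ^ 2 := by
  rw [eLpNorm_eq_lintegral_rpow_enorm_toReal (by norm_num) (by norm_num), ← ENNReal.rpow_natCast,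
    ← ENNReal.rpow_mul]
  norm_num

lemma lintegral_planch {a : ℝ → ℂ} (h : MemLp a 2 (volume : Measure ℝ)) :
    ∫⁻ z, ‖planch a z‖ₑ ^ 2 = ∫⁻ y, ‖a y‖ₑ ^ 2 := by
  rw [lintegral_enorm_sq_eq, lintegral_enorm_sq_eq, eLpNorm_planch h]

/-- The Plancherel transform is dual to the Fourier transform of test functions. -/
lemma integral_mul_planch {a : ℝ → ℂ} (h : MemLp a 2 (volume : Measure ℝ)) {g : ℝ → ℂ}
    (hg : HasCompactSupport g) (hg' : ContDiff ℝ (⊤ : ℕ∞) g) :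
    ∫ z, g z * planch a z = ∫ y, 𝓕 g y * a y := by
  set φ := hg.toSchwartzMap hg' with hφ
  have h1 := congrArg (fun T => T φ) (Lp.fourier_toTemperedDistribution_eq (h.toLp a))
  simp only [TemperedDistribution.fourier_apply, Lp.toTemperedDistribution_apply, smul_eq_mul] at h1
  rw [planch_eq h]
  have h2 : ∀ z, φ z = g z := fun z => rfl
  have h3 : ∀ z, (𝓕 φ) z = 𝓕 g z := fun z => by
    rw [SchwartzMap.fourier_coe]; rfl
  simp only [h2, h3] at h1
  rw [← h1]
  refine integral_congr_ae ?_
  filter_upwards [h.coeFn_toLp] with y hy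
  rw [hy]

/-- A locally integrable function which is dual to the Fourier transform of test functions is the
Plancherel transform. -/
lemma planch_ae_eq {a b : ℝ → ℂ} (h : MemLp a 2 (volume : Measure ℝ)) (hb : LocallyIntegrable b)
    (hab : ∀ g : ℝ → ℂ, HasCompactSupport g → ContDiff ℝ (⊤ : ℕ∞) g →
      ∫ z, g z * b z = ∫ y, 𝓕 g y * a y) :
    planch a =ᵐ[volume] b := by
  refine ae_eq_of_integral_contDiff_smul_eq
    ((memLp_planch h).locallyIntegrable (by norm_num)) hb fun g hg hg' => ?_
  have hc : ContDiff ℝ (⊤ : ℕ∞) fun z => (g z : ℂ) := Complex.ofRealCLM.contDiff.comp hg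
  have hs : HasCompactSupport fun z => (g z : ℂ) := hg'.comp_left (g := fun x : ℝ => (x : ℂ)) (by simp)
  have h1 := (integral_mul_planch h hs hc).trans (hab _ hs hc).symm
  simpa using h1

/-- The plane wave `e^{-2πi y ζ}`. -/
def wave (ζ y : ℝ) : ℂ := Complex.exp (-(2 * Real.pi * ζ * y : ℝ) * Complex.I)

lemma norm_wave (ζ y : ℝ) : ‖wave ζ y‖ = 1 := by
  unfold wave; rw [← Complex.ofReal_neg]; exact Complex.norm_exp_ofReal_mul_I _

lemma continuous_wave (ζ : ℝ) : Continuous (wave ζ) := by unfold wave; fun_prop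

lemma conj_wave (ζ y : ℝ) : (starRingEnd ℂ) (wave ζ y) = wave (-ζ) y := by
  unfold wave; rw [← Complex.exp_conj]; congr 1; simp [Complex.conj_ofNat]

lemma fourier_eq_integral_wave (g : ℝ → ℂ) (y : ℝ) : 𝓕 g y = ∫ z, wave y z * g z := by
  rw [Real.fourier_eq']
  refine integral_congr_ae (Eventually.of_forall fun z => ?_)
  simp only [smul_eq_mul, wave]
  congr 2
  simp only [RCLike.inner_apply, conj_trivial]
  push_cast; ring

lemma memLp_conj_mul_wave {a : ℝ → ℂ} (h : MemLp a 2 (volume : Measure ℝ)) (ζ : ℝ) :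
    MemLp (fun y => (starRingEnd ℂ) (a y * wave ζ y)) 2 (volume : Measure ℝ) := by
  refine h.of_le ?_ (Eventually.of_forall fun y => by simp [norm_wave])
  exact Complex.continuous_conj.comp_aestronglyMeasurable
    (h.1.mul (continuous_wave ζ).aestronglyMeasurable)

/-- Conjugation and modulation become reflection and translation under the Fourier transform. -/
lemma planch_conj_mul_wave {a : ℝ → ℂ} (h : MemLp a 2 (volume : Measure ℝ)) (ζ : ℝ) :
    planch (fun y => (starRingEnd ℂ) (a y * wave ζ y)) =ᵐ[volume]
      fun z => (starRingEnd ℂ) (planch a (ζ - z)) := by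
  have hm : MemLp (fun z => (starRingEnd ℂ) (planch a (ζ - z))) 2 (volume : Measure ℝ) := by
    have h1 : MemLp (fun z => planch a (ζ - z)) 2 (volume : Measure ℝ) :=
      (memLp_planch h).comp_measurePreserving (Measure.measurePreserving_sub_left volume ζ)
    exact h1.star
  refine planch_ae_eq (memLp_conj_mul_wave h ζ) (hm.locallyIntegrable (by norm_num))
    fun g hg hg' => ?_
  set k : ℝ → ℂ := fun z => (starRingEnd ℂ) (g (ζ - z)) with hk
  have hks : HasCompactSupport k := by
    have : HasCompactSupport fun z => g (ζ - z) :=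
      hg.comp_homeomorph (Homeomorph.subLeft ζ)
    exact this.comp_left (g := starRingEnd ℂ) (by simp)
  have hkc : ContDiff ℝ (⊤ : ℕ∞) k :=
    Complex.conjCLE.contDiff.comp (hg'.comp (contDiff_const.sub contDiff_id))
  have h1 := integral_mul_planch h hks hkc
  have h2 : ∀ y, 𝓕 k y = (starRingEnd ℂ) (𝓕 g y) * wave ζ y := by
    intro y
    rw [fourier_eq_integral_wave, fourier_eq_integral_wave, ← integral_conj,
      ← integral_mul_const, ← integral_sub_left_eq_self _ volume ζ]
    refine integral_congr_ae (Eventually.of_forall fun z => ?_)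
    simp only [hk, map_mul, conj_wave, sub_sub_cancel]
    rw [show wave y (ζ - z) = wave (-y) z * wave ζ y by
      unfold wave; rw [← Complex.exp_add]; congr 1; push_cast; ring]
    ring
  calc ∫ z, g z * (starRingEnd ℂ) (planch a (ζ - z))
      = ∫ z, g (ζ - z) * (starRingEnd ℂ) (planch a z) := by
        rw [← integral_sub_left_eq_self _ volume ζ]; simp
    _ = (starRingEnd ℂ) (∫ z, k z * planch a z) := by
        rw [← integral_conj]; simp [hk]
    _ = _ := by
        rw [h1, ← integral_conj]
        refine integral_congr_ae (Eventually.of_forall fun y => ?_)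
        simp only [h2, map_mul, Complex.conj_conj]
        ring

/-- Parseval's formula: the Fourier transform of a product of `L²` functions is the convolution of
their transforms, at every frequency. -/
lemma integral_mul_mul_wave {a b : ℝ → ℂ} (ha : MemLp a 2 (volume : Measure ℝ))
    (hb : MemLp b 2 (volume : Measure ℝ)) (ζ : ℝ) :
    ∫ y, a y * b y * wave ζ y = ∫ z, planch a z * planch b (ζ - z) := by
  have hx := memLp_conj_mul_wave hb ζ
  have h1 := Lp.inner_fourier_eq (hx.toLp _) (ha.toLp _)
  rw [L2.inner_def, L2.inner_def] at h1
  have h2 : ∫ y, a y * b y * wave ζ y = ∫ y, inner ℂ ((hx.toLp _ : Lp ℂ 2 volume) y)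
      ((ha.toLp _ : Lp ℂ 2 volume) y) := by
    refine integral_congr_ae ?_
    filter_upwards [hx.coeFn_toLp, ha.coeFn_toLp] with y h3 h4
    rw [h3, h4, RCLike.inner_apply]
    simp only [map_mul, Complex.conj_conj]
    ring
  rw [h2, ← h1, ← planch_eq hx, ← planch_eq ha]
  refine integral_congr_ae ?_
  filter_upwards [planch_conj_mul_wave hb ζ] with z hz
  rw [hz, RCLike.inner_apply]
  simp

lemma planch_conj {a : ℝ → ℂ} (h : MemLp a 2 (volume : Measure ℝ)) :
    planch (fun y => (starRingEnd ℂ) (a y)) =ᵐ[volume]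
      fun z => (starRingEnd ℂ) (planch a (-z)) := by
  have h1 := planch_conj_mul_wave h 0
  simpa [wave] using h1

lemma planch_add {a b : ℝ → ℂ} (ha : MemLp a 2 (volume : Measure ℝ))
    (hb : MemLp b 2 (volume : Measure ℝ)) :
    planch (a + b) =ᵐ[volume] planch a + planch b := by
  rw [planch_eq ha, planch_eq hb, planch_eq (ha.add hb), MemLp.toLp_add, FourierTransform.fourier_add]
  exact Lp.coeFn_add _ _

lemma planch_smul {a : ℝ → ℂ} (c : ℂ) (ha : MemLp a 2 (volume : Measure ℝ)) :
    planch (c • a) =ᵐ[volume] c • planch a := by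
  rw [planch_eq ha, planch_eq (ha.const_smul c), MemLp.toLp_const_smul, FourierTransform.fourier_smul]
  exact Lp.coeFn_smul _ _

lemma planch_congr {a b : ℝ → ℂ} (ha : MemLp a 2 (volume : Measure ℝ)) (h : a =ᵐ[volume] b) :
    planch a = planch b := by
  rw [planch_eq ha, planch_eq (ha.ae_eq h), (MemLp.toLp_eq_toLp_iff ha (ha.ae_eq h)).2 h]

/-! ### Fourier series on the circle and the Fourier transform on the cylinder -/

lemma volume_circle : (volume : Measure (AddCircle (2 * Real.pi))) =
    ENNReal.ofReal (2 * Real.pi) • AddCircle.haarAddCircle :=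
  AddCircle.volume_eq_smul_haarAddCircle

lemma memLp_haar {F : AddCircle (2 * Real.pi) → ℂ} (hF : MemLp F 2 volume) :
    MemLp F 2 AddCircle.haarAddCircle :=
  memLp_haarAddCircle_iff.2 hF

lemma fourierCoeff_eq_integral (F : AddCircle (2 * Real.pi) → ℂ) (k : ℤ) :
    fourierCoeff F k = ((2 * Real.pi)⁻¹ : ℝ) * ∫ x, fourier (-k) x * F x := by
  rw [fourierCoeff, AddCircle.integral_haarAddCircle]
  simp

/-- Parseval's identity on the circle. -/
lemma tsum_enorm_fourierCoeff_sq {F : AddCircle (2 * Real.pi) → ℂ} (hF : MemLp F 2 volume) :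
    ENNReal.ofReal (2 * Real.pi) * ∑' k : ℤ, ‖fourierCoeff F k‖ₑ ^ 2 = ∫⁻ x, ‖F x‖ₑ ^ 2 := by
  have h1 := hasSum_sq_fourierCoeff ((memLp_haar hF).toLp F)
  have h2 : ∀ k, fourierCoeff ((memLp_haar hF).toLp F : Lp ℂ 2 AddCircle.haarAddCircle) k =
      fourierCoeff F k := fun k =>
    congrFun (fourierCoeff_congr_ae (memLp_haar hF).coeFn_toLp) k
  simp_rw [h2] at h1
  have h3 : ∫ t, ‖((memLp_haar hF).toLp F : Lp ℂ 2 AddCircle.haarAddCircle) t‖ ^ 2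
      ∂AddCircle.haarAddCircle = ∫ t, ‖F t‖ ^ 2 ∂AddCircle.haarAddCircle := by
    refine integral_congr_ae ?_
    filter_upwards [(memLp_haar hF).coeFn_toLp] with t ht
    rw [ht]
  rw [h3] at h1
  have h4 : ∑' k : ℤ, ‖fourierCoeff F k‖ₑ ^ 2 =
      ∫⁻ x, ‖F x‖ₑ ^ 2 ∂AddCircle.haarAddCircle := by
    have h5 : ∀ k, ‖fourierCoeff F k‖ₑ ^ 2 = ENNReal.ofReal (‖fourierCoeff F k‖ ^ 2) := fun k => by
      rw [ENNReal.ofReal_pow (norm_nonneg _), ofReal_norm]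
    have h6 : ∀ x, ‖F x‖ₑ ^ 2 = ENNReal.ofReal (‖F x‖ ^ 2) := fun k => by
      rw [ENNReal.ofReal_pow (norm_nonneg _), ofReal_norm]
    simp_rw [h5, h6]
    rw [← ENNReal.ofReal_tsum_of_nonneg (fun k => by positivity) h1.summable, h1.tsum_eq,
      ofReal_integral_eq_lintegral_ofReal ((memLp_haar hF).integrable_norm_pow (by norm_num))
        (Eventually.of_forall fun x => by positivity)]
  rw [h4, volume_circle, lintegral_smul_measure, smul_eq_mul]

/-- Parseval's formula on the circle: the Fourier coefficients of a product are the convolution of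
the Fourier coefficients. -/
lemma hasSum_fourierCoeff_mul {F H : AddCircle (2 * Real.pi) → ℂ} (hF : MemLp F 2 volume)
    (hH : MemLp H 2 volume) (k : ℤ) :
    HasSum (fun l => fourierCoeff F l * fourierCoeff H (k - l))
      (fourierCoeff (fun x => F x * H x) k) := by
  have hF' := memLp_haar hF
  have hH' := memLp_haar hH
  set X : AddCircle (2 * Real.pi) → ℂ := fun x => (starRingEnd ℂ) (H x * fourier (-k) x) with hX
  have hXm : MemLp X 2 AddCircle.haarAddCircle := by
    refine hH'.of_le ?_ (Eventually.of_forall fun x => by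
      simp only [hX, RCLike.norm_conj, norm_mul]
      rw [fourier_apply, Circle.norm_coe, mul_one])
    exact Complex.continuous_conj.comp_aestronglyMeasurable
      (hH'.1.mul (fourier (-k)).continuous.aestronglyMeasurable)
  have h1 := (fourierBasis (T := 2 * Real.pi)).hasSum_inner_mul_inner (hXm.toLp X) (hF'.toLp F)
  have hrep : ∀ {Y : AddCircle (2 * Real.pi) → ℂ} (hY : MemLp Y 2 AddCircle.haarAddCircle) (l : ℤ),
      inner ℂ ((fourierBasis (T := 2 * Real.pi)) l) (hY.toLp Y) = fourierCoeff Y l := by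
    intro Y hY l
    rw [← HilbertBasis.repr_apply_apply, fourierBasis_repr]
    exact congrFun (fourierCoeff_congr_ae hY.coeFn_toLp) l
  have h2 : ∀ l, inner ℂ (hXm.toLp X) ((fourierBasis (T := 2 * Real.pi)) l) =
      fourierCoeff H (k - l) := by
    intro l
    rw [← inner_conj_symm, hrep hXm, fourierCoeff, fourierCoeff, ← integral_conj]
    refine integral_congr_ae (Eventually.of_forall fun x => ?_)
    simp only [hX, smul_eq_mul, map_mul, Complex.conj_conj]
    rw [← fourier_neg, neg_neg, show -(k - l) = l + -k by ring, fourier_add]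
    ring
  have h3 : inner ℂ (hXm.toLp X) (hF'.toLp F) = fourierCoeff (fun x => F x * H x) k := by
    rw [L2.inner_def, fourierCoeff]
    refine integral_congr_ae ?_
    filter_upwards [hXm.coeFn_toLp, hF'.coeFn_toLp] with x h4 h5
    rw [h4, h5, RCLike.inner_apply]
    simp only [hX, smul_eq_mul, map_mul, Complex.conj_conj]
    ring
  rw [← h3]
  convert! h1 using 2 with l
  rw [h2, hrep hF']
  ring

lemma enorm_ofReal (x : ℝ) : ‖(x : ℂ)‖ₑ = ‖x‖ₑ := by
  rw [← ofReal_norm, ← ofReal_norm, Complex.norm_real]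

lemma lintegral_enorm_sq_lt_top {α : Type*} [MeasurableSpace α] {μ : Measure α} {f : α → ℝ}
    (hf : MemLp f 2 μ) : ∫⁻ z, ‖f z‖ₑ ^ 2 ∂μ < ∞ := by
  have := lintegral_enorm_sq_eq (μ := μ) fun z => (f z : ℂ)
  simp_rw [enorm_ofReal] at this
  rw [this]
  exact ENNReal.pow_lt_top hf.ofReal.2

lemma hat_eq_planch (f : Field) (k : ℤ) : hat f k = planch (modeX f k) := rfl

/-- Almost every horizontal section of a square integrable field is square integrable. -/
lemma ae_memLp_section {f : Field} (hf : MemLp f 2 (volume : Measure Cyl)) :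
    ∀ᵐ y : ℝ, MemLp (fun x : AddCircle (2 * Real.pi) => (f (x, y) : ℂ)) 2 volume := by
  have hC : MemLp (fun z : Cyl => (f z : ℂ)) 2 volume := hf.ofReal
  have hsw : AEStronglyMeasurable (fun z : ℝ × AddCircle (2 * Real.pi) => (f z.swap : ℂ))
      (volume.prod volume) := hC.1.prod_swap
  have hm : AEMeasurable (fun z : ℝ × AddCircle (2 * Real.pi) => ‖(f z.swap : ℂ)‖ₑ ^ 2)
      (volume.prod volume) := hsw.enorm.pow_const 2
  have hfin : ∫⁻ z : ℝ × AddCircle (2 * Real.pi), ‖(f z.swap : ℂ)‖ₑ ^ 2 ∂(volume.prod volume) < ∞ := by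
    have h1 : ∫⁻ z : ℝ × AddCircle (2 * Real.pi), ‖(f z.swap : ℂ)‖ₑ ^ 2 ∂(volume.prod volume) =
        ∫⁻ z : Cyl, ‖(f z : ℂ)‖ₑ ^ 2 := by
      rw [← lintegral_prod_swap]; rfl
    rw [h1, lintegral_enorm_sq_eq]
    exact ENNReal.pow_lt_top hC.2
  rw [lintegral_prod _ hm] at hfin
  have hae := ae_lt_top' hm.lintegral_prod_right' hfin.ne
  filter_upwards [hae, hsw.prodMk_left] with y h1 h2
  refine ⟨h2, ?_⟩
  rw [lintegral_enorm_sq_eq] at h1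
  by_contra h3
  rw [not_lt_top_iff] at h3
  simp only [Prod.swap_prod_mk] at h1
  rw [h3] at h1
  simp at h1

lemma aestronglyMeasurable_modeX {f : Field} (hf : MemLp f 2 (volume : Measure Cyl)) (k : ℤ) :
    AEStronglyMeasurable (modeX f k) (volume : Measure ℝ) := by
  have hC : MemLp (fun z : Cyl => (f z : ℂ)) 2 volume := hf.ofReal
  have hsw : AEStronglyMeasurable (fun z : ℝ × AddCircle (2 * Real.pi) => (f z.swap : ℂ))
      (volume.prod volume) := hC.1.prod_swap
  have h1 : AEStronglyMeasurable (fun z : ℝ × AddCircle (2 * Real.pi) =>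
      fourier (-k) z.2 * (f z.swap : ℂ)) (volume.prod volume) :=
    (((fourier (-k)).continuous.comp continuous_snd).aestronglyMeasurable).mul hsw
  have h2 := h1.integral_prod_right'
  refine (h2.const_mul (((2 * Real.pi)⁻¹ : ℝ) : ℂ)).congr (Eventually.of_forall fun y => ?_)
  simp only [modeX, fourierCoeff_eq_integral, Prod.swap_prod_mk]

/-- Parseval's identity in `x`, integrated over `y`. -/
lemma tsum_lintegral_modeX {f : Field} (hf : MemLp f 2 (volume : Measure Cyl)) :
    ENNReal.ofReal (2 * Real.pi) * ∑' k : ℤ, ∫⁻ y : ℝ, ‖modeX f k y‖ₑ ^ 2 =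
      ∫⁻ z : Cyl, ‖f z‖ₑ ^ 2 := by
  have hm : AEMeasurable (fun z : Cyl => ‖f z‖ₑ ^ 2) volume := hf.1.enorm.pow_const 2
  have h1 : ∫⁻ z : Cyl, ‖f z‖ₑ ^ 2 = ∫⁻ y : ℝ, ∫⁻ x : AddCircle (2 * Real.pi), ‖f (x, y)‖ₑ ^ 2 :=
    lintegral_prod_symm _ hm
  rw [h1, ← lintegral_tsum fun k => (aestronglyMeasurable_modeX hf k).enorm.pow_const 2,
    ← lintegral_const_mul'' _ (AEMeasurable.tsum fun k =>
      (aestronglyMeasurable_modeX hf k).enorm.pow_const 2)]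
  refine lintegral_congr_ae ?_
  filter_upwards [ae_memLp_section hf] with y hy
  have h2 := tsum_enorm_fourierCoeff_sq hy
  simp_rw [enorm_ofReal] at h2
  exact h2

lemma memLp_modeX {f : Field} (hf : MemLp f 2 (volume : Measure Cyl)) (k : ℤ) :
    MemLp (modeX f k) 2 (volume : Measure ℝ) := by
  refine ⟨aestronglyMeasurable_modeX hf k, ?_⟩
  have h1 := tsum_lintegral_modeX hf
  have h3 : ∫⁻ z : Cyl, ‖f z‖ₑ ^ 2 < ∞ := lintegral_enorm_sq_lt_top hf
  have h5 : ∑' k : ℤ, ∫⁻ y : ℝ, ‖modeX f k y‖ₑ ^ 2 < ∞ := by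
    by_contra h
    rw [not_lt_top_iff] at h
    rw [h, ENNReal.mul_top (by simp [Real.pi_pos])] at h1
    exact h3.ne h1.symm
  have h6 := (ENNReal.le_tsum k).trans_lt h5
  rw [lintegral_enorm_sq_eq] at h6
  by_contra h
  rw [not_lt_top_iff] at h
  rw [h] at h6
  simp at h6

lemma measurable_hat (f : Field) : Measurable fun p : ℤ × ℝ => hat f p.1 p.2 :=
  measurable_from_prod_countable_right fun k => measurable_planch (modeX f k)

/-- Plancherel's theorem on the cylinder. -/
lemma lintegral_hat {f : Field} (hf : MemLp f 2 (volume : Measure Cyl)) :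
    ENNReal.ofReal (2 * Real.pi) * ∫⁻ p : ℤ × ℝ, ‖hat f p.1 p.2‖ₑ ^ 2 ∂freqVol =
      ∫⁻ z : Cyl, ‖f z‖ₑ ^ 2 := by
  rw [lintegral_freqVol ((measurable_hat f).enorm.pow_const 2), ← tsum_lintegral_modeX hf]
  congr 1
  refine tsum_congr fun k => ?_
  simp only [hat_eq_planch]
  exact lintegral_planch (memLp_modeX hf k)

lemma memLp_two_of_lintegral {α : Type*} [MeasurableSpace α] {μ : Measure α} {F : α → ℂ}
    (hF : AEStronglyMeasurable F μ) (h : ∫⁻ p, ‖F p‖ₑ ^ 2 ∂μ < ∞) : MemLp F 2 μ := by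
  refine ⟨hF, ?_⟩
  rw [lintegral_enorm_sq_eq] at h
  by_contra h'
  rw [not_lt_top_iff] at h'
  rw [h'] at h
  simp at h

lemma memLp_hat {f : Field} (hf : MemLp f 2 (volume : Measure Cyl)) :
    MemLp (fun p : ℤ × ℝ => hat f p.1 p.2) 2 freqVol := by
  refine memLp_two_of_lintegral (measurable_hat f).aestronglyMeasurable ?_
  have h1 := lintegral_hat hf
  by_contra h
  rw [not_lt_top_iff] at h
  rw [h, ENNReal.mul_top (by simp [Real.pi_pos])] at h1
  exact (lintegral_enorm_sq_lt_top hf).ne h1.symm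

lemma integral_freqVol {F : ℤ × ℝ → ℂ} (hF : Integrable F freqVol) :
    ∫ p, F p ∂freqVol = ∑' k : ℤ, ∫ ζ : ℝ, F (k, ζ) := by
  have h1 : Integrable (fun k : ℤ => ∫ ζ : ℝ, F (k, ζ)) Measure.count := hF.integral_prod_left
  rw [freqVol, integral_prod _ hF, integral_countable h1]
  simp

lemma integrable_mul_wave {F : Cyl → ℂ} (hF : Integrable F) (k : ℤ) (ζ : ℝ) :
    Integrable fun z : Cyl => F z * (fourier (-k) z.1 * wave ζ z.2) := by
  have hc : Continuous fun z : Cyl => fourier (-k) z.1 * wave ζ z.2 :=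
    ((fourier (-k)).continuous.comp continuous_fst).mul ((continuous_wave ζ).comp continuous_snd)
  refine hF.mono (hF.1.mul hc.aestronglyMeasurable) (Eventually.of_forall fun z => ?_)
  rw [norm_mul, norm_mul, norm_wave, fourier_apply, Circle.norm_coe, mul_one, mul_one]

/-- Parseval's formula in `x`, integrated over `y`. -/
lemma integral_mul_wave_eq_integral_tsum {f g : Field} (hf : MemLp f 2 (volume : Measure Cyl))
    (hg : MemLp g 2 (volume : Measure Cyl)) (k : ℤ) (ζ : ℝ) :
    ((2 * Real.pi)⁻¹ : ℝ) * ∫ z : Cyl, ((f z * g z : ℝ) : ℂ) * (fourier (-k) z.1 * wave ζ z.2) =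
      ∫ y : ℝ, ∑' l : ℤ, modeX f l y * modeX g (k - l) y * wave ζ y := by
  have h1 : Integrable (fun z : Cyl => ((f z * g z : ℝ) : ℂ)) volume :=
    (hf.integrable_mul hg).ofReal
  have h2 : ∫ z : Cyl, ((f z * g z : ℝ) : ℂ) * (fourier (-k) z.1 * wave ζ z.2) =
      ∫ y : ℝ, ∫ x : AddCircle (2 * Real.pi),
        ((f (x, y) * g (x, y) : ℝ) : ℂ) * (fourier (-k) x * wave ζ y) :=
    integral_prod_symm _ (integrable_mul_wave h1 k ζ)
  rw [h2, ← integral_const_mul]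
  refine integral_congr_ae ?_
  filter_upwards [ae_memLp_section hf, ae_memLp_section hg] with y h3 h4
  have h5 := (hasSum_fourierCoeff_mul h3 h4 k).tsum_eq
  have h6 : ∑' l : ℤ, modeX f l y * modeX g (k - l) y * wave ζ y =
      (∑' l : ℤ, modeX f l y * modeX g (k - l) y) * wave ζ y := tsum_mul_right
  have h7 : ∫ x : AddCircle (2 * Real.pi),
      ((f (x, y) * g (x, y) : ℝ) : ℂ) * (fourier (-k) x * wave ζ y) =
      (∫ x : AddCircle (2 * Real.pi), fourier (-k) x * ((f (x, y) : ℂ) * (g (x, y) : ℂ))) *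
        wave ζ y := by
    rw [← integral_mul_const]
    refine integral_congr_ae (Eventually.of_forall fun x => ?_)
    simp only [Complex.ofReal_mul]
    ring
  have h8 : ∑' l : ℤ, modeX f l y * modeX g (k - l) y =
      ((2 * Real.pi)⁻¹ : ℝ) * ∫ x : AddCircle (2 * Real.pi),
        fourier (-k) x * ((f (x, y) : ℂ) * (g (x, y) : ℂ)) := by
    rw [← fourierCoeff_eq_integral]; exact h5
  rw [h6, h7, h8, mul_assoc]

lemma tsum_lintegral_modeX_ne_top {f : Field} (hf : MemLp f 2 (volume : Measure Cyl)) :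
    ∑' l : ℤ, ∫⁻ y, ‖modeX f l y‖ₑ ^ 2 ≠ ∞ := by
  intro htop
  have h1 := tsum_lintegral_modeX hf
  rw [htop, ENNReal.mul_top (by simp [Real.pi_pos])] at h1
  exact (lintegral_enorm_sq_lt_top hf).ne h1.symm

lemma ennreal_mul_le_sq_add_sq (a b : ℝ≥0∞) : a * b ≤ a ^ 2 + b ^ 2 := by
  rcases le_total a b with h | h
  · calc a * b ≤ b * b := by gcongr
      _ ≤ _ := by rw [← pow_two]; exact le_add_self
  · calc a * b ≤ a * a := by gcongr
      _ ≤ _ := by rw [← pow_two]; exact le_self_add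

lemma tsum_lintegral_mul_wave_ne_top {f g : Field} (hf : MemLp f 2 (volume : Measure Cyl))
    (hg : MemLp g 2 (volume : Measure Cyl)) (k : ℤ) (ζ : ℝ) :
    ∑' l : ℤ, ∫⁻ y, ‖modeX f l y * modeX g (k - l) y * wave ζ y‖ₑ ≠ ∞ := by
  have hb : ∀ l, ∫⁻ y, ‖modeX f l y * modeX g (k - l) y * wave ζ y‖ₑ ≤
      (∫⁻ y, ‖modeX f l y‖ₑ ^ 2) + ∫⁻ y, ‖modeX g (k - l) y‖ₑ ^ 2 := by
    intro l
    rw [← lintegral_add_left' ((memLp_modeX hf l).1.enorm.pow_const 2)]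
    refine lintegral_mono fun y => ?_
    have hw : ‖wave ζ y‖ₑ = 1 := by rw [← ofReal_norm, norm_wave]; simp
    rw [enorm_mul, enorm_mul, hw, mul_one]
    exact ennreal_mul_le_sq_add_sq _ _
  refine ne_top_of_le_ne_top ?_ (ENNReal.tsum_le_tsum hb)
  rw [ENNReal.tsum_add]
  refine ENNReal.add_ne_top.2 ⟨tsum_lintegral_modeX_ne_top hf, ?_⟩
  have h2 := (Equiv.subLeft k).tsum_eq fun l => ∫⁻ y, ‖modeX g l y‖ₑ ^ 2
  simp only [Equiv.subLeft_apply] at h2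
  rw [h2]
  exact tsum_lintegral_modeX_ne_top hg

lemma memLp_comp_sub_left {F : ℤ × ℝ → ℂ} (hF : MemLp F 2 freqVol) (r : ℤ × ℝ) :
    MemLp (fun p => F (r.1 - p.1, r.2 - p.2)) 2 freqVol :=
  hF.comp_measurePreserving (Measure.measurePreserving_sub_left freqVol r)

/-- The convolution theorem for products of square integrable fields, valid at every frequency. -/
lemma integral_mul_wave_eq_conv {f g : Field} (hf : MemLp f 2 (volume : Measure Cyl))
    (hg : MemLp g 2 (volume : Measure Cyl)) (k : ℤ) (ζ : ℝ) :
    ((2 * Real.pi)⁻¹ : ℝ) * ∫ z : Cyl, ((f z * g z : ℝ) : ℂ) * (fourier (-k) z.1 * wave ζ z.2) =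
      ∫ p : ℤ × ℝ, hat f p.1 p.2 * hat g (k - p.1) (ζ - p.2) ∂freqVol := by
  have hmem' : MemLp (fun p : ℤ × ℝ => hat g (k - p.1) (ζ - p.2)) 2 freqVol :=
    memLp_comp_sub_left (memLp_hat hg) (k, ζ)
  have hint : Integrable (fun p : ℤ × ℝ => hat f p.1 p.2 * hat g (k - p.1) (ζ - p.2)) freqVol :=
    (memLp_hat hf).integrable_mul hmem'
  have hil : ∀ l, AEStronglyMeasurable
      (fun y => modeX f l y * modeX g (k - l) y * wave ζ y) volume := fun l =>
    ((memLp_modeX hf l).1.mul (memLp_modeX hg (k - l)).1).mul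
      (continuous_wave ζ).aestronglyMeasurable
  rw [integral_mul_wave_eq_integral_tsum hf hg, integral_freqVol hint,
    integral_tsum hil (tsum_lintegral_mul_wave_ne_top hf hg k ζ)]
  refine tsum_congr fun l => ?_
  simp only [hat_eq_planch]
  exact integral_mul_mul_wave (memLp_modeX hf l) (memLp_modeX hg (k - l)) ζ

/-! ### The spectrum of a field in the frame moving with the shear flow -/

/-- The frequency `ξ` dual to `y` in the fixed frame, at the point `p = (k, ζ)` of the moving frame:
`ξ = 2πζ - t k`. -/
def xi (t : ℝ) (p : ℤ × ℝ) : ℝ := 2 * Real.pi * p.2 - t * p.1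

/-- The symbol `k² + ξ²` of `-Δ` in the moving frame. -/
def lapSym (t : ℝ) (p : ℤ × ℝ) : ℝ := (p.1 : ℝ) ^ 2 + xi t p ^ 2

/-- The change of frequencies from the moving to the fixed frame. -/
def shear (t : ℝ) (p : ℤ × ℝ) : ℤ × ℝ := (p.1, p.2 - t * p.1 / (2 * Real.pi))

/-- The spectrum of `f` in the frame moving with the shear flow up to time `t`. -/
def sp (f : Field) (t : ℝ) (p : ℤ × ℝ) : ℂ := hat f (shear t p).1 (shear t p).2

lemma two_pi_mul_shear (t : ℝ) (p : ℤ × ℝ) : 2 * Real.pi * (shear t p).2 = xi t p := by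
  have := Real.pi_pos.ne'
  simp only [shear, xi]; field_simp

lemma shear_sub (t : ℝ) (p q : ℤ × ℝ) : shear t (p - q) = shear t p - shear t q := by
  refine Prod.ext rfl ?_
  simp only [shear, Prod.fst_sub, Prod.snd_sub, Int.cast_sub]; ring

lemma shear_neg (t : ℝ) (p : ℤ × ℝ) : shear t (-p) = -shear t p := by
  refine Prod.ext rfl ?_
  simp only [shear, Prod.fst_neg, Prod.snd_neg, Int.cast_neg]; ring

lemma xi_sub (t : ℝ) (p q : ℤ × ℝ) : xi t (p - q) = xi t p - xi t q := by
  simp only [xi, Prod.fst_sub, Prod.snd_sub, Int.cast_sub]; ring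

lemma measurable_shear (t : ℝ) : Measurable (shear t) := by
  unfold shear; fun_prop

lemma measurable_xi (t : ℝ) : Measurable (xi t) := by
  unfold xi; fun_prop

lemma measurable_lapSym (t : ℝ) : Measurable (lapSym t) := by
  have := measurable_xi t
  unfold lapSym; fun_prop

lemma lapSym_nonneg (t : ℝ) (p : ℤ × ℝ) : 0 ≤ lapSym t p := by unfold lapSym; positivity

lemma measurePreserving_shear (t : ℝ) : MeasurePreserving (shear t) freqVol freqVol := by
  refine (MeasurePreserving.id Measure.count).skew_product
    (g := fun (k : ℤ) (ζ : ℝ) => ζ - t * k / (2 * Real.pi)) (by fun_prop)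
    (Eventually.of_forall fun k => ?_)
  exact (measurePreserving_sub_right volume (t * k / (2 * Real.pi))).map_eq

lemma measurable_sp (f : Field) (t : ℝ) : Measurable (sp f t) :=
  (measurable_hat f).comp (measurable_shear t)

lemma memLp_sp {f : Field} (hf : MemLp f 2 (volume : Measure Cyl)) (t : ℝ) :
    MemLp (sp f t) 2 freqVol :=
  (memLp_hat hf).comp_measurePreserving (measurePreserving_shear t)

lemma lintegral_sp {f : Field} (hf : MemLp f 2 (volume : Measure Cyl)) (t : ℝ) :
    ENNReal.ofReal (2 * Real.pi) * ∫⁻ p, ‖sp f t p‖ₑ ^ 2 ∂freqVol = ∫⁻ z : Cyl, ‖f z‖ₑ ^ 2 := by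
  rw [← lintegral_hat hf]
  congr 1
  exact (measurePreserving_shear t).lintegral_comp ((measurable_hat f).enorm.pow_const 2)

/-- The plane wave `e^{-ikx - iξy}` at the frequency `r` of the moving frame. -/
def pw (t : ℝ) (r : ℤ × ℝ) (z : Cyl) : ℂ := fourier (-r.1) z.1 * wave (shear t r).2 z.2

lemma norm_pw (t : ℝ) (r : ℤ × ℝ) (z : Cyl) : ‖pw t r z‖ = 1 := by
  rw [pw, norm_mul, norm_wave, fourier_apply, Circle.norm_coe, mul_one]

lemma continuous_pw (t : ℝ) (r : ℤ × ℝ) : Continuous (pw t r) :=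
  ((fourier (-r.1)).continuous.comp continuous_fst).mul ((continuous_wave _).comp continuous_snd)

lemma measurable_comp_sub_left {F : ℤ × ℝ → ℂ} (hF : Measurable F) (r : ℤ × ℝ) :
    Measurable fun p : ℤ × ℝ => F (r.1 - p.1, r.2 - p.2) :=
  hF.comp (measurable_const.sub measurable_id : Measurable fun p : ℤ × ℝ => r - p)

/-- The convolution theorem in the moving frame. -/
lemma integral_mul_pw {f g : Field} (hf : MemLp f 2 (volume : Measure Cyl))
    (hg : MemLp g 2 (volume : Measure Cyl)) (t : ℝ) (r : ℤ × ℝ) :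
    ((2 * Real.pi)⁻¹ : ℝ) * ∫ z : Cyl, ((f z * g z : ℝ) : ℂ) * pw t r z =
      ∫ p, sp f t p * sp g t (r - p) ∂freqVol := by
  have h := integral_mul_wave_eq_conv hf hg r.1 (shear t r).2
  unfold pw
  rw [h]
  have hF : Measurable fun p : ℤ × ℝ => hat f p.1 p.2 * hat g (r.1 - p.1) ((shear t r).2 - p.2) :=
    (measurable_hat f).mul (measurable_comp_sub_left (measurable_hat g) (shear t r))
  have h1 := integral_map (μ := freqVol) (measurable_shear t).aemeasurable
    (f := fun p : ℤ × ℝ => hat f p.1 p.2 * hat g (r.1 - p.1) ((shear t r).2 - p.2))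
    hF.aestronglyMeasurable
  rw [(measurePreserving_shear t).map_eq] at h1
  rw [h1]
  refine integral_congr_ae (Eventually.of_forall fun p => ?_)
  simp only [sp, shear_sub, Prod.snd_sub]
  rfl

lemma modeX_neg (f : Field) (k : ℤ) :
    modeX f (-k) = fun y => (starRingEnd ℂ) (modeX f k y) := by
  ext y
  simp only [modeX, fourierCoeff]
  rw [← integral_conj]
  refine integral_congr_ae (Eventually.of_forall fun x => ?_)
  simp only [smul_eq_mul, map_mul, Complex.conj_ofReal, ← fourier_neg]

/-- The spectrum of a real field is conjugate symmetric. -/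
lemma sp_neg {f : Field} (hf : MemLp f 2 (volume : Measure Cyl)) (t : ℝ) :
    ∀ᵐ p ∂freqVol, sp f t (-p) = (starRingEnd ℂ) (sp f t p) := by
  have h : ∀ᵐ p : ℤ × ℝ ∂freqVol, hat f (-p.1) (-p.2) = (starRingEnd ℂ) (hat f p.1 p.2) := by
    refine ae_freqVol fun k => ?_
    have h1 := planch_conj (memLp_modeX hf k)
    rw [← modeX_neg] at h1
    have h2 := (Measure.measurePreserving_neg (volume : Measure ℝ)).quasiMeasurePreserving.ae h1
    filter_upwards [h2] with ζ h3
    simp only [hat_eq_planch]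
    rw [h3, neg_neg]
  filter_upwards [(measurePreserving_shear t).quasiMeasurePreserving.ae h] with p hp
  rw [sp, shear_neg]
  exact hp

lemma modeX_add {f g : Field} (hf : MemLp f 2 (volume : Measure Cyl))
    (hg : MemLp g 2 (volume : Measure Cyl)) (k : ℤ) :
    modeX (f + g) k =ᵐ[volume] modeX f k + modeX g k := by
  filter_upwards [ae_memLp_section hf, ae_memLp_section hg] with y h1 h2
  have h3 := (memLp_haar h1).integrable (by norm_num)
  have h4 := (memLp_haar h2).integrable (by norm_num)
  have h5 := congrFun (fourierCoeff.add h3 h4) k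
  simp only [Pi.add_apply] at h5 ⊢
  simp only [modeX]
  rw [← h5]
  congr 1
  ext x
  simp

lemma sp_add {f g : Field} (hf : MemLp f 2 (volume : Measure Cyl))
    (hg : MemLp g 2 (volume : Measure Cyl)) (t : ℝ) :
    ∀ᵐ p ∂freqVol, sp (f + g) t p = sp f t p + sp g t p := by
  have h : ∀ᵐ p : ℤ × ℝ ∂freqVol, hat (f + g) p.1 p.2 = hat f p.1 p.2 + hat g p.1 p.2 := by
    refine ae_freqVol fun k => ?_
    simp only [hat_eq_planch]
    rw [planch_congr (memLp_modeX (hf.add hg) k) (modeX_add hf hg k)]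
    exact planch_add (memLp_modeX hf k) (memLp_modeX hg k)
  exact (measurePreserving_shear t).quasiMeasurePreserving.ae h

lemma zeroMode_eq (f : Field) (z : Cyl) : zeroMode f z = (modeX f 0 z.2).re := by
  have h : modeX f 0 z.2 = (((2 * Real.pi)⁻¹ * ∫ x, f (x, z.2) : ℝ) : ℂ) := by
    rw [modeX, fourierCoeff_eq_integral]
    simp only [neg_zero, fourier_zero, one_mul]
    rw [integral_complex_ofReal]
    push_cast; rfl
  rw [h, Complex.ofReal_re]; rfl

lemma memLp_zeroMode {f : Field} (hf : MemLp f 2 (volume : Measure Cyl)) :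
    MemLp (zeroMode f) 2 (volume : Measure Cyl) := by
  have h1 : MemLp (fun z : Cyl => modeX f 0 z.2) 2 (volume.prod volume) :=
    (memLp_modeX hf 0).comp_snd volume
  have h2 := h1.re
  exact h2.ae_eq (Eventually.of_forall fun z => (zeroMode_eq f z).symm)

lemma memLp_sub_zeroMode {f : Field} (hf : MemLp f 2 (volume : Measure Cyl)) :
    MemLp (f - zeroMode f) 2 (volume : Measure Cyl) := hf.sub (memLp_zeroMode hf)

/-- Subtracting the zero mode removes the frequencies with `k = 0` and nothing else. -/
lemma sp_sub_zeroMode {f : Field} (hf : MemLp f 2 (volume : Measure Cyl)) (t : ℝ) :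
    ∀ᵐ p ∂freqVol, sp (f - zeroMode f) t p = if p.1 = 0 then 0 else sp f t p := by
  have hm : ∀ k, modeX (f - zeroMode f) k =ᵐ[volume] if k = 0 then 0 else modeX f k := by
    intro k
    filter_upwards [ae_memLp_section hf] with y h1
    have h3 := (memLp_haar h1).integrable (by norm_num)
    have h0 : ∀ x : AddCircle (2 * Real.pi), (((f - zeroMode f) (x, y) : ℝ) : ℂ) =
        (f (x, y) : ℂ) - modeX f 0 y := by
      intro x
      have h5 : modeX f 0 y = (((2 * Real.pi)⁻¹ * ∫ x, f (x, y) : ℝ) : ℂ) := by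
        rw [modeX, fourierCoeff_eq_integral]
        simp only [neg_zero, fourier_zero, one_mul]
        rw [integral_complex_ofReal]
        push_cast; rfl
      rw [h5, Pi.sub_apply, Complex.ofReal_sub]
      rfl
    have hc : fourierCoeff (fun _ : AddCircle (2 * Real.pi) => modeX f 0 y) k =
        if k = 0 then modeX f 0 y else 0 := by
      have h6 := fourierCoeff_fourier (T := 2 * Real.pi) 0
      have h7 := congrFun h6 k
      have h8 : (fun _ : AddCircle (2 * Real.pi) => modeX f 0 y) =
          fun x => modeX f 0 y * fourier 0 x := by ext x; simp
      rw [h8, fourierCoeff.const_mul, h7]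
      by_cases hk : k = 0
      · subst hk; simp
      · simp [hk]
    have h9 : modeX (f - zeroMode f) k y = modeX f k y - if k = 0 then modeX f 0 y else 0 := by
      rw [← hc]
      simp only [modeX, fourierCoeff]
      rw [← integral_sub]
      · refine integral_congr_ae (Eventually.of_forall fun x => ?_)
        simp only [h0, smul_eq_mul, modeX, fourierCoeff]
        ring
      · exact h3.fourier_smul _
      · exact (integrable_const _).fourier_smul _
    rw [h9]
    by_cases hk : k = 0
    · subst hk; simp
    · simp [hk]
  have h : ∀ᵐ p : ℤ × ℝ ∂freqVol,
      hat (f - zeroMode f) p.1 p.2 = if p.1 = 0 then 0 else hat f p.1 p.2 := by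
    refine ae_freqVol fun k => ?_
    simp only [hat_eq_planch]
    rw [planch_congr (memLp_modeX (memLp_sub_zeroMode hf) k) (hm k)]
    by_cases hk : k = 0
    · simp only [hk, if_true]
      have h0 : MemLp (0 : ℝ → ℂ) 2 volume := MemLp.zero'
      have := planch_smul 0 h0
      simp only [zero_smul] at this
      exact this
    · simp [hk]
  exact (measurePreserving_shear t).quasiMeasurePreserving.ae h

/-- `√(2π)`, the constant of Plancherel's theorem on the cylinder. -/
def rpi : ℝ := Real.sqrt (2 * Real.pi)

lemma rpi_pos : 0 < rpi := Real.sqrt_pos.2 Real.two_pi_pos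

lemma one_le_rpi : 1 ≤ rpi := Real.one_le_sqrt.2 (by linarith [Real.pi_gt_three])

/-- A multiplier norm is the weighted `L²` norm of the spectrum in the moving frame, for the
weight `ρ` into which the frame transforms the symbol. -/
lemma multNorm_eq {f : Field} (hf : MemLp f 2 (volume : Measure Cyl)) (t : ℝ) {σ : ℤ → ℝ → ℝ}
    {ρ : ℤ × ℝ → ℝ≥0∞} (hσ : Measurable fun p : ℤ × ℝ => σ p.1 (2 * Real.pi * p.2))
    (h : ∀ p, ‖σ p.1 (xi t p)‖ₑ = ρ p) :
    multNorm σ f = ENNReal.ofReal rpi * l2 fun p => ρ p * ‖sp f t p‖ₑ := by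
  rw [multNorm, if_pos hf]
  have hm : Measurable fun p : ℤ × ℝ => ‖σ p.1 (2 * Real.pi * p.2)‖ₑ ^ 2 * ‖hat f p.1 p.2‖ₑ ^ 2 :=
    (hσ.enorm.pow_const 2).mul ((measurable_hat f).enorm.pow_const 2)
  have h1 := lintegral_freqVol hm
  rw [← (measurePreserving_shear t).lintegral_comp hm] at h1
  simp only at h1
  rw [← h1, ENNReal.mul_rpow_of_nonneg _ _ (by norm_num),
    ENNReal.ofReal_rpow_of_pos Real.two_pi_pos, ← Real.sqrt_eq_rpow]
  congr 1
  unfold l2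
  congr 1
  refine lintegral_congr fun p => ?_
  rw [two_pi_mul_shear, mul_pow, ← h p]
  rfl

lemma jb_rpow_eq (s t : ℝ) (p : ℤ × ℝ) : symΛ s t p.1 (xi t p) = jb p ^ s := by
  rw [symΛ, jb, Real.sqrt_eq_rpow, ← Real.rpow_mul (by positivity)]
  congr 1
  · simp only [xi]; ring
  · ring

lemma enorm_jb_rpow (s : ℝ) (p : ℤ × ℝ) : ‖jb p ^ s‖ₑ = wt s p := by
  rw [wt, Real.enorm_of_nonneg (Real.rpow_pos_of_pos (jb_pos p) s).le]

lemma measurable_symΛ (s t : ℝ) :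
    Measurable fun p : ℤ × ℝ => symΛ s t p.1 (2 * Real.pi * p.2) := by
  unfold symΛ; fun_prop

lemma normΛ_eq {f : Field} (hf : MemLp f 2 (volume : Measure Cyl)) (s t : ℝ) :
    normΛ s t f = ENNReal.ofReal rpi * l2 fun p => wt s p * ‖sp f t p‖ₑ :=
  multNorm_eq hf t (measurable_symΛ s t) fun p => by rw [jb_rpow_eq, enorm_jb_rpow]

lemma normDxΛ_eq {f : Field} (hf : MemLp f 2 (volume : Measure Cyl)) (s t : ℝ) :
    normDxΛ s t f = ENNReal.ofReal rpi * l2 fun p => ‖(p.1 : ℝ)‖ₑ * wt s p * ‖sp f t p‖ₑ :=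
  multNorm_eq hf t (((measurable_from_top (f := fun k : ℤ => |(k : ℝ)|)).comp measurable_fst).mul
    (measurable_symΛ s t)) fun p => by rw [jb_rpow_eq, enorm_mul, enorm_jb_rpow, Real.enorm_abs]

lemma normJxΛ_eq {f : Field} (hf : MemLp f 2 (volume : Measure Cyl)) (s t : ℝ) :
    normJxΛ s t f = ENNReal.ofReal rpi *
      l2 fun p => ‖Real.sqrt (1 + (p.1 : ℝ) ^ 2)‖ₑ * wt s p * ‖sp f t p‖ₑ :=
  multNorm_eq hf t (((measurable_from_top (f := fun k : ℤ => Real.sqrt (1 + (k : ℝ) ^ 2))).comp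
    measurable_fst).mul (measurable_symΛ s t)) fun p => by
      rw [jb_rpow_eq, enorm_mul, enorm_jb_rpow]

/-! ### Plane waves with compactly supported profiles as test functions -/

/-- The test function `Re (χ(y) e^{-ikx})` with profile `χ`. -/
def prTest (χ : ℝ → ℂ) (k : ℤ) : Field := fun z => (χ z.2 * fourier (-k) z.1).re

lemma norm_fourier_apply (k : ℤ) (x : AddCircle (2 * Real.pi)) : ‖fourier k x‖ = 1 := by
  rw [fourier_apply, Circle.norm_coe]

lemma isTest_prTest {χ : ℝ → ℂ} (h : ContDiff ℝ (⊤ : ℕ∞) χ) (h' : HasCompactSupport χ) (k : ℤ) :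
    IsTest (prTest χ k) := by
  constructor
  · have h1 : (fun p : ℝ × ℝ => prTest χ k ((p.1 : AddCircle _), p.2)) = fun p : ℝ × ℝ =>
        Complex.reCLM (χ p.2 * Complex.exp (2 * Real.pi * Complex.I * (-k : ℤ) * (p.1 : ℂ) /
          (2 * Real.pi : ℝ))) := by
      ext p
      simp only [prTest, fourier_coe_apply, Complex.reCLM_apply]
    rw [h1]
    refine Complex.reCLM.contDiff.comp ((h.comp contDiff_snd).mul ?_)
    refine Complex.contDiff_exp.comp ?_
    have h2 : ContDiff ℝ (⊤ : ℕ∞) fun p : ℝ × ℝ => (p.1 : ℂ) :=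
      Complex.ofRealCLM.contDiff.comp contDiff_fst
    exact (contDiff_const.mul h2).div_const _
  · refine HasCompactSupport.intro (K := univ ×ˢ tsupport χ) (isCompact_univ.prod h') fun z hz => ?_
    have h1 : z.2 ∉ tsupport χ := fun h2 => hz ⟨mem_univ _, h2⟩
    simp [prTest, image_eq_zero_of_notMem_tsupport h1]

lemma dx_prTest (χ : ℝ → ℂ) (k : ℤ) :
    dx (prTest χ k) = prTest (fun y => -Complex.I * k * χ y) k := by
  ext z
  have h1 := hasDerivAt_fourier_neg (2 * Real.pi) k 0
  have h2 : ∀ h : ℝ, χ z.2 * fourier (-k) (z.1 + (h : AddCircle (2 * Real.pi))) =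
      χ z.2 * fourier (-k) z.1 * fourier (-k) (h : AddCircle (2 * Real.pi)) := by
    intro h
    rw [fourier_apply, smul_add, AddCircle.toCircle_add, Circle.coe_mul, ← fourier_apply,
      ← fourier_apply]
    ring
  have h3 := Complex.reCLM.hasFDerivAt.comp_hasDerivAt (0 : ℝ)
    (h1.const_mul (χ z.2 * fourier (-k) z.1))
  have h4 : dx (prTest χ k) z = deriv (fun h : ℝ => Complex.reCLM
      (χ z.2 * fourier (-k) z.1 * fourier (-k) (h : AddCircle (2 * Real.pi)))) 0 := by
    unfold dx prTest
    simp only [h2, Complex.reCLM_apply]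
  rw [h4]
  refine h3.deriv.trans ?_
  rw [Complex.reCLM_apply, prTest, AddCircle.coe_zero, fourier_eval_zero]
  congr 1
  have hpi : (Real.pi : ℂ) ≠ 0 := by exact_mod_cast Real.pi_pos.ne'
  push_cast
  field_simp

lemma dy_prTest {χ : ℝ → ℂ} (h : Differentiable ℝ χ) (k : ℤ) :
    dy (prTest χ k) = prTest (deriv χ) k := by
  ext z
  have h1 : HasDerivAt (fun h : ℝ => χ (z.2 + h)) (deriv χ z.2) 0 := by
    have := (h (z.2 + 0)).hasDerivAt.comp_const_add z.2 0
    simpa using this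
  have h2 := Complex.reCLM.hasFDerivAt.comp_hasDerivAt 0 (h1.mul_const (fourier (-k) z.1))
  exact h2.deriv

lemma lap_prTest {χ : ℝ → ℂ} (h : ContDiff ℝ (⊤ : ℕ∞) χ) (k : ℤ) :
    lap (prTest χ k) = prTest (fun y => -(k : ℂ) ^ 2 * χ y + deriv (deriv χ) y) k := by
  have hd : ContDiff ℝ (⊤ : ℕ∞) (deriv χ) := (contDiff_infty_iff_deriv.1 h).2
  ext z
  rw [lap, dx_prTest, dx_prTest, dy_prTest (h.differentiable (by simp)),
    dy_prTest (hd.differentiable (by simp))]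
  simp only [prTest]
  rw [← Complex.add_re]
  congr 1
  linear_combination ((k : ℂ) ^ 2 * χ z.2 * fourier (-k) z.1) * Complex.I_sq

/-- The pairing of a field with the plane wave `χ(y) e^{-ikx}`. -/
def cpair (f : Field) (χ : ℝ → ℂ) (k : ℤ) : ℂ := ∫ z : Cyl, (f z : ℂ) * (χ z.2 * fourier (-k) z.1)

lemma cpair_const_mul (f : Field) (χ : ℝ → ℂ) (k : ℤ) (c : ℂ) :
    cpair f (fun y => c * χ y) k = c * cpair f χ k := by
  unfold cpair
  rw [← integral_const_mul]
  congr 1; ext z; ring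

lemma integrable_cpair {f : Field} (hf : Integrable f (volume : Measure Cyl)) {χ : ℝ → ℂ}
    (hχ : Continuous χ) {C : ℝ} (hC : ∀ y, ‖χ y‖ ≤ C) (k : ℤ) :
    Integrable fun z : Cyl => (f z : ℂ) * (χ z.2 * fourier (-k) z.1) := by
  refine hf.ofReal.mul_bdd (c := C) (((hχ.comp continuous_snd).mul
    ((fourier (-k)).continuous.comp continuous_fst)).aestronglyMeasurable)
    (Eventually.of_forall fun z => ?_)
  rw [norm_mul, norm_fourier_apply, mul_one]; exact hC _

/-- Truncation of a field to `|y| ≤ R`. -/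
def trunc (R : ℝ) (f : Field) : Field := fun z => (if |z.2| ≤ R then 1 else 0) * f z

lemma memLp_strip (R : ℝ) :
    MemLp (fun z : Cyl => if |z.2| ≤ R then (1 : ℝ) else 0) 2 (volume : Measure Cyl) := by
  have hs : MeasurableSet {z : Cyl | |z.2| ≤ R} :=
    measurableSet_le (measurable_snd.abs) measurable_const
  have h1 : (fun z : Cyl => if |z.2| ≤ R then (1 : ℝ) else 0) =
      {z : Cyl | |z.2| ≤ R}.indicator fun _ => 1 := by
    ext z; simp [indicator_apply]
  rw [h1]
  refine memLp_indicator_const 2 hs 1 (Or.inr ?_)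
  have h2 : {z : Cyl | |z.2| ≤ R} ⊆ univ ×ˢ Icc (-R) R := fun z hz => ⟨mem_univ _, abs_le.1 hz⟩
  refine ((measure_mono h2).trans_lt ?_).ne
  rw [Measure.volume_eq_prod, Measure.prod_prod]
  exact ENNReal.mul_lt_top (measure_lt_top _ _) (by simp)

lemma integrable_trunc {f : Field} (hf : MemLp f 2 (volume : Measure Cyl)) (R : ℝ) :
    Integrable (trunc R f) (volume : Measure Cyl) :=
  (memLp_strip R).integrable_mul hf

lemma cpair_trunc (f : Field) {χ : ℝ → ℂ} {R : ℝ} (h : ∀ y, R < |y| → χ y = 0) (k : ℤ) :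
    cpair (trunc R f) χ k = cpair f χ k := by
  unfold cpair trunc
  congr 1; ext z
  by_cases hz : |z.2| ≤ R
  · simp [hz]
  · simp [h _ (not_le.1 hz)]

lemma exists_support_bound {χ : ℝ → ℂ} (h : HasCompactSupport χ) :
    ∃ R : ℝ, ∀ y, R < |y| → χ y = 0 := by
  obtain ⟨R, hR⟩ := h.isBounded.subset_closedBall 0
  refine ⟨R, fun y hy => ?_⟩
  by_contra hne
  have := hR (subset_tsupport χ hne)
  rw [mem_closedBall_zero_iff, Real.norm_eq_abs] at this
  linarith

lemma integrable_cpair_of_memLp {f : Field} (hf : MemLp f 2 (volume : Measure Cyl)) {χ : ℝ → ℂ}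
    (hχ : Continuous χ) (hs : HasCompactSupport χ) (k : ℤ) :
    Integrable fun z : Cyl => (f z : ℂ) * (χ z.2 * fourier (-k) z.1) := by
  obtain ⟨R, hR⟩ := exists_support_bound hs
  obtain ⟨C, hC⟩ := hs.exists_bound_of_continuous hχ
  refine (integrable_cpair (integrable_trunc hf R) hχ hC k).congr (Eventually.of_forall fun z => ?_)
  simp only [trunc]
  by_cases hz : |z.2| ≤ R
  · simp [hz]
  · simp [hR _ (not_le.1 hz)]

lemma pair_prTest {f : Field} {χ : ℝ → ℂ} {k : ℤ}
    (h : Integrable fun z : Cyl => (f z : ℂ) * (χ z.2 * fourier (-k) z.1)) :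
    pair f (prTest χ k) = (cpair f χ k).re := by
  have h1 : RCLike.re (cpair f χ k) = ∫ z : Cyl, RCLike.re ((f z : ℂ) * (χ z.2 * fourier (-k) z.1)) :=
    (integral_re h).symm
  simp only [RCLike.re_to_complex, Complex.re_ofReal_mul] at h1
  rw [h1]; rfl

/-! ### Continuity in time with values in `L¹` and `L²` -/

/-- `J ∈ C([0,T]; L¹)`. -/
def ContL1 (T : ℝ) (J : ℝ → Field) : Prop :=
  (∀ t ∈ Icc 0 T, Integrable (J t) (volume : Measure Cyl)) ∧
  ∀ t ∈ Icc 0 T, Tendsto (fun r => eLpNorm (J r - J t) 1 (volume : Measure Cyl))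
    (𝓝[Icc 0 T] t) (𝓝 0)

lemma ContL1.add {T : ℝ} {J J' : ℝ → Field} (h : ContL1 T J) (h' : ContL1 T J') :
    ContL1 T (fun t => J t + J' t) := by
  refine ⟨fun t ht => (h.1 t ht).add (h'.1 t ht), fun t ht => ?_⟩
  have h1 := (h.2 t ht).add (h'.2 t ht)
  rw [add_zero] at h1
  refine tendsto_of_tendsto_of_tendsto_of_le_of_le' tendsto_const_nhds h1
    (Eventually.of_forall fun _ => zero_le) ?_
  filter_upwards [self_mem_nhdsWithin] with r hr
  rw [add_sub_add_comm]
  exact eLpNorm_add_le ((h.1 r hr).sub (h.1 t ht)).1 ((h'.1 r hr).sub (h'.1 t ht)).1 le_rfl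

lemma eLpNorm_mul_le {a b : Field} (ha : MemLp a 2 (volume : Measure Cyl))
    (hb : MemLp b 2 (volume : Measure Cyl)) :
    eLpNorm (a * b) 1 (volume : Measure Cyl) ≤
      eLpNorm a 2 (volume : Measure Cyl) * eLpNorm b 2 (volume : Measure Cyl) := by
  have h := eLpNorm_smul_le_mul_eLpNorm (p := 2) (q := 2) (r := 1) hb.1 ha.1
  rwa [smul_eq_mul] at h

lemma ContL2.mul {T : ℝ} {u f : ℝ → Field} (hu : ContL2 T u) (hf : ContL2 T f) :
    ContL1 T (fun t => u t * f t) := by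
  refine ⟨fun t ht => (hu.1 t ht).integrable_mul (hf.1 t ht), fun t ht => ?_⟩
  have h1 : Tendsto (fun r => eLpNorm (u r - u t) 2 volume * (eLpNorm (f r - f t) 2 volume +
      eLpNorm (f t) 2 volume) + eLpNorm (u t) 2 volume * eLpNorm (f r - f t) 2 volume)
      (𝓝[Icc 0 T] t) (𝓝 (0 * (0 + eLpNorm (f t) 2 (volume : Measure Cyl)) +
        eLpNorm (u t) 2 (volume : Measure Cyl) * 0)) := by
    refine Tendsto.add ?_ ?_
    · refine ENNReal.Tendsto.mul (hu.2 t ht) (Or.inr ?_) ((hf.2 t ht).add tendsto_const_nhds)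
        (Or.inr (by simp))
      simpa using (hf.1 t ht).2.ne
    · exact ENNReal.Tendsto.mul tendsto_const_nhds (Or.inr (by simp)) (hf.2 t ht)
        (Or.inr (hu.1 t ht).2.ne)
  simp only [zero_mul, mul_zero, add_zero] at h1
  refine tendsto_of_tendsto_of_tendsto_of_le_of_le' tendsto_const_nhds h1
    (Eventually.of_forall fun _ => zero_le) ?_
  filter_upwards [self_mem_nhdsWithin] with r hr
  have hdu := (hu.1 r hr).sub (hu.1 t ht)
  have hdf := (hf.1 r hr).sub (hf.1 t ht)
  have h2 : u r * f r - u t * f t = (u r - u t) * f r + u t * (f r - f t) := by ring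
  rw [h2]
  refine (eLpNorm_add_le (hdu.integrable_mul (hf.1 r hr)).1
    ((hu.1 t ht).integrable_mul hdf).1 le_rfl).trans ?_
  refine add_le_add ((eLpNorm_mul_le hdu (hf.1 r hr)).trans ?_) (eLpNorm_mul_le (hu.1 t ht) hdf)
  gcongr
  have h3 : f r = (f r - f t) + f t := by ring
  conv_lhs => rw [h3]
  exact eLpNorm_add_le hdf.1 (hf.1 t ht).1 (by norm_num)

lemma contL2_const {T : ℝ} {g : Field} (hg : MemLp g 2 (volume : Measure Cyl)) :
    ContL2 T (fun _ => g) :=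
  ⟨fun _ _ => hg, fun _ _ => by simp [tendsto_const_nhds]⟩

lemma ContL2.trunc {T : ℝ} {f : ℝ → Field} (hf : ContL2 T f) (R : ℝ) :
    ContL1 T (fun t => trunc R (f t)) :=
  (contL2_const (memLp_strip R)).mul hf

/-- Passing to the limit in pairings of a curve in `L¹` with bounded functions which converge
pointwise. -/
lemma ContL1.tendsto {X : Type*} {l : Filter X} [l.IsCountablyGenerated] {T : ℝ} {J : ℝ → Field}
    (hJ : ContL1 T J) {τ : X → ℝ} {s : ℝ} (hs : s ∈ Icc 0 T) (hτ : Tendsto τ l (𝓝[Icc 0 T] s))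
    {b : X → Cyl → ℂ} {b₀ : Cyl → ℂ} {C : ℝ} (hm : ∀ x, Continuous (b x))
    (hb : ∀ᶠ x in l, ∀ z, ‖b x z‖ ≤ C) (hlim : ∀ z, Tendsto (fun x => b x z) l (𝓝 (b₀ z))) :
    Tendsto (fun x => ∫ z : Cyl, (J (τ x) z : ℂ) * b x z) l (𝓝 (∫ z : Cyl, (J s z : ℂ) * b₀ z)) := by
  have hC : ∀ᶠ x in l, ∀ z, ‖b x z‖ ≤ |C| := hb.mono fun x hx z => (hx z).trans (le_abs_self C)
  have h1 : Tendsto (fun x => ∫ z : Cyl, (J s z : ℂ) * b x z) l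
      (𝓝 (∫ z : Cyl, (J s z : ℂ) * b₀ z)) := by
    refine tendsto_integral_filter_of_dominated_convergence (fun z => ‖J s z‖ * |C|) ?_ ?_ ?_ ?_
    · exact Eventually.of_forall fun x =>
        (hJ.1 s hs).ofReal.1.mul (hm x).aestronglyMeasurable
    · filter_upwards [hC] with x hx
      refine Eventually.of_forall fun z => ?_
      rw [norm_mul, Complex.norm_real]
      gcongr; exact hx z
    · exact (hJ.1 s hs).norm.mul_const _
    · exact Eventually.of_forall fun z => (hlim z).const_mul _
  have h2 : Tendsto (fun x => ∫ z : Cyl, ((J (τ x) z - J s z : ℝ) : ℂ) * b x z) l (𝓝 0) := by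
    have h3 : Tendsto (fun x => |C| * (eLpNorm (J (τ x) - J s) 1 volume).toReal) l (𝓝 0) := by
      have h4 := (ENNReal.tendsto_toReal (by simp : (0 : ℝ≥0∞) ≠ ∞)).comp ((hJ.2 s hs).comp hτ)
      have h5 := h4.const_mul |C|
      simpa using h5
    refine squeeze_zero_norm' ?_ h3
    filter_upwards [hC, hτ.eventually self_mem_nhdsWithin] with x hx hx'
    have hd := (hJ.1 _ hx').sub (hJ.1 s hs)
    refine (norm_integral_le_integral_norm _).trans ?_
    have h6 : ∫ z : Cyl, ‖((J (τ x) z - J s z : ℝ) : ℂ) * b x z‖ ≤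
        ∫ z : Cyl, |C| * ‖(J (τ x) - J s) z‖ := by
      refine integral_mono_of_nonneg (Eventually.of_forall fun z => norm_nonneg _)
        (hd.norm.const_mul _) (Eventually.of_forall fun z => ?_)
      simp only [norm_mul, Complex.norm_real, Pi.sub_apply]
      rw [mul_comm]
      gcongr; exact hx z
    refine h6.trans (le_of_eq ?_)
    rw [integral_const_mul, eLpNorm_one_eq_lintegral_enorm, integral_norm_eq_lintegral_enorm hd.1]
  have h7 := h2.add h1
  rw [zero_add] at h7
  refine h7.congr' ?_
  filter_upwards [hC, hτ.eventually self_mem_nhdsWithin] with x hx hx'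
  have hi : ∀ t ∈ Icc 0 T, Integrable fun z : Cyl => (J t z : ℂ) * b x z := fun t ht =>
    (hJ.1 t ht).ofReal.mul_bdd (c := |C|) (hm x).aestronglyMeasurable (Eventually.of_forall hx)
  rw [← integral_add _ (hi s hs)]
  · congr 1; ext z; push_cast; ring
  · refine ((hi _ hx').sub (hi s hs)).congr (Eventually.of_forall fun z => ?_)
    simp only [Pi.sub_apply]; push_cast; ring

lemma ContL1.exists_bound {T : ℝ} {J : ℝ → Field} (hJ : ContL1 T J) :
    ∃ M : ℝ, 0 ≤ M ∧ ∀ t ∈ Icc 0 T, ∫ z : Cyl, ‖J t z‖ ≤ M := by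
  have h : ∃ M : ℝ, ∀ t ∈ Icc 0 T, ∫ z : Cyl, ‖J t z‖ ≤ M := by
    refine isCompact_Icc.induction_on (p := fun S => ∃ M : ℝ, ∀ t ∈ S ∩ Icc 0 T, ∫ z : Cyl, ‖J t z‖ ≤ M)
      ⟨0, by simp⟩ ?_ ?_ ?_ |>.imp fun M hM t ht => hM t ⟨ht, ht⟩
    · rintro S S' hS ⟨M, hM⟩
      exact ⟨M, fun t ht => hM t ⟨hS ht.1, ht.2⟩⟩
    · rintro S S' ⟨M, hM⟩ ⟨M', hM'⟩
      refine ⟨max M M', ?_⟩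
      rintro t ⟨ht | ht, ht'⟩
      · exact (hM t ⟨ht, ht'⟩).trans (le_max_left _ _)
      · exact (hM' t ⟨ht, ht'⟩).trans (le_max_right _ _)
    · intro t ht
      have h1 := (hJ.2 t ht).eventually (gt_mem_nhds (by simp : (0 : ℝ≥0∞) < 1))
      refine ⟨_, h1, 1 + ∫ z : Cyl, ‖J t z‖, ?_⟩
      rintro r ⟨hr, hr'⟩
      have hd := (hJ.1 r hr').sub (hJ.1 t ht)
      have h2 : ∫ z : Cyl, ‖(J r - J t) z‖ ≤ 1 := by
        rw [integral_norm_eq_lintegral_enorm hd.1, ← eLpNorm_one_eq_lintegral_enorm]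
        exact ENNReal.toReal_le_of_le_ofReal zero_le_one (by simpa using (le_of_lt hr))
      have h3 : ∫ z : Cyl, ‖J r z‖ ≤ ∫ z : Cyl, (‖(J r - J t) z‖ + ‖J t z‖) := by
        refine integral_mono (hJ.1 r hr').norm (hd.norm.add (hJ.1 t ht).norm) fun z => ?_
        calc ‖J r z‖ = ‖(J r - J t) z + J t z‖ := by simp
          _ ≤ _ := norm_add_le _ _
      rw [integral_add hd.norm (hJ.1 t ht).norm] at h3
      linarith
  obtain ⟨M, hM⟩ := h
  exact ⟨max M 0, le_max_right _ _, fun t ht => (hM t ht).trans (le_max_left _ _)⟩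

lemma ContL2.exists_bound {T : ℝ} {f : ℝ → Field} (hf : ContL2 T f) :
    ∃ M : ℝ, 0 ≤ M ∧ ∀ t ∈ Icc 0 T, ∫ z : Cyl, ‖f t z‖ ^ 2 ≤ M := by
  obtain ⟨M, h0, hM⟩ := (hf.mul hf).exists_bound
  refine ⟨M, h0, fun t ht => le_of_eq_of_le ?_ (hM t ht)⟩
  simp [pow_two]

/-! ### The amplitude of a weak solution along moving plane waves -/

/-- A smooth bump function equal to `1` on `[-1, 1]` and supported in `[-2, 2]`. -/
def cutBump : ContDiffBump (0 : ℝ) := ⟨1, 2, one_pos, one_lt_two⟩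

/-- The cut-off function `cutBump` rescaled to `|y| ≲ N + 1`. -/
def cut (N : ℕ) (y : ℝ) : ℝ := cutBump (y / (N + 1))

lemma contDiff_cut (N : ℕ) : ContDiff ℝ (⊤ : ℕ∞) (cut N) :=
  cutBump.contDiff.comp (contDiff_id.div_const _)

lemma cut_nonneg (N : ℕ) (y : ℝ) : 0 ≤ cut N y := cutBump.nonneg

lemma cut_le_one (N : ℕ) (y : ℝ) : cut N y ≤ 1 := cutBump.le_one

lemma cut_eq_one {N : ℕ} {y : ℝ} (h : |y| ≤ N + 1) : cut N y = 1 := by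
  refine cutBump.one_of_mem_closedBall ?_
  have hN : (0 : ℝ) < N + 1 := by positivity
  rw [mem_closedBall_zero_iff, Real.norm_eq_abs, abs_div, abs_of_pos hN]
  exact (div_le_one hN).2 h

lemma cut_eq_zero {N : ℕ} {y : ℝ} (h : 2 * ((N : ℝ) + 1) < |y|) : cut N y = 0 := by
  refine cutBump.zero_of_le_dist ?_
  have hN : (0 : ℝ) < N + 1 := by positivity
  rw [dist_zero_right, Real.norm_eq_abs, abs_div, abs_of_pos hN, le_div_iff₀ hN]
  exact h.le

lemma hasCompactSupport_cut (N : ℕ) : HasCompactSupport (cut N) := by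
  refine HasCompactSupport.intro (isCompact_closedBall (0 : ℝ) (2 * ((N : ℝ) + 1))) fun y hy => ?_
  rw [mem_closedBall_zero_iff, Real.norm_eq_abs, not_le] at hy
  exact cut_eq_zero hy

lemma tendsto_cut (y : ℝ) : Tendsto (fun N => cut N y) atTop (𝓝 1) := by
  refine tendsto_const_nhds.congr' ?_
  obtain ⟨M, hM⟩ := exists_nat_ge |y|
  filter_upwards [eventually_ge_atTop M] with N hN
  have : (M : ℝ) ≤ N := by exact_mod_cast hN
  exact (cut_eq_one (by linarith)).symm

lemma contDiff_deriv_cut (N : ℕ) : ContDiff ℝ (⊤ : ℕ∞) (deriv (cut N)) :=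
  (contDiff_infty_iff_deriv.1 (contDiff_cut N)).2

lemma contDiff_deriv_deriv_cut (N : ℕ) : ContDiff ℝ (⊤ : ℕ∞) (deriv (deriv (cut N))) :=
  (contDiff_infty_iff_deriv.1 (contDiff_deriv_cut N)).2

/-- The derivatives of the cut-off functions decay like `1 / (N + 1)`. -/
lemma exists_bound_deriv_cut : ∃ K : ℝ, 0 ≤ K ∧ ∀ (N : ℕ) (y : ℝ),
    |deriv (cut N) y| ≤ K / (N + 1) ∧ |deriv (deriv (cut N)) y| ≤ K / (N + 1) := by
  have hb : ContDiff ℝ (⊤ : ℕ∞) cutBump := cutBump.contDiff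
  have hb1 : ContDiff ℝ (⊤ : ℕ∞) (deriv cutBump) := (contDiff_infty_iff_deriv.1 hb).2
  have hb2 : ContDiff ℝ (⊤ : ℕ∞) (deriv (deriv cutBump)) := (contDiff_infty_iff_deriv.1 hb1).2
  obtain ⟨K1, hK1⟩ := cutBump.hasCompactSupport.deriv.exists_bound_of_continuous hb1.continuous
  obtain ⟨K2, hK2⟩ := cutBump.hasCompactSupport.deriv.deriv.exists_bound_of_continuous hb2.continuous
  refine ⟨max (max K1 K2) 0, le_max_right _ _, fun N y => ?_⟩
  have hN : (0 : ℝ) < N + 1 := by positivity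
  have hN1 : (1 : ℝ) ≤ N + 1 := by linarith [(Nat.cast_nonneg N : (0 : ℝ) ≤ N)]
  have e1 : ∀ y, HasDerivAt (cut N) (deriv cutBump (y / (N + 1)) * (1 / (N + 1))) y := fun y =>
    ((hb.differentiable (by simp)) _).hasDerivAt.comp y ((hasDerivAt_id y).div_const _)
  have e1' : deriv (cut N) = fun y => deriv cutBump (y / (N + 1)) * (1 / (N + 1)) :=
    funext fun y => (e1 y).deriv
  have e2 : HasDerivAt (deriv (cut N))
      (deriv (deriv cutBump) (y / (N + 1)) * (1 / (N + 1)) * (1 / (N + 1))) y := by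
    rw [e1']
    exact (((hb1.differentiable (by simp)) _).hasDerivAt.comp y
      ((hasDerivAt_id y).div_const _)).mul_const _
  have k1 := hK1 (y / (N + 1))
  have k2 := hK2 (y / (N + 1))
  rw [Real.norm_eq_abs] at k1 k2
  have hm1 := (k1.trans (le_max_left K1 K2)).trans (le_max_left _ (0 : ℝ))
  have hm2 := (k2.trans (le_max_right K1 K2)).trans (le_max_left _ (0 : ℝ))
  constructor
  · rw [(e1 y).deriv, abs_mul, abs_of_pos (by positivity : (0 : ℝ) < 1 / (N + 1)), mul_one_div]
    gcongr
  · rw [e2.deriv, abs_mul, abs_mul, abs_of_pos (by positivity : (0 : ℝ) < 1 / (N + 1)),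
      mul_one_div, mul_one_div]
    refine (div_le_self (by positivity) hN1).trans ?_
    gcongr

lemma deriv_cut_eq_zero {N : ℕ} {y : ℝ} (h : 2 * ((N : ℝ) + 1) < |y|) :
    deriv (cut N) y = 0 ∧ deriv (deriv (cut N)) y = 0 := by
  have hU : {z : ℝ | 2 * ((N : ℝ) + 1) < |z|} ∈ 𝓝 y :=
    (isOpen_lt continuous_const continuous_abs).mem_nhds h
  have h0 : cut N =ᶠ[𝓝 y] fun _ => 0 := by
    filter_upwards [hU] with z hz using cut_eq_zero hz
  have h1 := h0.deriv
  have h2 := h1.deriv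
  constructor
  · rw [h1.eq_of_nhds]; simp
  · rw [h2.eq_of_nhds]; simp

/-- The cut-off plane wave in `y`. -/
def prof (N : ℕ) (ζ y : ℝ) : ℂ := cut N y * wave ζ y

lemma contDiff_wave (ζ : ℝ) : ContDiff ℝ (⊤ : ℕ∞) (wave ζ) := by
  unfold wave
  refine Complex.contDiff_exp.comp ?_
  have : ContDiff ℝ (⊤ : ℕ∞) fun y : ℝ => ((-(2 * Real.pi * ζ * y) : ℝ) : ℂ) :=
    Complex.ofRealCLM.contDiff.comp (contDiff_const.mul contDiff_id).neg
  simp only [Complex.ofReal_neg] at this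
  exact this.mul contDiff_const

lemma contDiff_prof (N : ℕ) (ζ : ℝ) : ContDiff ℝ (⊤ : ℕ∞) (prof N ζ) :=
  (Complex.ofRealCLM.contDiff.comp (contDiff_cut N)).mul (contDiff_wave ζ)

lemma hasCompactSupport_ofReal_mul {c : ℝ → ℝ} (h : HasCompactSupport c) (g : ℝ → ℂ) :
    HasCompactSupport fun y => (c y : ℂ) * g y :=
  (h.comp_left (g := fun x : ℝ => (x : ℂ)) (by simp)).mul_right

lemma hasCompactSupport_prof (N : ℕ) (ζ : ℝ) : HasCompactSupport (prof N ζ) :=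
  hasCompactSupport_ofReal_mul (hasCompactSupport_cut N) _

lemma norm_prof_le (N : ℕ) (ζ y : ℝ) : ‖prof N ζ y‖ ≤ 1 := by
  rw [prof, norm_mul, norm_wave, mul_one, Complex.norm_real, Real.norm_of_nonneg (cut_nonneg N y)]
  exact cut_le_one N y

lemma hasDerivAt_wave (ζ y : ℝ) :
    HasDerivAt (wave ζ) (-Complex.I * (2 * Real.pi * ζ : ℝ) * wave ζ y) y := by
  have h : HasDerivAt (fun y : ℝ => -((2 * Real.pi * ζ * y : ℝ) : ℂ) * Complex.I)
      (-((2 * Real.pi * ζ : ℝ) : ℂ) * Complex.I) y := by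
    have h1 : HasDerivAt (fun y : ℝ => ((2 * Real.pi * ζ * y : ℝ) : ℂ))
        ((2 * Real.pi * ζ : ℝ) : ℂ) y := by
      have := ((hasDerivAt_id y).const_mul (2 * Real.pi * ζ)).ofReal_comp
      simpa using this
    exact h1.neg.mul_const _
  convert! h.cexp using 1
  unfold wave
  ring

lemma hasDerivAt_ofReal_mul_wave {c : ℝ → ℝ} (hc : Differentiable ℝ c) (ζ y : ℝ) :
    HasDerivAt (fun y => (c y : ℂ) * wave ζ y) (((deriv c y : ℝ) : ℂ) * wave ζ y +
      -Complex.I * (2 * Real.pi * ζ : ℝ) * (c y * wave ζ y)) y := by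
  convert! ((hc y).hasDerivAt.ofReal_comp).mul (hasDerivAt_wave ζ y) using 1
  ring

lemma deriv_prof (N : ℕ) (ζ : ℝ) : deriv (prof N ζ) = fun y =>
    ((deriv (cut N) y : ℝ) : ℂ) * wave ζ y + -Complex.I * (2 * Real.pi * ζ : ℝ) * prof N ζ y :=
  funext fun y => (hasDerivAt_ofReal_mul_wave ((contDiff_cut N).differentiable (by simp)) ζ y).deriv

/-- The error made in the Laplacian by the cut-off. -/
def lapErr (N : ℕ) (ζ y : ℝ) : ℂ := ((deriv (deriv (cut N)) y : ℝ) : ℂ) * wave ζ y +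
  2 * (-Complex.I * (2 * Real.pi * ζ : ℝ)) * (((deriv (cut N) y : ℝ) : ℂ) * wave ζ y)

lemma deriv_deriv_prof (N : ℕ) (ζ : ℝ) : deriv (deriv (prof N ζ)) = fun y =>
    lapErr N ζ y - ((2 * Real.pi * ζ : ℝ) : ℂ) ^ 2 * prof N ζ y := by
  ext y
  rw [deriv_prof]
  have h1 := hasDerivAt_ofReal_mul_wave ((contDiff_deriv_cut N).differentiable (by simp)) ζ y
  have h2 := hasDerivAt_ofReal_mul_wave ((contDiff_cut N).differentiable (by simp)) ζ y
  refine (h1.add (h2.const_mul (-Complex.I * (2 * Real.pi * ζ : ℝ)))).deriv.trans ?_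
  unfold lapErr prof
  linear_combination ((2 * Real.pi * ζ : ℝ) : ℂ) ^ 2 * (cut N y * wave ζ y) * Complex.I_sq

lemma continuous_deriv_cut_mul (N : ℕ) (ζ : ℝ) :
    Continuous fun y => ((deriv (cut N) y : ℝ) : ℂ) * wave ζ y :=
  (Complex.continuous_ofReal.comp (contDiff_deriv_cut N).continuous).mul (continuous_wave ζ)

lemma continuous_lapErr (N : ℕ) (ζ : ℝ) : Continuous (lapErr N ζ) :=
  ((Complex.continuous_ofReal.comp (contDiff_deriv_deriv_cut N).continuous).mul
    (continuous_wave ζ)).add (continuous_const.mul (continuous_deriv_cut_mul N ζ))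

lemma hasCompactSupport_deriv_cut_mul (N : ℕ) (ζ : ℝ) :
    HasCompactSupport fun y => ((deriv (cut N) y : ℝ) : ℂ) * wave ζ y :=
  hasCompactSupport_ofReal_mul (hasCompactSupport_cut N).deriv _

lemma hasCompactSupport_lapErr (N : ℕ) (ζ : ℝ) : HasCompactSupport (lapErr N ζ) :=
  (hasCompactSupport_ofReal_mul (hasCompactSupport_cut N).deriv.deriv _).add
    (hasCompactSupport_deriv_cut_mul N ζ).mul_left

lemma cpair_add {f : Field} {χ χ' : ℝ → ℂ} {k : ℤ}
    (h : Integrable fun z : Cyl => (f z : ℂ) * (χ z.2 * fourier (-k) z.1))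
    (h' : Integrable fun z : Cyl => (f z : ℂ) * (χ' z.2 * fourier (-k) z.1)) :
    cpair f (fun y => χ y + χ' y) k = cpair f χ k + cpair f χ' k := by
  unfold cpair
  rw [← integral_add h h']
  congr 1; ext z; ring

lemma continuousOn_cpair_of_contL1 {T : ℝ} {J : ℝ → Field} (hJ : ContL1 T J) {χ : ℝ → ℝ → ℂ} {C : ℝ}
    (hχ : ∀ s, Continuous (χ s)) (hχ' : ∀ y, Continuous fun s => χ s y) (hC : ∀ s y, ‖χ s y‖ ≤ C)
    (k : ℤ) : ContinuousOn (fun s => cpair (J s) (χ s) k) (Icc 0 T) := by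
  intro s hs
  refine hJ.tendsto hs tendsto_id (C := C) (b := fun s z => χ s z.2 * fourier (-k) z.1)
    (fun s => ((hχ s).comp continuous_snd).mul ((fourier (-k)).continuous.comp continuous_fst))
    (Eventually.of_forall fun s z => ?_) fun z => ?_
  · rw [norm_mul, norm_fourier_apply, mul_one]; exact hC _ _
  · exact (((hχ' z.2).tendsto s).mono_left nhdsWithin_le_nhds).mul_const _

lemma continuousOn_cpair_of_contL2 {T : ℝ} {f : ℝ → Field} (hf : ContL2 T f) {χ : ℝ → ℝ → ℂ}
    {C R : ℝ} (hχ : ∀ s, Continuous (χ s)) (hχ' : ∀ y, Continuous fun s => χ s y)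
    (hC : ∀ s y, ‖χ s y‖ ≤ C) (hR : ∀ s y, R < |y| → χ s y = 0) (k : ℤ) :
    ContinuousOn (fun s => cpair (f s) (χ s) k) (Icc 0 T) := by
  refine (continuousOn_cpair_of_contL1 (hf.trunc R) hχ hχ' hC k).congr fun s _ => ?_
  exact (cpair_trunc (f s) (hR s) k).symm

/-- `f` is a weak solution on `[0, T]`, with `f(0) = 0`, of the transport-diffusion equation
`∂_t f + y ∂_x f - ν Δ f + div J = ∂_x h` with flux `J = (J₁, J₂)`. The weak form is only required
for test functions with a single frequency in `x`. -/
structure IsTransport (ν T : ℝ) (f h J₁ J₂ : ℝ → Field) : Prop where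
  cont_f : ContL2 T f
  cont_h : ContL2 T h
  cont_J₁ : ContL1 T J₁
  cont_J₂ : ContL1 T J₂
  init : f 0 =ᵐ[volume] 0
  eq : ∀ χ : ℝ → ℂ, ContDiff ℝ (⊤ : ℕ∞) χ → HasCompactSupport χ → ∀ (k : ℤ), ∀ t ∈ Icc 0 T,
    pair (f t) (prTest χ k) = ∫ s in (0 : ℝ)..t, (shearDiffusion ν (f s) (prTest χ k) +
      (pair (J₁ s) (dx (prTest χ k)) + pair (J₂ s) (dy (prTest χ k))) -
      pair (h s) (dx (prTest χ k)))

/-- The right hand side of the weak equation, tested against `χ(y) e^{-ikx}`. -/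
def rate (ν : ℝ) (f h J₁ J₂ : Field) (χ : ℝ → ℂ) (k : ℤ) : ℂ :=
  cpair f (fun y => -Complex.I * k * y * χ y + ν * (-(k : ℂ) ^ 2 * χ y + deriv (deriv χ) y)) k +
    (-Complex.I * k * cpair J₁ χ k + cpair J₂ (deriv χ) k) + Complex.I * k * cpair h χ k

lemma rate_const_mul (ν : ℝ) (f h J₁ J₂ : Field) (χ : ℝ → ℂ) (k : ℤ) (c : ℂ) :
    rate ν f h J₁ J₂ (fun y => c * χ y) k = c * rate ν f h J₁ J₂ χ k := by
  have h1 : deriv (fun y => c * χ y) = fun y => c * deriv χ y := by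
    ext y; exact deriv_const_mul_field c
  have h2 : deriv (deriv fun y => c * χ y) = fun y => c * deriv (deriv χ) y := by
    rw [h1]; ext y; exact deriv_const_mul_field c
  unfold rate
  rw [h2, h1, cpair_const_mul, cpair_const_mul, cpair_const_mul]
  have h3 : (fun y : ℝ => -Complex.I * k * y * (c * χ y) +
      ν * (-(k : ℂ) ^ 2 * (c * χ y) + c * deriv (deriv χ) y)) =
      fun y : ℝ => c * (-Complex.I * k * y * χ y + ν * (-(k : ℂ) ^ 2 * χ y + deriv (deriv χ) y)) := by
    ext y; ring
  rw [h3, cpair_const_mul]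
  ring

section Smooth

variable {χ : ℝ → ℂ}

lemma continuous_rate_profile (h : ContDiff ℝ (⊤ : ℕ∞) χ) (ν : ℝ) (k : ℤ) :
    Continuous fun y : ℝ =>
      -Complex.I * k * y * χ y + ν * (-(k : ℂ) ^ 2 * χ y + deriv (deriv χ) y) := by
  have h0 := h.continuous
  have h1 := ((contDiff_infty_iff_deriv.1 (contDiff_infty_iff_deriv.1 h).2).2).continuous
  fun_prop

lemma hasCompactSupport_rate_profile (h' : HasCompactSupport χ) (ν : ℝ) (k : ℤ) :
    HasCompactSupport fun y : ℝ =>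
      -Complex.I * k * y * χ y + ν * (-(k : ℂ) ^ 2 * χ y + deriv (deriv χ) y) :=
  h'.mul_left.add (h'.mul_left.add h'.deriv.deriv).mul_left

lemma continuousOn_rate {ν T : ℝ} {f h J₁ J₂ : ℝ → Field} (hs : IsTransport ν T f h J₁ J₂)
    (hχ : ContDiff ℝ (⊤ : ℕ∞) χ) (hχ' : HasCompactSupport χ) (k : ℤ) :
    ContinuousOn (fun s => rate ν (f s) (h s) (J₁ s) (J₂ s) χ k) (Icc 0 T) := by
  have hL2 : ∀ {g : ℝ → Field} {η : ℝ → ℂ}, ContL2 T g → Continuous η → HasCompactSupport η →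
      ContinuousOn (fun s => cpair (g s) η k) (Icc 0 T) := by
    intro g η hg h1 h2
    obtain ⟨R, hR⟩ := exists_support_bound h2
    obtain ⟨C, hC⟩ := h2.exists_bound_of_continuous h1
    exact continuousOn_cpair_of_contL2 hg (χ := fun _ => η) (fun _ => h1)
      (fun _ => continuous_const) (fun _ => hC) (fun _ => hR) k
  have hL1 : ∀ {g : ℝ → Field} {η : ℝ → ℂ}, ContL1 T g → Continuous η → HasCompactSupport η →
      ContinuousOn (fun s => cpair (g s) η k) (Icc 0 T) := by
    intro g η hg h1 h2
    obtain ⟨C, hC⟩ := h2.exists_bound_of_continuous h1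
    exact continuousOn_cpair_of_contL1 hg (χ := fun _ => η) (fun _ => h1)
      (fun _ => continuous_const) (fun _ => hC) k
  have hc1 := ((contDiff_infty_iff_deriv.1 hχ).2).continuous
  exact ((hL2 hs.cont_f (continuous_rate_profile hχ ν k)
    (hasCompactSupport_rate_profile hχ' ν k)).add
      ((continuousOn_const.mul (hL1 hs.cont_J₁ hχ.continuous hχ')).add
        (hL1 hs.cont_J₂ hc1 hχ'.deriv))).add
      (continuousOn_const.mul (hL2 hs.cont_h hχ.continuous hχ'))

lemma shearDiffusion_prTest (ν : ℝ) (f : Field) (hχ : ContDiff ℝ (⊤ : ℕ∞) χ) (k : ℤ) :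
    shearDiffusion ν f (prTest χ k) = pair f (prTest (fun y : ℝ =>
      -Complex.I * k * y * χ y + ν * (-(k : ℂ) ^ 2 * χ y + deriv (deriv χ) y)) k) := by
  unfold shearDiffusion pair
  rw [dx_prTest, lap_prTest hχ]
  refine integral_congr_ae (Eventually.of_forall fun z => ?_)
  simp only [prTest]
  rw [← Complex.re_ofReal_mul, ← Complex.re_ofReal_mul, ← Complex.add_re]
  congr 2
  ring

lemma re_rate {f h J₁ J₂ : Field} (hf : MemLp f 2 (volume : Measure Cyl))
    (hh : MemLp h 2 (volume : Measure Cyl)) (hJ₁ : Integrable J₁ (volume : Measure Cyl))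
    (hJ₂ : Integrable J₂ (volume : Measure Cyl)) (hχ : ContDiff ℝ (⊤ : ℕ∞) χ)
    (hχ' : HasCompactSupport χ) (ν : ℝ) (k : ℤ) :
    shearDiffusion ν f (prTest χ k) +
      (pair J₁ (dx (prTest χ k)) + pair J₂ (dy (prTest χ k))) - pair h (dx (prTest χ k)) =
      (rate ν f h J₁ J₂ χ k).re := by
  have hd := (contDiff_infty_iff_deriv.1 hχ).2
  have hc : Continuous fun y => -Complex.I * (k : ℂ) * χ y := continuous_const.mul hχ.continuous
  have hcs : HasCompactSupport fun y => -Complex.I * (k : ℂ) * χ y := hχ'.mul_left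
  obtain ⟨C1, hC1⟩ := hcs.exists_bound_of_continuous hc
  obtain ⟨C2, hC2⟩ := hχ'.deriv.exists_bound_of_continuous hd.continuous
  have p1 := pair_prTest (χ := fun y : ℝ =>
      -Complex.I * k * y * χ y + ν * (-(k : ℂ) ^ 2 * χ y + deriv (deriv χ) y))
    (integrable_cpair_of_memLp hf (continuous_rate_profile hχ ν k)
      (hasCompactSupport_rate_profile hχ' ν k) k)
  have p2 := pair_prTest (χ := fun y => -Complex.I * (k : ℂ) * χ y)
    (integrable_cpair hJ₁ hc hC1 k)
  have p3 := pair_prTest (χ := deriv χ) (integrable_cpair hJ₂ hd.continuous hC2 k)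
  have p4 := pair_prTest (χ := fun y => -Complex.I * (k : ℂ) * χ y)
    (integrable_cpair_of_memLp hh hc hcs k)
  rw [shearDiffusion_prTest ν f hχ, dx_prTest, dy_prTest (hχ.differentiable (by simp)),
    p1, p2, p3, p4, cpair_const_mul,
    cpair_const_mul]
  unfold rate
  rw [← Complex.add_re, ← Complex.add_re, ← Complex.sub_re]
  congr 1
  generalize cpair f _ k = a
  ring

/-- The weak equation for complex test functions. -/
lemma IsTransport.cpair_eq {ν T : ℝ} {f h J₁ J₂ : ℝ → Field} (hs : IsTransport ν T f h J₁ J₂)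
    (hχ : ContDiff ℝ (⊤ : ℕ∞) χ) (hχ' : HasCompactSupport χ) (k : ℤ) {t : ℝ} (ht : t ∈ Icc 0 T) :
    cpair (f t) χ k = ∫ s in (0 : ℝ)..t, rate ν (f s) (h s) (J₁ s) (J₂ s) χ k := by
  have hsub : uIcc 0 t ⊆ Icc 0 T := by
    rw [uIcc_of_le ht.1]; exact Icc_subset_Icc_right ht.2
  have hre : ∀ {η : ℝ → ℂ}, ContDiff ℝ (⊤ : ℕ∞) η → HasCompactSupport η →
      (cpair (f t) η k).re = ∫ s in (0 : ℝ)..t, (rate ν (f s) (h s) (J₁ s) (J₂ s) η k).re := by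
    intro η h1 h2
    rw [← pair_prTest (χ := η) (integrable_cpair_of_memLp (hs.cont_f.1 t ht) h1.continuous h2 k),
      hs.eq η h1 h2 k t ht]
    refine intervalIntegral.integral_congr fun s hs' => ?_
    have hsT := hsub hs'
    exact re_rate (hs.cont_f.1 s hsT) (hs.cont_h.1 s hsT) (hs.cont_J₁.1 s hsT)
      (hs.cont_J₂.1 s hsT) h1 h2 ν k
  have hint : IntervalIntegrable (fun s => rate ν (f s) (h s) (J₁ s) (J₂ s) χ k) volume 0 t :=
    ((continuousOn_rate hs hχ hχ' k).mono hsub).intervalIntegrable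
  apply Complex.ext
  · rw [hre hχ hχ']
    exact Complex.reCLM.intervalIntegral_comp_comm hint
  · have h1 := hre (η := fun y => -Complex.I * χ y) (contDiff_const.mul hχ) hχ'.mul_left
    rw [cpair_const_mul] at h1
    simp only [rate_const_mul] at h1
    have h2 : ∀ z : ℂ, (-Complex.I * z).re = z.im := fun z => by simp
    simp only [h2] at h1
    rw [h1]
    exact Complex.imCLM.intervalIntegral_comp_comm hint

end Smooth

lemma continuous_comp_projIcc {E : Type*} [TopologicalSpace E] {T : ℝ} (hT : 0 ≤ T) {g : ℝ → E}
    (hg : ContinuousOn g (Icc 0 T)) : Continuous fun s => g (projIcc 0 T hT s) :=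
  (continuousOn_iff_continuous_domRestrict.1 hg).comp continuous_projIcc

lemma hasDerivWithinAt_integral {T : ℝ} {g : ℝ → ℂ} (hg : ContinuousOn g (Icc 0 T)) {t : ℝ}
    (ht : t ∈ Icc 0 T) :
    HasDerivWithinAt (fun t => ∫ s in (0 : ℝ)..t, g s) (g t) (Icc 0 T) t := by
  have hT : 0 ≤ T := ht.1.trans ht.2
  have hG := continuous_comp_projIcc hT hg
  have h1 := (hG.integral_hasStrictDerivAt 0 t).hasDerivAt.hasDerivWithinAt (s := Icc 0 T)
  have h2 : ∀ s ∈ Icc 0 T, g (projIcc 0 T hT s) = g s := fun s hs => by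
    rw [projIcc_of_mem hT hs]
  rw [h2 t ht] at h1
  refine h1.congr (fun x hx => ?_) ?_
  all_goals
    refine intervalIntegral.integral_congr fun s hs => ?_
    rw [uIcc_of_le (by first | exact hx.1 | exact ht.1)] at hs
    exact (h2 s ⟨hs.1, hs.2.trans (by first | exact hx.2 | exact ht.2)⟩).symm

lemma hasDerivWithinAt_sub_mul {S : Set ℝ} {a : ℝ} {c : ℝ → ℂ} (hc : ContinuousWithinAt c S a) :
    HasDerivWithinAt (fun s : ℝ => ((s - a : ℝ) : ℂ) * c s) (c a) S a := by
  rw [hasDerivWithinAt_iff_isLittleO]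
  have h1 : (fun s => c s - c a) =o[𝓝[S] a] (fun _ => (1 : ℝ)) := by
    rw [Asymptotics.isLittleO_one_iff]
    have := hc.tendsto.sub_const (c a)
    simpa using this
  have h2 : (fun s : ℝ => ((s - a : ℝ) : ℂ)) =O[𝓝[S] a] fun s => s - a :=
    Asymptotics.IsBigO.of_bound 1 (Eventually.of_forall fun s => by
      rw [Complex.norm_real, one_mul])
  have h3 := h2.mul_isLittleO h1
  simp only [mul_one] at h3
  refine h3.congr (fun s => ?_) fun _ => rfl
  simp only [sub_self, Complex.ofReal_zero, zero_mul, Complex.real_smul]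
  push_cast; ring

lemma norm_exp_sub_one_sub_le (x : ℝ) :
    ‖Complex.exp (x * Complex.I) - 1 - x * Complex.I‖ ≤ 3 * x ^ 2 := by
  have hx : ‖(x : ℂ) * Complex.I‖ = |x| := by simp
  rcases le_total |x| 1 with h | h
  · have h1 := Complex.norm_exp_sub_one_sub_id_le (x := x * Complex.I) (by rw [hx]; exact h)
    rw [hx, sq_abs] at h1
    nlinarith [sq_nonneg x]
  · have h1 : ‖Complex.exp (x * Complex.I) - 1 - x * Complex.I‖ ≤ 1 + 1 + |x| := by
      refine (norm_sub_le _ _).trans ?_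
      rw [hx]
      gcongr
      refine (norm_sub_le _ _).trans ?_
      rw [Complex.norm_exp_ofReal_mul_I, norm_one]
    nlinarith [sq_abs x, abs_nonneg x]

/-- The amplitude of `f` along the cut-off plane wave at the frequency `r` of the moving frame. -/
def amp (N : ℕ) (f : Field) (t : ℝ) (r : ℤ × ℝ) : ℂ := cpair f (prof N (shear t r).2) r.1

/-- The source term in the equation for the amplitude. -/
def ampSrc (ν : ℝ) (f h J₁ J₂ : Field) (N : ℕ) (t : ℝ) (r : ℤ × ℝ) : ℂ :=
  ν * cpair f (lapErr N (shear t r).2) r.1 +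
    (-Complex.I * r.1 * cpair J₁ (prof N (shear t r).2) r.1 +
      (cpair J₂ (fun y => ((deriv (cut N) y : ℝ) : ℂ) * wave (shear t r).2 y) r.1 +
        -Complex.I * xi t r * cpair J₂ (prof N (shear t r).2) r.1)) +
    Complex.I * r.1 * amp N h t r

lemma wave_shear (s t : ℝ) (r : ℤ × ℝ) (y : ℝ) :
    wave (shear s r).2 y = wave (shear t r).2 y * Complex.exp (((s - t) * r.1 * y : ℝ) * Complex.I) := by
  unfold wave
  rw [← Complex.exp_add]
  congr 1
  rw [← Complex.ofReal_neg, ← Complex.ofReal_neg, ← add_mul, ← Complex.ofReal_add]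
  congr 2
  rw [two_pi_mul_shear, two_pi_mul_shear]
  simp only [xi]; ring

/-- The exact equation for a cut-off moving plane wave: the derivatives of the wave give the
diffusion symbol, the shear term cancels against the motion of the wave, and the cut-off leaves the
error `lapErr`. -/
lemma rate_prof {f h J₁ J₂ : Field} (hf : MemLp f 2 (volume : Measure Cyl))
    (hJ₂ : Integrable J₂ (volume : Measure Cyl)) (ν : ℝ) (N : ℕ) (t : ℝ) (r : ℤ × ℝ) :
    rate ν f h J₁ J₂ (prof N (shear t r).2) r.1 +
      cpair f (fun y => Complex.I * r.1 * y * prof N (shear t r).2 y) r.1 =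
    -(ν * lapSym t r) * amp N f t r + ampSrc ν f h J₁ J₂ N t r := by
  set ζ := (shear t r).2 with hζ
  have hp := contDiff_prof N ζ
  have hps := hasCompactSupport_prof N ζ
  have hc := continuous_deriv_cut_mul N ζ
  have hcs := hasCompactSupport_deriv_cut_mul N ζ
  obtain ⟨C1, hC1⟩ := hcs.exists_bound_of_continuous hc
  have hcp : Continuous fun y => -Complex.I * (xi t r : ℂ) * prof N ζ y :=
    continuous_const.mul hp.continuous
  have hcps : HasCompactSupport fun y => -Complex.I * (xi t r : ℂ) * prof N ζ y := hps.mul_left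
  obtain ⟨C2, hC2⟩ := hcps.exists_bound_of_continuous hcp
  have e1 : cpair J₂ (deriv (prof N ζ)) r.1 =
      cpair J₂ (fun y => ((deriv (cut N) y : ℝ) : ℂ) * wave ζ y) r.1 +
        -Complex.I * xi t r * cpair J₂ (prof N ζ) r.1 := by
    rw [deriv_prof, hζ, two_pi_mul_shear, ← hζ, ← cpair_const_mul]
    exact cpair_add (χ := fun y => ((deriv (cut N) y : ℝ) : ℂ) * wave ζ y)
      (χ' := fun y => -Complex.I * (xi t r : ℂ) * prof N ζ y)
      (integrable_cpair hJ₂ hc hC1 r.1) (integrable_cpair hJ₂ hcp hC2 r.1)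
  have hIc : Continuous fun y : ℝ => Complex.I * r.1 * y * prof N ζ y := by
    have := hp.continuous; fun_prop
  have hIs : HasCompactSupport fun y : ℝ => Complex.I * r.1 * y * prof N ζ y := hps.mul_left
  have e2 : cpair f (fun y : ℝ => -Complex.I * r.1 * y * prof N ζ y +
        ν * (-(r.1 : ℂ) ^ 2 * prof N ζ y + deriv (deriv (prof N ζ)) y)) r.1 +
      cpair f (fun y => Complex.I * r.1 * y * prof N ζ y) r.1 =
      -(ν * lapSym t r) * cpair f (prof N ζ) r.1 + ν * cpair f (lapErr N ζ) r.1 := by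
    rw [← cpair_const_mul, ← cpair_const_mul]
    have hLc : Continuous fun y => (ν : ℂ) * lapErr N ζ y :=
      continuous_const.mul (continuous_lapErr N ζ)
    have hLs : HasCompactSupport fun y => (ν : ℂ) * lapErr N ζ y :=
      (hasCompactSupport_lapErr N ζ).mul_left
    have hQc : Continuous fun y => -((ν : ℂ) * lapSym t r) * prof N ζ y :=
      continuous_const.mul hp.continuous
    have hQs : HasCompactSupport fun y => -((ν : ℂ) * lapSym t r) * prof N ζ y := hps.mul_left
    have a1 := cpair_add (χ := fun y : ℝ => -Complex.I * r.1 * y * prof N ζ y +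
        ν * (-(r.1 : ℂ) ^ 2 * prof N ζ y + deriv (deriv (prof N ζ)) y))
      (χ' := fun y => Complex.I * r.1 * y * prof N ζ y)
      (integrable_cpair_of_memLp hf (continuous_rate_profile hp ν r.1)
        (hasCompactSupport_rate_profile hps ν r.1) r.1) (integrable_cpair_of_memLp hf hIc hIs r.1)
    have a2 := cpair_add (χ := fun y => -((ν : ℂ) * lapSym t r) * prof N ζ y)
      (χ' := fun y => (ν : ℂ) * lapErr N ζ y)
      (integrable_cpair_of_memLp hf hQc hQs r.1) (integrable_cpair_of_memLp hf hLc hLs r.1)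
    rw [← a1, ← a2]
    congr 1
    ext y
    rw [deriv_deriv_prof, hζ, two_pi_mul_shear, ← hζ]
    simp only [lapSym]
    push_cast; ring
  unfold rate ampSrc amp
  rw [← hζ, e1]
  linear_combination e2

/-- The ordinary differential equation for the amplitudes of a weak solution. The transport term
drops out because the plane waves move with the shear flow. -/
lemma IsTransport.hasDerivWithinAt_amp {ν T : ℝ} {f h J₁ J₂ : ℝ → Field}
    (hs : IsTransport ν T f h J₁ J₂) (N : ℕ) (r : ℤ × ℝ) {a : ℝ} (ha : a ∈ Icc 0 T) :
    HasDerivWithinAt (fun s => amp N (f s) s r) (-(ν * lapSym a r) * amp N (f a) a r +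
      ampSrc ν (f a) (h a) (J₁ a) (J₂ a) N a r) (Icc 0 T) a := by
  rw [← rate_prof (hs.cont_f.1 a ha) (hs.cont_J₂.1 a ha)]
  set k := r.1 with hk
  set χ := prof N (shear a r).2 with hχ
  have hp : ContDiff ℝ (⊤ : ℕ∞) χ := contDiff_prof N _
  have hps : HasCompactSupport χ := hasCompactSupport_prof N _
  set R : ℝ := 2 * ((N : ℝ) + 1) with hR
  have hχR : ∀ y, R < |y| → χ y = 0 := fun y hy => by
    rw [hχ, prof, cut_eq_zero hy]; simp
  -- the profile frozen at time `a`
  have d1 : HasDerivWithinAt (fun s => cpair (f s) χ k)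
      (rate ν (f a) (h a) (J₁ a) (J₂ a) χ k) (Icc 0 T) a :=
    (hasDerivWithinAt_integral (continuousOn_rate hs hp hps k) ha).congr
      (fun s hs' => hs.cpair_eq hp hps k hs') (hs.cpair_eq hp hps k ha)
  -- the first order change of the profile
  have hIc : Continuous fun y : ℝ => Complex.I * k * y * χ y := by
    have := hp.continuous; fun_prop
  have hIs : HasCompactSupport fun y : ℝ => Complex.I * k * y * χ y := hps.mul_left
  obtain ⟨C1, hC1⟩ := hIs.exists_bound_of_continuous hIc
  have d2 : HasDerivWithinAt (fun s : ℝ => ((s - a : ℝ) : ℂ) *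
      cpair (f s) (fun y => Complex.I * k * y * χ y) k)
      (cpair (f a) (fun y => Complex.I * k * y * χ y) k) (Icc 0 T) a := by
    refine hasDerivWithinAt_sub_mul ?_
    exact continuousOn_cpair_of_contL2 hs.cont_f (χ := fun _ y => Complex.I * k * y * χ y)
      (C := C1) (R := R) (fun _ => hIc) (fun _ => continuous_const) (fun _ => hC1)
      (fun _ y hy => by simp [hχR y hy]) k a ha
  -- the remainder
  set ρ : ℝ → ℝ → ℂ := fun s y => prof N (shear s r).2 y - χ y -
    ((s - a : ℝ) : ℂ) * (Complex.I * k * y * χ y) with hρ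
  have hρc : ∀ s, Continuous (ρ s) := fun s =>
    ((contDiff_prof N _).continuous.sub hp.continuous).sub (continuous_const.mul hIc)
  have hρs : ∀ s, HasCompactSupport (ρ s) := fun s =>
    ((hasCompactSupport_prof N _).sub hps).sub hIs.mul_left
  have hρ0 : ∀ s y, R < |y| → ρ s y = 0 := fun s y hy => by
    simp only [hρ, hχR y hy]
    rw [prof, cut_eq_zero hy]; simp
  have hρb : ∀ s y, ‖ρ s y‖ ≤ 3 * ((k : ℝ) * R) ^ 2 * (s - a) ^ 2 := by
    intro s y
    by_cases hy : R < |y|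
    · rw [hρ0 s y hy, norm_zero]; positivity
    have h1 : ρ s y = χ y * (Complex.exp (((s - a) * k * y : ℝ) * Complex.I) - 1 -
        ((s - a) * k * y : ℝ) * Complex.I) := by
      simp only [hρ, hχ, prof]
      rw [wave_shear s a]
      push_cast; ring
    rw [h1, norm_mul]
    have h2 : y ^ 2 ≤ R ^ 2 := sq_le_sq.2 (by rw [abs_of_nonneg (by positivity : 0 ≤ R)]; linarith)
    calc ‖χ y‖ * ‖_‖ ≤ 1 * (3 * ((s - a) * k * y) ^ 2) := by
          gcongr
          · exact norm_prof_le _ _ _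
          · exact norm_exp_sub_one_sub_le _
      _ = 3 * (k : ℝ) ^ 2 * (s - a) ^ 2 * y ^ 2 := by ring
      _ ≤ 3 * (k : ℝ) ^ 2 * (s - a) ^ 2 * R ^ 2 := by gcongr
      _ = _ := by ring
  obtain ⟨M, hM0, hM⟩ := (hs.cont_f.trunc R).exists_bound
  have d3 : HasDerivWithinAt (fun s => cpair (f s) (ρ s) k) 0 (Icc 0 T) a := by
    have hO : (fun s => cpair (f s) (ρ s) k) =O[𝓝[Icc 0 T] a] fun s => ‖s - a‖ ^ 2 := by
      refine Asymptotics.IsBigO.of_bound (M * (3 * ((k : ℝ) * R) ^ 2)) ?_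
      filter_upwards [self_mem_nhdsWithin] with s hs'
      rw [← cpair_trunc (f s) (hρ0 s)]
      have h1 : ‖cpair (trunc R (f s)) (ρ s) k‖ ≤
          ∫ z : Cyl, ‖trunc R (f s) z‖ * (3 * ((k : ℝ) * R) ^ 2 * (s - a) ^ 2) := by
        refine norm_integral_le_of_norm_le
          ((integrable_trunc (hs.cont_f.1 s hs') R).norm.mul_const _)
          (Eventually.of_forall fun z => ?_)
        rw [norm_mul, norm_mul, norm_fourier_apply, mul_one, Complex.norm_real]
        gcongr
        exact hρb s z.2
      refine h1.trans ?_
      rw [integral_mul_const, Real.norm_of_nonneg (by positivity), Real.norm_eq_abs, sq_abs]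
      have := hM s hs'
      calc _ ≤ M * (3 * ((k : ℝ) * R) ^ 2 * (s - a) ^ 2) := by gcongr
        _ = _ := by ring
    have h1 := hO.hasFDerivWithinAt (𝕜 := ℝ) ha one_lt_two
    have h2 := h1.hasDerivWithinAt
    simpa using h2
  have d := (d1.add d2).add d3
  rw [add_zero] at d
  -- the amplitude is the sum of the three parts
  have hdec : ∀ s ∈ Icc 0 T, amp N (f s) s r = cpair (f s) χ k +
      ((s - a : ℝ) : ℂ) * cpair (f s) (fun y => Complex.I * k * y * χ y) k +
      cpair (f s) (ρ s) k := by
    intro s hs'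
    have hfs := hs.cont_f.1 s hs'
    have hLc : Continuous fun y : ℝ => ((s - a : ℝ) : ℂ) * (Complex.I * k * y * χ y) :=
      continuous_const.mul hIc
    have hLs : HasCompactSupport fun y : ℝ => ((s - a : ℝ) : ℂ) * (Complex.I * k * y * χ y) :=
      hIs.mul_left
    rw [← cpair_const_mul]
    have a1 := cpair_add (χ := χ) (χ' := fun y : ℝ => ((s - a : ℝ) : ℂ) * (Complex.I * k * y * χ y))
      (integrable_cpair_of_memLp hfs hp.continuous hps k)
      (integrable_cpair_of_memLp hfs hLc hLs k)
    have a2 := cpair_add (χ := fun y : ℝ => χ y + ((s - a : ℝ) : ℂ) * (Complex.I * k * y * χ y))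
      (χ' := ρ s) (integrable_cpair_of_memLp hfs (hp.continuous.add hLc) (hps.add hLs) k)
      (integrable_cpair_of_memLp hfs (hρc s) (hρs s) k)
    rw [← a1, ← a2]
    unfold amp
    congr 1
    ext y
    simp only [hρ]
    ring
  exact d.congr hdec (hdec a ha)

/-! ### Removing the cut-off: Duhamel's formula for the spectrum -/

lemma wave_comm (ζ y : ℝ) : wave ζ y = wave y ζ := by
  unfold wave; rw [mul_right_comm]

/-- The mode-by-mode form of the pairing with a plane wave. -/
lemma cpair_eq_integral_modeX {f : Field} {χ : ℝ → ℂ} {k : ℤ}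
    (h : Integrable fun z : Cyl => (f z : ℂ) * (χ z.2 * fourier (-k) z.1)) :
    ((2 * Real.pi)⁻¹ : ℝ) * cpair f χ k = ∫ y, χ y * modeX f k y := by
  have h1 : cpair f χ k = ∫ y : ℝ, ∫ x : AddCircle (2 * Real.pi),
      (f (x, y) : ℂ) * (χ y * fourier (-k) x) := integral_prod_symm _ h
  rw [h1, ← integral_const_mul]
  refine integral_congr_ae (Eventually.of_forall fun y => ?_)
  simp only [modeX, fourierCoeff_eq_integral]
  have e : ∫ x : AddCircle (2 * Real.pi), (f (x, y) : ℂ) * (χ y * fourier (-k) x) =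
      χ y * ∫ x : AddCircle (2 * Real.pi), fourier (-k) x * (f (x, y) : ℂ) := by
    rw [← integral_const_mul]
    exact integral_congr_ae (Eventually.of_forall fun x => by simp only; ring)
  rw [e]; ring

/-- If the amplitudes of `f` along cut-off plane waves converge locally boundedly to a continuous
function of the frequency, then this function is the spectrum of `f`. -/
lemma hat_ae_eq_of_tendsto {f : Field} (hf : MemLp f 2 (volume : Measure Cyl)) (k : ℤ) {c : ℝ → ℂ}
    (hc : Continuous c)
    (hlim : ∀ ζ, Tendsto (fun N => ((2 * Real.pi)⁻¹ : ℝ) * cpair f (prof N ζ) k) atTop (𝓝 (c ζ)))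
    (hb : ∀ R : ℝ, ∃ C : ℝ, ∀ ζ, |ζ| ≤ R → ∀ N, ‖cpair f (prof N ζ) k‖ ≤ C) :
    hat f k =ᵐ[volume] c := by
  rw [hat_eq_planch]
  have ha := memLp_modeX hf k
  refine planch_ae_eq ha hc.locallyIntegrable fun g hg hg' => ?_
  obtain ⟨R, hR⟩ := exists_support_bound hg
  obtain ⟨C, hC⟩ := hb R
  have hC0 : 0 ≤ max C 0 := le_max_right _ _
  have hgi : Integrable g := hg'.continuous.integrable_of_hasCompactSupport hg
  have hpi : (0 : ℝ) < (2 * Real.pi)⁻¹ := inv_pos.2 Real.two_pi_pos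
  have hcb : ∀ N, MemLp (fun y => (cut N y : ℂ)) 2 (volume : Measure ℝ) := fun N =>
    (Complex.continuous_ofReal.comp (contDiff_cut N).continuous).memLp_of_hasCompactSupport
      ((hasCompactSupport_cut N).comp_left (g := fun x : ℝ => (x : ℂ)) (by simp))
  have hbi : ∀ N, Integrable fun y => (cut N y : ℂ) * modeX f k y := fun N =>
    (hcb N).integrable_mul ha
  have key : ∀ N, ∫ ζ, g ζ * (((2 * Real.pi)⁻¹ : ℝ) * cpair f (prof N ζ) k) =
      ∫ y, 𝓕 g y * (cut N y * modeX f k y) := by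
    intro N
    have h1 : ∀ ζ, ((2 * Real.pi)⁻¹ : ℝ) * cpair f (prof N ζ) k =
        ∫ y, prof N ζ y * modeX f k y := fun ζ =>
      cpair_eq_integral_modeX (integrable_cpair_of_memLp hf (contDiff_prof N ζ).continuous
        (hasCompactSupport_prof N ζ) k)
    simp_rw [h1, ← integral_const_mul]
    have hsw : Integrable (Function.uncurry fun ζ y => g ζ * (prof N ζ y * modeX f k y))
        (volume.prod volume) := by
      have h2 := hgi.mul_prod (hbi N)
      have hw : Continuous fun p : ℝ × ℝ => wave p.1 p.2 := by unfold wave; fun_prop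
      refine (h2.mul_bdd (c := 1) hw.aestronglyMeasurable (Eventually.of_forall fun p =>
        (norm_wave _ _).le)).congr (Eventually.of_forall fun p => ?_)
      simp only [Function.uncurry, prof]; ring
    rw [integral_integral_swap hsw]
    refine integral_congr_ae (Eventually.of_forall fun y => ?_)
    simp only
    rw [fourier_eq_integral_wave, ← integral_mul_const]
    refine integral_congr_ae (Eventually.of_forall fun ζ => ?_)
    simp only [prof]
    rw [wave_comm ζ y]; ring
  -- both sides of `key` converge: the left one by hypothesis, the right one because `𝓕 g` is `L²`
  have l1 : Tendsto (fun N => ∫ ζ, g ζ * (((2 * Real.pi)⁻¹ : ℝ) * cpair f (prof N ζ) k)) atTop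
      (𝓝 (∫ ζ, g ζ * c ζ)) := by
    refine tendsto_integral_of_dominated_convergence
      (fun ζ => ‖g ζ‖ * ((2 * Real.pi)⁻¹ * max C 0)) ?_ (hgi.norm.mul_const _) ?_ ?_
    · intro N
      have h1 : ∀ ζ, ((2 * Real.pi)⁻¹ : ℝ) * cpair f (prof N ζ) k =
          𝓕 (fun y => (cut N y : ℂ) * modeX f k y) ζ := fun ζ => by
        rw [cpair_eq_integral_modeX (integrable_cpair_of_memLp hf (contDiff_prof N ζ).continuous
          (hasCompactSupport_prof N ζ) k), fourier_eq_integral_wave]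
        refine integral_congr_ae (Eventually.of_forall fun y => ?_)
        simp only [prof]; ring
      simp_rw [h1]
      have h2 : Continuous (𝓕 fun y => (cut N y : ℂ) * modeX f k y) :=
        VectorFourier.fourierIntegral_continuous Real.continuous_fourierChar
          (by exact continuous_inner) (hbi N)
      exact (hg'.continuous.mul h2).aestronglyMeasurable
    · intro N
      refine Eventually.of_forall fun ζ => ?_
      by_cases hζ : |ζ| ≤ R
      · rw [norm_mul, norm_mul, Complex.norm_real, Real.norm_of_nonneg hpi.le]
        gcongr
        exact (hC ζ hζ N).trans (le_max_left _ _)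
      · rw [hR ζ (not_le.1 hζ)]; simp
    · exact Eventually.of_forall fun ζ => (hlim ζ).const_mul _
  have l2 : Tendsto (fun N => ∫ y, 𝓕 g y * (cut N y * modeX f k y)) atTop
      (𝓝 (∫ y, 𝓕 g y * modeX f k y)) := by
    have hFg : MemLp (𝓕 g) 2 (volume : Measure ℝ) := by
      have := (𝓕 (hg.toSchwartzMap hg')).memLp 2 (volume : Measure ℝ)
      rw [SchwartzMap.fourier_coe] at this
      exact this
    have hi : Integrable fun y => 𝓕 g y * modeX f k y := hFg.integrable_mul ha
    refine tendsto_integral_of_dominated_convergence (fun y => ‖𝓕 g y * modeX f k y‖) ?_ hi.norm ?_ ?_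
    · exact fun N => hFg.1.mul (hbi N).1
    · intro N
      refine Eventually.of_forall fun y => ?_
      rw [norm_mul, norm_mul, norm_mul, Complex.norm_real, Real.norm_of_nonneg (cut_nonneg N y)]
      gcongr
      exact mul_le_of_le_one_left (norm_nonneg _) (cut_le_one N y)
    · refine Eventually.of_forall fun y => ?_
      have h3 : Tendsto (fun N => (cut N y : ℂ)) atTop (𝓝 ((1 : ℝ) : ℂ)) :=
        (Complex.continuous_ofReal.tendsto _).comp (tendsto_cut y)
      have h4 := (h3.mul_const (modeX f k y)).const_mul (𝓕 g y)
      simpa using h4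
  simp_rw [key] at l1
  exact tendsto_nhds_unique l1 l2

/-- The Fourier transform of an integrable field at a frequency of the moving frame. -/
def spec1 (J : Field) (t : ℝ) (r : ℤ × ℝ) : ℂ :=
  ((2 * Real.pi)⁻¹ : ℝ) * ∫ z : Cyl, (J z : ℂ) * pw t r z

lemma spec1_add {J J' : Field} (h : Integrable J (volume : Measure Cyl))
    (h' : Integrable J' (volume : Measure Cyl)) (t : ℝ) (r : ℤ × ℝ) :
    spec1 (J + J') t r = spec1 J t r + spec1 J' t r := by
  have hi : ∀ {J : Field}, Integrable J (volume : Measure Cyl) →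
      Integrable fun z : Cyl => (J z : ℂ) * pw t r z := fun h =>
    integrable_mul_wave h.ofReal _ _
  unfold spec1
  rw [← mul_add, ← integral_add (hi h) (hi h')]
  congr 2; ext z
  simp only [Pi.add_apply]; push_cast; ring

lemma spec1_mul {f g : Field} (hf : MemLp f 2 (volume : Measure Cyl))
    (hg : MemLp g 2 (volume : Measure Cyl)) (t : ℝ) (r : ℤ × ℝ) :
    spec1 (f * g) t r = ∫ p, sp f t p * sp g t (r - p) ∂freqVol :=
  integral_mul_pw hf hg t r

lemma continuousOn_spec1 {T : ℝ} {J : ℝ → Field} (hJ : ContL1 T J) (k : ℤ) :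
    ContinuousOn (fun x : ℝ × ℝ => spec1 (J x.1) x.1 (k, x.2)) (Icc 0 T ×ˢ univ) := by
  rintro ⟨s, ζ⟩ hx
  refine Tendsto.const_mul _ ?_
  refine hJ.tendsto (X := ℝ × ℝ) (τ := Prod.fst) (C := 1) hx.1 ?_ (fun x => continuous_pw _ _)
    (Eventually.of_forall fun x z => (norm_pw _ _ _).le) fun z => ?_
  · refine tendsto_nhdsWithin_of_tendsto_nhds_of_eventually_within _
      (continuous_fst.continuousAt.tendsto.mono_left nhdsWithin_le_nhds) ?_
    filter_upwards [self_mem_nhdsWithin] with x hx' using hx'.1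
  · have : Continuous fun x : ℝ × ℝ => pw x.1 (k, x.2) z := by
      unfold pw wave shear; fun_prop
    exact (this.tendsto _).mono_left nhdsWithin_le_nhds

/-- The right hand side of the equation for the spectrum, without the diffusion. -/
def specSrc (J₁ J₂ : ℝ → Field) (Wh : ℝ → ℤ × ℝ → ℂ) (s : ℝ) (r : ℤ × ℝ) : ℂ :=
  -Complex.I * (r.1 * spec1 (J₁ s) s r + xi s r * spec1 (J₂ s) s r) + Complex.I * r.1 * Wh s r

/-- `W` is the pointwise limit, locally bounded in frequency, of the amplitudes of `f` along
cut-off moving plane waves. -/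
structure HasAmp (T : ℝ) (f : ℝ → Field) (W : ℝ → ℤ × ℝ → ℂ) : Prop where
  cont : ∀ k : ℤ, ContinuousOn (fun x : ℝ × ℝ => W x.1 (k, x.2)) (Icc 0 T ×ˢ univ)
  lim : ∀ r, ∀ s ∈ Icc 0 T,
    Tendsto (fun N => ((2 * Real.pi)⁻¹ : ℝ) * amp N (f s) s r) atTop (𝓝 (W s r))
  bdd : ∀ (k : ℤ) (R : ℝ), ∃ C : ℝ, ∀ ζ, |ζ| ≤ R → ∀ N, ∀ s ∈ Icc 0 T, ‖amp N (f s) s (k, ζ)‖ ≤ C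

lemma hasAmp_zero (T : ℝ) : HasAmp T (fun _ => 0) (fun _ _ => 0) where
  cont _ := continuousOn_const
  lim r s _ := by simp [amp, cpair]
  bdd _ _ := ⟨0, by simp [amp, cpair]⟩

lemma HasAmp.sp_ae_eq {T : ℝ} {f : ℝ → Field} {W : ℝ → ℤ × ℝ → ℂ} (h : HasAmp T f W) {t : ℝ}
    (ht : t ∈ Icc 0 T) (hf : MemLp (f t) 2 (volume : Measure Cyl)) :
    sp (f t) t =ᵐ[freqVol] W t := by
  have h1 : ∀ᵐ p : ℤ × ℝ ∂freqVol,
      hat (f t) p.1 p.2 = W t (p.1, p.2 + t * p.1 / (2 * Real.pi)) := by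
    refine ae_freqVol fun k => ?_
    have hsh : ∀ ζ : ℝ, (shear t (k, ζ + t * k / (2 * Real.pi))).2 = ζ := fun ζ => by simp [shear]
    refine hat_ae_eq_of_tendsto hf k ?_ (fun ζ => ?_) fun R => ?_
    · have h2 : ContinuousOn (fun ζ : ℝ => W t (k, ζ + t * k / (2 * Real.pi))) univ :=
        (h.cont k).comp (f := fun ζ : ℝ => (t, ζ + t * k / (2 * Real.pi)))
          (by fun_prop) fun ζ _ => ⟨ht, mem_univ _⟩
      exact continuousOn_univ.1 h2
    · have h2 := h.lim (k, ζ + t * k / (2 * Real.pi)) t ht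
      unfold amp at h2
      rwa [hsh] at h2
    · obtain ⟨C, hC⟩ := h.bdd k (R + |t * k / (2 * Real.pi)|)
      refine ⟨C, fun ζ hζ N => ?_⟩
      have h2 := hC (ζ + t * k / (2 * Real.pi)) ((abs_add_le _ _).trans (by gcongr)) N t ht
      unfold amp at h2
      rwa [hsh] at h2
  filter_upwards [(measurePreserving_shear t).quasiMeasurePreserving.ae h1] with p hp
  have h3 : ((shear t p).1, (shear t p).2 + t * (shear t p).1 / (2 * Real.pi)) = p := by
    refine Prod.ext rfl ?_
    simp only [shear]; ring
  rw [h3] at hp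
  exact hp

/-- The accumulated viscous damping `ν ∫_0^t (k² + ξ_s²) ds` at a frequency. -/
def damp (ν t : ℝ) (r : ℤ × ℝ) : ℝ :=
  ν * ((r.1 : ℝ) ^ 2 * t + ((2 * Real.pi * r.2) ^ 2 * t - 2 * Real.pi * r.2 * r.1 * t ^ 2 +
    (r.1 : ℝ) ^ 2 * t ^ 3 / 3))

lemma hasDerivAt_damp (ν t : ℝ) (r : ℤ × ℝ) :
    HasDerivAt (fun t => damp ν t r) (ν * lapSym t r) t := by
  have h2 := (hasDerivAt_pow 2 t).const_mul (2 * Real.pi * r.2 * r.1)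
  have h3 := ((hasDerivAt_pow 3 t).const_mul ((r.1 : ℝ) ^ 2)).div_const 3
  have h4 := (((hasDerivAt_id t).const_mul ((2 * Real.pi * r.2) ^ 2)).sub h2).add h3
  have h5 := (((hasDerivAt_id t).const_mul ((r.1 : ℝ) ^ 2)).add h4).const_mul ν
  convert! h5 using 1
  simp only [lapSym, xi]
  push_cast; ring

lemma monotone_damp {ν : ℝ} (hν : 0 ≤ ν) (r : ℤ × ℝ) : Monotone fun t => damp ν t r := by
  refine monotone_of_deriv_nonneg (fun t => (hasDerivAt_damp ν t r).differentiableAt) fun t => ?_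
  rw [(hasDerivAt_damp ν t r).deriv]
  exact mul_nonneg hν (lapSym_nonneg t r)

lemma continuous_damp (ν : ℝ) (k : ℤ) : Continuous fun x : ℝ × ℝ => damp ν x.1 (k, x.2) := by
  unfold damp; fun_prop

/-- Duhamel's formula for `∂_t W = -ν (k² + ξ_t²) W + B` with `W(0) = 0`. -/
def duhamel (ν : ℝ) (B : ℝ → ℤ × ℝ → ℂ) (t : ℝ) (r : ℤ × ℝ) : ℂ :=
  (Real.exp (-damp ν t r) : ℂ) * ∫ s in (0 : ℝ)..t, (Real.exp (damp ν s r) : ℂ) * B s r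

lemma duhamel_zero (ν : ℝ) (B : ℝ → ℤ × ℝ → ℂ) (r : ℤ × ℝ) : duhamel ν B 0 r = 0 := by
  simp [duhamel]

lemma hasDerivAt_duhamel {B : ℝ → ℤ × ℝ → ℂ} {r : ℤ × ℝ} (hB : Continuous fun s => B s r)
    (ν t : ℝ) : HasDerivAt (fun t => duhamel ν B t r)
      (-(ν * lapSym t r) * duhamel ν B t r + B t r) t := by
  have hc : Continuous fun s => (Real.exp (damp ν s r) : ℂ) * B s r := by
    have : Continuous fun s => damp ν s r :=
      continuous_iff_continuousAt.2 fun s => (hasDerivAt_damp ν s r).continuousAt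
    exact (Complex.continuous_ofReal.comp (Real.continuous_exp.comp this)).mul hB
  have h1 := (hc.integral_hasStrictDerivAt 0 t).hasDerivAt
  have h2 : HasDerivAt (fun t => (Real.exp (-damp ν t r) : ℂ))
      ((Real.exp (-damp ν t r) * -(ν * lapSym t r) : ℝ) : ℂ) t :=
    ((hasDerivAt_damp ν t r).fun_neg.exp).ofReal_comp
  have hE : (Real.exp (-damp ν t r) : ℂ) * (Real.exp (damp ν t r) : ℂ) = 1 := by
    rw [← Complex.ofReal_mul, ← Real.exp_add, neg_add_cancel, Real.exp_zero, Complex.ofReal_one]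
  have h3 := h2.mul h1
  refine h3.congr_deriv ?_
  unfold duhamel
  push_cast
  push_cast at hE
  linear_combination B t r * hE

lemma continuous_duhamel {B : ℝ → ℤ × ℝ → ℂ} {k : ℤ}
    (hB : Continuous fun x : ℝ × ℝ => B x.1 (k, x.2)) (ν : ℝ) :
    Continuous fun x : ℝ × ℝ => duhamel ν B x.1 (k, x.2) := by
  have hd := continuous_damp ν k
  have h1 : Continuous fun q : (ℝ × ℝ) × ℝ =>
      (Real.exp (damp ν q.2 (k, q.1.2)) : ℂ) * B q.2 (k, q.1.2) := by
    have e : Continuous fun q : (ℝ × ℝ) × ℝ => (q.2, q.1.2) := by fun_prop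
    exact (Complex.continuous_ofReal.comp (Real.continuous_exp.comp (hd.comp e))).mul (hB.comp e)
  exact (Complex.continuous_ofReal.comp (Real.continuous_exp.comp hd.neg)).mul
    (intervalIntegral.continuous_parametric_intervalIntegral_of_continuous
      (f := fun (x : ℝ × ℝ) s => (Real.exp (damp ν s (k, x.2)) : ℂ) * B s (k, x.2)) h1
      continuous_fst)

lemma norm_cpair_le {J : Field} (hJ : Integrable J (volume : Measure Cyl)) {χ : ℝ → ℂ} {C : ℝ}
    (hC : ∀ y, ‖χ y‖ ≤ C) (k : ℤ) : ‖cpair J χ k‖ ≤ C * ∫ z : Cyl, ‖J z‖ := by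
  rw [mul_comm, ← integral_mul_const]
  refine norm_integral_le_of_norm_le (hJ.norm.mul_const _) (Eventually.of_forall fun z => ?_)
  rw [norm_mul, norm_mul, norm_fourier_apply, mul_one, Complex.norm_real]
  gcongr; exact hC _

/-- By Cauchy–Schwarz, truncation to `|y| ≤ 2(N+1)` costs a factor `√(N+1)` in `L¹`. -/
lemma integral_norm_trunc_le {f : Field} (hf : MemLp f 2 (volume : Measure Cyl)) (N : ℕ) :
    ∫ z : Cyl, ‖trunc (2 * ((N : ℝ) + 1)) f z‖ ≤
      Real.sqrt (N + 1) * (8 * Real.pi + ∫ z : Cyl, ‖f z‖ ^ 2) := by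
  set R : ℝ := 2 * ((N : ℝ) + 1) with hR
  have hR0 : 0 ≤ R := by positivity
  set a : ℝ := Real.sqrt (N + 1) with ha
  have hN : (0 : ℝ) < N + 1 := by positivity
  have ha0 : 0 < a := Real.sqrt_pos.2 hN
  have ha2 : a * a = N + 1 := Real.mul_self_sqrt hN.le
  have hf2 : Integrable (fun z : Cyl => ‖f z‖ ^ 2) (volume : Measure Cyl) := by
    have := (memLp_two_iff_integrable_sq_norm hf.1).1 hf
    exact this
  have hs2 : Integrable (fun z : Cyl => if |z.2| ≤ R then (1 : ℝ) else 0) (volume : Measure Cyl) := by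
    have := (memLp_two_iff_integrable_sq (memLp_strip R).1).1 (memLp_strip R)
    refine this.congr (Eventually.of_forall fun z => ?_)
    by_cases hz : |z.2| ≤ R <;> simp [hz]
  have hsv : ∫ z : Cyl, (if |z.2| ≤ R then (1 : ℝ) else 0) = 8 * Real.pi * (N + 1) := by
    have h1 : (fun z : Cyl => if |z.2| ≤ R then (1 : ℝ) else 0) =
        (univ ×ˢ Icc (-R) R).indicator fun _ => 1 := by
      ext z; simp [indicator_apply, abs_le]
    rw [h1, integral_indicator_const _ (MeasurableSet.univ.prod measurableSet_Icc), Measure.real,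
      Measure.volume_eq_prod, Measure.prod_prod, Real.volume_Icc, AddCircle.measure_univ,
      ENNReal.toReal_mul, ENNReal.toReal_ofReal Real.two_pi_pos.le,
      ENNReal.toReal_ofReal (by linarith), smul_eq_mul, hR]
    ring
  have hle : ∀ z : Cyl, ‖trunc R f z‖ ≤
      a⁻¹ * (if |z.2| ≤ R then (1 : ℝ) else 0) + a * ‖f z‖ ^ 2 := by
    intro z
    by_cases hz : |z.2| ≤ R
    · simp only [trunc, hz, if_true, one_mul, mul_one]
      have h1 : a⁻¹ * (a * ‖f z‖) = ‖f z‖ := by field_simp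
      have h2 : a⁻¹ * (a * ‖f z‖) ^ 2 = a * ‖f z‖ ^ 2 := by field_simp
      have h3 : 0 < a⁻¹ := inv_pos.2 ha0
      nlinarith [mul_nonneg h3.le (sq_nonneg (a * ‖f z‖ - 1)), mul_nonneg h3.le (sq_nonneg (a * ‖f z‖)), norm_nonneg (f z)]
    · simp only [trunc, hz, if_false, zero_mul, norm_zero, mul_zero, zero_add]
      positivity
  have h1 := integral_mono (integrable_trunc hf R).norm
    ((hs2.const_mul a⁻¹).add (hf2.const_mul a)) hle
  refine h1.trans (le_of_eq ?_)
  rw [integral_add' (hs2.const_mul a⁻¹) (hf2.const_mul a), integral_const_mul, integral_const_mul,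
    hsv, ← ha2]
  field_simp

lemma norm_lapErr_le {K : ℝ} (hK : ∀ (N : ℕ) (y : ℝ),
    |deriv (cut N) y| ≤ K / (N + 1) ∧ |deriv (deriv (cut N)) y| ≤ K / (N + 1)) (N : ℕ) (ζ y : ℝ) :
    ‖lapErr N ζ y‖ ≤ K / (N + 1) * (1 + 2 * |2 * Real.pi * ζ|) := by
  unfold lapErr
  refine (norm_add_le _ _).trans ?_
  simp only [norm_mul, norm_neg, Complex.norm_I, norm_wave, Complex.norm_real, Complex.norm_ofNat,
    Real.norm_eq_abs, mul_one, one_mul]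
  have h1 := (hK N y).1
  have h2 := (hK N y).2
  have h3 := mul_le_mul_of_nonneg_left h1 (abs_nonneg (2 * Real.pi * ζ))
  simp only [abs_mul] at h3 ⊢
  linarith

lemma lapErr_eq_zero {N : ℕ} {ζ y : ℝ} (h : 2 * ((N : ℝ) + 1) < |y|) : lapErr N ζ y = 0 := by
  simp [lapErr, (deriv_cut_eq_zero h).1, (deriv_cut_eq_zero h).2]

/-- The error terms of the cut-off vanish in the limit, uniformly on bounded sets. -/
lemma norm_cpair_lapErr_le {f : Field} (hf : MemLp f 2 (volume : Measure Cyl)) {K : ℝ} (hK0 : 0 ≤ K)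
    (hK : ∀ (N : ℕ) (y : ℝ), |deriv (cut N) y| ≤ K / (N + 1) ∧
      |deriv (deriv (cut N)) y| ≤ K / (N + 1)) (N : ℕ) (ζ : ℝ) (k : ℤ) :
    ‖cpair f (lapErr N ζ) k‖ ≤
      K * (1 + 2 * |2 * Real.pi * ζ|) * (8 * Real.pi + ∫ z : Cyl, ‖f z‖ ^ 2) / Real.sqrt (N + 1) := by
  rw [← cpair_trunc (R := 2 * ((N : ℝ) + 1)) f (fun y hy => lapErr_eq_zero hy)]
  refine (norm_cpair_le (integrable_trunc hf _) (norm_lapErr_le hK N ζ) k).trans ?_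
  have hN : (0 : ℝ) < N + 1 := by positivity
  have ha0 : 0 < Real.sqrt (N + 1) := Real.sqrt_pos.2 hN
  have ha2 : Real.sqrt (N + 1) * Real.sqrt (N + 1) = N + 1 := Real.mul_self_sqrt hN.le
  refine (mul_le_mul_of_nonneg_left (integral_norm_trunc_le hf N) (by positivity)).trans
    (le_of_eq ?_)
  generalize Real.sqrt ((N : ℝ) + 1) = a at *
  rw [← ha2]; field_simp

lemma tendsto_const_div_sqrt (C : ℝ) :
    Tendsto (fun N : ℕ => C / Real.sqrt (N + 1)) atTop (𝓝 0) := by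
  refine Tendsto.const_div_atTop ?_ C
  exact Real.tendsto_sqrt_atTop.comp
    (tendsto_atTop_add_const_right _ 1 tendsto_natCast_atTop_atTop)

lemma tendsto_cpair_prof {J : Field} (hJ : Integrable J (volume : Measure Cyl)) (t : ℝ)
    (r : ℤ × ℝ) : Tendsto (fun N => ((2 * Real.pi)⁻¹ : ℝ) * cpair J (prof N (shear t r).2) r.1) atTop
      (𝓝 (spec1 J t r)) := by
  refine Tendsto.const_mul _ ?_
  refine tendsto_integral_of_dominated_convergence (fun z => ‖J z‖) ?_ hJ.norm ?_ ?_
  · exact fun N => (integrable_cpair hJ (contDiff_prof N _).continuous (norm_prof_le N _) _).1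
  · refine fun N => Eventually.of_forall fun z => ?_
    rw [norm_mul, norm_mul, norm_fourier_apply, mul_one, Complex.norm_real]
    exact mul_le_of_le_one_right (norm_nonneg _) (norm_prof_le _ _ _)
  · refine Eventually.of_forall fun z => ?_
    have h3 : Tendsto (fun N => (cut N z.2 : ℂ)) atTop (𝓝 ((1 : ℝ) : ℂ)) :=
      (Complex.continuous_ofReal.tendsto _).comp (tendsto_cut z.2)
    have h4 := ((h3.mul_const (wave (shear t r).2 z.2)).mul_const
      (fourier (-r.1) z.1)).const_mul (J z : ℂ)
    have e : (J z : ℂ) * (((1 : ℝ) : ℂ) * wave (shear t r).2 z.2 * fourier (-r.1) z.1) =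
        J z * pw t r z := by
      rw [pw, Complex.ofReal_one]; ring
    rwa [e] at h4

section Source

variable {ν T : ℝ} {f h J₁ J₂ : ℝ → Field} {Wh : ℝ → ℤ × ℝ → ℂ}

lemma tendsto_ampSrc (hs : IsTransport ν T f h J₁ J₂) (hh : HasAmp T h Wh) {s : ℝ}
    (hsT : s ∈ Icc 0 T) (r : ℤ × ℝ) :
    Tendsto (fun N => ((2 * Real.pi)⁻¹ : ℝ) * ampSrc ν (f s) (h s) (J₁ s) (J₂ s) N s r) atTop
      (𝓝 (specSrc J₁ J₂ Wh s r)) := by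
  obtain ⟨K, hK0, hK⟩ := exists_bound_deriv_cut
  have l1 : Tendsto (fun N => cpair (f s) (lapErr N (shear s r).2) r.1) atTop (𝓝 0) :=
    squeeze_zero_norm (fun N => norm_cpair_lapErr_le (hs.cont_f.1 s hsT) hK0 hK N _ _)
      (tendsto_const_div_sqrt _)
  have l2 : Tendsto (fun N => cpair (J₂ s) (fun y => ((deriv (cut N) y : ℝ) : ℂ) *
      wave (shear s r).2 y) r.1) atTop (𝓝 0) := by
    refine squeeze_zero_norm (fun N => norm_cpair_le (C := K / (N + 1)) (hs.cont_J₂.1 s hsT)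
      (fun y => ?_) _) ?_
    · rw [norm_mul, norm_wave, mul_one, Complex.norm_real]; exact (hK N y).1
    · have := (tendsto_const_div_atTop_nhds_zero_nat K).comp (tendsto_add_atTop_nat 1)
      have := this.mul_const (∫ z : Cyl, ‖J₂ s z‖)
      rw [zero_mul] at this
      refine this.congr fun N => ?_
      simp
  have l3 := tendsto_cpair_prof (hs.cont_J₁.1 s hsT) s r
  have l4 := tendsto_cpair_prof (hs.cont_J₂.1 s hsT) s r
  have l5 := hh.lim r s hsT
  have L := (((l1.const_mul (((2 * Real.pi)⁻¹ : ℝ) * ν : ℂ)).add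
    ((l3.const_mul (-Complex.I * r.1)).add ((l2.const_mul (((2 * Real.pi)⁻¹ : ℝ) : ℂ)).add
      (l4.const_mul (-Complex.I * xi s r))))).add (l5.const_mul (Complex.I * r.1)))
  have e : specSrc J₁ J₂ Wh s r = ((2 * Real.pi)⁻¹ : ℝ) * ν * 0 +
      (-Complex.I * r.1 * spec1 (J₁ s) s r +
        (((2 * Real.pi)⁻¹ : ℝ) * 0 + -Complex.I * xi s r * spec1 (J₂ s) s r)) +
      Complex.I * r.1 * Wh s r := by
    unfold specSrc; ring
  rw [e]
  refine L.congr fun N => ?_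
  unfold ampSrc; push_cast; ring

lemma abs_xi_le {s T R : ℝ} (hs : s ∈ Icc 0 T) {k : ℤ} {ζ : ℝ} (hζ : |ζ| ≤ R) :
    |xi s (k, ζ)| ≤ 2 * Real.pi * R + T * |(k : ℝ)| := by
  have hT := hs.1.trans hs.2
  unfold xi
  refine (abs_sub _ _).trans ?_
  rw [abs_mul (2 * Real.pi), abs_mul s, abs_of_pos Real.two_pi_pos, abs_of_nonneg hs.1]
  have := Real.pi_pos
  gcongr
  exact hs.2

lemma exists_bound_ampSrc (hs : IsTransport ν T f h J₁ J₂) (hh : HasAmp T h Wh) (k : ℤ) (R : ℝ) :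
    ∃ C : ℝ, 0 ≤ C ∧ ∀ ζ, |ζ| ≤ R → ∀ N, ∀ s ∈ Icc 0 T,
      ‖ampSrc ν (f s) (h s) (J₁ s) (J₂ s) N s (k, ζ)‖ ≤ C := by
  obtain ⟨K, hK0, hK⟩ := exists_bound_deriv_cut
  obtain ⟨M, hM0, hM⟩ := hs.cont_f.exists_bound
  obtain ⟨M1, hM10, hM1⟩ := hs.cont_J₁.exists_bound
  obtain ⟨M2, hM20, hM2⟩ := hs.cont_J₂.exists_bound
  obtain ⟨Ch, hCh⟩ := hh.bdd k R
  set X : ℝ := 2 * Real.pi * |R| + |T| * |(k : ℝ)| with hX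
  have hX0 : 0 ≤ X := by have := Real.pi_pos; positivity
  have hCpos : 0 ≤ |ν| * (K * (1 + 2 * X) * (8 * Real.pi + M)) +
    (|(k : ℝ)| * M1 + (K * M2 + X * M2)) + |(k : ℝ)| * |Ch| := by
    have := Real.pi_pos; positivity
  refine ⟨_, hCpos, fun ζ hζ N s hsT => ?_⟩
  have hx : |xi s (k, ζ)| ≤ X := by
    refine (abs_xi_le hsT hζ).trans ?_
    have := Real.pi_pos
    rw [hX]; gcongr <;> exact le_abs_self _
  have hN1 : (1 : ℝ) ≤ Real.sqrt (N + 1) := by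
    rw [Real.one_le_sqrt]; linarith [(Nat.cast_nonneg N : (0 : ℝ) ≤ N)]
  have b1 : ‖cpair (f s) (lapErr N (shear s (k, ζ)).2) k‖ ≤
      K * (1 + 2 * X) * (8 * Real.pi + M) := by
    refine (norm_cpair_lapErr_le (hs.cont_f.1 s hsT) hK0 hK N _ _).trans ?_
    have hf0 : 0 ≤ ∫ z : Cyl, ‖f s z‖ ^ 2 := integral_nonneg fun z => by positivity
    have := Real.pi_pos
    refine (div_le_self (by positivity) hN1).trans ?_
    rw [two_pi_mul_shear]
    gcongr
    exact hM s hsT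
  have b2 : ‖cpair (J₁ s) (prof N (shear s (k, ζ)).2) k‖ ≤ M1 := by
    refine (norm_cpair_le (hs.cont_J₁.1 s hsT) (norm_prof_le N _) k).trans ?_
    rw [one_mul]; exact hM1 s hsT
  have b3 : ‖cpair (J₂ s) (prof N (shear s (k, ζ)).2) k‖ ≤ M2 := by
    refine (norm_cpair_le (hs.cont_J₂.1 s hsT) (norm_prof_le N _) k).trans ?_
    rw [one_mul]; exact hM2 s hsT
  have b4 : ‖cpair (J₂ s) (fun y => ((deriv (cut N) y : ℝ) : ℂ) *
      wave (shear s (k, ζ)).2 y) k‖ ≤ K * M2 := by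
    refine (norm_cpair_le (C := K) (hs.cont_J₂.1 s hsT) (fun y => ?_) k).trans ?_
    · rw [norm_mul, norm_wave, mul_one, Complex.norm_real]
      refine (hK N y).1.trans (div_le_self hK0 ?_)
      linarith [(Nat.cast_nonneg N : (0 : ℝ) ≤ N)]
    · gcongr; exact hM2 s hsT
  have b5 : ‖amp N (h s) s (k, ζ)‖ ≤ |Ch| := (hCh ζ hζ N s hsT).trans (le_abs_self _)
  unfold ampSrc
  refine (norm_add_le _ _).trans (add_le_add ((norm_add_le _ _).trans (add_le_add ?_
    ((norm_add_le _ _).trans (add_le_add ?_ ((norm_add_le _ _).trans (add_le_add b4 ?_)))))) ?_)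
  all_goals
    simp only [norm_mul, norm_neg, Complex.norm_I, Complex.norm_real, Complex.norm_intCast,
      Real.norm_eq_abs, one_mul]
    gcongr

lemma cpair_lapErr {f : Field} (hf : MemLp f 2 (volume : Measure Cyl)) (N : ℕ) (ζ : ℝ) (k : ℤ) :
    cpair f (lapErr N ζ) k =
      cpair f (fun y => ((deriv (deriv (cut N)) y : ℝ) : ℂ) * wave ζ y) k +
      2 * (-Complex.I * (2 * Real.pi * ζ : ℝ)) *
        cpair f (fun y => ((deriv (cut N) y : ℝ) : ℂ) * wave ζ y) k := by
  generalize hc : 2 * (-Complex.I * (2 * Real.pi * ζ : ℝ)) = c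
  have e : lapErr N ζ = fun y => ((deriv (deriv (cut N)) y : ℝ) : ℂ) * wave ζ y +
      c * (((deriv (cut N) y : ℝ) : ℂ) * wave ζ y) := by
    ext y; rw [lapErr, hc]
  have h1 := integrable_cpair_of_memLp hf
    (χ := fun y => ((deriv (deriv (cut N)) y : ℝ) : ℂ) * wave ζ y)
    ((Complex.continuous_ofReal.comp (contDiff_deriv_deriv_cut N).continuous).mul
      (continuous_wave _))
    (hasCompactSupport_ofReal_mul (hasCompactSupport_cut N).deriv.deriv _) k
  have h2 := integrable_cpair_of_memLp hf
    (χ := fun y => c * (((deriv (cut N) y : ℝ) : ℂ) * wave ζ y))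
    (continuous_const.mul (continuous_deriv_cut_mul N ζ))
    (hasCompactSupport_deriv_cut_mul N ζ).mul_left k
  rw [e, ← cpair_const_mul]
  exact cpair_add h1 h2

lemma continuous_wave_shear (k : ℤ) (ζ y : ℝ) : Continuous fun s => wave (shear s (k, ζ)).2 y := by
  unfold wave shear; fun_prop

lemma continuousOn_ampSrc (hs : IsTransport ν T f h J₁ J₂) (N : ℕ) (r : ℤ × ℝ) :
    ContinuousOn (fun s => ampSrc ν (f s) (h s) (J₁ s) (J₂ s) N s r) (Icc 0 T) := by
  obtain ⟨k, ζ⟩ := r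
  obtain ⟨K, hK0, hK⟩ := exists_bound_deriv_cut
  have hwave := continuous_wave_shear k ζ
  have hxi : Continuous fun s => (xi s (k, ζ) : ℂ) := by unfold xi; fun_prop
  have c1 : ContinuousOn (fun s => cpair (f s) (fun y => ((deriv (deriv (cut N)) y : ℝ) : ℂ) *
      wave (shear s (k, ζ)).2 y) k) (Icc 0 T) :=
    continuousOn_cpair_of_contL2 hs.cont_f (C := K / (N + 1)) (R := 2 * ((N : ℝ) + 1))
      (χ := fun s y => ((deriv (deriv (cut N)) y : ℝ) : ℂ) * wave (shear s (k, ζ)).2 y)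
      (fun s => (Complex.continuous_ofReal.comp (contDiff_deriv_deriv_cut N).continuous).mul
        (continuous_wave _)) (fun y => continuous_const.mul (hwave y))
      (fun s y => by rw [norm_mul, norm_wave, mul_one, Complex.norm_real]; exact (hK N y).2)
      (fun s y hy => by rw [(deriv_cut_eq_zero hy).2]; simp) k
  have c2 : ContinuousOn (fun s => cpair (f s) (fun y => ((deriv (cut N) y : ℝ) : ℂ) *
      wave (shear s (k, ζ)).2 y) k) (Icc 0 T) :=
    continuousOn_cpair_of_contL2 hs.cont_f (C := K / (N + 1)) (R := 2 * ((N : ℝ) + 1))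
      (fun s => continuous_deriv_cut_mul N _) (fun y => continuous_const.mul (hwave y))
      (fun s y => by rw [norm_mul, norm_wave, mul_one, Complex.norm_real]; exact (hK N y).1)
      (fun s y hy => by rw [(deriv_cut_eq_zero hy).1]; simp) k
  have c3 : ∀ {g : ℝ → Field}, ContL2 T g →
      ContinuousOn (fun s => cpair (g s) (prof N (shear s (k, ζ)).2) k) (Icc 0 T) := fun hg =>
    continuousOn_cpair_of_contL2 hg (C := 1) (R := 2 * ((N : ℝ) + 1))
      (fun s => (contDiff_prof N _).continuous) (fun y => continuous_const.mul (hwave y))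
      (fun s y => norm_prof_le N _ y) (fun s y hy => by rw [prof, cut_eq_zero hy]; simp) k
  have c4 : ∀ {g : ℝ → Field}, ContL1 T g →
      ContinuousOn (fun s => cpair (g s) (prof N (shear s (k, ζ)).2) k) (Icc 0 T) := fun hg =>
    continuousOn_cpair_of_contL1 hg (C := 1)
      (fun s => (contDiff_prof N _).continuous) (fun y => continuous_const.mul (hwave y))
      (fun s y => norm_prof_le N _ y) k
  have c5 : ContinuousOn (fun s => cpair (J₂ s) (fun y => ((deriv (cut N) y : ℝ) : ℂ) *
      wave (shear s (k, ζ)).2 y) k) (Icc 0 T) :=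
    continuousOn_cpair_of_contL1 hs.cont_J₂ (C := K / (N + 1))
      (fun s => continuous_deriv_cut_mul N _) (fun y => continuous_const.mul (hwave y))
      (fun s y => by rw [norm_mul, norm_wave, mul_one, Complex.norm_real]; exact (hK N y).1) k
  have c6 : ContinuousOn (fun s => cpair (f s) (lapErr N (shear s (k, ζ)).2) k) (Icc 0 T) := by
    refine (c1.add (((hxi.continuousOn (s := Icc 0 T)).const_mul
      (-2 * Complex.I)).mul c2)).congr fun s hsT => ?_
    rw [cpair_lapErr (hs.cont_f.1 s hsT), two_pi_mul_shear]
    simp only [Pi.add_apply, Pi.mul_apply]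
    ring
  have hx := hxi.continuousOn (s := Icc 0 T)
  have c7 := c4 hs.cont_J₁
  have c8 := c4 hs.cont_J₂
  have c9 := c3 hs.cont_h
  simp only [ampSrc, amp]
  exact ((c6.const_mul _).add ((c7.const_mul _).add
    (c5.add ((hx.const_mul _).mul c8)))).add (c9.const_mul _)

lemma amp_congr {f g : Field} (h : f =ᵐ[volume] g) (N : ℕ) (t : ℝ) (r : ℤ × ℝ) :
    amp N f t r = amp N g t r := by
  unfold amp cpair
  refine integral_congr_ae ?_
  filter_upwards [h] with z hz
  rw [hz]

lemma continuous_damp_fst (ν : ℝ) (r : ℤ × ℝ) : Continuous fun s => damp ν s r :=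
  continuous_iff_continuousAt.2 fun s => (hasDerivAt_damp ν s r).continuousAt

/-- Duhamel's formula for the amplitudes. -/
lemma exp_damp_mul_amp (hs : IsTransport ν T f h J₁ J₂) (N : ℕ) (r : ℤ × ℝ) {t : ℝ}
    (ht : t ∈ Icc 0 T) : (Real.exp (damp ν t r) : ℂ) * amp N (f t) t r =
      ∫ s in (0 : ℝ)..t, (Real.exp (damp ν s r) : ℂ) *
        ampSrc ν (f s) (h s) (J₁ s) (J₂ s) N s r := by
  have hE : ∀ s, HasDerivAt (fun s => (Real.exp (damp ν s r) : ℂ))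
      ((Real.exp (damp ν s r) * (ν * lapSym s r) : ℝ) : ℂ) s := fun s =>
    (hasDerivAt_damp ν s r).exp.ofReal_comp
  have hsub : Icc 0 t ⊆ Icc 0 T := Icc_subset_Icc_right ht.2
  have hd : ∀ s ∈ Icc 0 T, HasDerivWithinAt
      (fun s => (Real.exp (damp ν s r) : ℂ) * amp N (f s) s r)
      ((Real.exp (damp ν s r) : ℂ) * ampSrc ν (f s) (h s) (J₁ s) (J₂ s) N s r) (Icc 0 T) s := by
    intro s hsT
    refine ((hE s).hasDerivWithinAt.mul (hs.hasDerivWithinAt_amp N r hsT)).congr_deriv ?_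
    push_cast; ring
  have hcont : ContinuousOn (fun s => (Real.exp (damp ν s r) : ℂ) *
      ampSrc ν (f s) (h s) (J₁ s) (J₂ s) N s r) (Icc 0 T) :=
    (Complex.continuous_ofReal.comp
      (Real.continuous_exp.comp (continuous_damp_fst ν r))).continuousOn.mul (continuousOn_ampSrc hs N r)
  have h1 := intervalIntegral.integral_eq_sub_of_hasDerivAt_of_le ht.1
    (fun s hs' => ((hd s (hsub hs')).continuousWithinAt.mono hsub))
    (fun s hs' => ((hd s (hsub (Ioo_subset_Icc_self hs'))).mono hsub).hasDerivAt
      (Icc_mem_nhds hs'.1 hs'.2))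
    ((hcont.mono (by rw [uIcc_of_le ht.1]; exact hsub)).intervalIntegrable)
  rw [h1, amp_congr hs.init]
  simp [amp, cpair]

lemma continuousOn_specSrc (hs : IsTransport ν T f h J₁ J₂) (hh : HasAmp T h Wh) (k : ℤ) :
    ContinuousOn (fun x : ℝ × ℝ => specSrc J₁ J₂ Wh x.1 (k, x.2)) (Icc 0 T ×ˢ univ) := by
  have hxi : Continuous fun x : ℝ × ℝ => (xi x.1 (k, x.2) : ℂ) := by unfold xi; fun_prop
  have c1 := continuousOn_spec1 hs.cont_J₁ k
  have c2 := continuousOn_spec1 hs.cont_J₂ k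
  have c3 := hh.cont k
  simp only [specSrc]
  exact (((c1.const_mul _).add (hxi.continuousOn.mul c2)).const_mul _).add (c3.const_mul _)

/-- The source extended to all times by its values at the end points. -/
def clampSrc (hT : 0 ≤ T) (J₁ J₂ : ℝ → Field) (Wh : ℝ → ℤ × ℝ → ℂ) (s : ℝ) (r : ℤ × ℝ) : ℂ :=
  specSrc J₁ J₂ Wh (projIcc 0 T hT s) r

lemma clampSrc_of_mem (hT : 0 ≤ T) {s : ℝ} (hs : s ∈ Icc 0 T) (r : ℤ × ℝ) :
    clampSrc hT J₁ J₂ Wh s r = specSrc J₁ J₂ Wh s r := by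
  rw [clampSrc, projIcc_of_mem hT hs]

lemma continuous_clampSrc (hT : 0 ≤ T) (hs : IsTransport ν T f h J₁ J₂) (hh : HasAmp T h Wh)
    (k : ℤ) : Continuous fun x : ℝ × ℝ => clampSrc hT J₁ J₂ Wh x.1 (k, x.2) := by
  have h1 : ContinuousOn (fun x : ℝ × ℝ => clampSrc hT J₁ J₂ Wh x.1 (k, x.2)) univ := by
    refine (continuousOn_specSrc hs hh k).comp
      (f := fun x : ℝ × ℝ => ((projIcc 0 T hT x.1 : ℝ), x.2)) ?_ fun x _ => ⟨Subtype.coe_prop _, mem_univ _⟩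
    exact ((continuous_subtype_val.comp (continuous_projIcc.comp continuous_fst)).prodMk
      continuous_snd).continuousOn
  exact continuousOn_univ.1 h1

/-- Duhamel's formula for weak solutions: the spectrum in the moving frame of a weak solution is an
explicit jointly continuous function. -/
lemma IsTransport.hasAmp (hs : IsTransport ν T f h J₁ J₂) (hh : HasAmp T h Wh) (hT : 0 ≤ T)
    (hν : 0 ≤ ν) : HasAmp T f (duhamel ν (clampSrc hT J₁ J₂ Wh)) where
  cont k := (continuous_duhamel (continuous_clampSrc hT hs hh k) ν).continuousOn
  lim r t ht := by
    obtain ⟨k, ζ⟩ := r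
    obtain ⟨C, hC0, hC⟩ := exists_bound_ampSrc hs hh k |ζ|
    have hsub : uIoc 0 t ⊆ Icc 0 T := by
      rw [uIoc_of_le ht.1]
      exact fun s hs' => ⟨hs'.1.le, hs'.2.trans ht.2⟩
    have hEc : Continuous fun s => (Real.exp (damp ν s (k, ζ)) : ℂ) :=
      Complex.continuous_ofReal.comp (Real.continuous_exp.comp (continuous_damp_fst ν _))
    have h1 : Tendsto (fun N => ∫ s in (0 : ℝ)..t, (Real.exp (damp ν s (k, ζ)) : ℂ) *
        (((2 * Real.pi)⁻¹ : ℝ) * ampSrc ν (f s) (h s) (J₁ s) (J₂ s) N s (k, ζ))) atTop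
        (𝓝 (∫ s in (0 : ℝ)..t, (Real.exp (damp ν s (k, ζ)) : ℂ) *
          clampSrc hT J₁ J₂ Wh s (k, ζ))) := by
      refine intervalIntegral.tendsto_integral_filter_of_dominated_convergence
        (fun s => Real.exp (damp ν s (k, ζ)) * ((2 * Real.pi)⁻¹ * C)) ?_ ?_ ?_ ?_
      · refine Eventually.of_forall fun N => ?_
        have := (hEc.continuousOn (s := Icc 0 T)).mul
          ((continuousOn_const (c := (((2 * Real.pi)⁻¹ : ℝ) : ℂ))).mul (continuousOn_ampSrc hs N (k, ζ)))
        exact (this.aestronglyMeasurable measurableSet_Icc).mono_set hsub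
      · refine Eventually.of_forall fun N => Eventually.of_forall fun s hs' => ?_
        rw [norm_mul, norm_mul, Complex.norm_real, Complex.norm_real,
          Real.norm_of_nonneg (Real.exp_pos _).le,
          Real.norm_of_nonneg (inv_pos.2 Real.two_pi_pos).le]
        have := Real.pi_pos
        gcongr
        exact hC ζ le_rfl N s (hsub hs')
      · exact ((Real.continuous_exp.comp (continuous_damp_fst ν _)).mul
          continuous_const).intervalIntegrable _ _
      · refine Eventually.of_forall fun s hs' => ?_
        rw [clampSrc_of_mem hT (hsub hs')]
        exact (tendsto_ampSrc hs hh (hsub hs') _).const_mul _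
    have h2 := h1.const_mul ((Real.exp (-damp ν t (k, ζ)) : ℂ))
    refine h2.congr fun N => ?_
    have hE : (Real.exp (-damp ν t (k, ζ)) : ℂ) * (Real.exp (damp ν t (k, ζ)) : ℂ) = 1 := by
      rw [← Complex.ofReal_mul, ← Real.exp_add, neg_add_cancel, Real.exp_zero, Complex.ofReal_one]
    have h3 := exp_damp_mul_amp hs N (k, ζ) ht
    simp_rw [mul_left_comm (Real.exp (damp ν _ (k, ζ)) : ℂ) (((2 * Real.pi)⁻¹ : ℝ) : ℂ)]
    rw [intervalIntegral.integral_const_mul, ← h3]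
    linear_combination (((2 * Real.pi)⁻¹ : ℝ) : ℂ) * amp N (f t) t (k, ζ) * hE
  bdd k R := by
    obtain ⟨C, hC0, hC⟩ := exists_bound_ampSrc hs hh k R
    refine ⟨C * T, fun ζ hζ N t ht => ?_⟩
    have h3 := exp_damp_mul_amp hs N (k, ζ) ht
    have hsub : uIoc 0 t ⊆ Icc 0 T := by
      rw [uIoc_of_le ht.1]
      exact fun s hs' => ⟨hs'.1.le, hs'.2.trans ht.2⟩
    have hp := Real.exp_pos (damp ν t (k, ζ))
    have h4 : ‖(Real.exp (damp ν t (k, ζ)) : ℂ) * amp N (f t) t (k, ζ)‖ ≤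
        Real.exp (damp ν t (k, ζ)) * C * |t - 0| := by
      rw [h3]
      refine intervalIntegral.norm_integral_le_of_norm_le_const fun s hs' => ?_
      rw [norm_mul, Complex.norm_real, Real.norm_of_nonneg (Real.exp_pos _).le]
      have hst : s ≤ t := by rw [uIoc_of_le ht.1] at hs'; exact hs'.2
      gcongr
      · exact monotone_damp hν (k, ζ) hst
      · exact hC ζ hζ N s (hsub hs')
    rw [norm_mul, Complex.norm_real, Real.norm_of_nonneg hp.le, sub_zero, abs_of_nonneg ht.1,
      mul_assoc] at h4
    exact (le_of_mul_le_mul_left h4 hp).trans (by gcongr; exact ht.2)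

end Source

/-! ### The velocity on the Fourier side -/

/-- Complex homogeneous functionals with equal real parts are equal. -/
lemma complex_of_re {a b : (ℝ → ℂ) → ℂ} (ha : ∀ χ (c : ℂ), a (fun y => c * χ y) = c * a χ)
    (hb : ∀ χ (c : ℂ), b (fun y => c * χ y) = c * b χ) {χ : ℝ → ℂ}
    (h : ∀ c : ℂ, (a fun y => c * χ y).re = (b fun y => c * χ y).re) : a χ = b χ := by
  have h1 := h 1
  have h2 := h (-Complex.I)
  rw [ha, hb] at h1 h2
  simp only [one_mul, neg_mul, Complex.neg_re, Complex.I_mul_re, neg_neg] at h1 h2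
  exact Complex.ext h1 h2

/-- The Fourier transform of a test function and its derivative. -/
lemma fourier_test {ψ : ℝ → ℂ} (hψ : HasCompactSupport ψ) (hψ' : ContDiff ℝ (⊤ : ℕ∞) ψ) :
    ContDiff ℝ (⊤ : ℕ∞) (𝓕 ψ) ∧ MemLp (𝓕 ψ) 2 (volume : Measure ℝ) ∧
    ∃ ψ₁ : ℝ → ℂ, (ψ₁ = fun z => (-(2 * Real.pi * z : ℝ) * Complex.I) * ψ z) ∧
      HasCompactSupport ψ₁ ∧ ContDiff ℝ (⊤ : ℕ∞) ψ₁ ∧ MemLp (𝓕 ψ₁) 2 (volume : Measure ℝ) ∧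
      deriv (𝓕 ψ) = 𝓕 ψ₁ := by
  set S := hψ.toSchwartzMap hψ' with hS
  have hFc : ∀ y, (𝓕 S) y = 𝓕 ψ y := fun y => by rw [SchwartzMap.fourier_coe]; rfl
  have hFs : ContDiff ℝ (⊤ : ℕ∞) (𝓕 ψ) := by
    have := (𝓕 S).smooth (⊤ : ℕ∞)
    rwa [show ((𝓕 S : SchwartzMap ℝ ℂ) : ℝ → ℂ) = 𝓕 ψ from funext hFc] at this
  have hFm : MemLp (𝓕 ψ) 2 (volume : Measure ℝ) := by
    have := (𝓕 S).memLp 2 (volume : Measure ℝ)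
    rwa [show ((𝓕 S : SchwartzMap ℝ ℂ) : ℝ → ℂ) = 𝓕 ψ from funext hFc] at this
  obtain ⟨ψ₁, hψ₁⟩ : ∃ ψ₁ : ℝ → ℂ, ψ₁ = fun z => (-(2 * Real.pi * z : ℝ) * Complex.I) * ψ z := ⟨_, rfl⟩
  have hψ₁s : HasCompactSupport ψ₁ := hψ₁ ▸ hψ.mul_left
  have hψ₁c : ContDiff ℝ (⊤ : ℕ∞) ψ₁ := by
    rw [hψ₁]
    refine ContDiff.mul (ContDiff.mul (ContDiff.neg ?_) contDiff_const) hψ'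
    exact Complex.ofRealCLM.contDiff.comp (contDiff_const.mul contDiff_id)
  have hFm₁ : MemLp (𝓕 ψ₁) 2 (volume : Measure ℝ) := by
    have := (𝓕 (hψ₁s.toSchwartzMap hψ₁c)).memLp 2 (volume : Measure ℝ)
    rw [SchwartzMap.fourier_coe] at this
    exact this
  have hFd : deriv (𝓕 ψ) = 𝓕 ψ₁ := by
    have i1 : Integrable ψ := hψ'.continuous.integrable_of_hasCompactSupport hψ
    have i2 : Integrable fun x : ℝ => x • ψ x := by
      refine Continuous.integrable_of_hasCompactSupport (continuous_id.smul hψ'.continuous)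
        (HasCompactSupport.intro hψ fun x hx => ?_)
      rw [image_eq_zero_of_notMem_tsupport hx, smul_zero]
    have e : (fun x : ℝ => (-2 * Real.pi * Complex.I * x) • ψ x) = ψ₁ := by
      rw [hψ₁]; ext z
      rw [smul_eq_mul]; push_cast; ring
    rw [Real.deriv_fourier i1 i2, e]
  exact ⟨hFs, hFm, ψ₁, hψ₁, hψ₁s, hψ₁c, hFm₁, hFd⟩

section WeakDiv

variable {f g h : Field} {a b : ℝ}

/-- The weak equation `f = -(a ∂_x g + b ∂_y h)` tested against `χ(y) e^{-ikx}`. -/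
lemma cpair_of_weak_div (hf : MemLp f 2 (volume : Measure Cyl))
    (hg : MemLp g 2 (volume : Measure Cyl)) (hh : MemLp h 2 (volume : Measure Cyl))
    (hw : ∀ φ, IsTest φ → pair f φ = a * pair g (dx φ) + b * pair h (dy φ))
    {χ : ℝ → ℂ} (hχ : ContDiff ℝ (⊤ : ℕ∞) χ) (hχ' : HasCompactSupport χ) (k : ℤ) :
    cpair f χ k = a * (-Complex.I * k * cpair g χ k) + b * cpair h (deriv χ) k := by
  refine complex_of_re (a := fun χ => cpair f χ k)
    (b := fun χ => a * (-Complex.I * k * cpair g χ k) + b * cpair h (deriv χ) k)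
    (fun χ c => cpair_const_mul _ _ _ _) (fun χ c => ?_) fun c => ?_
  · have h1 : deriv (fun y => c * χ y) = fun y => c * deriv χ y := by
      ext y; exact deriv_const_mul_field c
    simp only [h1, cpair_const_mul]; ring
  · have h1 : deriv (fun y => c * χ y) = fun y => c * deriv χ y := by
      ext y; exact deriv_const_mul_field c
    have hη : ContDiff ℝ (⊤ : ℕ∞) fun y => c * χ y := contDiff_const.mul hχ
    have hη' : HasCompactSupport fun y => c * χ y := hχ'.mul_left
    generalize (fun y => c * χ y) = η at hη hη'
    have hd := (contDiff_infty_iff_deriv.1 hη).2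
    have p1 := pair_prTest (χ := η) (integrable_cpair_of_memLp hf hη.continuous hη' k)
    have p2 := pair_prTest (χ := fun y => -Complex.I * (k : ℂ) * η y)
      (integrable_cpair_of_memLp hg (continuous_const.mul hη.continuous) hη'.mul_left k)
    have p3 := pair_prTest (χ := deriv η)
      (integrable_cpair_of_memLp hh hd.continuous hη'.deriv k)
    have p4 := hw _ (isTest_prTest hη hη' k)
    rw [dx_prTest, dy_prTest (hη.differentiable (by simp)), p1, p2, p3, cpair_const_mul] at p4
    rw [p4, Complex.add_re, Complex.re_ofReal_mul, Complex.re_ofReal_mul]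

/-- Removing a cut-off in a pairing of square integrable functions. -/
lemma tendsto_integral_cut {c : ℕ → ℝ → ℝ} {x C : ℝ} (hc : ∀ N, Continuous (c N))
    (hC : ∀ N y, |c N y| ≤ C) (hx : ∀ y, Tendsto (fun N => c N y) atTop (𝓝 x))
    {F : ℝ → ℂ} (hF : Integrable F) :
    Tendsto (fun N => ∫ y, (c N y : ℂ) * F y) atTop (𝓝 (x * ∫ y, F y)) := by
  rw [← integral_const_mul]
  refine tendsto_integral_of_dominated_convergence (fun y => C * ‖F y‖) ?_ (hF.norm.const_mul C) ?_ ?_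
  · exact fun N => (Complex.continuous_ofReal.comp (hc N)).aestronglyMeasurable.mul hF.1
  · refine fun N => Eventually.of_forall fun y => ?_
    rw [norm_mul, Complex.norm_real]
    gcongr; exact hC N y
  · exact Eventually.of_forall fun y =>
      ((Complex.continuous_ofReal.tendsto _).comp (hx y)).mul_const _

/-- On the Fourier side, a weak equation `f = -(a ∂_x g + b ∂_y h)` holds pointwise. -/
lemma hat_of_weak_div (hf : MemLp f 2 (volume : Measure Cyl))
    (hg : MemLp g 2 (volume : Measure Cyl)) (hh : MemLp h 2 (volume : Measure Cyl))
    (hw : ∀ φ, IsTest φ → pair f φ = a * pair g (dx φ) + b * pair h (dy φ)) (k : ℤ) :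
    ∀ᵐ ζ : ℝ, hat f k ζ =
      -Complex.I * (a * k * hat g k ζ + b * (2 * Real.pi * ζ : ℝ) * hat h k ζ) := by
  have mf := memLp_modeX hf k
  have mg := memLp_modeX hg k
  have mh := memLp_modeX hh k
  have hmode : ∀ {χ : ℝ → ℂ}, ContDiff ℝ (⊤ : ℕ∞) χ → HasCompactSupport χ →
      ∫ y, χ y * modeX f k y = a * (-Complex.I * k * ∫ y, χ y * modeX g k y) +
        b * ∫ y, deriv χ y * modeX h k y := by
    intro χ hχ hχ'
    have hd := (contDiff_infty_iff_deriv.1 hχ).2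
    rw [← cpair_eq_integral_modeX (integrable_cpair_of_memLp hf hχ.continuous hχ' k),
      ← cpair_eq_integral_modeX (integrable_cpair_of_memLp hg hχ.continuous hχ' k),
      ← cpair_eq_integral_modeX (integrable_cpair_of_memLp hh hd.continuous hχ'.deriv k),
      cpair_of_weak_div hf hg hh hw hχ hχ' k]
    ring
  simp only [hat_eq_planch]
  have hloc : LocallyIntegrable fun ζ : ℝ =>
      -Complex.I * (a * k * planch (modeX g k) ζ +
        b * (2 * Real.pi * ζ : ℝ) * planch (modeX h k) ζ) := by
    have l1 : LocallyIntegrable (planch (modeX g k)) :=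
      (memLp_planch mg).locallyIntegrable (by norm_num)
    have l2 : LocallyIntegrable (planch (modeX h k)) :=
      (memLp_planch mh).locallyIntegrable (by norm_num)
    have l3 : LocallyIntegrable fun ζ : ℝ =>
        (-Complex.I * (b * (2 * Real.pi * ζ : ℝ)) : ℂ) * planch (modeX h k) ζ := by
      rw [← locallyIntegrableOn_univ] at l2 ⊢
      exact l2.continuousOn_mul (by fun_prop) isOpen_univ.isLocallyClosed
    have l4 : LocallyIntegrable fun ζ : ℝ => (-Complex.I * (a * k) : ℂ) * planch (modeX g k) ζ := by
      rw [← locallyIntegrableOn_univ] at l1 ⊢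
      exact l1.continuousOn_mul continuousOn_const isOpen_univ.isLocallyClosed
    refine (l4.add l3).congr (Eventually.of_forall fun ζ => ?_)
    simp only [Pi.add_apply]; ring
  refine planch_ae_eq mf hloc fun ψ hψ hψ' => ?_
  -- pairing with `𝓕 ψ`, cut off to have compact support
  obtain ⟨hFs, hFm, ψ₁, hψ₁, hψ₁s, hψ₁c, hFm₁, hFd⟩ := fourier_test hψ hψ'
  have pg := integral_mul_planch mg hψ hψ'
  have ph := integral_mul_planch mh hψ₁s hψ₁c
  generalize 𝓕 ψ = Φ at *
  generalize 𝓕 ψ₁ = Φ₁ at *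
  obtain ⟨K, hK0, hK⟩ := exists_bound_deriv_cut
  have hcd : ∀ N, ContDiff ℝ (⊤ : ℕ∞) fun y => (cut N y : ℂ) * Φ y := fun N =>
    (Complex.ofRealCLM.contDiff.comp (contDiff_cut N)).mul hFs
  have hcs : ∀ N, HasCompactSupport fun y => (cut N y : ℂ) * Φ y := fun N =>
    hasCompactSupport_ofReal_mul (hasCompactSupport_cut N) _
  have hder : ∀ N y, deriv (fun y => (cut N y : ℂ) * Φ y) y =
      ((deriv (cut N) y : ℝ) : ℂ) * Φ y + cut N y * Φ₁ y := by
    intro N y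
    have d1 := ((contDiff_cut N).differentiable (by simp) y).hasDerivAt.ofReal_comp
    have d2 := (hFs.differentiable (by simp) y).hasDerivAt
    rw [hFd] at d2
    exact (d1.mul d2).deriv
  have hcut : ∀ N y, |cut N y| ≤ 1 := fun N y => by
    rw [abs_of_nonneg (cut_nonneg N y)]; exact cut_le_one N y
  have if1 : Integrable fun y => Φ y * modeX f k y := hFm.integrable_mul mf
  have ig1 : Integrable fun y => Φ y * modeX g k y := hFm.integrable_mul mg
  have ih1 : Integrable fun y => Φ y * modeX h k y := hFm.integrable_mul mh
  have ih2 : Integrable fun y => Φ₁ y * modeX h k y := hFm₁.integrable_mul mh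
  have t1 := tendsto_integral_cut (fun N => (contDiff_cut N).continuous) hcut tendsto_cut if1
  have t2 := tendsto_integral_cut (fun N => (contDiff_cut N).continuous) hcut tendsto_cut ig1
  have t3 := tendsto_integral_cut (fun N => (contDiff_cut N).continuous) hcut tendsto_cut ih2
  have t4 := tendsto_integral_cut (c := fun N => deriv (cut N)) (x := 0) (C := K)
    (fun N => (contDiff_deriv_cut N).continuous)
    (fun N y => (hK N y).1.trans (div_le_self hK0
      (by linarith [(Nat.cast_nonneg N : (0 : ℝ) ≤ N)])))
    (fun y => squeeze_zero_norm (fun N => (hK N y).1) (by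
      have := (tendsto_const_div_atTop_nhds_zero_nat K).comp (tendsto_add_atTop_nat 1)
      exact this.congr fun N => by simp)) ih1
  have e : ∀ N, ∫ y, (cut N y : ℂ) * (Φ y * modeX f k y) =
      a * (-Complex.I * k * ∫ y, (cut N y : ℂ) * (Φ y * modeX g k y)) +
        b * ((∫ y, ((deriv (cut N) y : ℝ) : ℂ) * (Φ y * modeX h k y)) +
          ∫ y, (cut N y : ℂ) * (Φ₁ y * modeX h k y)) := by
    intro N
    have h1 := hmode (hcd N) (hcs N)
    simp only [hder] at h1
    rw [← integral_add]
    · simp only [mul_assoc, add_mul] at h1 ⊢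
      exact h1
    · refine ih1.bdd_mul (c := K) (Complex.continuous_ofReal.comp
        (contDiff_deriv_cut N).continuous).aestronglyMeasurable (Eventually.of_forall fun y => ?_)
      refine (Complex.norm_real _).trans_le ?_
      exact (hK N y).1.trans (div_le_self hK0 (by linarith [(Nat.cast_nonneg N : (0 : ℝ) ≤ N)]))
    · refine ih2.bdd_mul (c := 1) (Complex.continuous_ofReal.comp
        (contDiff_cut N).continuous).aestronglyMeasurable (Eventually.of_forall fun y => ?_)
      refine (Complex.norm_real _).trans_le ?_
      exact hcut N y
  have t5 := ((t2.const_mul (-Complex.I * k)).const_mul (a : ℂ)).add ((t4.add t3).const_mul (b : ℂ))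
  have t6 := tendsto_nhds_unique (t1.congr e) t5
  simp only [Complex.ofReal_one, one_mul, Complex.ofReal_zero, zero_mul, zero_add] at t6
  rw [t6, ← pg, ← ph,
    ← integral_const_mul, ← integral_const_mul, ← integral_const_mul, ← integral_add]
  · refine integral_congr_ae (Eventually.of_forall fun z => ?_)
    simp only [hψ₁]; ring
  · refine Integrable.const_mul (Integrable.const_mul ?_ _) _
    exact (hψ'.continuous.memLp_of_hasCompactSupport hψ :
      MemLp ψ 2 (volume : Measure ℝ)).integrable_mul (memLp_planch mg)
  · refine Integrable.const_mul ?_ _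
    exact (hψ₁c.continuous.memLp_of_hasCompactSupport hψ₁s :
      MemLp ψ₁ 2 (volume : Measure ℝ)).integrable_mul (memLp_planch mh)

lemma sp_of_weak_div (hf : MemLp f 2 (volume : Measure Cyl))
    (hg : MemLp g 2 (volume : Measure Cyl)) (hh : MemLp h 2 (volume : Measure Cyl))
    (hw : ∀ φ, IsTest φ → pair f φ = a * pair g (dx φ) + b * pair h (dy φ)) (t : ℝ) :
    ∀ᵐ p ∂freqVol, sp f t p =
      -Complex.I * (a * p.1 * sp g t p + b * xi t p * sp h t p) := by
  have h1 := ae_freqVol (P := fun p => hat f p.1 p.2 =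
    -Complex.I * (a * p.1 * hat g p.1 p.2 + b * (2 * Real.pi * p.2 : ℝ) * hat h p.1 p.2))
    fun k => hat_of_weak_div hf hg hh hw k
  filter_upwards [(measurePreserving_shear t).quasiMeasurePreserving.ae h1] with p hp
  rw [two_pi_mul_shear] at hp
  exact hp

end WeakDiv

/-- The relations between the spectra `U₁, U₂` of a velocity field and `A` of its vorticity. -/
structure IsVelSpec (t : ℝ) (U₁ U₂ A : ℤ × ℝ → ℂ) : Prop where
  div_free : ∀ᵐ p ∂freqVol, (p.1 : ℂ) * U₁ p + xi t p * U₂ p = 0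
  curl_eq : ∀ᵐ p ∂freqVol, A p = Complex.I * (p.1 * U₂ p - xi t p * U₁ p)
  conj₁ : ∀ᵐ p ∂freqVol, U₁ (-p) = (starRingEnd ℂ) (U₁ p)
  conj₂ : ∀ᵐ p ∂freqVol, U₂ (-p) = (starRingEnd ℂ) (U₂ p)

lemma IsVelocity.isVelSpec {u : VField} {ω : Field} (h : IsVelocity u ω)
    (hω : MemLp ω 2 (volume : Measure Cyl)) (t : ℝ) :
    IsVelSpec t (sp u.1 t) (sp u.2 t) (sp ω t) where
  div_free := by
    have h1 := sp_of_weak_div (f := 0) (a := 1) (b := 1) MemLp.zero' h.memLp_fst h.memLp_snd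
      (fun φ hφ => by
        have := h.div_free φ hφ
        rw [one_mul, one_mul, this]; simp [pair]) t
    have h2 := sp_of_weak_div (f := 0) (a := 0) (b := 0) MemLp.zero' h.memLp_fst h.memLp_snd
      (fun φ hφ => by simp [pair]) t
    filter_upwards [h1, h2] with p hp hp'
    rw [hp'] at hp
    simp only [Complex.ofReal_zero, zero_mul, add_zero, mul_zero, Complex.ofReal_one, one_mul,
      neg_mul] at hp
    have := neg_eq_zero.1 hp.symm
    exact (mul_eq_zero.1 this).resolve_left Complex.I_ne_zero
  curl_eq := by
    have h1 := sp_of_weak_div (a := -1) (b := 1) hω h.memLp_snd h.memLp_fst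
      (fun φ hφ => by rw [h.curl_eq φ hφ]; ring) t
    filter_upwards [h1] with p hp
    rw [hp]; push_cast; ring
  conj₁ := sp_neg h.memLp_fst t
  conj₂ := sp_neg h.memLp_snd t

/-! ### Norms of the spectrum, and the error system as a transport-diffusion system -/

lemma sp_sub {f g : Field} (hf : MemLp f 2 (volume : Measure Cyl))
    (hg : MemLp g 2 (volume : Measure Cyl)) (t : ℝ) :
    ∀ᵐ p ∂freqVol, sp (f - g) t p = sp f t p - sp g t p := by
  filter_upwards [sp_add (hf.sub hg) hg t] with p hp
  rw [sub_add_cancel] at hp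
  rw [hp]; ring

lemma eLpNorm_eq_l2 {f : Field} (hf : MemLp f 2 (volume : Measure Cyl)) (t : ℝ) :
    eLpNorm f 2 volume = ENNReal.ofReal rpi * l2 fun p => ‖sp f t p‖ₑ := by
  have h1 := lintegral_sp hf t
  have h2 : ∫⁻ z : Cyl, ‖f z‖ₑ ^ 2 = eLpNorm f 2 volume ^ 2 := by
    rw [eLpNorm_eq_lintegral_rpow_enorm_toReal (by norm_num) (by norm_num), ← ENNReal.rpow_natCast,
      ← ENNReal.rpow_mul]
    norm_num
  have h3 : (ENNReal.ofReal rpi) ^ 2 = ENNReal.ofReal (2 * Real.pi) := by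
    rw [← ENNReal.ofReal_pow rpi_pos.le, rpi, Real.sq_sqrt Real.two_pi_pos.le]
  rw [h2, ← h3, ← l2_sq, ← mul_pow] at h1
  exact ((ENNReal.pow_right_strictMono two_ne_zero).injective h1).symm

lemma memLp_of_normΛ {f : Field} {s t : ℝ} (h : normΛ s t f < ∞) :
    MemLp f 2 (volume : Measure Cyl) := by
  by_contra h1
  rw [normΛ, multNorm, if_neg h1] at h
  exact lt_irrefl _ h

lemma eLpNorm_le_normΛ {s : ℝ} (hs : 0 ≤ s) (t : ℝ) {f : Field} : eLpNorm f 2 volume ≤ normΛ s t f := by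
  by_cases hf : MemLp f 2 (volume : Measure Cyl)
  · rw [eLpNorm_eq_l2 hf t, normΛ_eq hf s t]
    gcongr
    exact l2_mono fun p => le_mul_of_one_le_left zero_le (one_le_wt hs p)
  · rw [normΛ, multNorm, if_neg hf]; exact le_top

lemma ContSobolev.contL2 {s T : ℝ} (hs : 0 ≤ s) {f : ℝ → Field} (hf : ContSobolev s T f) :
    ContL2 T f := by
  refine ⟨fun t ht => memLp_of_normΛ (hf.1 t ht), fun t ht => ?_⟩
  exact tendsto_of_tendsto_of_tendsto_of_le_of_le tendsto_const_nhds (hf.2 t ht)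
    (fun _ => zero_le) fun r => eLpNorm_le_normΛ hs 0

lemma measurable_wt_sp (s : ℝ) (f : Field) (t : ℝ) :
    Measurable fun p => wt s p * ‖sp f t p‖ₑ := (measurable_wt s).mul (measurable_sp f t).enorm

lemma normΛ_le_add {s : ℝ} {f g : Field} (hf : MemLp f 2 (volume : Measure Cyl))
    (hg : MemLp g 2 (volume : Measure Cyl)) (t : ℝ) :
    normΛ s t f ≤ normΛ s t (f - g) + normΛ s t g := by
  rw [normΛ_eq hf, normΛ_eq hg, normΛ_eq (hf.sub hg), ← mul_add]
  gcongr
  refine le_trans (l2_mono_ae ?_) (l2_add_le (measurable_wt_sp s _ t) (measurable_wt_sp s _ t))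
  filter_upwards [sp_sub hf hg t] with p hp
  rw [← mul_add, hp]
  gcongr
  calc ‖sp f t p‖ₑ = ‖(sp f t p - sp g t p) + sp g t p‖ₑ := by rw [sub_add_cancel]
    _ ≤ _ := enorm_add_le _ _

lemma ContSobolev.exists_bound_normΛ {s T : ℝ} {f : ℝ → Field} (hf : ContSobolev s T f) :
    ∃ M : ℝ≥0∞, M < ∞ ∧ ∀ t ∈ Icc 0 T, normΛ s 0 (f t) ≤ M := by
  obtain ⟨M, hM, h⟩ := isCompact_Icc.induction_on
    (p := fun S => ∃ M : ℝ≥0∞, M < ∞ ∧ ∀ t ∈ S ∩ Icc 0 T, normΛ s 0 (f t) ≤ M)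
    ⟨0, by simp⟩
    (by rintro S S' hS ⟨M, hM, h⟩; exact ⟨M, hM, fun t ht => h t ⟨hS ht.1, ht.2⟩⟩)
    (by
      rintro S S' ⟨M, hM, h⟩ ⟨M', hM', h'⟩
      refine ⟨M + M', ENNReal.add_lt_top.2 ⟨hM, hM'⟩, ?_⟩
      rintro t ⟨ht | ht, ht'⟩
      · exact (h t ⟨ht, ht'⟩).trans le_self_add
      · exact (h' t ⟨ht, ht'⟩).trans le_add_self)
    (fun t ht => by
      have h1 := (hf.2 t ht).eventually (gt_mem_nhds (by simp : (0 : ℝ≥0∞) < 1))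
      refine ⟨_, h1, 1 + normΛ s 0 (f t), ENNReal.add_lt_top.2 ⟨by simp, hf.1 t ht⟩, ?_⟩
      rintro r ⟨hr, hr'⟩
      refine (normΛ_le_add (memLp_of_normΛ (hf.1 r hr')) (memLp_of_normΛ (hf.1 t ht)) 0).trans ?_
      gcongr
      exact (le_of_lt hr))
  exact ⟨M, hM, fun t ht => h t ⟨ht, ht⟩⟩

/-- The shear changes the bracket of a frequency by a factor of at most `√(2 + 2t²)`. -/
lemma jb_le_shear (t : ℝ) (p : ℤ × ℝ) : jb p ≤ Real.sqrt (2 + 2 * t ^ 2) * jb (shear t p) := by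
  refine abs_le_of_sq_le_sq' ?_ (mul_nonneg (Real.sqrt_nonneg _) (jb_pos _).le) |>.2
  rw [mul_pow, Real.sq_sqrt (by positivity), jb_sq, jb_sq, two_pi_mul_shear]
  have h : 2 * Real.pi * p.2 = xi t p + t * p.1 := by simp only [xi]; ring
  rw [h]
  simp only [shear]
  nlinarith [sq_nonneg (xi t p - t * p.1), mul_nonneg (sq_nonneg t) (sq_nonneg (xi t p))]

/-- The frame moves with bounded speed: Sobolev norms in the fixed frame control those in the moving
frame on bounded time intervals. -/
lemma ContSobolev.exists_bound {s T : ℝ} (hs : 0 ≤ s) {f : ℝ → Field} (hf : ContSobolev s T f) :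
    ∃ M : ℝ≥0∞, M < ∞ ∧ ∀ t ∈ Icc 0 T, l2 (fun p => wt s p * ‖sp (f t) t p‖ₑ) ≤ M := by
  obtain ⟨M, hM, h⟩ := hf.exists_bound_normΛ
  refine ⟨ENNReal.ofReal (Real.sqrt (2 + 2 * T ^ 2) ^ s) * M,
    ENNReal.mul_lt_top ENNReal.ofReal_lt_top hM, fun t ht => ?_⟩
  have hm := memLp_of_normΛ (hf.1 t ht)
  have h1 : ∀ p, wt s p * ‖sp (f t) t p‖ₑ ≤ ENNReal.ofReal (Real.sqrt (2 + 2 * T ^ 2) ^ s) *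
      (wt s (shear t p) * ‖sp (f t) 0 (shear t p)‖ₑ) := by
    intro p
    have e : sp (f t) 0 (shear t p) = sp (f t) t p := by
      simp [sp, shear]
    rw [e, ← mul_assoc]
    gcongr
    unfold wt
    rw [← ENNReal.ofReal_mul (by positivity), ← Real.mul_rpow (by positivity) (jb_pos _).le]
    refine ENNReal.ofReal_le_ofReal (Real.rpow_le_rpow (jb_pos _).le ?_ hs)
    refine (jb_le_shear t p).trans ?_
    have := (jb_pos (shear t p)).le
    have := ht.1
    gcongr
    exact ht.2
  have hmeas : Measurable fun p => wt s (shear t p) * ‖sp (f t) 0 (shear t p)‖ₑ :=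
    (measurable_wt_sp s (f t) 0).comp (measurable_shear t)
  refine (l2_mono h1).trans ?_
  rw [l2_const_mul _ hmeas]
  gcongr
  have h2 : l2 (fun p => wt s (shear t p) * ‖sp (f t) 0 (shear t p)‖ₑ) =
      l2 fun p => wt s p * ‖sp (f t) 0 p‖ₑ := by
    unfold l2
    rw [← (measurePreserving_shear t).lintegral_comp ((measurable_wt_sp s (f t) 0).pow_const 2)]
  rw [h2]
  refine le_trans ?_ (h t ht)
  rw [normΛ_eq hm]
  refine le_mul_of_one_le_left zero_le ?_
  rw [ENNReal.one_le_ofReal]; exact one_le_rpi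

lemma ContL2.exists_bound_l2 {T : ℝ} {f : ℝ → Field} (hf : ContL2 T f) :
    ∃ M : ℝ≥0∞, M < ∞ ∧ ∀ t ∈ Icc 0 T, l2 (fun p => ‖sp (f t) t p‖ₑ) ≤ M := by
  obtain ⟨M, hM0, hM⟩ := hf.exists_bound
  refine ⟨ENNReal.ofReal M ^ (1 / 2 : ℝ), ENNReal.rpow_lt_top_of_nonneg (by norm_num)
    ENNReal.ofReal_ne_top, fun t ht => ?_⟩
  have hm := hf.1 t ht
  unfold l2
  gcongr ?_ ^ _
  have h2 : ∫⁻ z : Cyl, ‖f t z‖ₑ ^ 2 ≤ ENNReal.ofReal M := by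
    have h3 : Integrable (fun z : Cyl => ‖f t z‖ ^ 2) (volume : Measure Cyl) :=
      (memLp_two_iff_integrable_sq_norm hm.1).1 hm
    have h4 := ofReal_integral_eq_lintegral_ofReal h3 (Eventually.of_forall fun z => by positivity)
    refine le_trans (le_of_eq ?_) (ENNReal.ofReal_le_ofReal (hM t ht))
    rw [h4]
    refine lintegral_congr fun z => ?_
    rw [ENNReal.ofReal_pow (norm_nonneg _), ofReal_norm]
  refine le_trans ?_ h2
  rw [← lintegral_sp hm t]
  refine le_mul_of_one_le_left zero_le ?_
  rw [ENNReal.one_le_ofReal]; linarith [Real.pi_gt_three]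

lemma ContL2.sub_zeroMode {T : ℝ} {f : ℝ → Field} (hf : ContL2 T f) :
    ContL2 T fun t => f t - zeroMode (f t) := by
  refine ⟨fun t ht => memLp_sub_zeroMode (hf.1 t ht), fun t ht => ?_⟩
  refine tendsto_of_tendsto_of_tendsto_of_le_of_le' tendsto_const_nhds (hf.2 t ht)
    (Eventually.of_forall fun _ => zero_le) ?_
  filter_upwards [self_mem_nhdsWithin] with r hr
  have h1 := hf.1 r hr
  have h2 := hf.1 t ht
  have h3 := memLp_sub_zeroMode h1
  have h4 := memLp_sub_zeroMode h2
  rw [eLpNorm_eq_l2 (h3.sub h4) 0, eLpNorm_eq_l2 (h1.sub h2) 0]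
  gcongr
  refine l2_mono_ae ?_
  filter_upwards [sp_sub h3 h4 0, sp_sub h1 h2 0, sp_sub_zeroMode h1 0, sp_sub_zeroMode h2 0]
    with p e1 e2 e3 e4
  rw [e1, e2, e3, e4]
  split_ifs <;> simp

lemma integrable_mul_prTest {J : Field} (hJ : Integrable J (volume : Measure Cyl)) {χ : ℝ → ℂ}
    (hχ : Continuous χ) (hχ' : HasCompactSupport χ) (k : ℤ) :
    Integrable fun z : Cyl => J z * prTest χ k z := by
  obtain ⟨C, hC⟩ := hχ'.exists_bound_of_continuous hχ
  have h := (integrable_cpair hJ hχ hC k).re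
  refine h.congr (Eventually.of_forall fun z => ?_)
  simp only [prTest, RCLike.re_to_complex]
  exact Complex.re_ofReal_mul _ _

lemma transport_prTest {v : VField} {g : Field} (h1 : MemLp v.1 2 (volume : Measure Cyl))
    (h2 : MemLp v.2 2 (volume : Measure Cyl)) (hg : MemLp g 2 (volume : Measure Cyl)) {χ : ℝ → ℂ}
    (hχ : ContDiff ℝ (⊤ : ℕ∞) χ) (hχ' : HasCompactSupport χ) (k : ℤ) :
    transport v g (prTest χ k) =
      pair (v.1 * g) (dx (prTest χ k)) + pair (v.2 * g) (dy (prTest χ k)) := by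
  have hd := (contDiff_infty_iff_deriv.1 hχ).2
  unfold transport pair
  rw [dx_prTest, dy_prTest (hχ.differentiable (by simp)), ← integral_add]
  · congr 1; ext z
    simp only [Pi.mul_apply]; ring
  · exact integrable_mul_prTest (h1.integrable_mul hg) (continuous_const.mul hχ.continuous)
      hχ'.mul_left k
  · exact integrable_mul_prTest (h2.integrable_mul hg) hd.continuous hχ'.deriv k

lemma pair_add_left {J J' : Field} (hJ : Integrable J (volume : Measure Cyl))
    (hJ' : Integrable J' (volume : Measure Cyl)) {χ : ℝ → ℂ} (hχ : Continuous χ)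
    (hχ' : HasCompactSupport χ) (k : ℤ) :
    pair (J + J') (prTest χ k) = pair J (prTest χ k) + pair J' (prTest χ k) := by
  unfold pair
  rw [← integral_add (integrable_mul_prTest hJ hχ hχ' k) (integrable_mul_prTest hJ' hχ hχ' k)]
  congr 1; ext z
  simp only [Pi.add_apply]; ring

/-- The flux of the vorticity in the error system. -/
def fluxω (v v' f f' : ℝ → Field) (t : ℝ) : Field := v t * f' t + v' t * f t + v' t * f' t

/-- The flux of the temperature in the error system. -/
def fluxθ (v v' f f' : ℝ → Field) (t : ℝ) : Field :=
  (v t - zeroMode (v t)) * f t + v t * f' t + v' t * f' t + v' t * f t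

section Flux

variable {T : ℝ} {v v' f f' : ℝ → Field}

lemma contL1_fluxω (hv : ContL2 T v) (hv' : ContL2 T v') (hf : ContL2 T f) (hf' : ContL2 T f') :
    ContL1 T (fluxω v v' f f') :=
  ((hv.mul hf').add (hv'.mul hf)).add (hv'.mul hf')

lemma contL1_fluxθ (hv : ContL2 T v) (hv' : ContL2 T v') (hf : ContL2 T f) (hf' : ContL2 T f') :
    ContL1 T (fluxθ v v' f f') :=
  (((hv.sub_zeroMode.mul hf).add (hv.mul hf')).add (hv'.mul hf')).add (hv'.mul hf)

end Flux

section System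

variable {ν n T : ℝ} {ωin θin : Field} {ωi θi ωe θe : ℝ → Field} {ui ue : ℝ → VField}

/-- The temperature equation of the error system. -/
lemma isTransport_θ (hn : 0 ≤ n) (hi : IsIdealSolution ν T ωin θin ωi θi ui)
    (he : IsErrorSolution ν n T ωi θi ui ωe θe ue) :
    IsTransport ν T θe (fun _ => 0)
      (fluxθ (fun t => (ui t).1) (fun t => (ue t).1) θi θe)
      (fluxθ (fun t => (ui t).2) (fun t => (ue t).2) θi θe) where
  cont_f := he.cont_θ.contL2 hn
  cont_h := contL2_const MemLp.zero'
  cont_J₁ := contL1_fluxθ hi.cont_u₁ he.cont_u₁ hi.cont_θ (he.cont_θ.contL2 hn)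
  cont_J₂ := contL1_fluxθ hi.cont_u₂ he.cont_u₂ hi.cont_θ (he.cont_θ.contL2 hn)
  init := he.init_θ
  eq χ hχ hχ' k t ht := by
    have hθ := he.cont_θ.contL2 hn
    have hd := (contDiff_infty_iff_deriv.1 hχ).2
    rw [he.eq_θ _ (isTest_prTest hχ hχ' k) t ht]
    refine intervalIntegral.integral_congr fun s hs => ?_
    rw [uIcc_of_le ht.1] at hs
    have hsT : s ∈ Icc 0 T := ⟨hs.1, hs.2.trans ht.2⟩
    have a1 := hi.cont_u₁.1 s hsT
    have a2 := hi.cont_u₂.1 s hsT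
    have b1 := he.cont_u₁.1 s hsT
    have b2 := he.cont_u₂.1 s hsT
    have c1 := hi.cont_θ.1 s hsT
    have c2 := hθ.1 s hsT
    have z1 := memLp_sub_zeroMode a1
    have z2 := memLp_sub_zeroMode a2
    have p0 : pair (fun _ => 0) (dx (prTest χ k)) = 0 := by simp [pair]
    have hχc : Continuous fun y => -Complex.I * (k : ℂ) * χ y := continuous_const.mul hχ.continuous
    have hχs : HasCompactSupport fun y => -Complex.I * (k : ℂ) * χ y := hχ'.mul_left
    rw [transport_prTest (v := velNe (ui s)) z1 z2 c1 hχ hχ', transport_prTest a1 a2 c2 hχ hχ',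
      transport_prTest b1 b2 c2 hχ hχ', transport_prTest b1 b2 c1 hχ hχ',
      show pair (0 : Field) (dx (prTest χ k)) = 0 from p0]
    unfold fluxθ
    rw [dx_prTest, dy_prTest (hχ.differentiable (by simp))]
    rw [pair_add_left (((z1.integrable_mul c1).add (a1.integrable_mul c2)).add
        (b1.integrable_mul c2)) (b1.integrable_mul c1) hχc hχs,
      pair_add_left ((z1.integrable_mul c1).add (a1.integrable_mul c2)) (b1.integrable_mul c2)
        hχc hχs,
      pair_add_left (z1.integrable_mul c1) (a1.integrable_mul c2) hχc hχs,
      pair_add_left (((z2.integrable_mul c1).add (a2.integrable_mul c2)).add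
        (b2.integrable_mul c2)) (b2.integrable_mul c1) hd.continuous hχ'.deriv,
      pair_add_left ((z2.integrable_mul c1).add (a2.integrable_mul c2)) (b2.integrable_mul c2)
        hd.continuous hχ'.deriv,
      pair_add_left (z2.integrable_mul c1) (a2.integrable_mul c2) hd.continuous hχ'.deriv]
    simp only [velNe]
    ring

/-- The vorticity equation of the error system. -/
lemma isTransport_ω (hn : 0 ≤ n) (hi : IsIdealSolution ν T ωin θin ωi θi ui)
    (he : IsErrorSolution ν n T ωi θi ui ωe θe ue) :
    IsTransport ν T ωe θe
      (fluxω (fun t => (ui t).1) (fun t => (ue t).1) ωi ωe)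
      (fluxω (fun t => (ui t).2) (fun t => (ue t).2) ωi ωe) where
  cont_f := he.cont_ω.contL2 hn
  cont_h := he.cont_θ.contL2 hn
  cont_J₁ := contL1_fluxω hi.cont_u₁ he.cont_u₁ hi.cont_ω (he.cont_ω.contL2 hn)
  cont_J₂ := contL1_fluxω hi.cont_u₂ he.cont_u₂ hi.cont_ω (he.cont_ω.contL2 hn)
  init := he.init_ω
  eq χ hχ hχ' k t ht := by
    have hω := he.cont_ω.contL2 hn
    have hd := (contDiff_infty_iff_deriv.1 hχ).2
    rw [he.eq_ω _ (isTest_prTest hχ hχ' k) t ht]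
    refine intervalIntegral.integral_congr fun s hs => ?_
    rw [uIcc_of_le ht.1] at hs
    have hsT : s ∈ Icc 0 T := ⟨hs.1, hs.2.trans ht.2⟩
    have a1 := hi.cont_u₁.1 s hsT
    have a2 := hi.cont_u₂.1 s hsT
    have b1 := he.cont_u₁.1 s hsT
    have b2 := he.cont_u₂.1 s hsT
    have c1 := hi.cont_ω.1 s hsT
    have c2 := hω.1 s hsT
    have hχc : Continuous fun y => -Complex.I * (k : ℂ) * χ y := continuous_const.mul hχ.continuous
    have hχs : HasCompactSupport fun y => -Complex.I * (k : ℂ) * χ y := hχ'.mul_left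
    rw [transport_prTest a1 a2 c2 hχ hχ', transport_prTest b1 b2 c1 hχ hχ',
      transport_prTest b1 b2 c2 hχ hχ']
    unfold fluxω
    rw [dx_prTest, dy_prTest (hχ.differentiable (by simp))]
    rw [pair_add_left ((a1.integrable_mul c2).add (b1.integrable_mul c1)) (b1.integrable_mul c2)
        hχc hχs,
      pair_add_left (a1.integrable_mul c2) (b1.integrable_mul c1) hχc hχs,
      pair_add_left ((a2.integrable_mul c2).add (b2.integrable_mul c1)) (b2.integrable_mul c2)
        hd.continuous hχ'.deriv,
      pair_add_left (a2.integrable_mul c2) (b2.integrable_mul c1) hd.continuous hχ'.deriv]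
    ring

end System

/-! ### The energy identity -/

lemma measurable_joint {E : Type*} [TopologicalSpace E] [MeasurableSpace E] [BorelSpace E]
    {F : ℝ → ℤ × ℝ → E} (hF : ∀ k : ℤ, Continuous fun x : ℝ × ℝ => F x.1 (k, x.2)) :
    Measurable fun z : ℝ × (ℤ × ℝ) => F z.1 z.2 := by
  have h1 : Measurable fun y : ℤ × (ℝ × ℝ) => F y.2.1 (y.1, y.2.2) :=
    measurable_from_prod_countable_right fun k => (hF k).measurable
  have h2 : Measurable fun z : ℝ × (ℤ × ℝ) => (z.2.1, (z.1, z.2.2)) := by fun_prop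
  exact h1.comp h2

/-- `W` solves `∂_t W = -ν (k² + ξ_t²) W + B` with `W(0) = 0` at each frequency, and on `[0, T]` the
source `B` is the divergence of a flux of size `h`. -/
structure IsEvol (ν T : ℝ) (W B : ℝ → ℤ × ℝ → ℂ) (h : ℝ → ℤ × ℝ → ℝ) : Prop where
  contW : ∀ k : ℤ, Continuous fun x : ℝ × ℝ => W x.1 (k, x.2)
  contB : ∀ k : ℤ, Continuous fun x : ℝ × ℝ => B x.1 (k, x.2)
  conth : ∀ k : ℤ, Continuous fun x : ℝ × ℝ => h x.1 (k, x.2)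
  hasDeriv : ∀ t r, HasDerivAt (fun t => W t r) (-(ν * lapSym t r) * W t r + B t r) t
  init : ∀ r, W 0 r = 0
  bound : ∀ s ∈ Icc 0 T, ∀ r, ‖B s r‖ ≤ Real.sqrt (lapSym s r) * h s r

lemma continuous_lapSym (k : ℤ) : Continuous fun x : ℝ × ℝ => lapSym x.1 (k, x.2) := by
  unfold lapSym xi; fun_prop

/-- The rate of change of `|W|²`. -/
def enRate (ν : ℝ) (W B : ℝ → ℤ × ℝ → ℂ) (s : ℝ) (r : ℤ × ℝ) : ℝ :=
  -(2 * ν) * (lapSym s r * ‖W s r‖ ^ 2) + 2 * (B s r * (starRingEnd ℂ) (W s r)).re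

namespace IsEvol

variable {ν T : ℝ} {W B : ℝ → ℤ × ℝ → ℂ} {h : ℝ → ℤ × ℝ → ℝ} {ρ : ℤ × ℝ → ℝ}

lemma cont_fst {E : Type*} [TopologicalSpace E] {F : ℝ → ℤ × ℝ → E}
    (hF : ∀ k : ℤ, Continuous fun x : ℝ × ℝ => F x.1 (k, x.2)) (r : ℤ × ℝ) :
    Continuous fun s => F s r := by
  have : Continuous fun s : ℝ => (s, r.2) := by fun_prop
  exact (hF r.1).comp this

lemma cont_dis (hE : IsEvol ν T W B h) (k : ℤ) :
    Continuous fun x : ℝ × ℝ => lapSym x.1 (k, x.2) * ‖W x.1 (k, x.2)‖ ^ 2 :=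
  (continuous_lapSym k).mul ((hE.contW k).norm.pow 2)

lemma cont_re (hE : IsEvol ν T W B h) (k : ℤ) :
    Continuous fun x : ℝ × ℝ => (B x.1 (k, x.2) * (starRingEnd ℂ) (W x.1 (k, x.2))).re :=
  Complex.continuous_re.comp ((hE.contB k).mul (Complex.continuous_conj.comp (hE.contW k)))

lemma cont_dis_fst (hE : IsEvol ν T W B h) (r : ℤ × ℝ) :
    Continuous fun s => lapSym s r * ‖W s r‖ ^ 2 :=
  cont_fst (F := fun s r => lapSym s r * ‖W s r‖ ^ 2) hE.cont_dis r

lemma measurable_dis (hE : IsEvol ν T W B h) :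
    Measurable fun z : ℝ × (ℤ × ℝ) => lapSym z.1 z.2 * ‖W z.1 z.2‖ ^ 2 :=
  measurable_joint (F := fun s r => lapSym s r * ‖W s r‖ ^ 2) hE.cont_dis

lemma measurable_re (hE : IsEvol ν T W B h) :
    Measurable fun z : ℝ × (ℤ × ℝ) => (B z.1 z.2 * (starRingEnd ℂ) (W z.1 z.2)).re :=
  measurable_joint (F := fun s r => (B s r * (starRingEnd ℂ) (W s r)).re) hE.cont_re

lemma cont_enRate (hE : IsEvol ν T W B h) (k : ℤ) :
    Continuous fun x : ℝ × ℝ => enRate ν W B x.1 (k, x.2) :=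
  ((hE.cont_dis k).const_mul _).add ((hE.cont_re k).const_mul _)

lemma norm_sq_eq (hE : IsEvol ν T W B h) (t : ℝ) (r : ℤ × ℝ) :
    ‖W t r‖ ^ 2 = ∫ s in (0 : ℝ)..t, enRate ν W B s r := by
  have hd : ∀ s, HasDerivAt (fun s => ‖W s r‖ ^ 2) (enRate ν W B s r) s := by
    intro s
    refine (hE.hasDeriv s r).norm_sq.congr_deriv ?_
    rw [Complex.inner]
    have h1 : (starRingEnd ℂ) (W s r) * (-(ν * lapSym s r) * W s r + B s r) =
        ((-(ν * lapSym s r) * ‖W s r‖ ^ 2 : ℝ) : ℂ) + B s r * (starRingEnd ℂ) (W s r) := by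
      rw [← Complex.normSq_eq_norm_sq, Complex.ofReal_mul, Complex.normSq_eq_conj_mul_self]
      push_cast; ring
    rw [mul_comm (-(ν * lapSym s r : ℂ) * W s r + B s r), h1, Complex.add_re, Complex.ofReal_re,
      enRate]
    ring
  rw [intervalIntegral.integral_eq_sub_of_hasDerivAt (fun s _ => hd s)
    ((cont_fst hE.cont_enRate r).intervalIntegrable _ _), hE.init]
  simp

lemma two_mul_re_le (hE : IsEvol ν T W B h) (hν : 0 < ν) {s : ℝ} (hs : s ∈ Icc 0 T) (r : ℤ × ℝ) :
    2 * |(B s r * (starRingEnd ℂ) (W s r)).re| ≤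
      ν * (lapSym s r * ‖W s r‖ ^ 2) + ν⁻¹ * h s r ^ 2 := by
  have h1 : |(B s r * (starRingEnd ℂ) (W s r)).re| ≤
      Real.sqrt (lapSym s r) * h s r * ‖W s r‖ := by
    refine (Complex.abs_re_le_norm _).trans ?_
    rw [norm_mul, RCLike.norm_conj]
    gcongr
    exact hE.bound s hs r
  have h2 : Real.sqrt (lapSym s r) ^ 2 = lapSym s r := Real.sq_sqrt (lapSym_nonneg s r)
  have h3 : 0 ≤ ν⁻¹ * (ν * (Real.sqrt (lapSym s r) * ‖W s r‖) - h s r) ^ 2 := by positivity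
  have h4 : ν⁻¹ * (ν * (Real.sqrt (lapSym s r) * ‖W s r‖) - h s r) ^ 2 =
      ν * (lapSym s r * ‖W s r‖ ^ 2) - 2 * (Real.sqrt (lapSym s r) * h s r * ‖W s r‖) +
        ν⁻¹ * h s r ^ 2 := by
    have h5 : lapSym s r * ‖W s r‖ ^ 2 = (Real.sqrt (lapSym s r) * ‖W s r‖) ^ 2 := by
      rw [mul_pow, h2]
    rw [h5]; field_simp; ring
  linarith

lemma norm_sq_add_le (hE : IsEvol ν T W B h) (hν : 0 < ν) {t : ℝ} (ht : t ∈ Icc 0 T) (r : ℤ × ℝ) :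
    ‖W t r‖ ^ 2 + ν * ∫ s in (0 : ℝ)..t, lapSym s r * ‖W s r‖ ^ 2 ≤
      ν⁻¹ * ∫ s in (0 : ℝ)..t, h s r ^ 2 := by
  have c1 := (cont_fst hE.cont_enRate r).intervalIntegrable (μ := volume) 0 t
  have c2 := ((hE.cont_dis_fst r).const_mul ν).intervalIntegrable (μ := volume) 0 t
  have c3 := (((cont_fst hE.conth r).pow 2).const_mul ν⁻¹).intervalIntegrable (μ := volume) 0 t
  rw [hE.norm_sq_eq, ← intervalIntegral.integral_const_mul, ← intervalIntegral.integral_const_mul,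
    ← intervalIntegral.integral_add c1 c2]
  refine intervalIntegral.integral_mono_on ht.1 (c1.add c2) c3 fun s hs => ?_
  have h1 := hE.two_mul_re_le hν ⟨hs.1, hs.2.trans ht.2⟩ r
  have h2 := le_abs_self (B s r * (starRingEnd ℂ) (W s r)).re
  unfold enRate
  linarith

/-- The measure `ds × dk dζ` on `(0, t] × (ℤ × ℝ)`. -/
abbrev timeFreq (t : ℝ) : Measure (ℝ × (ℤ × ℝ)) := (volume.restrict (Ioc 0 t)).prod freqVol

lemma _root_.MeasureTheory.Integrable.timeFreq_mono {F : ℝ × (ℤ × ℝ) → ℝ} {t T : ℝ} (ht : t ≤ T)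
    (hF : Integrable F (timeFreq T)) : Integrable F (timeFreq t) := by
  have e : ∀ t : ℝ, timeFreq t = (volume.prod freqVol).restrict (Ioc 0 t ×ˢ univ) := fun t => by
    rw [← Measure.prod_restrict, Measure.restrict_univ]
  rw [e] at hF ⊢
  exact IntegrableOn.mono_set hF (prod_mono (Ioc_subset_Ioc_right ht) Subset.rfl)

lemma ae_timeFreq (t : ℝ) : ∀ᵐ z ∂timeFreq t, z.1 ∈ Icc 0 t :=
  Measure.quasiMeasurePreserving_fst.ae
    ((ae_restrict_mem measurableSet_Ioc).mono fun _ hs => Ioc_subset_Icc_self hs)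

section

variable (hE : IsEvol ν T W B h) (hν : 0 < ν) (hT : 0 ≤ T) (hρ : Measurable ρ)
  (hI : Integrable (fun z => ρ z.2 ^ 2 * h z.1 z.2 ^ 2) (timeFreq T))

include hE hν hT hρ hI

/-- The weighted dissipation is finite. -/
lemma integrable_dis :
    Integrable (fun z => ρ z.2 ^ 2 * (lapSym z.1 z.2 * ‖W z.1 z.2‖ ^ 2)) (timeFreq T) := by
  have hm : Measurable fun z : ℝ × (ℤ × ℝ) => ρ z.2 ^ 2 * (lapSym z.1 z.2 * ‖W z.1 z.2‖ ^ 2) :=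
    ((hρ.comp measurable_snd).pow_const 2).mul (hE.measurable_dis)
  have hTT : T ∈ Icc 0 T := ⟨hT, le_rfl⟩
  rw [integrable_prod_iff' hm.aestronglyMeasurable]
  constructor
  · refine Eventually.of_forall fun r => ?_
    have := ((hE.cont_dis_fst r).const_mul (ρ r ^ 2)).intervalIntegrable (μ := volume) 0 T
    exact (intervalIntegrable_iff_integrableOn_Ioc_of_le hT).1 this
  · have h1 := (((integrable_prod_iff' hI.1).1 hI).2).const_mul (ν⁻¹ * ν⁻¹)
    refine h1.mono' ?_ (Eventually.of_forall fun r => ?_)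
    · exact hm.norm.stronglyMeasurable.integral_prod_left'.aestronglyMeasurable
    · have h2 := hE.norm_sq_add_le hν hTT r
      have h3 : 0 ≤ ‖W T r‖ ^ 2 := by positivity
      rw [Real.norm_of_nonneg (integral_nonneg fun s => norm_nonneg _)]
      have e1 : ∫ s in Ioc 0 T, ‖ρ r ^ 2 * (lapSym s r * ‖W s r‖ ^ 2)‖ =
          ρ r ^ 2 * ∫ s in (0 : ℝ)..T, lapSym s r * ‖W s r‖ ^ 2 := by
        rw [intervalIntegral.integral_of_le hT, ← integral_const_mul]
        congr 1; ext s
        exact Real.norm_of_nonneg (mul_nonneg (sq_nonneg _)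
          (mul_nonneg (lapSym_nonneg s r) (sq_nonneg _)))
      have e2 : ∫ s in Ioc 0 T, ‖ρ r ^ 2 * h s r ^ 2‖ =
          ρ r ^ 2 * ∫ s in (0 : ℝ)..T, h s r ^ 2 := by
        rw [intervalIntegral.integral_of_le hT, ← integral_const_mul]
        congr 1; ext s
        exact Real.norm_of_nonneg (by positivity)
      rw [e1, e2]
      have h4 : ∫ s in (0 : ℝ)..T, lapSym s r * ‖W s r‖ ^ 2 ≤
          ν⁻¹ * (ν⁻¹ * ∫ s in (0 : ℝ)..T, h s r ^ 2) := by
        rw [le_inv_mul_iff₀ hν]; linarith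
      calc _ ≤ ρ r ^ 2 * (ν⁻¹ * (ν⁻¹ * ∫ s in (0 : ℝ)..T, h s r ^ 2)) := by gcongr
        _ = _ := by ring

lemma integrable_norm_sq {t : ℝ} (ht : t ∈ Icc 0 T) :
    Integrable (fun r => ρ r ^ 2 * ‖W t r‖ ^ 2) freqVol := by
  have h1 := (((integrable_prod_iff' hI.1).1 hI).2).const_mul ν⁻¹
  refine h1.mono' ?_ (Eventually.of_forall fun r => ?_)
  · have h2 : Measurable (W t) := (measurable_joint hE.contW).comp measurable_prodMk_left
    exact ((hρ.pow_const 2).mul (h2.norm.pow_const 2)).aestronglyMeasurable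
  · have h2 := hE.norm_sq_add_le hν ht r
    have h3 : 0 ≤ ∫ s in (0 : ℝ)..t, lapSym s r * ‖W s r‖ ^ 2 :=
      intervalIntegral.integral_nonneg ht.1 fun s _ =>
        mul_nonneg (lapSym_nonneg s r) (sq_nonneg _)
    have h4 : ∫ s in (0 : ℝ)..t, h s r ^ 2 ≤ ∫ s in (0 : ℝ)..T, h s r ^ 2 :=
      intervalIntegral.integral_mono_interval le_rfl ht.1 ht.2
        (Eventually.of_forall fun s => sq_nonneg _)
        (((cont_fst hE.conth r).pow 2).intervalIntegrable _ _)
    rw [Real.norm_of_nonneg (by positivity)]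
    have e2 : ∫ s in Ioc 0 T, ‖ρ r ^ 2 * h s r ^ 2‖ =
        ρ r ^ 2 * ∫ s in (0 : ℝ)..T, h s r ^ 2 := by
      rw [intervalIntegral.integral_of_le hT, ← integral_const_mul]
      congr 1; ext s
      exact Real.norm_of_nonneg (by positivity)
    rw [e2]
    have h5 : ‖W t r‖ ^ 2 ≤ ν⁻¹ * ∫ s in (0 : ℝ)..T, h s r ^ 2 := by
      have : ν⁻¹ * ∫ s in (0 : ℝ)..t, h s r ^ 2 ≤ ν⁻¹ * ∫ s in (0 : ℝ)..T, h s r ^ 2 := by gcongr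
      nlinarith
    calc _ ≤ ρ r ^ 2 * (ν⁻¹ * ∫ s in (0 : ℝ)..T, h s r ^ 2) := by gcongr
      _ = _ := by ring

lemma integrable_re :
    Integrable (fun z => ρ z.2 ^ 2 * (B z.1 z.2 * (starRingEnd ℂ) (W z.1 z.2)).re)
      (timeFreq T) := by
  have h1 := ((hE.integrable_dis hν hT hρ hI).const_mul ν).add (hI.const_mul ν⁻¹)
  refine h1.mono' ?_ ?_
  · exact (((hρ.comp measurable_snd).pow_const 2).mul
      (hE.measurable_re)).aestronglyMeasurable
  · filter_upwards [ae_timeFreq T] with z hz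
    have h2 := hE.two_mul_re_le hν hz z.2
    have h3 := abs_nonneg (B z.1 z.2 * (starRingEnd ℂ) (W z.1 z.2)).re
    rw [norm_mul, Real.norm_of_nonneg (sq_nonneg _), Real.norm_eq_abs, Pi.add_apply]
    have h4 : ρ z.2 ^ 2 * |(B z.1 z.2 * (starRingEnd ℂ) (W z.1 z.2)).re| ≤ ρ z.2 ^ 2 *
        (ν * (lapSym z.1 z.2 * ‖W z.1 z.2‖ ^ 2) + ν⁻¹ * h z.1 z.2 ^ 2) := by
      gcongr; linarith
    linarith

lemma integrable_enRate : Integrable (fun z => ρ z.2 ^ 2 * enRate ν W B z.1 z.2) (timeFreq T) := by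
  refine (((hE.integrable_dis hν hT hρ hI).const_mul (-(2 * ν))).add
    ((hE.integrable_re hν hT hρ hI).const_mul 2)).congr (Eventually.of_forall fun z => ?_)
  simp only [Pi.add_apply, enRate]; ring

/-- The weighted energy is the time integral of its rate of change. -/
lemma integral_norm_sq_eq {t : ℝ} (ht : t ∈ Icc 0 T) :
    ∫ r, ρ r ^ 2 * ‖W t r‖ ^ 2 ∂freqVol =
      ∫ s in (0 : ℝ)..t, ∫ r, ρ r ^ 2 * enRate ν W B s r ∂freqVol := by
  have h1 := (hE.integrable_enRate hν hT hρ hI).timeFreq_mono ht.2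
  rw [intervalIntegral.integral_of_le ht.1, integral_integral_swap h1]
  refine integral_congr_ae (Eventually.of_forall fun r => ?_)
  simp only
  rw [integral_const_mul, hE.norm_sq_eq, intervalIntegral.integral_of_le ht.1]

lemma continuousOn_energy :
    ContinuousOn (fun t => ∫ r, ρ r ^ 2 * ‖W t r‖ ^ 2 ∂freqVol) (Icc 0 T) := by
  have h1 : IntegrableOn (fun s => ∫ r, ρ r ^ 2 * enRate ν W B s r ∂freqVol) (Ioc 0 T) :=
    (hE.integrable_enRate hν hT hρ hI).integral_prod_left
  have h2 := intervalIntegral.continuousOn_primitive_interval (a := 0) (b := T) (μ := volume)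
    (f := fun s => ∫ r, ρ r ^ 2 * enRate ν W B s r ∂freqVol)
    (by rwa [uIcc_of_le hT, integrableOn_Icc_iff_integrableOn_Ioc])
  rw [uIcc_of_le hT] at h2
  exact h2.congr fun t ht => hE.integral_norm_sq_eq hν hT hρ hI ht

/-- The energy inequality: half of the dissipation is available to absorb the source. -/
lemma energy_le {t : ℝ} (ht : t ∈ Icc 0 T) {g : ℝ → ℝ} (hg : IntervalIntegrable g volume 0 t)
    (hle : ∀ s ∈ Icc 0 t, Integrable (fun r => ρ r ^ 2 * (lapSym s r * ‖W s r‖ ^ 2)) freqVol →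
      Integrable (fun r => ρ r ^ 2 * (B s r * (starRingEnd ℂ) (W s r)).re) freqVol →
      ∫ r, ρ r ^ 2 * (B s r * (starRingEnd ℂ) (W s r)).re ∂freqVol ≤
        g s + ν * ∫ r, ρ r ^ 2 * (lapSym s r * ‖W s r‖ ^ 2) ∂freqVol) :
    ∫ r, ρ r ^ 2 * ‖W t r‖ ^ 2 ∂freqVol ≤ 2 * ∫ s in (0 : ℝ)..t, g s := by
  rw [hE.integral_norm_sq_eq hν hT hρ hI ht, ← intervalIntegral.integral_const_mul,
    intervalIntegral.integral_of_le ht.1, intervalIntegral.integral_of_le ht.1]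
  refine integral_mono_ae ((hE.integrable_enRate hν hT hρ hI).timeFreq_mono ht.2).integral_prod_left
    ((hg.const_mul 2).1) ?_
  have a1 := ((hE.integrable_dis hν hT hρ hI).timeFreq_mono ht.2).prod_right_ae
  have a2 := ((hE.integrable_re hν hT hρ hI).timeFreq_mono ht.2).prod_right_ae
  filter_upwards [a1, a2, ae_restrict_mem measurableSet_Ioc] with s h1 h2 hs
  have h3 := hle s (Ioc_subset_Icc_self hs) h1 h2
  have e : ∀ r, ρ r ^ 2 * enRate ν W B s r =
      -(2 * ν) * (ρ r ^ 2 * (lapSym s r * ‖W s r‖ ^ 2)) +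
        2 * (ρ r ^ 2 * (B s r * (starRingEnd ℂ) (W s r)).re) := fun r => by
    unfold enRate; ring
  simp only [e]
  rw [integral_add (h1.const_mul _) (h2.const_mul _), integral_const_mul, integral_const_mul]
  linarith

end

end IsEvol

/-! ### Pointwise bounds for the transport term -/

/-- The symbol `U(p) · (k_q, ξ_q)` of the derivative along the velocity `U(p)`. -/
def dotU (t : ℝ) (U₁ U₂ : ℤ × ℝ → ℂ) (p q : ℤ × ℝ) : ℂ := q.1 * U₁ p + xi t q * U₂ p

/-- The transport term `-u · ∇f` on the Fourier side, in the conservative form `-div (u f)`. -/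
def adv (t : ℝ) (U₁ U₂ F : ℤ × ℝ → ℂ) (r : ℤ × ℝ) : ℂ :=
  -Complex.I * ∫ p, dotU t U₁ U₂ p r * F (r - p) ∂freqVol

/-- The size of the velocity at a frequency. -/
def speed (U₁ U₂ : ℤ × ℝ → ℂ) (p : ℤ × ℝ) : ℝ≥0∞ := ‖U₁ p‖ₑ + ‖U₂ p‖ₑ

/-- The symbol `(k² + ξ_t²)^{1/2}` of the full derivative. -/
def grad (t : ℝ) (p : ℤ × ℝ) : ℝ≥0∞ := ENNReal.ofReal (Real.sqrt (lapSym t p))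

/-- The symbol `|k|` of `∂_x`. -/
def absK (p : ℤ × ℝ) : ℝ≥0∞ := ENNReal.ofReal |(p.1 : ℝ)|

lemma measurable_grad (t : ℝ) : Measurable (grad t) :=
  (measurable_lapSym t).sqrt.ennreal_ofReal

lemma measurable_absK : Measurable absK :=
  ((measurable_from_top (f := fun k : ℤ => ENNReal.ofReal |(k : ℝ)|))).comp measurable_fst

lemma measurable_speed {U₁ U₂ : ℤ × ℝ → ℂ} (h₁ : Measurable U₁) (h₂ : Measurable U₂) :
    Measurable (speed U₁ U₂) := h₁.enorm.add h₂.enorm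

lemma absK_sub (r p : ℤ × ℝ) : absK r ≤ absK p + absK (r - p) := by
  unfold absK
  rw [← ENNReal.ofReal_add (abs_nonneg _) (abs_nonneg _)]
  refine ENNReal.ofReal_le_ofReal ?_
  rw [Prod.fst_sub, Int.cast_sub]
  calc |(r.1 : ℝ)| = |(p.1 : ℝ) + (r.1 - p.1)| := by rw [add_sub_cancel]
    _ ≤ _ := abs_add_le _ _

lemma abs_fst_le_sqrt (t : ℝ) (p : ℤ × ℝ) : |(p.1 : ℝ)| ≤ Real.sqrt (lapSym t p) :=
  Real.abs_le_sqrt (by unfold lapSym; nlinarith [sq_nonneg (xi t p)])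

lemma abs_xi_le_sqrt (t : ℝ) (p : ℤ × ℝ) : |xi t p| ≤ Real.sqrt (lapSym t p) :=
  Real.abs_le_sqrt (by unfold lapSym; nlinarith [sq_nonneg (p.1 : ℝ)])

lemma absK_le_grad (t : ℝ) (p : ℤ × ℝ) : absK p ≤ grad t p :=
  ENNReal.ofReal_le_ofReal (abs_fst_le_sqrt t p)

lemma sqrt_lapSym_le {t : ℝ} (ht : 0 ≤ t) (p : ℤ × ℝ) :
    Real.sqrt (lapSym t p) ≤ 2 * (1 + t) * nm p := by
  refine Real.sqrt_le_iff.2 ⟨by have := nm_nonneg p; positivity, ?_⟩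
  have h1 := abs_fst_le_nm p
  have h2 := abs_snd_le_nm p
  have h3 : |xi t p| ≤ (1 + t) * nm p := by
    unfold xi
    refine (abs_sub _ _).trans ?_
    rw [abs_mul t, abs_of_nonneg ht]
    nlinarith
  have h4 : (p.1 : ℝ) ^ 2 ≤ nm p ^ 2 := sq_le_sq' (by linarith [abs_le.1 h1]) (abs_le.1 h1).2
  have h5 : xi t p ^ 2 ≤ ((1 + t) * nm p) ^ 2 :=
    sq_le_sq' (by linarith [abs_le.1 h3]) (abs_le.1 h3).2
  unfold lapSym
  nlinarith [sq_nonneg (nm p), mul_nonneg ht (sq_nonneg (nm p)), mul_nonneg (mul_nonneg ht ht) (sq_nonneg (nm p))]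

lemma wt_one (p : ℤ × ℝ) : wt 1 p = ENNReal.ofReal (jb p) := by rw [wt, Real.rpow_one]

lemma absK_le_wt_one (p : ℤ × ℝ) : absK p ≤ wt 1 p := by
  rw [wt_one]
  exact ENNReal.ofReal_le_ofReal ((abs_fst_le_nm p).trans (nm_le_jb p))

lemma grad_le {t : ℝ} (ht : 0 ≤ t) (p : ℤ × ℝ) : grad t p ≤ ENNReal.ofReal (2 * (1 + t)) * wt 1 p := by
  rw [wt_one, ← ENNReal.ofReal_mul (by positivity)]
  refine ENNReal.ofReal_le_ofReal ((sqrt_lapSym_le ht p).trans ?_)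
  gcongr
  exact nm_le_jb p

lemma ofReal_mul_enorm {x : ℝ} (hx : 0 ≤ x) (z : ℂ) :
    ENNReal.ofReal x * ‖z‖ₑ = ENNReal.ofReal (x * ‖z‖) := by
  rw [ENNReal.ofReal_mul hx, ofReal_norm]

lemma enorm_dotU_le (t : ℝ) (U₁ U₂ : ℤ × ℝ → ℂ) (p q : ℤ × ℝ) :
    ‖dotU t U₁ U₂ p q‖ₑ ≤ grad t q * speed U₁ U₂ p := by
  unfold dotU speed grad
  refine (enorm_add_le _ _).trans ?_
  rw [enorm_mul, enorm_mul, mul_add]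
  gcongr
  · rw [← ofReal_norm, Complex.norm_intCast]
    exact ENNReal.ofReal_le_ofReal (abs_fst_le_sqrt t q)
  · rw [← ofReal_norm, Complex.norm_real]
    exact ENNReal.ofReal_le_ofReal (abs_xi_le_sqrt t q)

lemma enorm_adv_le (t : ℝ) (U₁ U₂ F : ℤ × ℝ → ℂ) (r : ℤ × ℝ) :
    ‖adv t U₁ U₂ F r‖ₑ ≤ ∫⁻ p, ‖dotU t U₁ U₂ p r‖ₑ * ‖F (r - p)‖ₑ ∂freqVol := by
  unfold adv
  rw [enorm_mul, enorm_neg, ← ofReal_norm Complex.I, Complex.norm_I, ENNReal.ofReal_one, one_mul]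
  refine (enorm_integral_le_lintegral_enorm _).trans (le_of_eq ?_)
  simp only [enorm_mul]

/-- The bound used when a derivative is recovered from the dissipation. -/
lemma enorm_adv_le_grad_mul (t : ℝ) {U₁ U₂ F : ℤ × ℝ → ℂ} (h₁ : Measurable U₁)
    (h₂ : Measurable U₂) (hF : Measurable F) (r : ℤ × ℝ) :
    ‖adv t U₁ U₂ F r‖ₑ ≤ grad t r * conv (speed U₁ U₂) (fun q => ‖F q‖ₑ) r := by
  refine (enorm_adv_le t U₁ U₂ F r).trans ?_
  unfold conv
  have hm : Measurable fun p => speed U₁ U₂ p * ‖F (r - p)‖ₑ :=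
    (measurable_speed h₁ h₂).mul (hF.comp (measurable_const.sub measurable_id)).enorm
  rw [← lintegral_const_mul _ hm]
  refine lintegral_mono fun p => ?_
  rw [← mul_assoc]
  gcongr
  exact enorm_dotU_le t U₁ U₂ p r

/-- The moving Laplacian degenerates only where the fixed one does: for `k = 0` the symbols agree,
and for `k ≠ 0` the moving one is at least `1`. -/
lemma nm_sq_le (t : ℝ) (p : ℤ × ℝ) : nm p ^ 2 ≤ lapSym t p * jb p ^ 2 := by
  have h0 := lapSym_nonneg t p
  have h1 := one_le_jb p
  by_cases hk : p.1 = 0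
  · have h2 : lapSym t p = nm p ^ 2 := by rw [nm_sq, lapSym, xi, hk]; simp
    rw [h2]
    exact le_mul_of_one_le_right (sq_nonneg _) (one_le_pow₀ h1)
  · have h2 : 1 ≤ lapSym t p := by
      have : (1 : ℝ) ≤ (p.1 : ℝ) ^ 2 := by
        have := Int.one_le_abs hk
        have h3 : (1 : ℝ) ≤ |(p.1 : ℝ)| := by exact_mod_cast this
        rw [← sq_abs]; exact one_le_pow₀ h3
      unfold lapSym; nlinarith [sq_nonneg (xi t p)]
    calc nm p ^ 2 ≤ jb p ^ 2 := pow_le_pow_left₀ (nm_nonneg p) (nm_le_jb p) 2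
      _ ≤ _ := le_mul_of_one_le_left (sq_nonneg _) h2

lemma one_le_sq_of_ne_zero {k : ℤ} (hk : k ≠ 0) : (1 : ℝ) ≤ (k : ℝ) ^ 2 := by
  have h3 : (1 : ℝ) ≤ |(k : ℝ)| := by exact_mod_cast Int.one_le_abs hk
  rw [← sq_abs]; exact one_le_pow₀ h3

lemma one_le_lapSym {t : ℝ} {p : ℤ × ℝ} (hk : p.1 ≠ 0) : 1 ≤ lapSym t p := by
  unfold lapSym; nlinarith [sq_nonneg (xi t p), one_le_sq_of_ne_zero hk]

/-- The symbol of the Laplacian at nonzero modes grows like `t²`: the tilting of the frequencies by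
the shear makes the inviscid damping. -/
lemma one_add_sq_le {t : ℝ} (ht : 0 ≤ t) {p : ℤ × ℝ} (hk : p.1 ≠ 0) :
    (1 + t) ^ 2 ≤ 6 * jb p ^ 2 * lapSym t p := by
  have hk1 : (1 : ℝ) ≤ |(p.1 : ℝ)| := by exact_mod_cast Int.one_le_abs hk
  have h1 : t * |(p.1 : ℝ)| ≤ |2 * Real.pi * p.2| + |xi t p| := by
    have : t * (p.1 : ℝ) = 2 * Real.pi * p.2 - xi t p := by unfold xi; ring
    rw [← abs_of_nonneg ht, ← abs_mul, abs_of_nonneg ht, this]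
    exact abs_sub _ _
  have h2 : 1 + t ≤ |(p.1 : ℝ)| + |2 * Real.pi * p.2| + |xi t p| := by nlinarith
  have h3 : (1 + t) ^ 2 ≤ (|(p.1 : ℝ)| + |2 * Real.pi * p.2| + |xi t p|) ^ 2 :=
    pow_le_pow_left₀ (by linarith) h2 2
  have hQ := one_le_lapSym (t := t) hk
  have hj : 1 ≤ jb p ^ 2 := one_le_pow₀ (one_le_jb p)
  have hj2 := jb_sq p
  have e1 := sq_abs (p.1 : ℝ)
  have e2 := sq_abs (2 * Real.pi * p.2)
  have e3 := sq_abs (xi t p)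
  have hL : lapSym t p = (p.1 : ℝ) ^ 2 + xi t p ^ 2 := rfl
  generalize |(p.1 : ℝ)| = a at *
  generalize |2 * Real.pi * p.2| = b at *
  generalize |xi t p| = c at *
  nlinarith [sq_nonneg (a - b), sq_nonneg (b - c), sq_nonneg (a - c),
    mul_nonneg (sub_nonneg.2 hQ) (sub_nonneg.2 hj)]

/-- The cross product of two frequencies, which is invariant under the shear, is bounded by their
lengths. -/
lemma abs_cross_le (p q : ℤ × ℝ) :
    |(q.1 : ℝ) * (2 * Real.pi * p.2) - 2 * Real.pi * q.2 * p.1| ≤ nm p * nm q := by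
  refine abs_le_of_sq_le_sq ?_ (mul_nonneg (nm_nonneg p) (nm_nonneg q))
  rw [mul_pow, nm_sq, nm_sq]
  nlinarith [sq_nonneg ((p.1 : ℝ) * q.1 + (2 * Real.pi * p.2) * (2 * Real.pi * q.2))]

namespace IsVelSpec

variable {t : ℝ} {U₁ U₂ A : ℤ × ℝ → ℂ}

/-- Incompressibility: `u · ∇f` and `div (u f)` have the same symbol. -/
lemma dotU_sub (h : IsVelSpec t U₁ U₂ A) :
    ∀ᵐ p ∂freqVol, ∀ r, dotU t U₁ U₂ p r = dotU t U₁ U₂ p (r - p) := by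
  filter_upwards [h.div_free] with p hp r
  unfold dotU
  rw [xi_sub, Prod.fst_sub]
  push_cast
  linear_combination hp

/-- The Biot–Savart law on the Fourier side. -/
lemma biotSavart (h : IsVelSpec t U₁ U₂ A) : ∀ᵐ p ∂freqVol,
    (lapSym t p : ℂ) * U₁ p = Complex.I * xi t p * A p ∧
    (lapSym t p : ℂ) * U₂ p = -Complex.I * p.1 * A p := by
  filter_upwards [h.div_free, h.curl_eq] with p h1 h2
  rw [h2]
  unfold lapSym
  push_cast
  constructor
  · linear_combination (p.1 : ℂ) * h1 - (xi t p : ℂ) * (p.1 * U₂ p - xi t p * U₁ p) * Complex.I_sq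
  · linear_combination (xi t p : ℂ) * h1 + (p.1 : ℂ) * (p.1 * U₂ p - xi t p * U₁ p) * Complex.I_sq

/-- The cancellation of the growing part of `∇` in `u · ∇`. -/
lemma lapSym_mul_dotU_le (h : IsVelSpec t U₁ U₂ A) : ∀ᵐ p ∂freqVol, ∀ q,
    lapSym t p * ‖dotU t U₁ U₂ p q‖ ≤ ‖A p‖ * nm p * nm q := by
  filter_upwards [h.biotSavart] with p hp q
  have h1 : (lapSym t p : ℂ) * dotU t U₁ U₂ p q = Complex.I * A p *
      (((q.1 : ℝ) * (2 * Real.pi * p.2) - 2 * Real.pi * q.2 * p.1 : ℝ) : ℂ) := by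
    unfold dotU
    have : xi t q = 2 * Real.pi * q.2 - t * q.1 := rfl
    have h2 : xi t p = 2 * Real.pi * p.2 - t * p.1 := rfl
    calc _ = q.1 * ((lapSym t p : ℂ) * U₁ p) + xi t q * ((lapSym t p : ℂ) * U₂ p) := by ring
      _ = _ := by rw [hp.1, hp.2, this, h2]; push_cast; ring
  have h2 : lapSym t p * ‖dotU t U₁ U₂ p q‖ = ‖(lapSym t p : ℂ) * dotU t U₁ U₂ p q‖ := by
    rw [norm_mul, Complex.norm_real, Real.norm_of_nonneg (lapSym_nonneg t p)]
  rw [h2, h1, norm_mul, norm_mul, Complex.norm_I, one_mul, Complex.norm_real, mul_assoc ‖A p‖ (nm p)]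
  exact mul_le_mul_of_nonneg_left (abs_cross_le p q) (norm_nonneg _)

/-- The bound for all modes of the velocity; the weight `nm p` is the one that the commutator of
`⟨∇⟩ⁿ` with `u · ∇` provides. -/
lemma nm_mul_dotU_le (h : IsVelSpec t U₁ U₂ A) : ∀ᵐ p ∂freqVol, ∀ q,
    nm p * ‖dotU t U₁ U₂ p q‖ ≤ ‖A p‖ * jb p ^ 2 * nm q := by
  filter_upwards [h.lapSym_mul_dotU_le] with p hp q
  have hq := nm_nonneg q
  have hA := norm_nonneg (A p)
  rcases (nm_nonneg p).eq_or_lt with h0 | h0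
  · rw [← h0, zero_mul]; positivity
  · have h1 := nm_sq_le t p
    have hQ : 0 < lapSym t p := by
      rcases (lapSym_nonneg t p).eq_or_lt with h2 | h2
      · rw [← h2, zero_mul] at h1; exact absurd h1 (not_le.2 (by positivity))
      · exact h2
    refine le_of_mul_le_mul_left ?_ hQ
    calc lapSym t p * (nm p * ‖dotU t U₁ U₂ p q‖)
        = nm p * (lapSym t p * ‖dotU t U₁ U₂ p q‖) := by ring
      _ ≤ nm p * (‖A p‖ * nm p * nm q) := mul_le_mul_of_nonneg_left (hp q) h0.le
      _ = ‖A p‖ * nm q * nm p ^ 2 := by ring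
      _ ≤ ‖A p‖ * nm q * (lapSym t p * jb p ^ 2) := by gcongr
      _ = _ := by ring

lemma dotU_le (h : IsVelSpec t U₁ U₂ A) : ∀ᵐ p ∂freqVol, p.1 ≠ 0 → ∀ q,
    ‖dotU t U₁ U₂ p q‖ ≤ ‖A p‖ * nm p * nm q := by
  filter_upwards [h.lapSym_mul_dotU_le] with p hp hk q
  refine le_trans ?_ (hp q)
  exact le_mul_of_one_le_left (norm_nonneg _) (one_le_lapSym hk)

/-- The inviscid damping of `u_≠ · ∇`: the rate `(1 + t)^{-2}` is integrable in time. -/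
lemma dotU_le_decay (h : IsVelSpec t U₁ U₂ A) (ht : 0 ≤ t) : ∀ᵐ p ∂freqVol, p.1 ≠ 0 → ∀ q,
    ‖dotU t U₁ U₂ p q‖ ≤ 6 / (1 + t) ^ 2 * (jb p ^ 3 * ‖A p‖) * nm q := by
  filter_upwards [h.lapSym_mul_dotU_le] with p hp hk q
  have h1 := one_add_sq_le ht hk
  have ht2 : 0 < (1 + t) ^ 2 := by positivity
  have hq := nm_nonneg q
  have hj := jb_pos p
  refine le_of_mul_le_mul_left ?_ ht2
  calc (1 + t) ^ 2 * ‖dotU t U₁ U₂ p q‖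
      ≤ 6 * jb p ^ 2 * lapSym t p * ‖dotU t U₁ U₂ p q‖ := by gcongr
    _ = 6 * jb p ^ 2 * (lapSym t p * ‖dotU t U₁ U₂ p q‖) := by ring
    _ ≤ 6 * jb p ^ 2 * (‖A p‖ * nm p * nm q) := mul_le_mul_of_nonneg_left (hp q) (by positivity)
    _ ≤ 6 * jb p ^ 2 * (‖A p‖ * jb p * nm q) := by gcongr; exact nm_le_jb p
    _ = _ := by field_simp

lemma sqrt_mul_norm_le (h : IsVelSpec t U₁ U₂ A) : ∀ᵐ p ∂freqVol,
    Real.sqrt (lapSym t p) * ‖U₁ p‖ ≤ ‖A p‖ ∧ Real.sqrt (lapSym t p) * ‖U₂ p‖ ≤ ‖A p‖ := by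
  filter_upwards [h.biotSavart] with p hp
  have hA := norm_nonneg (A p)
  have hs := Real.sqrt_nonneg (lapSym t p)
  have key : ∀ {U : ℂ} {x : ℝ}, |x| ≤ Real.sqrt (lapSym t p) →
      lapSym t p * ‖U‖ = |x| * ‖A p‖ → Real.sqrt (lapSym t p) * ‖U‖ ≤ ‖A p‖ := by
    intro U x hx hU
    rcases hs.eq_or_lt with h0 | h0
    · rw [← h0, zero_mul]; exact hA
    · refine le_of_mul_le_mul_left ?_ h0
      rw [← mul_assoc, Real.mul_self_sqrt (lapSym_nonneg t p), hU]
      gcongr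
  have n1 : ∀ U : ℂ, ‖(lapSym t p : ℂ) * U‖ = lapSym t p * ‖U‖ := fun U => by
    rw [norm_mul, Complex.norm_real, Real.norm_of_nonneg (lapSym_nonneg t p)]
  constructor
  · refine key (abs_xi_le_sqrt t p) ?_
    rw [← n1, hp.1, norm_mul, norm_mul, Complex.norm_I, one_mul, Complex.norm_real,
      Real.norm_eq_abs]
  · refine key (abs_fst_le_sqrt t p) ?_
    rw [← n1, hp.2, norm_mul, norm_mul, norm_neg, Complex.norm_I, one_mul, Complex.norm_intCast]

lemma grad_mul_speed_le (h : IsVelSpec t U₁ U₂ A) : ∀ᵐ p ∂freqVol,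
    grad t p * speed U₁ U₂ p ≤ 2 * ‖A p‖ₑ := by
  filter_upwards [h.sqrt_mul_norm_le] with p hp
  unfold grad speed
  rw [mul_add, ofReal_mul_enorm (Real.sqrt_nonneg _), ofReal_mul_enorm (Real.sqrt_nonneg _), two_mul,
    ← ofReal_norm (A p)]
  exact add_le_add (ENNReal.ofReal_le_ofReal hp.1) (ENNReal.ofReal_le_ofReal hp.2)

lemma speed_le (h : IsVelSpec t U₁ U₂ A) : ∀ᵐ p ∂freqVol, 1 ≤ lapSym t p →
    speed U₁ U₂ p ≤ 2 * ‖A p‖ₑ := by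
  filter_upwards [h.grad_mul_speed_le] with p hp hQ
  refine le_trans (le_mul_of_one_le_left zero_le ?_) hp
  unfold grad
  rw [ENNReal.one_le_ofReal]
  exact Real.one_le_sqrt.2 hQ

lemma absK_mul_speed_le (h : IsVelSpec t U₁ U₂ A) : ∀ᵐ p ∂freqVol,
    absK p * speed U₁ U₂ p ≤ 2 * ‖A p‖ₑ := by
  filter_upwards [h.grad_mul_speed_le] with p hp
  exact le_trans (mul_le_mul_left (absK_le_grad t p) _) hp

/-- The inviscid damping of `∂_x u`. -/
lemma absK_mul_speed_le_decay (h : IsVelSpec t U₁ U₂ A) (ht : 0 ≤ t) : ∀ᵐ p ∂freqVol,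
    absK p * speed U₁ U₂ p ≤ ENNReal.ofReal (6 / (1 + t)) * (wt 2 p * ‖A p‖ₑ) := by
  filter_upwards [h.sqrt_mul_norm_le] with p hp
  by_cases hk : p.1 = 0
  · simp [absK, hk]
  have hj := one_le_jb p
  have h1 : 1 + t ≤ 3 * jb p * Real.sqrt (lapSym t p) := by
    refine abs_le_of_sq_le_sq' ?_ (by positivity) |>.2
    rw [mul_pow, mul_pow, Real.sq_sqrt (lapSym_nonneg t p)]
    have := one_add_sq_le ht hk
    have h3 := mul_nonneg (sq_nonneg (jb p)) (lapSym_nonneg t p)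
    nlinarith
  have hkj : |(p.1 : ℝ)| ≤ jb p := (abs_fst_le_nm p).trans (nm_le_jb p)
  have ht1 : 0 < 1 + t := by positivity
  have key : ∀ {U : ℂ}, Real.sqrt (lapSym t p) * ‖U‖ ≤ ‖A p‖ →
      |(p.1 : ℝ)| * ‖U‖ ≤ 3 / (1 + t) * (jb p ^ 2 * ‖A p‖) := by
    intro U hU
    refine le_of_mul_le_mul_left ?_ ht1
    calc (1 + t) * (|(p.1 : ℝ)| * ‖U‖)
        ≤ 3 * jb p * Real.sqrt (lapSym t p) * (jb p * ‖U‖) := by gcongr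
      _ = 3 * jb p ^ 2 * (Real.sqrt (lapSym t p) * ‖U‖) := by ring
      _ ≤ 3 * jb p ^ 2 * ‖A p‖ := by gcongr
      _ = _ := by field_simp
  unfold absK speed wt
  rw [mul_add, ofReal_mul_enorm (abs_nonneg _), ofReal_mul_enorm (abs_nonneg _),
    ofReal_mul_enorm (Real.rpow_nonneg (jb_pos p).le 2), ← ENNReal.ofReal_mul (by positivity),
    ← ENNReal.ofReal_add (by positivity) (by positivity)]
  refine ENNReal.ofReal_le_ofReal ?_
  have k1 := key hp.1
  have k2 := key hp.2
  rw [Real.rpow_two]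
  have e : 6 / (1 + t) * (jb p ^ 2 * ‖A p‖) = 3 / (1 + t) * (jb p ^ 2 * ‖A p‖) +
      3 / (1 + t) * (jb p ^ 2 * ‖A p‖) := by ring
  linarith

lemma ae_snd_ne_zero : ∀ᵐ p : ℤ × ℝ ∂freqVol, p.2 ≠ 0 := by
  refine ae_freqVol fun k => ?_
  simp [ae_iff]

/-- The second component of the velocity has no zero mode, so it is controlled by the vorticity at
all frequencies. -/
lemma norm_snd_le (h : IsVelSpec t U₁ U₂ A) : ∀ᵐ p ∂freqVol, ‖U₂ p‖ₑ ≤ ‖A p‖ₑ := by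
  filter_upwards [h.sqrt_mul_norm_le, h.div_free, ae_snd_ne_zero] with p hp h0 h2
  rw [← ofReal_norm, ← ofReal_norm]
  refine ENNReal.ofReal_le_ofReal ?_
  by_cases hk : p.1 = 0
  · have h3 : (xi t p : ℂ) ≠ 0 := by
      have := Real.pi_pos.ne'
      simp [xi, hk, h2, this]
    rw [hk] at h0
    simp only [Int.cast_zero, zero_mul, zero_add] at h0
    rw [(mul_eq_zero.1 h0).resolve_left h3, norm_zero]
    exact norm_nonneg _
  · exact (le_mul_of_one_le_left (norm_nonneg _)
      (Real.one_le_sqrt.2 (one_le_lapSym hk))).trans hp.2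

end IsVelSpec

/-! ### The commutator estimate -/

lemma lintegral_mul_conv_le {a G H : ℤ × ℝ → ℝ≥0∞} (ha : Measurable a) (hG : Measurable G)
    (hH : Measurable H) :
    ∫⁻ r, a r * conv G H r ∂freqVol ≤ l2 a * ((∫⁻ p, G p ∂freqVol) * l2 H) :=
  (lintegral_mul_le_l2 ha (measurable_conv hG hH)).trans (by gcongr; exact l2_conv_le hG hH)

lemma measurable_wt_mul_enorm (n : ℝ) {F : ℤ × ℝ → ℂ} (hF : Measurable F) :
    Measurable fun p => wt n p * ‖F p‖ₑ := (measurable_wt n).mul hF.enorm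

lemma measurable_dotU (t : ℝ) {U₁ U₂ : ℤ × ℝ → ℂ} (h₁ : Measurable U₁) (h₂ : Measurable U₂) :
    Measurable fun z : (ℤ × ℝ) × (ℤ × ℝ) => dotU t U₁ U₂ z.2 z.1 := by
  unfold dotU
  have h3 : Measurable fun k : ℤ => (k : ℂ) := measurable_from_top
  have h4 := (Complex.measurable_ofReal.comp (measurable_xi t)).comp
    (measurable_fst : Measurable fun z : (ℤ × ℝ) × (ℤ × ℝ) => z.1)
  exact ((h3.comp (measurable_fst.comp measurable_fst)).mul (h₁.comp measurable_snd)).add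
    (h4.mul (h₂.comp measurable_snd))

section Commutator

variable {t n : ℝ} {U₁ U₂ A F : ℤ × ℝ → ℂ}

/-- The pointwise commutator estimate: the difference of the weights compensates the singularity of
the Biot–Savart law at low frequencies. -/
lemma IsVelSpec.abs_sub_mul_dotU_le (h : IsVelSpec t U₁ U₂ A) (hn : 1 ≤ n) :
    ∀ᵐ p ∂freqVol, ∀ r, |jb r ^ n - jb (r - p) ^ n| * ‖dotU t U₁ U₂ p r‖ ≤
      n * 2 ^ (n - 1) * (jb p ^ (n + 1) * ‖A p‖ * jb (r - p) ^ n) := by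
  filter_upwards [h.nm_mul_dotU_le, h.dotU_sub] with p h1 h2 r
  have h3 := abs_jb_rpow_sub_le hn p (r - p)
  rw [add_sub_cancel] at h3
  have h4 := h1 (r - p)
  rw [← h2 r] at h4
  have hp := jb_pos p
  have hq := jb_pos (r - p)
  have e1 : jb p ^ (n + 1) = jb p ^ (n - 1) * jb p ^ 2 := by
    rw [← Real.rpow_two, ← Real.rpow_add hp]; congr 1; ring
  have e2 : jb (r - p) ^ n = jb (r - p) ^ (n - 1) * jb (r - p) := by
    rw [← Real.rpow_add_one hq.ne']; congr 1; ring
  have hc : 0 ≤ n * (2 : ℝ) ^ (n - 1) := by positivity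
  have hx := Real.rpow_nonneg hp.le (n - 1)
  have hy := Real.rpow_nonneg hq.le (n - 1)
  calc _ ≤ n * 2 ^ (n - 1) * (nm p * (jb p ^ (n - 1) * jb (r - p) ^ (n - 1))) *
        ‖dotU t U₁ U₂ p r‖ := by gcongr
    _ = n * 2 ^ (n - 1) * (jb p ^ (n - 1) * jb (r - p) ^ (n - 1)) *
        (nm p * ‖dotU t U₁ U₂ p r‖) := by ring
    _ ≤ n * 2 ^ (n - 1) * (jb p ^ (n - 1) * jb (r - p) ^ (n - 1)) *
        (‖A p‖ * jb p ^ 2 * nm (r - p)) := by gcongr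
    _ ≤ n * 2 ^ (n - 1) * (jb p ^ (n - 1) * jb (r - p) ^ (n - 1)) *
        (‖A p‖ * jb p ^ 2 * jb (r - p)) := by gcongr; exact nm_le_jb _
    _ = _ := by rw [e1]; conv_rhs => rw [e2]
                ring

/-- The integrand of the energy pairing of the transport term. -/
def advKer (t : ℝ) (U₁ U₂ F : ℤ × ℝ → ℂ) (z : (ℤ × ℝ) × (ℤ × ℝ)) : ℂ :=
  dotU t U₁ U₂ z.2 z.1 * F (z.1 - z.2) * (starRingEnd ℂ) (F z.1)

lemma measurable_advKer (h₁ : Measurable U₁) (h₂ : Measurable U₂) (hF : Measurable F) :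
    Measurable (advKer t U₁ U₂ F) :=
  ((measurable_dotU t h₁ h₂).mul (hF.comp (measurable_fst.sub measurable_snd))).mul
    (Complex.continuous_conj.measurable.comp (hF.comp measurable_fst))

lemma measurable_jb_rpow (n : ℝ) : Measurable fun p => jb p ^ n := measurable_jb.pow_const n

/-- The dissipation makes the pairing absolutely convergent, so that it may be split. -/
lemma integrable_symmetric (h₁ : Measurable U₁) (h₂ : Measurable U₂) (hF : Measurable F)
    (hS : ∫⁻ p, speed U₁ U₂ p ∂freqVol < ∞) (hFn : l2 (fun p => wt n p * ‖F p‖ₑ) < ∞)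
    (hFg : l2 (fun p => wt n p * (grad t p * ‖F p‖ₑ)) < ∞) :
    Integrable (fun z => ((jb z.1 ^ n * jb (z.1 - z.2) ^ n : ℝ) : ℂ) * advKer t U₁ U₂ F z)
      (freqVol.prod freqVol) := by
  have hm : Measurable fun z : (ℤ × ℝ) × (ℤ × ℝ) =>
      ((jb z.1 ^ n * jb (z.1 - z.2) ^ n : ℝ) : ℂ) * advKer t U₁ U₂ F z :=
    (Complex.measurable_ofReal.comp (((measurable_jb_rpow n).comp measurable_fst).mul
      ((measurable_jb_rpow n).comp (measurable_fst.sub measurable_snd)))).mul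
      (measurable_advKer h₁ h₂ hF)
  refine ⟨hm.aestronglyMeasurable, ?_⟩
  rw [hasFiniteIntegral_iff_enorm, lintegral_prod _ hm.enorm.aemeasurable]
  have hF1 := measurable_wt_mul_enorm n hF
  have hF2 : Measurable fun p => wt n p * (grad t p * ‖F p‖ₑ) :=
    (measurable_wt n).mul ((measurable_grad t).mul hF.enorm)
  refine (lintegral_mono fun r => ?_).trans_lt ((lintegral_mul_conv_le hF2
    (measurable_speed h₁ h₂) hF1).trans_lt
      (ENNReal.mul_lt_top hFg (ENNReal.mul_lt_top hS hFn)))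
  unfold conv
  have hm' : Measurable fun p => speed U₁ U₂ p * (wt n (r - p) * ‖F (r - p)‖ₑ) :=
    (measurable_speed h₁ h₂).mul (hF1.comp (measurable_const.sub measurable_id))
  rw [← lintegral_const_mul _ hm']
  refine lintegral_mono fun p => ?_
  simp only [advKer, enorm_mul, RCLike.enorm_conj, Complex.ofReal_mul]
  have e : ∀ x, ‖((jb x ^ n : ℝ) : ℂ)‖ₑ = wt n x := fun x => by
    rw [enorm_ofReal, enorm_jb_rpow]
  rw [e, e]
  calc _ ≤ wt n r * wt n (r - p) * (grad t r * speed U₁ U₂ p * ‖F (r - p)‖ₑ * ‖F r‖ₑ) := by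
        gcongr; exact enorm_dotU_le t U₁ U₂ p r
    _ = _ := by ring

/-- The part of the energy pairing with a difference of weights costs no derivative of `F`. -/
lemma lintegral_commutator_le (h : IsVelSpec t U₁ U₂ A) (hn : 1 ≤ n) (h₁ : Measurable U₁)
    (h₂ : Measurable U₂) (hA : Measurable A) (hF : Measurable F) :
    ∫⁻ z, ‖((jb z.1 ^ n * (jb z.1 ^ n - jb (z.1 - z.2) ^ n) : ℝ) : ℂ) * advKer t U₁ U₂ F z‖ₑ
      ∂(freqVol.prod freqVol) ≤ ENNReal.ofReal (n * 2 ^ (n - 1)) *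
        ((∫⁻ p, wt (n + 1) p * ‖A p‖ₑ ∂freqVol) * l2 (fun p => wt n p * ‖F p‖ₑ) ^ 2) := by
  have hm : Measurable fun z : (ℤ × ℝ) × (ℤ × ℝ) =>
      ((jb z.1 ^ n * (jb z.1 ^ n - jb (z.1 - z.2) ^ n) : ℝ) : ℂ) * advKer t U₁ U₂ F z :=
    (Complex.measurable_ofReal.comp (((measurable_jb_rpow n).comp measurable_fst).mul
      (((measurable_jb_rpow n).comp measurable_fst).sub
      ((measurable_jb_rpow n).comp (measurable_fst.sub measurable_snd))))).mul
      (measurable_advKer h₁ h₂ hF)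
  have hF1 := measurable_wt_mul_enorm n hF
  have hA1 := measurable_wt_mul_enorm (n + 1) hA
  rw [lintegral_prod _ hm.enorm.aemeasurable]
  have hle : ∀ r, ∫⁻ p, ‖((jb r ^ n * (jb r ^ n - jb (r - p) ^ n) : ℝ) : ℂ) *
      advKer t U₁ U₂ F (r, p)‖ₑ ∂freqVol ≤ ENNReal.ofReal (n * 2 ^ (n - 1)) *
        (wt n r * ‖F r‖ₑ * conv (fun p => wt (n + 1) p * ‖A p‖ₑ) (fun q => wt n q * ‖F q‖ₑ) r) := by
    intro r
    unfold conv
    have hm' : Measurable fun p => wt (n + 1) p * ‖A p‖ₑ * (wt n (r - p) * ‖F (r - p)‖ₑ) :=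
      hA1.mul (hF1.comp (measurable_const.sub measurable_id))
    rw [← mul_assoc, ← lintegral_const_mul _ hm']
    refine lintegral_mono_ae ?_
    filter_upwards [h.abs_sub_mul_dotU_le hn] with p hp
    have h3 := ENNReal.ofReal_le_ofReal (hp r)
    have hj := Real.rpow_nonneg (jb_pos p).le (n + 1)
    have hj' := Real.rpow_nonneg (jb_pos (r - p)).le n
    have e1 : ENNReal.ofReal (|jb r ^ n - jb (r - p) ^ n| * ‖dotU t U₁ U₂ p r‖) =
        ‖((jb r ^ n - jb (r - p) ^ n : ℝ) : ℂ)‖ₑ * ‖dotU t U₁ U₂ p r‖ₑ := by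
      rw [ENNReal.ofReal_mul (abs_nonneg _), ofReal_norm, enorm_ofReal, ← Real.norm_eq_abs,
        ofReal_norm]
    have e2 : ENNReal.ofReal (n * 2 ^ (n - 1) * (jb p ^ (n + 1) * ‖A p‖ * jb (r - p) ^ n)) =
        ENNReal.ofReal (n * 2 ^ (n - 1)) * (wt (n + 1) p * ‖A p‖ₑ * wt n (r - p)) := by
      rw [ENNReal.ofReal_mul (by positivity), ENNReal.ofReal_mul (mul_nonneg hj (norm_nonneg _)),
        ENNReal.ofReal_mul hj, ofReal_norm]; rfl
    rw [e1, e2] at h3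
    rw [Complex.ofReal_mul, enorm_mul, enorm_mul]
    simp only [advKer, enorm_mul, RCLike.enorm_conj]
    have e : ∀ x, ‖((jb x ^ n : ℝ) : ℂ)‖ₑ = wt n x := fun x => by
      rw [enorm_ofReal, enorm_jb_rpow]
    rw [e]
    calc _ = wt n r * ‖F r‖ₑ * ‖F (r - p)‖ₑ *
          (‖((jb r ^ n - jb (r - p) ^ n : ℝ) : ℂ)‖ₑ * ‖dotU t U₁ U₂ p r‖ₑ) := by ring
      _ ≤ wt n r * ‖F r‖ₑ * ‖F (r - p)‖ₑ * (ENNReal.ofReal (n * 2 ^ (n - 1)) *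
          (wt (n + 1) p * ‖A p‖ₑ * wt n (r - p))) := by gcongr
      _ = _ := by ring
  refine (lintegral_mono hle).trans ?_
  have hm' : Measurable fun r => wt n r * ‖F r‖ₑ *
      conv (fun p => wt (n + 1) p * ‖A p‖ₑ) (fun q => wt n q * ‖F q‖ₑ) r :=
    hF1.mul (measurable_conv hA1 hF1)
  rw [lintegral_const_mul _ hm']
  gcongr
  refine (lintegral_mul_conv_le hF1 hA1 hF1).trans (le_of_eq ?_)
  ring

/-- The part of the energy pairing with a symmetric weight vanishes because the velocity is real and
divergence free. -/
lemma im_integral_symmetric (h : IsVelSpec t U₁ U₂ A)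
    (hi : Integrable (fun z => ((jb z.1 ^ n * jb (z.1 - z.2) ^ n : ℝ) : ℂ) * advKer t U₁ U₂ F z)
      (freqVol.prod freqVol)) :
    (∫ z, ((jb z.1 ^ n * jb (z.1 - z.2) ^ n : ℝ) : ℂ) * advKer t U₁ U₂ F z
      ∂(freqVol.prod freqVol)).im = 0 := by
  set g : (ℤ × ℝ) × (ℤ × ℝ) → ℂ := fun z =>
    ((jb z.1 ^ n * jb (z.1 - z.2) ^ n : ℝ) : ℂ) * advKer t U₁ U₂ F z with hg
  -- the change of variables `(r, p) ↦ (r - p, -p)` preserves the measure and conjugates the integrand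
  have hsym : ∀ᵐ p ∂freqVol, ∀ r, g (r - p, -p) = (starRingEnd ℂ) (g (r, p)) := by
    filter_upwards [h.dotU_sub, h.conj₁, h.conj₂] with p h1 h2 h3 r
    have e1 : dotU t U₁ U₂ (-p) (r - p) = (starRingEnd ℂ) (dotU t U₁ U₂ p r) := by
      rw [h1 r]
      unfold dotU
      rw [h2, h3]
      simp [Complex.conj_ofReal]
    have e2 : r - p - -p = r := by abel
    simp only [hg, advKer]
    rw [e1, e2]
    simp only [map_mul, Complex.conj_conj, Complex.conj_ofReal, Complex.ofReal_mul]
    ring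
  have h1 : (starRingEnd ℂ) (∫ z, g z ∂(freqVol.prod freqVol)) = ∫ z, g z ∂(freqVol.prod freqVol) := by
    calc (starRingEnd ℂ) (∫ z, g z ∂(freqVol.prod freqVol))
        = ∫ p, ∫ r, (starRingEnd ℂ) (g (r, p)) ∂freqVol ∂freqVol := by
          rw [integral_prod_symm _ hi, ← integral_conj]
          congr 1; ext p
          rw [← integral_conj]
      _ = ∫ p, ∫ r, g (r - p, -p) ∂freqVol ∂freqVol := by
          refine integral_congr_ae ?_
          filter_upwards [hsym] with p hp
          exact integral_congr_ae (Eventually.of_forall fun r => (hp r).symm)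
      _ = ∫ p, ∫ r, g (r, -p) ∂freqVol ∂freqVol := by
          congr 1; ext p
          exact integral_sub_right_eq_self (fun r => g (r, -p)) p
      _ = ∫ p, ∫ r, g (r, p) ∂freqVol ∂freqVol :=
          integral_neg_eq_self (fun p => ∫ r, g (r, p) ∂freqVol) freqVol
      _ = _ := (integral_prod_symm _ hi).symm
  exact Complex.conj_eq_iff_im.1 h1

/-- Commutator estimate: transport by a velocity field costs no derivative in the energy. -/
lemma IsVelSpec.energy_adv_le (h : IsVelSpec t U₁ U₂ A) (hn : 1 ≤ n) (h₁ : Measurable U₁)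
    (h₂ : Measurable U₂) (hA : Measurable A) (hF : Measurable F)
    (hS : ∫⁻ p, speed U₁ U₂ p ∂freqVol < ∞) (hFn : l2 (fun p => wt n p * ‖F p‖ₑ) < ∞)
    (hFg : l2 (fun p => wt n p * (grad t p * ‖F p‖ₑ)) < ∞)
    (hAn : ∫⁻ p, wt (n + 1) p * ‖A p‖ₑ ∂freqVol < ∞) :
    Integrable (fun r => (jb r ^ n) ^ 2 * (adv t U₁ U₂ F r * (starRingEnd ℂ) (F r)).re) freqVol ∧
    |∫ r, (jb r ^ n) ^ 2 * (adv t U₁ U₂ F r * (starRingEnd ℂ) (F r)).re ∂freqVol| ≤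
      (ENNReal.ofReal (n * 2 ^ (n - 1)) * ((∫⁻ p, wt (n + 1) p * ‖A p‖ₑ ∂freqVol) *
        l2 (fun p => wt n p * ‖F p‖ₑ) ^ 2)).toReal := by
  have i1 := integrable_symmetric h₁ h₂ hF hS hFn hFg
  have hle := lintegral_commutator_le h hn h₁ h₂ hA hF
  have hfin : ENNReal.ofReal (n * 2 ^ (n - 1)) * ((∫⁻ p, wt (n + 1) p * ‖A p‖ₑ ∂freqVol) *
        l2 (fun p => wt n p * ‖F p‖ₑ) ^ 2) < ∞ :=
    ENNReal.mul_lt_top ENNReal.ofReal_lt_top (ENNReal.mul_lt_top hAn (ENNReal.pow_lt_top hFn))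
  have hm : Measurable fun z : (ℤ × ℝ) × (ℤ × ℝ) =>
      ((jb z.1 ^ n * (jb z.1 ^ n - jb (z.1 - z.2) ^ n) : ℝ) : ℂ) * advKer t U₁ U₂ F z :=
    (Complex.measurable_ofReal.comp (((measurable_jb_rpow n).comp measurable_fst).mul
      (((measurable_jb_rpow n).comp measurable_fst).sub
      ((measurable_jb_rpow n).comp (measurable_fst.sub measurable_snd))))).mul
      (measurable_advKer h₁ h₂ hF)
  have i2 : Integrable (fun z => ((jb z.1 ^ n * (jb z.1 ^ n - jb (z.1 - z.2) ^ n) : ℝ) : ℂ) *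
      advKer t U₁ U₂ F z) (freqVol.prod freqVol) :=
    ⟨hm.aestronglyMeasurable, by rw [hasFiniteIntegral_iff_enorm]; exact hle.trans_lt hfin⟩
  have i3 : Integrable (fun z => (((jb z.1 ^ n) ^ 2 : ℝ) : ℂ) * advKer t U₁ U₂ F z)
      (freqVol.prod freqVol) := by
    refine (i1.add i2).congr (Eventually.of_forall fun z => ?_)
    simp only [Pi.add_apply]; push_cast; ring
  have hker : ∀ r, ((jb r ^ n) ^ 2 * (adv t U₁ U₂ F r * (starRingEnd ℂ) (F r)).re : ℝ) =
      (∫ p, (((jb r ^ n) ^ 2 : ℝ) : ℂ) * advKer t U₁ U₂ F (r, p) ∂freqVol).im := by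
    intro r
    have e : ∫ p, (((jb r ^ n) ^ 2 : ℝ) : ℂ) * advKer t U₁ U₂ F (r, p) ∂freqVol =
        (((jb r ^ n) ^ 2 : ℝ) : ℂ) * ((∫ p, dotU t U₁ U₂ p r * F (r - p) ∂freqVol) *
          (starRingEnd ℂ) (F r)) := by
      rw [integral_const_mul, ← integral_mul_const]; rfl
    rw [e, Complex.im_ofReal_mul, adv, mul_assoc]
    congr 1
    simp
  have i4 : Integrable (fun r => ∫ p, (((jb r ^ n) ^ 2 : ℝ) : ℂ) * advKer t U₁ U₂ F (r, p) ∂freqVol)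
      freqVol := i3.integral_prod_left
  simp only [hker]
  refine ⟨i4.im, ?_⟩
  have e1 : ∫ r, (∫ p, (((jb r ^ n) ^ 2 : ℝ) : ℂ) * advKer t U₁ U₂ F (r, p) ∂freqVol).im ∂freqVol =
      (∫ r, ∫ p, (((jb r ^ n) ^ 2 : ℝ) : ℂ) * advKer t U₁ U₂ F (r, p) ∂freqVol ∂freqVol).im :=
    integral_im i4
  rw [e1, ← integral_prod _ i3]
  -- split `⟨r⟩^{2n} = ⟨r⟩ⁿ ⟨r - p⟩ⁿ + ⟨r⟩ⁿ (⟨r⟩ⁿ - ⟨r - p⟩ⁿ)`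
  have e2 : ∫ z, (((jb z.1 ^ n) ^ 2 : ℝ) : ℂ) * advKer t U₁ U₂ F z ∂(freqVol.prod freqVol) =
      ∫ z, ((jb z.1 ^ n * jb (z.1 - z.2) ^ n : ℝ) : ℂ) * advKer t U₁ U₂ F z
        ∂(freqVol.prod freqVol) +
      ∫ z, ((jb z.1 ^ n * (jb z.1 ^ n - jb (z.1 - z.2) ^ n) : ℝ) : ℂ) * advKer t U₁ U₂ F z
        ∂(freqVol.prod freqVol) := by
    rw [← integral_add i1 i2]
    congr 1; ext z; push_cast; ring
  rw [e2, Complex.add_im, im_integral_symmetric h i1, zero_add]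
  refine (Complex.abs_im_le_norm _).trans ?_
  refine (norm_integral_le_lintegral_norm _).trans (ENNReal.toReal_mono hfin.ne ?_)
  simp only [ofReal_norm]
  exact hle

end Commutator

/-! ### Sobolev bounds for the transport term -/

/-- The weighted `L²` norm `‖⟨p⟩^n G‖` on frequency space. -/
def sob (n : ℝ) (G : ℤ × ℝ → ℝ≥0∞) : ℝ≥0∞ := l2 fun p => wt n p * G p

section Sob

variable {n m : ℝ} {G H : ℤ × ℝ → ℝ≥0∞}

lemma sob_mono_ae (h : ∀ᵐ p ∂freqVol, G p ≤ H p) : sob n G ≤ sob n H :=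
  l2_mono_ae (h.mono fun _ hp => mul_le_mul_right hp _)

lemma sob_mono (h : ∀ p, G p ≤ H p) : sob n G ≤ sob n H :=
  sob_mono_ae (Eventually.of_forall h)

lemma sob_congr_ae (h : ∀ᵐ p ∂freqVol, G p = H p) : sob n G = sob n H :=
  le_antisymm (sob_mono_ae (h.mono fun _ hp => hp.le)) (sob_mono_ae (h.mono fun _ hp => hp.ge))

lemma sob_add_le (hG : Measurable G) (hH : Measurable H) :
    sob n (fun p => G p + H p) ≤ sob n G + sob n H := by
  unfold sob
  simp only [mul_add]
  exact l2_add_le ((measurable_wt n).mul hG) ((measurable_wt n).mul hH)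

lemma sob_const_mul (c : ℝ≥0∞) (hG : Measurable G) : sob n (fun p => c * G p) = c * sob n G := by
  unfold sob
  simp only [mul_left_comm _ c]
  exact l2_const_mul c ((measurable_wt n).mul hG)

lemma sob_wt_mul (n k : ℝ) (G : ℤ × ℝ → ℝ≥0∞) : sob n (fun p => wt k p * G p) = sob (n + k) G := by
  unfold sob
  simp only [← mul_assoc, wt_mul]

lemma sob_le_sob (h : n ≤ m) (G : ℤ × ℝ → ℝ≥0∞) : sob n G ≤ sob m G :=
  l2_mono fun p => mul_le_mul_left (wt_mono h p) _

lemma l2_le_sob (h : 0 ≤ n) (G : ℤ × ℝ → ℝ≥0∞) : l2 G ≤ sob n G :=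
  l2_mono fun p => le_mul_of_one_le_left zero_le (one_le_wt h p)

lemma sob_conv_le (hn : 0 ≤ n) (hG : Measurable G) (hH : Measurable H) :
    sob n (conv G H) ≤ algC n * sob n G * sob n H := l2_wt_conv_le hn hG hH

lemma sob_grad_mul_le {t : ℝ} (ht : 0 ≤ t) (n : ℝ) (hG : Measurable G) :
    sob n (fun p => grad t p * G p) ≤ ENNReal.ofReal (2 * (1 + t)) * sob (n + 1) G := by
  have hm : Measurable fun p => wt 1 p * G p := (measurable_wt 1).mul hG
  rw [← sob_wt_mul n 1 G, ← sob_const_mul _ hm]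
  refine sob_mono fun p => ?_
  rw [← mul_assoc]
  exact mul_le_mul_left (grad_le ht p) _

lemma conv_mono_ae {G' : ℤ × ℝ → ℝ≥0∞} (h : ∀ᵐ p ∂freqVol, G p ≤ G' p) (r : ℤ × ℝ) :
    conv G H r ≤ conv G' H r :=
  lintegral_mono_ae (h.mono fun _ hp => mul_le_mul_left hp _)

lemma absK_mul_conv_le (hG : Measurable G) (hH : Measurable H) (r : ℤ × ℝ) :
    absK r * conv G H r ≤
      conv (fun p => absK p * G p) H r + conv G (fun q => absK q * H q) r := by
  have hHr : Measurable fun p => H (r - p) := hH.comp (measurable_const.sub measurable_id)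
  have hKr : Measurable fun p => absK (r - p) :=
    measurable_absK.comp (measurable_const.sub measurable_id)
  have m1 : Measurable fun p => G p * H (r - p) := hG.mul hHr
  have m2 : Measurable fun p => absK p * G p * H (r - p) := (measurable_absK.mul hG).mul hHr
  unfold conv
  rw [← lintegral_const_mul _ m1, ← lintegral_add_left m2]
  refine lintegral_mono fun p => ?_
  calc absK r * (G p * H (r - p)) ≤ (absK p + absK (r - p)) * (G p * H (r - p)) :=
        mul_le_mul_left (absK_sub r p) _
    _ = _ := by ring

lemma conv_const_mul (c : ℝ≥0∞) (hG : Measurable G) (hH : Measurable H) (r : ℤ × ℝ) :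
    conv (fun p => c * G p) H r = c * conv G H r := by
  have m1 : Measurable fun p => G p * H (r - p) :=
    hG.mul (hH.comp (measurable_const.sub measurable_id))
  unfold conv
  rw [← lintegral_const_mul _ m1]
  simp only [mul_assoc]

end Sob

/-- The nonzero modes. -/
def neMode (U : ℤ × ℝ → ℂ) (p : ℤ × ℝ) : ℂ := if p.1 = 0 then 0 else U p

/-- The `x`-derivative, up to the factor `i`. -/
def mulK (U : ℤ × ℝ → ℂ) (p : ℤ × ℝ) : ℂ := p.1 * U p

lemma measurable_neMode {U : ℤ × ℝ → ℂ} (hU : Measurable U) : Measurable (neMode U) :=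
  Measurable.ite (measurable_fst (measurableSet_singleton 0)) measurable_const hU

lemma measurable_mulK {U : ℤ × ℝ → ℂ} (hU : Measurable U) : Measurable (mulK U) :=
  ((measurable_from_top (f := fun k : ℤ => (k : ℂ))).comp measurable_fst).mul hU

lemma enorm_mulK (U : ℤ × ℝ → ℂ) (p : ℤ × ℝ) : ‖mulK U p‖ₑ = absK p * ‖U p‖ₑ := by
  rw [mulK, enorm_mul, absK, ← ofReal_norm (p.1 : ℂ), Complex.norm_intCast]

lemma speed_mulK (U₁ U₂ : ℤ × ℝ → ℂ) (p : ℤ × ℝ) :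
    speed (mulK U₁) (mulK U₂) p = absK p * speed U₁ U₂ p := by
  rw [speed, enorm_mulK, enorm_mulK, speed, mul_add]

lemma speed_neMode_le (U₁ U₂ : ℤ × ℝ → ℂ) (p : ℤ × ℝ) :
    speed (neMode U₁) (neMode U₂) p ≤ speed U₁ U₂ p := by
  unfold speed neMode
  split_ifs <;> simp

section Adv

variable {t : ℝ} {U₁ U₂ A F : ℤ × ℝ → ℂ}

/-- The bound used when the transported function is smoother than the energy norm. -/
lemma IsVelSpec.enorm_adv_le_conv_grad (h : IsVelSpec t U₁ U₂ A) (r : ℤ × ℝ) :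
    ‖adv t U₁ U₂ F r‖ₑ ≤ conv (speed U₁ U₂) (fun q => grad t q * ‖F q‖ₑ) r := by
  refine (enorm_adv_le t U₁ U₂ F r).trans (lintegral_mono_ae ?_)
  filter_upwards [h.dotU_sub] with p hp
  rw [hp r]
  calc _ ≤ grad t (r - p) * speed U₁ U₂ p * ‖F (r - p)‖ₑ :=
        mul_le_mul_left (enorm_dotU_le _ _ _ _ _) _
    _ = _ := by ring

lemma dotU_neMode (t : ℝ) (U₁ U₂ : ℤ × ℝ → ℂ) (p q : ℤ × ℝ) :
    dotU t (neMode U₁) (neMode U₂) p q = if p.1 = 0 then 0 else dotU t U₁ U₂ p q := by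
  unfold dotU neMode; split_ifs <;> simp

lemma enorm_nm_le {c : ℝ} {z : ℂ} {x : ℝ} (hx : 0 ≤ x) {q : ℤ × ℝ} (h : ‖z‖ ≤ c * x * nm q)
    (hc : 0 ≤ c) : ‖z‖ₑ ≤ ENNReal.ofReal c * ENNReal.ofReal x * wt 1 q := by
  rw [wt_one, ← ENNReal.ofReal_mul hc, ← ENNReal.ofReal_mul (mul_nonneg hc hx), ← ofReal_norm]
  refine ENNReal.ofReal_le_ofReal (h.trans ?_)
  exact mul_le_mul_of_nonneg_left (nm_le_jb q) (mul_nonneg hc hx)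

/-- Transport by the nonzero modes of a velocity decays at the integrable rate `(1 + t)^{-2}`. -/
lemma IsVelSpec.enorm_adv_neMode_le_decay (h : IsVelSpec t U₁ U₂ A) (ht : 0 ≤ t)
    (hA : Measurable A) (hF : Measurable F) (r : ℤ × ℝ) :
    ‖adv t (neMode U₁) (neMode U₂) F r‖ₑ ≤ ENNReal.ofReal (6 / (1 + t) ^ 2) *
      conv (fun p => wt 3 p * ‖A p‖ₑ) (fun q => wt 1 q * ‖F q‖ₑ) r := by
  rw [← conv_const_mul _ (measurable_wt_mul_enorm 3 hA) (measurable_wt_mul_enorm 1 hF)]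
  refine (enorm_adv_le t _ _ F r).trans (lintegral_mono_ae ?_)
  filter_upwards [h.dotU_sub, h.dotU_le_decay ht] with p h1 h2
  rw [dotU_neMode]
  split_ifs with hk
  · simp
  · have h3 := enorm_nm_le (by have := jb_pos p; positivity) (h2 hk (r - p)) (by positivity)
    rw [← h1 r, ENNReal.ofReal_mul (by have := jb_pos p; positivity), ofReal_norm] at h3
    have e : ENNReal.ofReal (jb p ^ 3) = wt 3 p := by
      rw [wt]; congr 1; exact_mod_cast (Real.rpow_natCast (jb p) 3).symm
    rw [e] at h3
    calc _ ≤ ENNReal.ofReal (6 / (1 + t) ^ 2) * (wt 3 p * ‖A p‖ₑ) * wt 1 (r - p) * ‖F (r - p)‖ₑ :=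
          mul_le_mul_left h3 _
      _ = _ := by ring

/-- A bound for transport by the nonzero modes without decay, which costs only one derivative of the
vorticity. -/
lemma IsVelSpec.enorm_adv_neMode_le (h : IsVelSpec t U₁ U₂ A) (r : ℤ × ℝ) :
    ‖adv t (neMode U₁) (neMode U₂) F r‖ₑ ≤
      conv (fun p => wt 1 p * ‖A p‖ₑ) (fun q => wt 1 q * ‖F q‖ₑ) r := by
  refine (enorm_adv_le t _ _ F r).trans (lintegral_mono_ae ?_)
  filter_upwards [h.dotU_sub, h.dotU_le] with p h1 h2
  rw [dotU_neMode]
  split_ifs with hk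
  · simp
  · have h4 : ‖dotU t U₁ U₂ p (r - p)‖ ≤ 1 * (jb p * ‖A p‖) * nm (r - p) := by
      refine (h2 hk (r - p)).trans ?_
      have := nm_le_jb p
      have := nm_nonneg (r - p)
      rw [one_mul, mul_comm (jb p)]
      gcongr
    have h3 := enorm_nm_le (by have := jb_pos p; positivity) h4 zero_le_one
    rw [← h1 r, ENNReal.ofReal_mul (jb_pos p).le, ofReal_norm, ENNReal.ofReal_one, one_mul,
      ← wt_one] at h3
    calc _ ≤ wt 1 p * ‖A p‖ₑ * wt 1 (r - p) * ‖F (r - p)‖ₑ := mul_le_mul_left h3 _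
      _ = _ := by ring

lemma integrable_mul_sub {U F : ℤ × ℝ → ℂ} (hU : Measurable U) (hF : Measurable F)
    (hU2 : l2 (fun p => ‖U p‖ₑ) < ∞) (hF2 : l2 (fun p => ‖F p‖ₑ) < ∞) (r : ℤ × ℝ) :
    Integrable (fun p => U p * F (r - p)) freqVol := by
  have hFr : Measurable fun p => F (r - p) := hF.comp (measurable_const.sub measurable_id)
  refine ⟨(hU.mul hFr).aestronglyMeasurable, ?_⟩
  rw [hasFiniteIntegral_iff_enorm]
  simp only [enorm_mul]
  refine (lintegral_mul_le_l2 hU.enorm hFr.enorm).trans_lt (ENNReal.mul_lt_top hU2 ?_)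
  have e : l2 (fun p => ‖F (r - p)‖ₑ) = l2 (fun p => ‖F p‖ₑ) := by
    unfold l2
    rw [lintegral_sub_left_eq_self (fun p => ‖F p‖ₑ ^ 2) r]
  rwa [e]

lemma integrable_dotU_mul (h₁ : Measurable U₁) (h₂ : Measurable U₂) (hF : Measurable F)
    (h₁' : l2 (fun p => ‖U₁ p‖ₑ) < ∞) (h₂' : l2 (fun p => ‖U₂ p‖ₑ) < ∞)
    (hF' : l2 (fun p => ‖F p‖ₑ) < ∞) (r : ℤ × ℝ) :
    Integrable (fun p => dotU t U₁ U₂ p r * F (r - p)) freqVol := by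
  refine (((integrable_mul_sub h₁ hF h₁' hF' r).const_mul (r.1 : ℂ)).add
    ((integrable_mul_sub h₂ hF h₂' hF' r).const_mul (xi t r : ℂ))).congr
      (Eventually.of_forall fun p => ?_)
  simp only [Pi.add_apply, dotU]; ring

/-- The Leibniz rule for `∂_x (u · ∇f)`. -/
lemma fst_mul_adv (h₁ : Measurable U₁) (h₂ : Measurable U₂) (hF : Measurable F)
    (h₁' : l2 (fun p => ‖U₁ p‖ₑ) < ∞) (h₂' : l2 (fun p => ‖U₂ p‖ₑ) < ∞)
    (h₁k : l2 (fun p => ‖mulK U₁ p‖ₑ) < ∞) (h₂k : l2 (fun p => ‖mulK U₂ p‖ₑ) < ∞)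
    (hF' : l2 (fun p => ‖F p‖ₑ) < ∞) (hFk : l2 (fun p => ‖mulK F p‖ₑ) < ∞) (r : ℤ × ℝ) :
    r.1 * adv t U₁ U₂ F r = adv t U₁ U₂ (mulK F) r + adv t (mulK U₁) (mulK U₂) F r := by
  have i1 := integrable_dotU_mul (t := t) h₁ h₂ (measurable_mulK hF) h₁' h₂' hFk r
  have i2 := integrable_dotU_mul (t := t) (measurable_mulK h₁) (measurable_mulK h₂) hF h₁k h₂k hF' r
  unfold adv
  rw [← mul_add, ← integral_add i1 i2, mul_left_comm, ← integral_const_mul]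
  congr 1
  refine integral_congr_ae (Eventually.of_forall fun p => ?_)
  simp only [dotU, mulK, Prod.fst_sub]
  push_cast; ring

end Adv

/-! ### The energy inequality at a fixed time -/

lemma sob_eq_sqrt {n : ℝ} {G : ℤ × ℝ → ℝ≥0∞} {g : ℤ × ℝ → ℝ} (h : ∀ r, (wt n r * G r) ^ 2 =
    ENNReal.ofReal (g r)) (hg : ∀ r, 0 ≤ g r) (hi : Integrable g freqVol) :
    sob n G = ENNReal.ofReal (Real.sqrt (∫ r, g r ∂freqVol)) := by
  have h0 : 0 ≤ ∫ r, g r ∂freqVol := integral_nonneg hg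
  unfold sob l2
  simp only [h]
  rw [← ofReal_integral_eq_lintegral_ofReal hi (Eventually.of_forall hg),
    ENNReal.ofReal_rpow_of_nonneg h0 (by norm_num), Real.sqrt_eq_rpow]

lemma sob_enorm_eq {n : ℝ} {W : ℤ × ℝ → ℂ}
    (hi : Integrable (fun r => (jb r ^ n) ^ 2 * ‖W r‖ ^ 2) freqVol) :
    sob n (fun p => ‖W p‖ₑ) =
      ENNReal.ofReal (Real.sqrt (∫ r, (jb r ^ n) ^ 2 * ‖W r‖ ^ 2 ∂freqVol)) := by
  refine sob_eq_sqrt (fun r => ?_) (fun r => by positivity) hi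
  have := jb_pos r
  rw [wt, ← ofReal_norm, ← ENNReal.ofReal_mul (by positivity),
    ← ENNReal.ofReal_pow (by positivity), mul_pow]

lemma sob_grad_eq {n s : ℝ} {W : ℤ × ℝ → ℂ}
    (hi : Integrable (fun r => (jb r ^ n) ^ 2 * (lapSym s r * ‖W r‖ ^ 2)) freqVol) :
    sob n (fun p => grad s p * ‖W p‖ₑ) =
      ENNReal.ofReal (Real.sqrt (∫ r, (jb r ^ n) ^ 2 * (lapSym s r * ‖W r‖ ^ 2) ∂freqVol)) := by
  have h0 := lapSym_nonneg s
  refine sob_eq_sqrt (fun r => ?_) (fun r => mul_nonneg (sq_nonneg _)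
    (mul_nonneg (h0 r) (sq_nonneg _))) hi
  have := jb_pos r
  have h2 : Real.sqrt (lapSym s r) ^ 2 = lapSym s r := Real.sq_sqrt (h0 r)
  rw [wt, grad, ← ofReal_norm, ← ENNReal.ofReal_mul (Real.sqrt_nonneg _),
    ← ENNReal.ofReal_mul (by positivity), ← ENNReal.ofReal_pow (by positivity), mul_pow, mul_pow, h2]

/-- The work of the source on the energy: `N` is the part treated by cancellation, `X` a part
estimated directly, and `∇ · Y` a part absorbed in the dissipation. -/
lemma integral_re_le {n s ν a b c e : ℝ} (hν : 0 < ν) (ha0 : 0 ≤ a) (hb0 : 0 ≤ b) (he0 : 0 ≤ e)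
    {W B N : ℤ × ℝ → ℂ} {X Y : ℤ × ℝ → ℝ≥0∞} (hW : Measurable W) (hX : Measurable X)
    (hY : Measurable Y)
    (hi : Integrable (fun r => (jb r ^ n) ^ 2 * (lapSym s r * ‖W r‖ ^ 2)) freqVol)
    (hBW : Integrable (fun r => (jb r ^ n) ^ 2 * (B r * (starRingEnd ℂ) (W r)).re) freqVol)
    (hNW : Integrable (fun r => (jb r ^ n) ^ 2 * (N r * (starRingEnd ℂ) (W r)).re) freqVol)
    (hc : ∫ r, (jb r ^ n) ^ 2 * (N r * (starRingEnd ℂ) (W r)).re ∂freqVol ≤ c)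
    (hR : ∀ r, ‖B r - N r‖ₑ ≤ X r + grad s r * Y r)
    (hb : sob n X ≤ ENNReal.ofReal b) (ha : sob n Y ≤ ENNReal.ofReal a)
    (he : sob n (fun p => ‖W p‖ₑ) ≤ ENNReal.ofReal e) :
    ∫ r, (jb r ^ n) ^ 2 * (B r * (starRingEnd ℂ) (W r)).re ∂freqVol ≤
      c + b * e + a ^ 2 / (4 * ν) + ν * ∫ r, (jb r ^ n) ^ 2 * (lapSym s r * ‖W r‖ ^ 2) ∂freqVol := by
  set D := ∫ r, (jb r ^ n) ^ 2 * (lapSym s r * ‖W r‖ ^ 2) ∂freqVol with hD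
  have hD0 : 0 ≤ D := integral_nonneg fun r =>
    mul_nonneg (sq_nonneg _) (mul_nonneg (lapSym_nonneg s r) (sq_nonneg _))
  have hw := measurable_wt n
  have hle : ∫⁻ r, ENNReal.ofReal ‖(jb r ^ n) ^ 2 * (B r * (starRingEnd ℂ) (W r)).re -
      (jb r ^ n) ^ 2 * (N r * (starRingEnd ℂ) (W r)).re‖ ∂freqVol ≤
      ENNReal.ofReal (b * e + a * Real.sqrt D) := by
    have hpt : ∀ r, ENNReal.ofReal ‖(jb r ^ n) ^ 2 * (B r * (starRingEnd ℂ) (W r)).re -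
        (jb r ^ n) ^ 2 * (N r * (starRingEnd ℂ) (W r)).re‖ ≤
        (wt n r * X r) * (wt n r * ‖W r‖ₑ) + (wt n r * Y r) * (wt n r * (grad s r * ‖W r‖ₑ)) := by
      intro r
      have hj := jb_pos r
      rw [← mul_sub, ← Complex.sub_re, ← sub_mul, norm_mul, Real.norm_of_nonneg (by positivity)]
      have h1 : ‖((B r - N r) * (starRingEnd ℂ) (W r)).re‖ ≤ ‖B r - N r‖ * ‖W r‖ := by
        refine (Complex.abs_re_le_norm _).trans ?_
        rw [norm_mul, RCLike.norm_conj]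
      calc _ ≤ ENNReal.ofReal ((jb r ^ n) ^ 2 * (‖B r - N r‖ * ‖W r‖)) := by gcongr
        _ = wt n r ^ 2 * (‖B r - N r‖ₑ * ‖W r‖ₑ) := by
          rw [ENNReal.ofReal_mul (by positivity), ENNReal.ofReal_mul (norm_nonneg _), ofReal_norm,
            ofReal_norm, ENNReal.ofReal_pow (by positivity), wt]
        _ ≤ wt n r ^ 2 * ((X r + grad s r * Y r) * ‖W r‖ₑ) := by gcongr; exact hR r
        _ = _ := by ring
    have m1 : Measurable fun r => (wt n r * X r) * (wt n r * ‖W r‖ₑ) :=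
      (hw.mul hX).mul (hw.mul hW.enorm)
    refine (lintegral_mono hpt).trans ?_
    rw [lintegral_add_left m1, ENNReal.ofReal_add (by positivity) (by positivity),
      ENNReal.ofReal_mul hb0, ENNReal.ofReal_mul ha0, ← sob_grad_eq hi]
    refine add_le_add ?_ ?_
    · exact (lintegral_mul_le_l2 (hw.mul hX) (hw.mul hW.enorm)).trans (mul_le_mul' hb he)
    · exact (lintegral_mul_le_l2 (hw.mul hY) (hw.mul ((measurable_grad s).mul hW.enorm))).trans
        (mul_le_mul' ha le_rfl)
  have h2 : ∫ r, (jb r ^ n) ^ 2 * (B r * (starRingEnd ℂ) (W r)).re ∂freqVol -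
      ∫ r, (jb r ^ n) ^ 2 * (N r * (starRingEnd ℂ) (W r)).re ∂freqVol ≤ b * e + a * Real.sqrt D := by
    rw [← integral_sub hBW hNW]
    refine (Real.le_norm_self _).trans ((norm_integral_le_lintegral_norm _).trans ?_)
    exact ENNReal.toReal_le_of_le_ofReal (by positivity) hle
  -- Young's inequality moves the square root into the dissipation
  have h3 : a * Real.sqrt D ≤ a ^ 2 / (4 * ν) + ν * D := by
    have h4 := Real.sq_sqrt hD0
    have h5 : 0 ≤ (a - 2 * ν * Real.sqrt D) ^ 2 / (4 * ν) := by positivity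
    have h6 : (a - 2 * ν * Real.sqrt D) ^ 2 / (4 * ν) =
        a ^ 2 / (4 * ν) - a * Real.sqrt D + ν * Real.sqrt D ^ 2 := by field_simp; ring
    rw [h6, h4] at h5
    linarith
  linarith

/-! ### The velocity at low frequencies -/

/-- The frequencies at which the velocity is not controlled by the vorticity. -/
def lowFreq : Set (ℤ × ℝ) := {p | p.1 = 0 ∧ |2 * Real.pi * p.2| < 1}

lemma measurableSet_lowFreq : MeasurableSet lowFreq := by
  have h1 : MeasurableSet {p : ℤ × ℝ | p.1 = 0} := measurable_fst (measurableSet_singleton 0)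
  have h2 : Measurable fun p : ℤ × ℝ => |2 * Real.pi * p.2| :=
    (measurable_snd.const_mul _).abs
  exact h1.inter (measurableSet_lt h2 measurable_const)

lemma freqVol_lowFreq_le : freqVol lowFreq ≤ 1 := by
  have e : lowFreq = {0} ×ˢ {ζ : ℝ | |2 * Real.pi * ζ| < 1} := by
    ext p; simp [lowFreq]
  have hpi := Real.pi_gt_three
  have h2 : {ζ : ℝ | |2 * Real.pi * ζ| < 1} ⊆ Icc (-(1 / 2)) (1 / 2) := by
    intro ζ hζ
    have h1 : |2 * Real.pi * ζ| < 1 := hζ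
    rw [abs_mul, abs_of_pos Real.two_pi_pos] at h1
    have h3 : |ζ| ≤ 1 / 2 := by nlinarith [abs_nonneg ζ]
    exact abs_le.1 h3
  rw [e, freqVol, Measure.prod_prod, Measure.count_singleton, one_mul]
  refine (measure_mono h2).trans ?_
  rw [Real.volume_Icc]; norm_num

section LowFreq

variable {t n : ℝ} {U₁ U₂ A F : ℤ × ℝ → ℂ}

lemma wt_le_of_mem_lowFreq (hn : 0 ≤ n) {p : ℤ × ℝ} (hp : p ∈ lowFreq) :
    wt n p ≤ ENNReal.ofReal (2 ^ n) := by
  refine ENNReal.ofReal_le_ofReal (Real.rpow_le_rpow (jb_pos p).le ?_ hn)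
  have h1 := jb_sq p
  rw [hp.1] at h1
  have h2 := sq_lt_one_iff_abs_lt_one (2 * Real.pi * p.2) |>.2 hp.2
  have h3 := jb_pos p
  simp only [Int.cast_zero] at h1
  nlinarith

lemma one_le_lapSym_of_notMem {p : ℤ × ℝ} (hp : p ∉ lowFreq) : 1 ≤ lapSym t p := by
  by_cases hk : p.1 = 0
  · have h1 : ¬ |2 * Real.pi * p.2| < 1 := fun h => hp ⟨hk, h⟩
    rw [← sq_lt_one_iff_abs_lt_one] at h1
    unfold lapSym xi
    rw [hk]
    simp only [Int.cast_zero]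
    nlinarith
  · exact one_le_lapSym hk

lemma xi_ne_zero {p : ℤ × ℝ} (hk : p.1 = 0) (hp : p.2 ≠ 0) : xi t p ≠ 0 := by
  have := Real.pi_pos.ne'
  simp [xi, hk, hp, this]

/-- Away from low frequencies the velocity is smoother than the vorticity. -/
lemma IsVelSpec.sob_speed_le (h : IsVelSpec t U₁ U₂ A) (hn : 0 ≤ n) (h₁ : Measurable U₁)
    (hA : Measurable A) : sob n (speed U₁ U₂) ≤ 2 * sob n (fun p => ‖A p‖ₑ) +
      ENNReal.ofReal (2 ^ n) * l2 (lowFreq.indicator fun p => ‖U₁ p‖ₑ) := by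
  have m1 : Measurable fun p => 2 * ‖A p‖ₑ := hA.enorm.const_mul 2
  have m2 : Measurable (lowFreq.indicator fun p => ‖U₁ p‖ₑ) :=
    h₁.enorm.indicator measurableSet_lowFreq
  rw [← sob_const_mul _ hA.enorm, ← l2_const_mul _ m2]
  refine le_trans ?_ (l2_add_le ((measurable_wt n).mul m1) (m2.const_mul _))
  refine l2_mono_ae ?_
  filter_upwards [h.speed_le, h.div_free, ae_snd_ne_zero] with p h1 h2 h3
  by_cases hp : p ∈ lowFreq
  · rw [hp.1] at h2
    simp only [Int.cast_zero, zero_mul, zero_add] at h2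
    have h4 : U₂ p = 0 := (mul_eq_zero.1 h2).resolve_left (by exact_mod_cast xi_ne_zero hp.1 h3)
    rw [indicator_of_mem hp, speed, h4, enorm_zero, add_zero]
    refine le_add_left ?_
    gcongr
    exact wt_le_of_mem_lowFreq hn hp
  · refine le_add_right ?_
    gcongr
    exact h1 (one_le_lapSym_of_notMem hp)

/-- `lowFreq` has measure at most `1`. -/
lemma l2_indicator_le {M : ℝ≥0∞} (h : ∀ᵐ p ∂freqVol, p ∈ lowFreq → ‖U₁ p‖ₑ ≤ M) :
    l2 (lowFreq.indicator fun p => ‖U₁ p‖ₑ) ≤ M := by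
  have h1 : l2 (lowFreq.indicator fun p => ‖U₁ p‖ₑ) ≤ l2 (lowFreq.indicator fun _ => M) := by
    refine l2_mono_ae ?_
    filter_upwards [h] with p hp
    by_cases hl : p ∈ lowFreq
    · rw [indicator_of_mem hl, indicator_of_mem hl]; exact hp hl
    · rw [indicator_of_notMem hl]; exact zero_le
  refine h1.trans ?_
  have e : ∀ p, (lowFreq.indicator (fun _ => M) p) ^ 2 = lowFreq.indicator (fun _ => M ^ 2) p := by
    intro p
    by_cases hl : p ∈ lowFreq
    · rw [indicator_of_mem hl, indicator_of_mem hl]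
    · rw [indicator_of_notMem hl, indicator_of_notMem hl]; norm_num
  unfold l2
  simp only [e]
  rw [lintegral_indicator_const measurableSet_lowFreq]
  calc (M ^ 2 * freqVol lowFreq) ^ (1 / 2 : ℝ) ≤ (M ^ 2 * 1) ^ (1 / 2 : ℝ) := by
        gcongr; exact freqVol_lowFreq_le
    _ = M := by rw [mul_one, ← ENNReal.rpow_natCast, ← ENNReal.rpow_mul]; norm_num

/-- The zero mode of the transport term is a `y`-derivative. -/
lemma enorm_adv_le_of_fst_eq_zero (h₂ : Measurable U₂) (hF : Measurable F) {r : ℤ × ℝ}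
    (hr : r.1 = 0) : ‖adv t U₁ U₂ F r‖ₑ ≤
      ENNReal.ofReal |xi t r| * (l2 (fun p => ‖U₂ p‖ₑ) * l2 (fun p => ‖F p‖ₑ)) := by
  have hFr : Measurable fun p => F (r - p) := hF.comp (measurable_const.sub measurable_id)
  have e : l2 (fun p => ‖F (r - p)‖ₑ) = l2 (fun p => ‖F p‖ₑ) := by
    unfold l2
    rw [lintegral_sub_left_eq_self (fun p => ‖F p‖ₑ ^ 2) r]
  refine (enorm_adv_le t U₁ U₂ F r).trans ?_
  have h1 : ∀ p, ‖dotU t U₁ U₂ p r‖ₑ * ‖F (r - p)‖ₑ =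
      ENNReal.ofReal |xi t r| * (‖U₂ p‖ₑ * ‖F (r - p)‖ₑ) := fun p => by
    rw [dotU, hr, Int.cast_zero, zero_mul, zero_add, enorm_mul, enorm_ofReal, ← ofReal_norm (xi t r),
      Real.norm_eq_abs, mul_assoc]
  simp only [h1]
  have m1 : Measurable fun p => ‖U₂ p‖ₑ * ‖F (r - p)‖ₑ := h₂.enorm.mul hFr.enorm
  rw [lintegral_const_mul _ m1, ← e]
  gcongr
  exact lintegral_mul_le_l2 h₂.enorm hFr.enorm

end LowFreq

/-- Without the dissipation the amplitude is at most the time integral of the source. -/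
lemma IsEvol.norm_le {ν T b : ℝ} {W B : ℝ → ℤ × ℝ → ℂ} {h : ℝ → ℤ × ℝ → ℝ} (hE : IsEvol ν T W B h)
    (hν : 0 ≤ ν) {t : ℝ} (ht : 0 ≤ t) {r : ℤ × ℝ} (hb : ∀ s ∈ Icc 0 t, ‖B s r‖ ≤ b) :
    ‖W t r‖ ≤ b * t := by
  have hb0 : 0 ≤ b := (norm_nonneg _).trans (hb 0 ⟨le_rfl, ht⟩)
  have hd : ∀ s, HasDerivAt (fun s => (Real.exp (damp ν s r) : ℂ) * W s r)
      ((Real.exp (damp ν s r) : ℂ) * B s r) s := by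
    intro s
    have h1 : HasDerivAt (fun s => (Real.exp (damp ν s r) : ℂ))
        ((Real.exp (damp ν s r) * (ν * lapSym s r) : ℝ) : ℂ) s :=
      (hasDerivAt_damp ν s r).exp.ofReal_comp
    refine (h1.mul (hE.hasDeriv s r)).congr_deriv ?_
    push_cast; ring
  have h2 := norm_image_sub_le_of_norm_deriv_le_segment' (C := Real.exp (damp ν t r) * b)
    (fun s (_ : s ∈ Icc 0 t) => (hd s).hasDerivWithinAt) (fun s hs => by
      rw [norm_mul, Complex.norm_real, Real.norm_of_nonneg (Real.exp_pos _).le]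
      gcongr
      · exact monotone_damp hν r hs.2.le
      · exact hb s (Ico_subset_Icc_self hs)) t ⟨ht, le_rfl⟩
  rw [hE.init, mul_zero, sub_zero, sub_zero, norm_mul, Complex.norm_real,
    Real.norm_of_nonneg (Real.exp_pos _).le, mul_assoc] at h2
  exact le_of_mul_le_mul_left h2 (Real.exp_pos _)

/-! ### The error system on the Fourier side -/

/-- The convolution of two spectra: the spectrum of a product. -/
def specMul (U F : ℤ × ℝ → ℂ) (r : ℤ × ℝ) : ℂ := ∫ p, U p * F (r - p) ∂freqVol

lemma ae_sub_left {P : ℤ × ℝ → Prop} (h : ∀ᵐ p ∂freqVol, P p) (r : ℤ × ℝ) :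
    ∀ᵐ p ∂freqVol, P (r - p) :=
  (Measure.measurePreserving_sub_left freqVol r).quasiMeasurePreserving.ae h

lemma specMul_congr {U U' F F' : ℤ × ℝ → ℂ} (hU : U =ᵐ[freqVol] U') (hF : F =ᵐ[freqVol] F')
    (r : ℤ × ℝ) : specMul U F r = specMul U' F' r := by
  refine integral_congr_ae ?_
  filter_upwards [hU, ae_sub_left hF r] with p h1 h2
  rw [h1, h2]

lemma enorm_specMul_add_le {U₁ U₂ F : ℤ × ℝ → ℂ} (h₁ : Measurable U₁) (hF : Measurable F)
    (r : ℤ × ℝ) : ‖specMul U₁ F r‖ₑ + ‖specMul U₂ F r‖ₑ ≤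
      conv (speed U₁ U₂) (fun p => ‖F p‖ₑ) r := by
  have hFr : Measurable fun p => F (r - p) := hF.comp (measurable_const.sub measurable_id)
  have m1 : Measurable fun p => ‖U₁ p‖ₑ * ‖F (r - p)‖ₑ := h₁.enorm.mul hFr.enorm
  unfold conv speed
  simp only [add_mul]
  rw [lintegral_add_left m1]
  refine add_le_add ?_ ?_
  · exact (enorm_integral_le_lintegral_enorm _).trans (le_of_eq (by simp only [enorm_mul]))
  · exact (enorm_integral_le_lintegral_enorm _).trans (le_of_eq (by simp only [enorm_mul]))

lemma adv_eq_specMul {t : ℝ} {U₁ U₂ F : ℤ × ℝ → ℂ} (h₁ : Measurable U₁) (h₂ : Measurable U₂)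
    (hF : Measurable F) (h₁' : l2 (fun p => ‖U₁ p‖ₑ) < ∞) (h₂' : l2 (fun p => ‖U₂ p‖ₑ) < ∞)
    (hF' : l2 (fun p => ‖F p‖ₑ) < ∞) (r : ℤ × ℝ) :
    adv t U₁ U₂ F r = -Complex.I * (r.1 * specMul U₁ F r + xi t r * specMul U₂ F r) := by
  unfold adv specMul
  rw [← integral_const_mul (r.1 : ℂ), ← integral_const_mul (xi t r : ℂ), ← integral_add
    ((integrable_mul_sub h₁ hF h₁' hF' r).const_mul _)
    ((integrable_mul_sub h₂ hF h₂' hF' r).const_mul _)]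
  congr 1
  refine integral_congr_ae (Eventually.of_forall fun p => ?_)
  simp only [dotU]; ring

lemma l2_sp_lt_top {f : Field} (hf : MemLp f 2 (volume : Measure Cyl)) (t : ℝ) :
    l2 (fun p => ‖sp f t p‖ₑ) < ∞ := by
  unfold l2
  refine ENNReal.rpow_lt_top_of_nonneg (by norm_num) (ne_of_lt ?_)
  have h := (memLp_sp hf t).2
  rw [eLpNorm_lt_top_iff_lintegral_rpow_enorm_lt_top (by norm_num) (by norm_num)] at h
  simpa using h

section Amplitude

variable {ν T : ℝ} {f h J₁ J₂ : ℝ → Field} {Wh : ℝ → ℤ × ℝ → ℂ}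

/-- The size of the fluxes, extended to all times by its values at the end points. -/
def fluxSize (hT : 0 ≤ T) (J₁ J₂ : ℝ → Field) (Wh : ℝ → ℤ × ℝ → ℂ) (s : ℝ) (r : ℤ × ℝ) : ℝ :=
  ‖spec1 (J₁ (projIcc 0 T hT s)) (projIcc 0 T hT s) r‖ +
  ‖spec1 (J₂ (projIcc 0 T hT s)) (projIcc 0 T hT s) r‖ + ‖Wh (projIcc 0 T hT s) r‖

lemma fluxSize_of_mem (hT : 0 ≤ T) {s : ℝ} (hs : s ∈ Icc 0 T) (r : ℤ × ℝ) :
    fluxSize hT J₁ J₂ Wh s r = ‖spec1 (J₁ s) s r‖ + ‖spec1 (J₂ s) s r‖ + ‖Wh s r‖ := by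
  rw [fluxSize, projIcc_of_mem hT hs]

lemma continuous_clamp {E : Type*} [TopologicalSpace E] (hT : 0 ≤ T) {G : ℝ → ℤ × ℝ → E}
    {k : ℤ} (hG : ContinuousOn (fun x : ℝ × ℝ => G x.1 (k, x.2)) (Icc 0 T ×ˢ univ)) :
    Continuous fun x : ℝ × ℝ => G (projIcc 0 T hT x.1) (k, x.2) := by
  have h1 : ContinuousOn (fun x : ℝ × ℝ => G (projIcc 0 T hT x.1) (k, x.2)) univ := by
    refine hG.comp (f := fun x : ℝ × ℝ => ((projIcc 0 T hT x.1 : ℝ), x.2)) ?_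
      fun x _ => ⟨Subtype.coe_prop _, mem_univ _⟩
    exact ((continuous_subtype_val.comp (continuous_projIcc.comp continuous_fst)).prodMk
      continuous_snd).continuousOn
  exact continuousOn_univ.1 h1

lemma norm_specSrc_le (s : ℝ) (r : ℤ × ℝ) : ‖specSrc J₁ J₂ Wh s r‖ ≤
    Real.sqrt (lapSym s r) * (‖spec1 (J₁ s) s r‖ + ‖spec1 (J₂ s) s r‖ + ‖Wh s r‖) := by
  unfold specSrc
  refine (norm_add_le _ _).trans ?_
  rw [mul_add (Real.sqrt _), norm_mul, norm_mul, norm_mul, norm_neg, Complex.norm_I, one_mul,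
    one_mul, Complex.norm_intCast]
  refine add_le_add ?_ (mul_le_mul_of_nonneg_right (abs_fst_le_sqrt s r) (norm_nonneg _))
  refine (norm_add_le _ _).trans ?_
  rw [mul_add, norm_mul, norm_mul, Complex.norm_intCast, Complex.norm_real, Real.norm_eq_abs]
  exact add_le_add (mul_le_mul_of_nonneg_right (abs_fst_le_sqrt s r) (norm_nonneg _))
    (mul_le_mul_of_nonneg_right (abs_xi_le_sqrt s r) (norm_nonneg _))

/-- The Duhamel spectrum of a weak solution evolves by an ordinary differential equation at each
frequency. -/
lemma IsTransport.isEvol (hs : IsTransport ν T f h J₁ J₂) (hh : HasAmp T h Wh) (hT : 0 ≤ T) :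
    IsEvol ν T (duhamel ν (clampSrc hT J₁ J₂ Wh)) (clampSrc hT J₁ J₂ Wh)
      (fluxSize hT J₁ J₂ Wh) where
  contW k := continuous_duhamel (continuous_clampSrc hT hs hh k) ν
  contB := continuous_clampSrc hT hs hh
  conth k := by
    refine continuous_clamp hT
      (G := fun s r => ‖spec1 (J₁ s) s r‖ + ‖spec1 (J₂ s) s r‖ + ‖Wh s r‖) ?_
    exact ((continuousOn_spec1 hs.cont_J₁ k).norm.add (continuousOn_spec1 hs.cont_J₂ k).norm).add
      (hh.cont k).norm
  hasDeriv t r := hasDerivAt_duhamel (IsEvol.cont_fst (F := clampSrc hT J₁ J₂ Wh)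
    (continuous_clampSrc hT hs hh) r) ν t
  init := duhamel_zero ν _
  bound s hs r := by
    rw [clampSrc_of_mem hT hs, fluxSize_of_mem hT hs]
    exact norm_specSrc_le s r

end Amplitude

/-- The error system on the Fourier side, in the frame moving with the shear flow: `A`, `Θ` and
`(U₁, U₂)` are the spectra of the ideal vorticity, temperature and velocity, and `W`, `F` and
`(V₁, V₂)` those of the errors. The sources `Bω`, `Bθ` are divergences of fluxes of size `hω`, `hθ`. -/
structure IsErrorSpec (ν n T : ℝ) (A Θ U₁ U₂ W F V₁ V₂ Bω Bθ : ℝ → ℤ × ℝ → ℂ)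
    (hω hθ : ℝ → ℤ × ℝ → ℝ) : Prop where
  meas_A : ∀ s, Measurable (A s)
  meas_Θ : ∀ s, Measurable (Θ s)
  meas_U₁ : ∀ s, Measurable (U₁ s)
  meas_U₂ : ∀ s, Measurable (U₂ s)
  meas_V₁ : ∀ s, Measurable (V₁ s)
  meas_V₂ : ∀ s, Measurable (V₂ s)
  velU : ∀ s ∈ Icc 0 T, IsVelSpec s (U₁ s) (U₂ s) (A s)
  velV : ∀ s ∈ Icc 0 T, IsVelSpec s (V₁ s) (V₂ s) (W s)
  evolω : IsEvol ν T W Bω hω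
  evolθ : IsEvol ν T F Bθ hθ
  srcω : ∀ s ∈ Icc 0 T, ∀ r, Bω s r = adv s (U₁ s) (U₂ s) (W s) r + adv s (V₁ s) (V₂ s) (A s) r +
    adv s (V₁ s) (V₂ s) (W s) r + Complex.I * mulK (F s) r
  srcθ : ∀ s ∈ Icc 0 T, ∀ r, Bθ s r = adv s (neMode (U₁ s)) (neMode (U₂ s)) (Θ s) r +
    adv s (U₁ s) (U₂ s) (F s) r + adv s (V₁ s) (V₂ s) (F s) r + adv s (V₁ s) (V₂ s) (Θ s) r
  sizeω : ∀ s ∈ Icc 0 T, ∀ r, ‖hω s r‖ₑ ≤ conv (speed (U₁ s) (U₂ s)) (fun p => ‖W s p‖ₑ) r +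
    conv (speed (V₁ s) (V₂ s)) (fun p => ‖A s p‖ₑ) r +
    conv (speed (V₁ s) (V₂ s)) (fun p => ‖W s p‖ₑ) r + ‖F s r‖ₑ
  sizeθ : ∀ s ∈ Icc 0 T, ∀ r, ‖hθ s r‖ₑ ≤ conv (speed (U₁ s) (U₂ s)) (fun p => ‖Θ s p‖ₑ) r +
    conv (speed (U₁ s) (U₂ s)) (fun p => ‖F s p‖ₑ) r +
    conv (speed (V₁ s) (V₂ s)) (fun p => ‖F s p‖ₑ) r +
    conv (speed (V₁ s) (V₂ s)) (fun p => ‖Θ s p‖ₑ) r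
  bdd : ∃ M : ℝ≥0∞, M < ∞ ∧ ∀ s ∈ Icc 0 T, l2 (fun p => ‖U₁ s p‖ₑ) ≤ M ∧ l2 (fun p => ‖U₂ s p‖ₑ) ≤ M ∧
    l2 (fun p => ‖V₁ s p‖ₑ) ≤ M ∧ l2 (fun p => ‖V₂ s p‖ₑ) ≤ M ∧
    sob n (fun p => ‖W s p‖ₑ) ≤ M ∧ sob n (fun p => ‖F s p‖ₑ) ≤ M

lemma IsVelSpec.congr {t : ℝ} {U₁ U₂ A A' : ℤ × ℝ → ℂ} (h : IsVelSpec t U₁ U₂ A)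
    (hA : A =ᵐ[freqVol] A') : IsVelSpec t U₁ U₂ A' where
  div_free := h.div_free
  curl_eq := by filter_upwards [h.curl_eq, hA] with p h1 h2; rw [← h2, h1]
  conj₁ := h.conj₁
  conj₂ := h.conj₂

lemma IsEvol.measurable {ν T : ℝ} {W B : ℝ → ℤ × ℝ → ℂ} {h : ℝ → ℤ × ℝ → ℝ} (hE : IsEvol ν T W B h)
    (s : ℝ) : Measurable (W s) := (measurable_joint hE.contW).comp measurable_prodMk_left

section Spectra

variable {t : ℝ} {u : VField} {f : Field} {F : ℤ × ℝ → ℂ}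

lemma spec1_mul_eq {v : Field} (hv : MemLp v 2 (volume : Measure Cyl))
    (hf : MemLp f 2 (volume : Measure Cyl)) (hF : sp f t =ᵐ[freqVol] F) (r : ℤ × ℝ) :
    spec1 (v * f) t r = specMul (sp v t) F r := by
  rw [spec1_mul hv hf]
  exact specMul_congr (Eventually.of_forall fun _ => rfl) hF r

lemma spec1_ne_mul_eq {v : Field} (hv : MemLp v 2 (volume : Measure Cyl))
    (hf : MemLp f 2 (volume : Measure Cyl)) (hF : sp f t =ᵐ[freqVol] F) (r : ℤ × ℝ) :
    spec1 ((v - zeroMode v) * f) t r = specMul (neMode (sp v t)) F r := by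
  rw [spec1_mul (memLp_sub_zeroMode hv) hf]
  exact specMul_congr (sp_sub_zeroMode hv t) hF r

lemma spec1_fluxω {v v' f f' : ℝ → Field} (hv : MemLp (v t) 2 (volume : Measure Cyl))
    (hv' : MemLp (v' t) 2 (volume : Measure Cyl)) (hf : MemLp (f t) 2 (volume : Measure Cyl))
    (hf' : MemLp (f' t) 2 (volume : Measure Cyl)) (hF : sp (f' t) t =ᵐ[freqVol] F) (r : ℤ × ℝ) :
    spec1 (fluxω v v' f f' t) t r = specMul (sp (v t) t) F r +
      specMul (sp (v' t) t) (sp (f t) t) r + specMul (sp (v' t) t) F r := by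
  unfold fluxω
  rw [spec1_add ((hv.integrable_mul hf').add (hv'.integrable_mul hf)) (hv'.integrable_mul hf'),
    spec1_add (hv.integrable_mul hf') (hv'.integrable_mul hf), spec1_mul_eq hv hf' hF,
    spec1_mul_eq hv' hf (Eventually.of_forall fun _ => rfl), spec1_mul_eq hv' hf' hF]

lemma spec1_fluxθ {v v' f f' : ℝ → Field} (hv : MemLp (v t) 2 (volume : Measure Cyl))
    (hv' : MemLp (v' t) 2 (volume : Measure Cyl)) (hf : MemLp (f t) 2 (volume : Measure Cyl))
    (hf' : MemLp (f' t) 2 (volume : Measure Cyl)) (hF : sp (f' t) t =ᵐ[freqVol] F) (r : ℤ × ℝ) :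
    spec1 (fluxθ v v' f f' t) t r = specMul (neMode (sp (v t) t)) (sp (f t) t) r +
      specMul (sp (v t) t) F r + specMul (sp (v' t) t) F r +
      specMul (sp (v' t) t) (sp (f t) t) r := by
  have i1 := (memLp_sub_zeroMode hv).integrable_mul hf
  have i2 := hv.integrable_mul hf'
  have i3 := hv'.integrable_mul hf'
  unfold fluxθ
  rw [spec1_add ((i1.add i2).add i3) (hv'.integrable_mul hf), spec1_add (i1.add i2) i3,
    spec1_add i1 i2, spec1_ne_mul_eq hv hf (Eventually.of_forall fun _ => rfl),
    spec1_mul_eq hv hf' hF, spec1_mul_eq hv' hf' hF,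
    spec1_mul_eq hv' hf (Eventually.of_forall fun _ => rfl)]

end Spectra

lemma enorm_norm_add_three (a b c : ℂ) : ‖‖a‖ + ‖b‖ + ‖c‖‖ₑ = ‖a‖ₑ + ‖b‖ₑ + ‖c‖ₑ := by
  rw [Real.enorm_of_nonneg (by positivity), ENNReal.ofReal_add (by positivity) (by positivity),
    ENNReal.ofReal_add (by positivity) (by positivity), ofReal_norm, ofReal_norm, ofReal_norm]

lemma enorm_neMode_le (U : ℤ × ℝ → ℂ) (p : ℤ × ℝ) : ‖neMode U p‖ₑ ≤ ‖U p‖ₑ := by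
  unfold neMode; split_ifs <;> simp

section System

variable {ν n T : ℝ} {ωin θin : Field} {ωi θi ωe θe : ℝ → Field} {ui ue : ℝ → VField}

/-- Weak solutions of the error system solve the system on the Fourier side. -/
lemma exists_isErrorSpec (hn : 0 ≤ n) (hν : 0 ≤ ν) (hT : 0 ≤ T)
    (hi : IsIdealSolution ν T ωin θin ωi θi ui)
    (he : IsErrorSolution ν n T ωi θi ui ωe θe ue) : ∃ W F Bω Bθ hω hθ,
    IsErrorSpec ν n T (fun s => sp (ωi s) s) (fun s => sp (θi s) s) (fun s => sp (ui s).1 s)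
      (fun s => sp (ui s).2 s) W F (fun s => sp (ue s).1 s) (fun s => sp (ue s).2 s) Bω Bθ hω hθ ∧
    ∀ s ∈ Icc 0 T, sp (ωe s) s =ᵐ[freqVol] W s ∧ sp (θe s) s =ᵐ[freqVol] F s := by
  have hθt := isTransport_θ hn hi he
  have hωt := isTransport_ω hn hi he
  have aθ := hθt.hasAmp (hasAmp_zero T) hT hν
  have aω := hωt.hasAmp aθ hT hν
  have eθ := hθt.isEvol (hasAmp_zero T) hT
  have eω := hωt.isEvol aθ hT
  have sθ : ∀ s ∈ Icc 0 T, _ := fun s hs => aθ.sp_ae_eq hs (hθt.cont_f.1 s hs)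
  have sω : ∀ s ∈ Icc 0 T, _ := fun s hs => aω.sp_ae_eq hs (hωt.cont_f.1 s hs)
  -- `F` and `W` are the Duhamel representatives of the spectra of `θ^e` and `ω^e`
  generalize hF : duhamel ν (clampSrc hT _ _ fun _ _ => 0) = F at *
  generalize hW : duhamel ν (clampSrc hT _ _ F) = W at *
  have mF := eθ.measurable
  have mW := eω.measurable
  have fF : ∀ s ∈ Icc 0 T, l2 (fun p => ‖F s p‖ₑ) < ∞ := fun s hs => by
    rw [← l2_congr_ae (F := fun p => ‖sp (θe s) s p‖ₑ) ((sθ s hs).mono fun p hp => by rw [hp])]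
    exact l2_sp_lt_top (hθt.cont_f.1 s hs) s
  have fW : ∀ s ∈ Icc 0 T, l2 (fun p => ‖W s p‖ₑ) < ∞ := fun s hs => by
    rw [← l2_congr_ae (F := fun p => ‖sp (ωe s) s p‖ₑ) ((sω s hs).mono fun p hp => by rw [hp])]
    exact l2_sp_lt_top (hωt.cont_f.1 s hs) s
  have kω₁ := fun s (hs : s ∈ Icc 0 T) => spec1_fluxω (t := s) (v := fun t => (ui t).1)
    (v' := fun t => (ue t).1) (f := ωi) (f' := ωe) (hi.cont_u₁.1 s hs) (he.cont_u₁.1 s hs) (hi.cont_ω.1 s hs)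
    (hωt.cont_f.1 s hs) (sω s hs)
  have kω₂ := fun s (hs : s ∈ Icc 0 T) => spec1_fluxω (t := s) (v := fun t => (ui t).2)
    (v' := fun t => (ue t).2) (f := ωi) (f' := ωe) (hi.cont_u₂.1 s hs) (he.cont_u₂.1 s hs) (hi.cont_ω.1 s hs)
    (hωt.cont_f.1 s hs) (sω s hs)
  have kθ₁ := fun s (hs : s ∈ Icc 0 T) => spec1_fluxθ (t := s) (v := fun t => (ui t).1)
    (v' := fun t => (ue t).1) (f := θi) (f' := θe) (hi.cont_u₁.1 s hs) (he.cont_u₁.1 s hs) (hi.cont_θ.1 s hs)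
    (hθt.cont_f.1 s hs) (sθ s hs)
  have kθ₂ := fun s (hs : s ∈ Icc 0 T) => spec1_fluxθ (t := s) (v := fun t => (ui t).2)
    (v' := fun t => (ue t).2) (f := θi) (f' := θe) (hi.cont_u₂.1 s hs) (he.cont_u₂.1 s hs) (hi.cont_θ.1 s hs)
    (hθt.cont_f.1 s hs) (sθ s hs)
  beta_reduce at kω₁ kω₂ kθ₁ kθ₂
  have u₁ := fun s (hs : s ∈ Icc 0 T) => l2_sp_lt_top (hi.cont_u₁.1 s hs) s
  have u₂ := fun s (hs : s ∈ Icc 0 T) => l2_sp_lt_top (hi.cont_u₂.1 s hs) s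
  have v₁ := fun s (hs : s ∈ Icc 0 T) => l2_sp_lt_top (he.cont_u₁.1 s hs) s
  have v₂ := fun s (hs : s ∈ Icc 0 T) => l2_sp_lt_top (he.cont_u₂.1 s hs) s
  have fA := fun s (hs : s ∈ Icc 0 T) => l2_sp_lt_top (hi.cont_ω.1 s hs) s
  have fΘ := fun s (hs : s ∈ Icc 0 T) => l2_sp_lt_top (hi.cont_θ.1 s hs) s
  refine ⟨W, F, _, _, _, _, ⟨fun s => measurable_sp _ _, fun s => measurable_sp _ _,
    fun s => measurable_sp _ _, fun s => measurable_sp _ _, fun s => measurable_sp _ _,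
    fun s => measurable_sp _ _, fun s hs => (hi.velocity s hs).isVelSpec (hi.cont_ω.1 s hs) s,
    fun s hs => ((he.velocity s hs).isVelSpec (hωt.cont_f.1 s hs) s).congr (sω s hs), eω, eθ,
    ?_, ?_, ?_, ?_, ?_⟩, fun s hs => ⟨sω s hs, sθ s hs⟩⟩
  · intro s hs r
    rw [clampSrc_of_mem hT hs, specSrc, kω₁ s hs, kω₂ s hs,
      adv_eq_specMul (measurable_sp _ _) (measurable_sp _ _) (mW s) (u₁ s hs) (u₂ s hs) (fW s hs),
      adv_eq_specMul (measurable_sp _ _) (measurable_sp _ _) (measurable_sp _ _) (v₁ s hs)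
        (v₂ s hs) (fA s hs),
      adv_eq_specMul (measurable_sp _ _) (measurable_sp _ _) (mW s) (v₁ s hs) (v₂ s hs) (fW s hs)]
    simp only [mulK]
    ring
  · intro s hs r
    have n₁ := (l2_mono (enorm_neMode_le (sp (ui s).1 s))).trans_lt (u₁ s hs)
    have n₂ := (l2_mono (enorm_neMode_le (sp (ui s).2 s))).trans_lt (u₂ s hs)
    rw [clampSrc_of_mem hT hs, specSrc, kθ₁ s hs, kθ₂ s hs,
      adv_eq_specMul (measurable_neMode (measurable_sp _ _)) (measurable_neMode (measurable_sp _ _))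
        (measurable_sp _ _) n₁ n₂ (fΘ s hs),
      adv_eq_specMul (measurable_sp _ _) (measurable_sp _ _) (mF s) (u₁ s hs) (u₂ s hs) (fF s hs),
      adv_eq_specMul (measurable_sp _ _) (measurable_sp _ _) (mF s) (v₁ s hs) (v₂ s hs) (fF s hs),
      adv_eq_specMul (measurable_sp _ _) (measurable_sp _ _) (measurable_sp _ _) (v₁ s hs)
        (v₂ s hs) (fΘ s hs)]
    ring
  · intro s hs r
    rw [fluxSize_of_mem hT hs, enorm_norm_add_three, kω₁ s hs, kω₂ s hs]
    have c1 := enorm_specMul_add_le (U₂ := sp (ui s).2 s) (measurable_sp (ui s).1 s) (mW s) r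
    have c2 := enorm_specMul_add_le (U₂ := sp (ue s).2 s) (measurable_sp (ue s).1 s)
      (measurable_sp (ωi s) s) r
    have c3 := enorm_specMul_add_le (U₂ := sp (ue s).2 s) (measurable_sp (ue s).1 s) (mW s) r
    gcongr ?_ + _
    refine (add_le_add enorm_add₃_le enorm_add₃_le).trans
      (le_trans (le_of_eq ?_) (add_le_add (add_le_add c1 c2) c3))
    ring
  · intro s hs r
    rw [fluxSize_of_mem hT hs, enorm_norm_add_three, kθ₁ s hs, kθ₂ s hs, enorm_zero, add_zero]
    have c0 := (enorm_specMul_add_le (U₂ := neMode (sp (ui s).2 s))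
      (measurable_neMode (measurable_sp (ui s).1 s)) (measurable_sp (θi s) s) r).trans
      (conv_mono (speed_neMode_le _ _) (fun _ => le_rfl) r)
    have c1 := enorm_specMul_add_le (U₂ := sp (ui s).2 s) (measurable_sp (ui s).1 s) (mF s) r
    have c2 := enorm_specMul_add_le (U₂ := sp (ue s).2 s) (measurable_sp (ue s).1 s) (mF s) r
    have c3 := enorm_specMul_add_le (U₂ := sp (ue s).2 s) (measurable_sp (ue s).1 s)
      (measurable_sp (θi s) s) r
    refine (add_le_add ((enorm_add_le _ _).trans (add_le_add_left enorm_add₃_le _))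
      ((enorm_add_le _ _).trans (add_le_add_left enorm_add₃_le _))).trans
      (le_trans (le_of_eq ?_) (add_le_add (add_le_add (add_le_add c0 c1) c2) c3))
    ring
  · obtain ⟨M1, f1, h1⟩ := hi.cont_u₁.exists_bound_l2
    obtain ⟨M2, f2, h2⟩ := hi.cont_u₂.exists_bound_l2
    obtain ⟨M3, f3, h3⟩ := he.cont_u₁.exists_bound_l2
    obtain ⟨M4, f4, h4⟩ := he.cont_u₂.exists_bound_l2
    obtain ⟨M5, f5, h5⟩ := he.cont_ω.exists_bound hn
    obtain ⟨M6, f6, h6⟩ := he.cont_θ.exists_bound hn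
    refine ⟨max (max (max M1 M2) (max M3 M4)) (max M5 M6), by simp [*], fun s hs => ?_⟩
    have h5' : sob n (fun p => ‖W s p‖ₑ) ≤ M5 := by
      rw [← sob_congr_ae (G := fun p => ‖sp (ωe s) s p‖ₑ) ((sω s hs).mono fun p hp => by rw [hp])]
      exact h5 s hs
    have h6' : sob n (fun p => ‖F s p‖ₑ) ≤ M6 := by
      rw [← sob_congr_ae (G := fun p => ‖sp (θe s) s p‖ₑ) ((sθ s hs).mono fun p hp => by rw [hp])]
      exact h6 s hs
    have h1' := h1 s hs
    have h2' := h2 s hs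
    have h3' := h3 s hs
    have h4' := h4 s hs
    simp only [le_max_iff]
    tauto

end System

/-! ### Finiteness of the energies -/

/-- The `x`-derivative commutes with the evolution. -/
lemma IsEvol.mulK {ν T : ℝ} {W B : ℝ → ℤ × ℝ → ℂ} {h : ℝ → ℤ × ℝ → ℝ} (hE : IsEvol ν T W B h) :
    IsEvol ν T (fun s => mulK (W s)) (fun s => mulK (B s)) (fun s r => |(r.1 : ℝ)| * h s r) where
  contW k := (hE.contW k).const_mul (k : ℂ)
  contB k := (hE.contB k).const_mul (k : ℂ)
  conth k := (hE.conth k).const_mul |(k : ℝ)|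
  hasDeriv t r := by
    refine ((hE.hasDeriv t r).const_mul (r.1 : ℂ)).congr_deriv ?_
    simp only [Couette.mulK]; ring
  init r := by simp only [Couette.mulK, hE.init, mul_zero]
  bound s hs r := by
    simp only [Couette.mulK]
    rw [norm_mul, Complex.norm_intCast, mul_left_comm]
    exact mul_le_mul_of_nonneg_left (hE.bound s hs r) (abs_nonneg _)

lemma integrable_timeFreq_of_sob {n T : ℝ} {h : ℝ → ℤ × ℝ → ℝ}
    (hc : ∀ k : ℤ, Continuous fun x : ℝ × ℝ => h x.1 (k, x.2))
    (hf : ∫⁻ s in Ioc 0 T, sob n (fun p => ‖h s p‖ₑ) ^ 2 < ∞) :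
    Integrable (fun z => (jb z.2 ^ n) ^ 2 * h z.1 z.2 ^ 2) (IsEvol.timeFreq T) := by
  have hm : Measurable fun z : ℝ × (ℤ × ℝ) => (jb z.2 ^ n) ^ 2 * h z.1 z.2 ^ 2 :=
    (((measurable_jb_rpow n).comp measurable_snd).pow_const 2).mul ((measurable_joint hc).pow_const 2)
  refine ⟨hm.aestronglyMeasurable, ?_⟩
  rw [hasFiniteIntegral_iff_enorm, IsEvol.timeFreq, lintegral_prod _ hm.enorm.aemeasurable]
  refine lt_of_le_of_lt (le_of_eq ?_) hf
  refine lintegral_congr fun s => ?_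
  rw [sob, l2_sq]
  refine lintegral_congr fun p => ?_
  have := jb_pos p
  rw [enorm_mul, enorm_pow, enorm_pow, mul_pow, Real.enorm_of_nonneg (by positivity)]
  rfl

lemma lintegral_sob_sq_lt_top {n T : ℝ} {h : ℝ → ℤ × ℝ → ℝ} {D : ℝ → ℝ≥0∞} {C : ℝ≥0∞} (hC : C < ∞)
    (hh : ∀ s ∈ Icc 0 T, sob n (fun p => ‖h s p‖ₑ) ≤ C * (1 + D s))
    (hD : ∫⁻ s in Ioc 0 T, D s ^ 2 < ∞) :
    ∫⁻ s in Ioc 0 T, sob n (fun p => ‖h s p‖ₑ) ^ 2 < ∞ := by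
  have h1 : ∀ x : ℝ≥0∞, (1 + x) ^ 2 ≤ 4 + 4 * x ^ 2 := by
    intro x
    rcases le_total x 1 with hx | hx
    · calc (1 + x) ^ 2 ≤ (1 + 1) ^ 2 := by gcongr
        _ = 4 := by norm_num
        _ ≤ _ := le_add_right le_rfl
    · calc (1 + x) ^ 2 ≤ (x + x) ^ 2 := by gcongr
        _ = 4 * x ^ 2 := by ring
        _ ≤ _ := le_add_left le_rfl
  calc ∫⁻ s in Ioc 0 T, sob n (fun p => ‖h s p‖ₑ) ^ 2
      ≤ ∫⁻ s in Ioc 0 T, C ^ 2 * (4 + 4 * D s ^ 2) := by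
        refine setLIntegral_mono' measurableSet_Ioc fun s hs => ?_
        calc _ ≤ (C * (1 + D s)) ^ 2 := by gcongr; exact hh s (Ioc_subset_Icc_self hs)
          _ = C ^ 2 * (1 + D s) ^ 2 := mul_pow _ _ _
          _ ≤ _ := by gcongr; exact h1 _
    _ = C ^ 2 * (4 * volume (Ioc 0 T) + 4 * ∫⁻ s in Ioc 0 T, D s ^ 2) := by
        rw [lintegral_const_mul' _ _ (ENNReal.pow_ne_top hC.ne), lintegral_add_left measurable_const,
          lintegral_const_mul' _ _ (by simp), lintegral_const, Measure.restrict_apply_univ]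
    _ < ∞ := by
        refine ENNReal.mul_lt_top (ENNReal.pow_lt_top hC) (ENNReal.add_lt_top.2 ⟨?_, ?_⟩)
        · rw [Real.volume_Ioc]; exact ENNReal.mul_lt_top (by simp) ENNReal.ofReal_lt_top
        · exact ENNReal.mul_lt_top (by simp) hD

/-- The time integral of the dissipation is finite. -/
lemma IsEvol.lintegral_sob_grad_lt_top {ν n T : ℝ} {W B : ℝ → ℤ × ℝ → ℂ} {h : ℝ → ℤ × ℝ → ℝ}
    (hE : IsEvol ν T W B h) (hν : 0 < ν) (hT : 0 ≤ T)
    (hI : Integrable (fun z => (jb z.2 ^ n) ^ 2 * h z.1 z.2 ^ 2) (IsEvol.timeFreq T)) :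
    ∫⁻ s in Ioc 0 T, sob n (fun p => grad s p * ‖W s p‖ₑ) ^ 2 < ∞ := by
  have h1 := (hE.integrable_dis hν hT (measurable_jb_rpow n) hI)
  have hm : Measurable fun z : ℝ × (ℤ × ℝ) =>
      (jb z.2 ^ n) ^ 2 * (lapSym z.1 z.2 * ‖W z.1 z.2‖ ^ 2) :=
    (((measurable_jb_rpow n).comp measurable_snd).pow_const 2).mul hE.measurable_dis
  have h2 := h1.2
  rw [hasFiniteIntegral_iff_enorm, IsEvol.timeFreq, lintegral_prod _ hm.enorm.aemeasurable] at h2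
  refine lt_of_le_of_lt (le_of_eq ?_) h2
  refine lintegral_congr fun s => ?_
  rw [sob, l2_sq]
  refine lintegral_congr fun p => ?_
  have := jb_pos p
  have h0 := lapSym_nonneg s p
  rw [Real.enorm_of_nonneg (by positivity), wt, grad, ← ofReal_norm,
    ← ENNReal.ofReal_mul (Real.sqrt_nonneg _), ← ENNReal.ofReal_mul (by positivity),
    ← ENNReal.ofReal_pow (by positivity), mul_pow, mul_pow, Real.sq_sqrt h0]

section

variable {n : ℝ} {S G : ℤ × ℝ → ℝ≥0∞} {M : ℝ≥0∞}

lemma sob_conv_le_of_le (hn : 0 ≤ n) (hS : Measurable S) (hG : Measurable G) (h1 : sob n S ≤ M)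
    (h2 : sob n G ≤ M) : sob n (conv S G) ≤ algC n * M * M :=
  (sob_conv_le hn hS hG).trans (by gcongr)

/-- The product rule for `∂_x (u g)`; `∂_x u` is controlled by the vorticity without low
frequencies. -/
lemma sob_absK_conv_le {t : ℝ} {U₁ U₂ A : ℤ × ℝ → ℂ} (h : IsVelSpec t U₁ U₂ A) (hn : 0 ≤ n)
    (m₁ : Measurable U₁) (m₂ : Measurable U₂) (hA : Measurable A) (hG : Measurable G) :
    sob n (fun r => absK r * conv (speed U₁ U₂) G r) ≤
      algC n * (2 * sob n fun p => ‖A p‖ₑ) * sob n G +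
      algC n * sob n (speed U₁ U₂) * sob n (fun p => absK p * G p) := by
  have mS := measurable_speed m₁ m₂
  have mA : Measurable fun p => 2 * ‖A p‖ₑ := hA.enorm.const_mul 2
  have mG : Measurable fun p => absK p * G p := measurable_absK.mul hG
  refine (sob_mono (fun r => absK_mul_conv_le mS hG r)).trans ?_
  refine (sob_add_le (measurable_conv (measurable_absK.mul mS) hG) (measurable_conv mS mG)).trans ?_
  refine add_le_add ?_ (sob_conv_le hn mS mG)
  refine (sob_mono fun r => conv_mono_ae h.absK_mul_speed_le r).trans ?_
  rw [← sob_const_mul 2 hA.enorm]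
  exact sob_conv_le hn mA hG

end

section Energies

variable {ν n T : ℝ} {A Θ U₁ U₂ W F V₁ V₂ Bω Bθ : ℝ → ℤ × ℝ → ℂ} {hω hθ : ℝ → ℤ × ℝ → ℝ}
  {a θ : ℝ}

namespace IsErrorSpec

variable (hS : IsErrorSpec ν n T A Θ U₁ U₂ W F V₁ V₂ Bω Bθ hω hθ) (hn : 1 < n) (hν : 0 < ν)
  (hT : 0 ≤ T) (hA : ∀ s ∈ Icc 0 T, sob (n + 3) (fun p => ‖A s p‖ₑ) ≤ ENNReal.ofReal a)
  (hΘ : ∀ s ∈ Icc 0 T, sob (n + 3) (fun p => ‖Θ s p‖ₑ) ≤ ENNReal.ofReal θ)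

include hS hn hA hΘ

lemma exists_bound : ∃ M : ℝ≥0∞, M < ∞ ∧ ∀ s ∈ Icc 0 T, sob n (speed (U₁ s) (U₂ s)) ≤ M ∧
    sob n (speed (V₁ s) (V₂ s)) ≤ M ∧ sob n (fun p => ‖W s p‖ₑ) ≤ M ∧ sob n (fun p => ‖F s p‖ₑ) ≤ M ∧
    sob n (fun p => ‖A s p‖ₑ) ≤ M ∧ sob n (fun p => ‖Θ s p‖ₑ) ≤ M ∧
    sob n (fun p => absK p * ‖Θ s p‖ₑ) ≤ M := by
  obtain ⟨M, hM, h⟩ := hS.bdd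
  have hn0 : 0 ≤ n := by linarith
  have low : ∀ U : ℤ × ℝ → ℂ, l2 (lowFreq.indicator fun p => ‖U p‖ₑ) ≤ l2 fun p => ‖U p‖ₑ :=
    fun U => l2_mono fun p => indicator_le_self' (fun _ _ => zero_le) p
  set N := M + ENNReal.ofReal a + ENNReal.ofReal θ with hN
  have hNf : N < ∞ := by simp [hN, hM]
  have le1 : M ≤ N := le_add_right (le_add_right le_rfl)
  have le2 : ENNReal.ofReal a ≤ N := le_add_right (le_add_left le_rfl)
  have le3 : ENNReal.ofReal θ ≤ N := le_add_left le_rfl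
  set N' := 2 * N + ENNReal.ofReal (2 ^ n) * N + N with hN'
  have le4 : N ≤ N' := le_add_left le_rfl
  have le5 : 2 * N + ENNReal.ofReal (2 ^ n) * N ≤ N' := le_add_right le_rfl
  refine ⟨N', ?_, fun s hs => ?_⟩
  · have : ENNReal.ofReal (2 ^ n) * N < ∞ := ENNReal.mul_lt_top ENNReal.ofReal_lt_top hNf
    have : 2 * N < ∞ := ENNReal.mul_lt_top (by simp) hNf
    exact ENNReal.add_lt_top.2 ⟨ENNReal.add_lt_top.2 ⟨by assumption, by assumption⟩, hNf⟩
  obtain ⟨a1, -, a3, -, a5, a6⟩ := h s hs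
  have hAs := (sob_le_sob (by linarith : n ≤ n + 3) _).trans ((hA s hs).trans le2)
  have hΘs := (sob_le_sob (by linarith : n ≤ n + 3) _).trans ((hΘ s hs).trans le3)
  have hΘk : sob n (fun p => absK p * ‖Θ s p‖ₑ) ≤ N := by
    refine (sob_mono fun p => mul_le_mul_left (absK_le_wt_one p) _).trans ?_
    rw [sob_wt_mul]
    exact (sob_le_sob (by linarith : n + 1 ≤ n + 3) _).trans ((hΘ s hs).trans le3)
  refine ⟨?_, ?_, a5.trans (le1.trans le4), a6.trans (le1.trans le4), hAs.trans le4, hΘs.trans le4,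
    hΘk.trans le4⟩
  · refine ((hS.velU s hs).sob_speed_le hn0 (hS.meas_U₁ s) (hS.meas_A s)).trans (le_trans ?_ le5)
    gcongr
    exact (low _).trans (a1.trans le1)
  · refine ((hS.velV s hs).sob_speed_le hn0 (hS.meas_V₁ s) (hS.evolω.measurable s)).trans
      (le_trans ?_ le5)
    gcongr
    · exact a5.trans le1
    · exact (low _).trans (a3.trans le1)

lemma integrable_sizeω :
    Integrable (fun z => (jb z.2 ^ n) ^ 2 * hω z.1 z.2 ^ 2) (IsEvol.timeFreq T) := by
  obtain ⟨M, hM, h⟩ := hS.exists_bound hn hA hΘ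
  have hn0 : 0 ≤ n := by linarith
  have hf := algC_lt_top hn
  refine integrable_timeFreq_of_sob hS.evolω.conth (lintegral_sob_sq_lt_top
    (C := 3 * (algC n * M * M) + M) (D := 0) ?_ (fun s hs => ?_) (by simp))
  · have : algC n * M * M < ∞ := ENNReal.mul_lt_top (ENNReal.mul_lt_top hf hM) hM
    have : 3 * (algC n * M * M) < ∞ := ENNReal.mul_lt_top (by simp) this
    simp [*]
  obtain ⟨b1, b2, b3, b4, b5, b6, -⟩ := h s hs
  have mW := (hS.evolω.measurable s).enorm
  have mA := (hS.meas_A s).enorm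
  have mU := measurable_speed (hS.meas_U₁ s) (hS.meas_U₂ s)
  have mV := measurable_speed (hS.meas_V₁ s) (hS.meas_V₂ s)
  have c1 := measurable_conv mU mW
  have c2 := measurable_conv mV mA
  have c3 := measurable_conv mV mW
  refine (sob_mono (hS.sizeω s hs)).trans ?_
  refine (sob_add_le ((c1.add c2).add c3) (hS.evolθ.measurable s).enorm).trans ?_
  refine (add_le_add ((sob_add_le (c1.add c2) c3).trans (add_le_add (sob_add_le c1 c2) le_rfl))
    le_rfl).trans ?_
  refine (add_le_add (add_le_add (add_le_add (sob_conv_le_of_le hn0 mU mW b1 b3)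
    (sob_conv_le_of_le hn0 mV mA b2 b5)) (sob_conv_le_of_le hn0 mV mW b2 b3)) b4).trans ?_
  simp only [Pi.zero_apply, add_zero, mul_one]
  exact le_of_eq (by ring)

lemma integrable_sizeθ :
    Integrable (fun z => (jb z.2 ^ n) ^ 2 * hθ z.1 z.2 ^ 2) (IsEvol.timeFreq T) := by
  obtain ⟨M, hM, h⟩ := hS.exists_bound hn hA hΘ
  have hn0 : 0 ≤ n := by linarith
  have hf := algC_lt_top hn
  refine integrable_timeFreq_of_sob hS.evolθ.conth (lintegral_sob_sq_lt_top
    (C := 4 * (algC n * M * M)) (D := 0) ?_ (fun s hs => ?_) (by simp))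
  · have : algC n * M * M < ∞ := ENNReal.mul_lt_top (ENNReal.mul_lt_top hf hM) hM
    exact ENNReal.mul_lt_top (by simp) this
  obtain ⟨b1, b2, b3, b4, b5, b6, -⟩ := h s hs
  have mF := (hS.evolθ.measurable s).enorm
  have mΘ := (hS.meas_Θ s).enorm
  have mU := measurable_speed (hS.meas_U₁ s) (hS.meas_U₂ s)
  have mV := measurable_speed (hS.meas_V₁ s) (hS.meas_V₂ s)
  have c1 := measurable_conv mU mΘ
  have c2 := measurable_conv mU mF
  have c3 := measurable_conv mV mF
  have c4 := measurable_conv mV mΘ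
  refine (sob_mono (hS.sizeθ s hs)).trans ?_
  refine (sob_add_le ((c1.add c2).add c3) c4).trans ?_
  refine (add_le_add ((sob_add_le (c1.add c2) c3).trans (add_le_add (sob_add_le c1 c2) le_rfl))
    le_rfl).trans ?_
  refine (add_le_add (add_le_add (add_le_add (sob_conv_le_of_le hn0 mU mΘ b1 b6)
    (sob_conv_le_of_le hn0 mU mF b1 b4)) (sob_conv_le_of_le hn0 mV mF b2 b4))
    (sob_conv_le_of_le hn0 mV mΘ b2 b6)).trans ?_
  simp only [Pi.zero_apply, add_zero, mul_one]
  exact le_of_eq (by ring)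

include hν hT

/-- An `x`-derivative of the fluxes is controlled by the dissipation. -/
lemma integrable_mulK_sizeθ :
    Integrable (fun z => (jb z.2 ^ n) ^ 2 * (|(z.2.1 : ℝ)| * hθ z.1 z.2) ^ 2) (IsEvol.timeFreq T) := by
  obtain ⟨M, hM, h⟩ := hS.exists_bound hn hA hΘ
  have hn0 : 0 ≤ n := by linarith
  have hf := algC_lt_top hn
  have hD := hS.evolθ.lintegral_sob_grad_lt_top hν hT (hS.integrable_sizeθ hn hA hΘ)
  set K := algC n with hK
  set C := 4 * (K * (2 * M) * M) + 2 * (K * M * M) + 2 * (K * M) with hC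
  have hCf : C < ∞ := by
    have h1 : K * M < ∞ := ENNReal.mul_lt_top hf hM
    have h2 : 4 * (K * (2 * M) * M) < ∞ := ENNReal.mul_lt_top (by simp)
      (ENNReal.mul_lt_top (ENNReal.mul_lt_top hf (ENNReal.mul_lt_top (by simp) hM)) hM)
    have h3 : 2 * (K * M * M) < ∞ := ENNReal.mul_lt_top (by simp) (ENNReal.mul_lt_top h1 hM)
    have h4 : 2 * (K * M) < ∞ := ENNReal.mul_lt_top (by simp) h1
    exact ENNReal.add_lt_top.2 ⟨ENNReal.add_lt_top.2 ⟨h2, h3⟩, h4⟩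
  refine integrable_timeFreq_of_sob (h := fun s r => |(r.1 : ℝ)| * hθ s r) hS.evolθ.mulK.conth
    (lintegral_sob_sq_lt_top hCf (fun s hs => ?_) hD)
  obtain ⟨b1, b2, b3, b4, b5, b6, b7⟩ := h s hs
  have mF := (hS.evolθ.measurable s).enorm
  have mΘ := (hS.meas_Θ s).enorm
  have mU := measurable_speed (hS.meas_U₁ s) (hS.meas_U₂ s)
  have mV := measurable_speed (hS.meas_V₁ s) (hS.meas_V₂ s)
  have mk := measurable_absK
  have c1 := mk.mul (measurable_conv mU mΘ)
  have c2 := mk.mul (measurable_conv mU mF)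
  have c3 := mk.mul (measurable_conv mV mF)
  have c4 := mk.mul (measurable_conv mV mΘ)
  set D := sob n (fun p => grad s p * ‖F s p‖ₑ) with hDdef
  have hkF : sob n (fun p => absK p * ‖F s p‖ₑ) ≤ D :=
    sob_mono fun p => mul_le_mul_left (absK_le_grad s p) _
  have d1 := sob_absK_conv_le (hS.velU s hs) hn0 (hS.meas_U₁ s) (hS.meas_U₂ s) (hS.meas_A s) mΘ
  have d2 := sob_absK_conv_le (hS.velU s hs) hn0 (hS.meas_U₁ s) (hS.meas_U₂ s) (hS.meas_A s) mF
  have d3 := sob_absK_conv_le (hS.velV s hs) hn0 (hS.meas_V₁ s) (hS.meas_V₂ s)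
    (hS.evolω.measurable s) mF
  have d4 := sob_absK_conv_le (hS.velV s hs) hn0 (hS.meas_V₁ s) (hS.meas_V₂ s)
    (hS.evolω.measurable s) mΘ
  have e1 : ∀ {x y z u w : ℝ≥0∞}, x ≤ M → y ≤ M → z ≤ M → u ≤ w →
      K * (2 * x) * y + K * z * u ≤ K * (2 * M) * M + K * M * w := by
    intro x y z u w h1 h2 h3 h4; gcongr
  have hle : ∀ r, ‖|(r.1 : ℝ)| * hθ s r‖ₑ ≤
      absK r * conv (speed (U₁ s) (U₂ s)) (fun p => ‖Θ s p‖ₑ) r +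
      absK r * conv (speed (U₁ s) (U₂ s)) (fun p => ‖F s p‖ₑ) r +
      absK r * conv (speed (V₁ s) (V₂ s)) (fun p => ‖F s p‖ₑ) r +
      absK r * conv (speed (V₁ s) (V₂ s)) (fun p => ‖Θ s p‖ₑ) r := by
    intro r
    rw [enorm_mul, Real.enorm_of_nonneg (abs_nonneg _), ← mul_add, ← mul_add, ← mul_add]
    exact mul_le_mul_right (hS.sizeθ s hs r) _
  refine (sob_mono hle).trans ?_
  refine (sob_add_le ((c1.add c2).add c3) c4).trans ?_
  refine (add_le_add ((sob_add_le (c1.add c2) c3).trans (add_le_add (sob_add_le c1 c2) le_rfl))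
    le_rfl).trans ?_
  refine (add_le_add (add_le_add (add_le_add (d1.trans (e1 b5 b6 b1 b7))
    (d2.trans (e1 b5 b4 b1 hkF))) (d3.trans (e1 b3 b4 b2 hkF)))
    (d4.trans (e1 b3 b6 b2 b7))).trans ?_
  calc _ = 4 * (K * (2 * M) * M) + 2 * (K * M * M) + 2 * (K * M) * D := by ring
    _ ≤ C + C * D := by
        gcongr
        · rw [hC]; exact le_add_right le_rfl
        · rw [hC]; exact le_add_left le_rfl
    _ = _ := by ring

end IsErrorSpec

end Energies

/-! ### Energy estimates for the error -/

/-- The energy `‖⟨p⟩^n W(t)‖²`. -/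
def energy (n : ℝ) (W : ℝ → ℤ × ℝ → ℂ) (t : ℝ) : ℝ := ∫ r, (jb r ^ n) ^ 2 * ‖W t r‖ ^ 2 ∂freqVol

/-- The time integral of the inviscid damping rate. -/
lemma integral_inv_sq_le {t : ℝ} (ht : 0 ≤ t) : ∫ s in (0 : ℝ)..t, 1 / (1 + s) ^ 2 ≤ 1 := by
  have hd : ∀ s ∈ uIcc 0 t, HasDerivAt (fun s : ℝ => -(1 + s)⁻¹) (1 / (1 + s) ^ 2) s := by
    intro s hs
    rw [uIcc_of_le ht] at hs
    have h1 : (1 + s) ≠ 0 := by linarith [hs.1]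
    refine ((((hasDerivAt_id s).const_add 1).inv h1).neg).congr_deriv ?_
    simp only [id]; ring
  have hc : IntervalIntegrable (fun s : ℝ => 1 / (1 + s) ^ 2) volume 0 t := by
    refine ContinuousOn.intervalIntegrable fun s hs => ?_
    rw [uIcc_of_le ht] at hs
    have h1 : (1 + s) ^ 2 ≠ 0 := by have := hs.1; positivity
    exact (continuousAt_const.div (by fun_prop : ContinuousAt (fun s : ℝ => (1 + s) ^ 2) s) h1).continuousWithinAt
  rw [intervalIntegral.integral_eq_sub_of_hasDerivAt hd hc]
  have : 0 ≤ (1 + t)⁻¹ := by positivity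
  norm_num; linarith

lemma intervalIntegrable_inv_sq {t : ℝ} (ht : 0 ≤ t) (α β : ℝ) :
    IntervalIntegrable (fun s : ℝ => α + β * (1 / (1 + s) ^ 2)) volume 0 t := by
  refine ContinuousOn.intervalIntegrable fun s hs => ?_
  rw [uIcc_of_le ht] at hs
  have h1 : (1 + s) ^ 2 ≠ 0 := by have := hs.1; positivity
  exact (continuousAt_const.add (continuousAt_const.mul
    (continuousAt_const.div (by fun_prop : ContinuousAt (fun s : ℝ => (1 + s) ^ 2) s) h1))).continuousWithinAt

/-- The energy inequality for a source whose work is bounded by an integrable function of time. -/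
lemma IsEvol.energy_le_of {ν n T α β : ℝ} {W B : ℝ → ℤ × ℝ → ℂ} {h : ℝ → ℤ × ℝ → ℝ}
    (hE : IsEvol ν T W B h) (hν : 0 < ν) (hT : 0 ≤ T) (hβ : 0 ≤ β)
    (hI : Integrable (fun z => (jb z.2 ^ n) ^ 2 * h z.1 z.2 ^ 2) (IsEvol.timeFreq T)) {t : ℝ}
    (ht : t ∈ Icc 0 T)
    (hle : ∀ s ∈ Icc 0 t,
      Integrable (fun r => (jb r ^ n) ^ 2 * (lapSym s r * ‖W s r‖ ^ 2)) freqVol →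
      Integrable (fun r => (jb r ^ n) ^ 2 * (B s r * (starRingEnd ℂ) (W s r)).re) freqVol →
      ∫ r, (jb r ^ n) ^ 2 * (B s r * (starRingEnd ℂ) (W s r)).re ∂freqVol ≤
        α + β * (1 / (1 + s) ^ 2) +
          ν * ∫ r, (jb r ^ n) ^ 2 * (lapSym s r * ‖W s r‖ ^ 2) ∂freqVol) :
    energy n W t ≤ 2 * (α * t + β) := by
  have hc := intervalIntegrable_inv_sq ht.1 0 1
  simp only [zero_add, one_mul] at hc
  refine (hE.energy_le hν hT (measurable_jb_rpow n) hI ht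
    (intervalIntegrable_inv_sq ht.1 α β) hle).trans ?_
  rw [intervalIntegral.integral_add intervalIntegrable_const (hc.const_mul β),
    intervalIntegral.integral_const_mul, intervalIntegral.integral_const, smul_eq_mul, sub_zero]
  nlinarith [integral_inv_sq_le ht.1]

/-- The constant of the algebra property. -/
def algR (n : ℝ) : ℝ := (algC n).toReal

/-- The constant of the commutator estimate. -/
def commR (n : ℝ) : ℝ := n * 2 ^ (n - 1) * (l2 (wt (-2))).toReal

lemma algR_nonneg (n : ℝ) : 0 ≤ algR n := ENNReal.toReal_nonneg

lemma commR_nonneg {n : ℝ} (hn : 0 ≤ n) : 0 ≤ commR n := by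
  have : 0 ≤ (l2 (wt (-2))).toReal := ENNReal.toReal_nonneg
  unfold commR; positivity

section Bounds

variable {n g h : ℝ} {G H : ℤ × ℝ → ℝ≥0∞}

lemma sob_conv_le_ofReal (hn : 1 < n) (hg0 : 0 ≤ g) (mG : Measurable G) (mH : Measurable H)
    (hG : sob n G ≤ ENNReal.ofReal g) (hH : sob n H ≤ ENNReal.ofReal h) :
    sob n (conv G H) ≤ ENNReal.ofReal (algR n * (g * h)) := by
  refine (sob_conv_le (by linarith) mG mH).trans ?_
  rw [algR, ENNReal.ofReal_mul ENNReal.toReal_nonneg, ENNReal.ofReal_toReal (algC_lt_top hn).ne,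
    ENNReal.ofReal_mul hg0, ← mul_assoc]
  gcongr

lemma sob_add_le_ofReal (hg0 : 0 ≤ g) (hh0 : 0 ≤ h) (mG : Measurable G) (mH : Measurable H)
    (hG : sob n G ≤ ENNReal.ofReal g) (hH : sob n H ≤ ENNReal.ofReal h) :
    sob n (fun p => G p + H p) ≤ ENNReal.ofReal (g + h) := by
  rw [ENNReal.ofReal_add hg0 hh0]
  exact (sob_add_le mG mH).trans (add_le_add hG hH)

lemma sob_const_mul_le_ofReal {c : ℝ} (hc : 0 ≤ c) (mG : Measurable G)
    (hG : sob n G ≤ ENNReal.ofReal g) :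
    sob n (fun p => ENNReal.ofReal c * G p) ≤ ENNReal.ofReal (c * g) := by
  rw [sob_const_mul _ mG, ENNReal.ofReal_mul hc]
  gcongr

lemma sob_grad_le_ofReal {t : ℝ} (ht : 0 ≤ t) (mG : Measurable G)
    (hG : sob (n + 1) G ≤ ENNReal.ofReal g) :
    sob n (fun p => grad t p * G p) ≤ ENNReal.ofReal (2 * (1 + t) * g) := by
  rw [ENNReal.ofReal_mul (by positivity)]
  exact (sob_grad_mul_le ht n mG).trans (by gcongr)

/-- The commutator estimate in terms of Sobolev norms. -/
lemma IsVelSpec.integral_adv_le {t a e : ℝ} {U₁ U₂ A F : ℤ × ℝ → ℂ} (hv : IsVelSpec t U₁ U₂ A)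
    (hn : 1 < n) (h₁ : Measurable U₁) (h₂ : Measurable U₂) (hA : Measurable A) (hF : Measurable F)
    (hS : sob n (speed U₁ U₂) < ∞) (ha : 0 ≤ a)
    (he0 : 0 ≤ e) (hAa : sob (n + 3) (fun p => ‖A p‖ₑ) ≤ ENNReal.ofReal a)
    (he : sob n (fun p => ‖F p‖ₑ) ≤ ENNReal.ofReal e)
    (hi : Integrable (fun r => (jb r ^ n) ^ 2 * (lapSym t r * ‖F r‖ ^ 2)) freqVol) :
    Integrable (fun r => (jb r ^ n) ^ 2 * (adv t U₁ U₂ F r * (starRingEnd ℂ) (F r)).re) freqVol ∧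
    ∫ r, (jb r ^ n) ^ 2 * (adv t U₁ U₂ F r * (starRingEnd ℂ) (F r)).re ∂freqVol ≤
      commR n * a * e ^ 2 := by
  have hw2 := l2_wt_neg_lt_top (n := 2) (by norm_num)
  have hwn := l2_wt_neg_lt_top hn
  have hA1 : ∫⁻ p, wt (n + 1) p * ‖A p‖ₑ ∂freqVol ≤ l2 (wt (-2)) * ENNReal.ofReal a := by
    refine (lintegral_le_l2_wt 2 (measurable_wt_mul_enorm (n + 1) hA)).trans ?_
    gcongr
    refine le_trans (le_of_eq ?_) hAa
    change sob 2 (fun p => wt (n + 1) p * ‖A p‖ₑ) = _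
    rw [sob_wt_mul]; congr 1; ring
  have hg : l2 (fun p => wt n p * (grad t p * ‖F p‖ₑ)) < ∞ := by
    change sob n (fun p => grad t p * ‖F p‖ₑ) < ∞
    rw [sob_grad_eq hi]; exact ENNReal.ofReal_lt_top
  obtain ⟨k1, k2⟩ := hv.energy_adv_le (by linarith : 1 ≤ n) h₁ h₂ hA hF
    ((lintegral_le_l2_wt n (measurable_speed h₁ h₂)).trans_lt (ENNReal.mul_lt_top hwn hS))
    (he.trans_lt ENNReal.ofReal_lt_top) hg
    (hA1.trans_lt (ENNReal.mul_lt_top hw2 ENNReal.ofReal_lt_top))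
  refine ⟨k1, (le_abs_self _).trans (k2.trans ?_)⟩
  have hc : 0 ≤ n * 2 ^ (n - 1) := by positivity
  refine ENNReal.toReal_le_of_le_ofReal ?_ ?_
  · have := commR_nonneg (n := n) (by linarith); positivity
  calc _ ≤ ENNReal.ofReal (n * 2 ^ (n - 1)) * ((l2 (wt (-2)) * ENNReal.ofReal a) *
        ENNReal.ofReal e ^ 2) := by
        gcongr
        exact he
    _ = _ := by
        rw [← ENNReal.ofReal_toReal hw2.ne, ← ENNReal.ofReal_mul ENNReal.toReal_nonneg,
          ← ENNReal.ofReal_pow he0, ← ENNReal.ofReal_mul (by positivity),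
          ← ENNReal.ofReal_mul hc, commR]
        congr 1; ring

end Bounds

lemma sob_absK_mul_le (n : ℝ) (G : ℤ × ℝ → ℝ≥0∞) : sob n (fun p => absK p * G p) ≤ sob (n + 1) G := by
  rw [← sob_wt_mul]
  exact sob_mono fun p => mul_le_mul_left (absK_le_wt_one p) _

namespace IsErrorSpec

section

variable {ν n T : ℝ} {A Θ U₁ U₂ W F V₁ V₂ Bω Bθ : ℝ → ℤ × ℝ → ℂ} {hω hθ : ℝ → ℤ × ℝ → ℝ}
  {a θ E Z X v : ℝ}

variable (hS : IsErrorSpec ν n T A Θ U₁ U₂ W F V₁ V₂ Bω Bθ hω hθ) (hn : 1 < n) (hν : 0 < ν)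
  (hT : 0 ≤ T) (ha : 0 ≤ a) (hθ0 : 0 ≤ θ) (hE : 0 ≤ E) (hZ : 0 ≤ Z) (hX : 0 ≤ X) (hv : 0 ≤ v)
  (hA : ∀ s ∈ Icc 0 T, sob (n + 3) (fun p => ‖A s p‖ₑ) ≤ ENNReal.ofReal a)
  (hΘ : ∀ s ∈ Icc 0 T, sob (n + 3) (fun p => ‖Θ s p‖ₑ) ≤ ENNReal.ofReal θ)

include hS hn ha hE hA

/-- The velocity of the error is controlled by its vorticity. At low frequencies, where the
Biot–Savart law is singular, the zero mode of `ω^e`, which is `-∂_y u^{e,1}`, is bounded by the time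
integral of `∂_y` of the vorticity flux; the two factors `ξ` cancel. -/
lemma sob_speed_le {t : ℝ} (ht : t ∈ Icc 0 T) (hν : 0 ≤ ν)
    (hW : ∀ s ∈ Icc 0 t, sob n (fun p => ‖W s p‖ₑ) ≤ ENNReal.ofReal E) :
    sob n (speed (V₁ t) (V₂ t)) ≤
      ENNReal.ofReal (2 * E + 2 ^ n * ((2 * (a * E) + E ^ 2) * t)) := by
  have hn0 : 0 ≤ n := by linarith
  have ht0 := ht.1
  have hb : ∀ r : ℤ × ℝ, r.1 = 0 → ∀ s ∈ Icc 0 t, ‖Bω s r‖ ≤ |2 * Real.pi * r.2| * (2 * (a * E) + E ^ 2) := by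
    intro r hr s hs
    have hsT : s ∈ Icc 0 T := ⟨hs.1, hs.2.trans ht.2⟩
    have mW := hS.evolω.measurable s
    have hxi : xi s r = 2 * Real.pi * r.2 := by simp [xi, hr]
    have l1 : l2 (fun p => ‖U₂ s p‖ₑ) ≤ ENNReal.ofReal a :=
      (l2_mono_ae (hS.velU s hsT).norm_snd_le).trans
        ((l2_le_sob (by linarith : 0 ≤ n + 3) _).trans (hA s hsT))
    have l2' : l2 (fun p => ‖A s p‖ₑ) ≤ ENNReal.ofReal a :=
      (l2_le_sob (by linarith : 0 ≤ n + 3) _).trans (hA s hsT)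
    have l3 : l2 (fun p => ‖W s p‖ₑ) ≤ ENNReal.ofReal E := (l2_le_sob hn0 _).trans (hW s hs)
    have l4 : l2 (fun p => ‖V₂ s p‖ₑ) ≤ ENNReal.ofReal E :=
      (l2_mono_ae (hS.velV s hsT).norm_snd_le).trans l3
    have e1 := enorm_adv_le_of_fst_eq_zero (t := s) (U₁ := U₁ s) (hS.meas_U₂ s) mW hr
    have e2 := enorm_adv_le_of_fst_eq_zero (t := s) (U₁ := V₁ s) (hS.meas_V₂ s) (hS.meas_A s) hr
    have e3 := enorm_adv_le_of_fst_eq_zero (t := s) (U₁ := V₁ s) (hS.meas_V₂ s) mW hr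
    have hk : mulK (F s) r = 0 := by simp [mulK, hr]
    have key : ‖Bω s r‖ₑ ≤ ENNReal.ofReal (|2 * Real.pi * r.2| * (2 * (a * E) + E ^ 2)) := by
      rw [hS.srcω s hsT, hk, mul_zero, add_zero]
      refine enorm_add₃_le.trans ((add_le_add (add_le_add e1 e2) e3).trans ?_)
      rw [hxi]
      calc _ ≤ ENNReal.ofReal |2 * Real.pi * r.2| * (ENNReal.ofReal a * ENNReal.ofReal E) +
            ENNReal.ofReal |2 * Real.pi * r.2| * (ENNReal.ofReal E * ENNReal.ofReal a) +
            ENNReal.ofReal |2 * Real.pi * r.2| * (ENNReal.ofReal E * ENNReal.ofReal E) := by gcongr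
        _ = _ := by
          rw [← ENNReal.ofReal_mul ha, ← ENNReal.ofReal_mul hE, ← ENNReal.ofReal_mul hE,
            ← ENNReal.ofReal_mul (abs_nonneg _), ← ENNReal.ofReal_mul (abs_nonneg _),
            ← ENNReal.ofReal_mul (abs_nonneg _), ← ENNReal.ofReal_add (by positivity)
            (by positivity), ← ENNReal.ofReal_add (by positivity) (by positivity)]
          congr 1; ring
    rw [← ofReal_norm] at key
    exact (ENNReal.ofReal_le_ofReal_iff (by positivity)).1 key
  have hlow : l2 (lowFreq.indicator fun p => ‖V₁ t p‖ₑ) ≤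
      ENNReal.ofReal ((2 * (a * E) + E ^ 2) * t) := by
    refine l2_indicator_le ?_
    filter_upwards [(hS.velV t ht).curl_eq, IsVelSpec.ae_snd_ne_zero] with p h1 h2 hp
    have h3 := hS.evolω.norm_le hν ht0 (hb p hp.1)
    have hxi : xi t p = 2 * Real.pi * p.2 := by simp [xi, hp.1]
    have hpos : 0 < |2 * Real.pi * p.2| := abs_pos.2 (mul_ne_zero Real.two_pi_pos.ne' h2)
    rw [h1, hp.1, hxi, norm_mul, Complex.norm_I, one_mul, Int.cast_zero, zero_mul, zero_sub,
      norm_neg, norm_mul, Complex.norm_real, Real.norm_eq_abs, mul_assoc |2 * Real.pi * p.2|] at h3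
    rw [← ofReal_norm]
    exact ENNReal.ofReal_le_ofReal (le_of_mul_le_mul_left h3 hpos)
  refine ((hS.velV t ht).sob_speed_le hn0 (hS.meas_V₁ t) (hS.evolω.measurable t)).trans ?_
  rw [ENNReal.ofReal_add (by positivity) (by positivity), ENNReal.ofReal_mul (by norm_num),
    ENNReal.ofReal_mul (p := 2 ^ n) (by positivity)]
  have := hW t ⟨ht0, le_rfl⟩
  gcongr
  simp

include hν hT hΘ hX hv hθ0

omit hθ0 in
/-- The energy estimate for `ω^e`. The terms are `u^i · ∇ω^e` (commutator), `u^e · ∇ω^i` and `∂_x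
θ^e` (directly, with a factor `1 + t` from `∇ω^i`) and `u^e · ∇ω^e` (dissipation). -/
lemma energy_ω_le {t : ℝ} (ht : t ∈ Icc 0 T)
    (hW : ∀ s ∈ Icc 0 t, sob n (fun p => ‖W s p‖ₑ) ≤ ENNReal.ofReal E)
    (hF : ∀ s ∈ Icc 0 t, sob n (fun p => ‖mulK (F s) p‖ₑ) ≤ ENNReal.ofReal X)
    (hV : ∀ s ∈ Icc 0 t, sob n (speed (V₁ s) (V₂ s)) ≤ ENNReal.ofReal v) :
    energy n W t ≤ 2 * ((commR n * a * E ^ 2 + (algR n * (v * (2 * (1 + T) * a)) + X) * E +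
      (algR n * (v * E)) ^ 2 / (4 * ν)) * t + 0) := by
  obtain ⟨M, hM, hbd⟩ := hS.exists_bound hn hA hΘ
  refine hS.evolω.energy_le_of hν hT le_rfl (hS.integrable_sizeω hn hA hΘ) ht fun s hs hi hBW => ?_
  have hsT : s ∈ Icc 0 T := ⟨hs.1, hs.2.trans ht.2⟩
  have mW := hS.evolω.measurable s
  have mA := hS.meas_A s
  have mF := measurable_mulK (hS.evolθ.measurable s)
  have mV := measurable_speed (hS.meas_V₁ s) (hS.meas_V₂ s)
  have mg : Measurable fun p => grad s p * ‖A s p‖ₑ := (measurable_grad s).mul mA.enorm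
  have hK := algR_nonneg n
  obtain ⟨hN, hc⟩ := (hS.velU s hsT).integral_adv_le hn (hS.meas_U₁ s) (hS.meas_U₂ s) mA mW
    ((hbd s hsT).1.trans_lt hM) ha hE (hA s hsT) (hW s hs) hi
  have hA1 : sob (n + 1) (fun p => ‖A s p‖ₑ) ≤ ENNReal.ofReal a :=
    (sob_le_sob (by linarith) _).trans (hA s hsT)
  have hs0 := hs.1
  have h1s : 0 ≤ 2 * (1 + s) * a := by positivity
  have cX := measurable_conv mV mg
  have hb := sob_add_le_ofReal (by positivity) hX cX mF.enorm
    (sob_conv_le_ofReal hn hv mV mg (hV s hs) (sob_grad_le_ofReal hs0 mA.enorm hA1)) (hF s hs)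
  have hY := sob_conv_le_ofReal hn hv mV mW.enorm (hV s hs) (hW s hs)
  refine (integral_re_le hν (by positivity) (by positivity) hE mW (cX.add mF.enorm)
    (measurable_conv mV mW.enorm) hi hBW hN hc (fun r => ?_) hb hY (hW s hs)).trans ?_
  · have e : Bω s r - adv s (U₁ s) (U₂ s) (W s) r = adv s (V₁ s) (V₂ s) (A s) r +
        Complex.I * mulK (F s) r + adv s (V₁ s) (V₂ s) (W s) r := by rw [hS.srcω s hsT]; ring
    rw [e]
    refine enorm_add₃_le.trans (add_le_add (add_le_add
      ((hS.velV s hsT).enorm_adv_le_conv_grad r) ?_)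
      (enorm_adv_le_grad_mul s (hS.meas_V₁ s) (hS.meas_V₂ s) mW r))
    rw [enorm_mul, ← ofReal_norm Complex.I, Complex.norm_I, ENNReal.ofReal_one, one_mul]
  · have : 2 * (1 + s) * a ≤ 2 * (1 + T) * a := by have := hsT.2; gcongr
    rw [zero_mul, add_zero]
    gcongr

omit hE hX in
include hZ in
/-- The energy estimate for `θ^e`. The terms `u^i · ∇θ^e`, `u^e · ∇θ^i` and `u^e · ∇θ^e` are treated
as for the vorticity; the forcing `u^i_≠ · ∇θ^i` is integrable in time by inviscid damping, which
gives the term without a factor `t`. -/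
lemma energy_θ_le {t : ℝ} (ht : t ∈ Icc 0 T)
    (hF : ∀ s ∈ Icc 0 t, sob n (fun p => ‖F s p‖ₑ) ≤ ENNReal.ofReal Z)
    (hV : ∀ s ∈ Icc 0 t, sob n (speed (V₁ s) (V₂ s)) ≤ ENNReal.ofReal v) :
    energy n F t ≤ 2 * ((commR n * a * Z ^ 2 + algR n * (v * (2 * (1 + T) * θ)) * Z +
      (algR n * (v * Z)) ^ 2 / (4 * ν)) * t + 6 * (algR n * (a * θ)) * Z) := by
  obtain ⟨M, hM, hbd⟩ := hS.exists_bound hn hA hΘ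
  have hK := algR_nonneg n
  refine hS.evolθ.energy_le_of hν hT (by positivity) (hS.integrable_sizeθ hn hA hΘ) ht
    fun s hs hi hBW => ?_
  have hsT : s ∈ Icc 0 T := ⟨hs.1, hs.2.trans ht.2⟩
  have mA := hS.meas_A s
  have mΘ := hS.meas_Θ s
  have mF := hS.evolθ.measurable s
  have mV := measurable_speed (hS.meas_V₁ s) (hS.meas_V₂ s)
  have mg : Measurable fun p => grad s p * ‖Θ s p‖ₑ := (measurable_grad s).mul mΘ.enorm
  obtain ⟨hN, hc⟩ := (hS.velU s hsT).integral_adv_le hn (hS.meas_U₁ s) (hS.meas_U₂ s) mA mF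
    ((hbd s hsT).1.trans_lt hM) ha hZ (hA s hsT) (hF s hs) hi
  have hΘ1 : sob (n + 1) (fun p => ‖Θ s p‖ₑ) ≤ ENNReal.ofReal θ :=
    (sob_le_sob (by linarith) _).trans (hΘ s hsT)
  have hs0 := hs.1
  have h1s : 0 ≤ 2 * (1 + s) * θ := by positivity
  have cA := measurable_wt_mul_enorm 3 mA
  have cΘ := measurable_wt_mul_enorm 1 mΘ
  have c1 := measurable_conv cA cΘ
  have c2 := measurable_conv mV mg
  have hb1 := sob_const_mul_le_ofReal (c := 6 / (1 + s) ^ 2) (by positivity) c1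
    (sob_conv_le_ofReal hn ha cA cΘ ((sob_wt_mul n 3 _).le.trans (hA s hsT))
      ((sob_wt_mul n 1 _).le.trans hΘ1))
  have hb := sob_add_le_ofReal (by positivity) (by positivity) (c1.const_mul _) c2 hb1
    (sob_conv_le_ofReal hn hv mV mg (hV s hs) (sob_grad_le_ofReal hs0 mΘ.enorm hΘ1))
  have hY := sob_conv_le_ofReal hn hv mV mF.enorm (hV s hs) (hF s hs)
  refine (integral_re_le hν (by positivity) (by positivity) hZ mF ((c1.const_mul _).add c2)
    (measurable_conv mV mF.enorm) hi hBW hN hc (fun r => ?_) hb hY (hF s hs)).trans ?_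
  · have e : Bθ s r - adv s (U₁ s) (U₂ s) (F s) r =
        adv s (neMode (U₁ s)) (neMode (U₂ s)) (Θ s) r + adv s (V₁ s) (V₂ s) (Θ s) r +
        adv s (V₁ s) (V₂ s) (F s) r := by rw [hS.srcθ s hsT]; ring
    rw [e]
    exact enorm_add₃_le.trans (add_le_add (add_le_add
      ((hS.velU s hsT).enorm_adv_neMode_le_decay hs0 mA mΘ r)
      ((hS.velV s hsT).enorm_adv_le_conv_grad r))
      (enorm_adv_le_grad_mul s (hS.meas_V₁ s) (hS.meas_V₂ s) mF r))
  · have h3 : 2 * (1 + s) * θ ≤ 2 * (1 + T) * θ := by have := hsT.2; gcongr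
    have h4 : algR n * (v * (2 * (1 + s) * θ)) * Z ≤ algR n * (v * (2 * (1 + T) * θ)) * Z := by
      gcongr
    have h5 : 6 / (1 + s) ^ 2 * (algR n * (a * θ)) * Z =
        6 * (algR n * (a * θ)) * Z * (1 / (1 + s) ^ 2) := by ring
    rw [add_mul _ _ Z, h5]
    linarith

include hZ in
/-- The energy estimate for `∂_x θ^e`. After the Leibniz rule the new terms are `∂_x u^i · ∇θ^e` and
`∂_x u^e · ∇θ^e`, absorbed in the dissipation; the first is square integrable in time because `∂_x
u^i` decays like `(1 + t)^{-1}`. -/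
lemma energy_mulK_θ_le {t : ℝ} (ht : t ∈ Icc 0 T)
    (hW : ∀ s ∈ Icc 0 t, sob n (fun p => ‖W s p‖ₑ) ≤ ENNReal.ofReal E)
    (hF : ∀ s ∈ Icc 0 t, sob n (fun p => ‖F s p‖ₑ) ≤ ENNReal.ofReal Z)
    (hkF : ∀ s ∈ Icc 0 t, sob n (fun p => ‖mulK (F s) p‖ₑ) ≤ ENNReal.ofReal X)
    (hV : ∀ s ∈ Icc 0 t, sob n (speed (V₁ s) (V₂ s)) ≤ ENNReal.ofReal v) :
    energy n (fun s => mulK (F s)) t ≤ 2 * ((commR n * a * X ^ 2 +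
      (2 * (algR n * (a * θ)) + algR n * ((2 * E + v) * (2 * (1 + T) * θ))) * X +
      (algR n * (2 * E * Z + v * X)) ^ 2 / (2 * ν)) * t + (6 * algR n * (a * Z)) ^ 2 / (2 * ν)) := by
  obtain ⟨M, hM, hbd⟩ := hS.exists_bound hn hA hΘ
  obtain ⟨M', hM', hbd'⟩ := hS.bdd
  have hK := algR_nonneg n
  refine hS.evolθ.mulK.energy_le_of hν hT (by positivity)
    (hS.integrable_mulK_sizeθ hn hν hT hA hΘ) ht fun s hs hi hBW => ?_
  have hsT : s ∈ Icc 0 T := ⟨hs.1, hs.2.trans ht.2⟩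
  have hs0 := hs.1
  have hn0 : 0 ≤ n := by linarith
  have mA := hS.meas_A s
  have mΘ := hS.meas_Θ s
  have mF := hS.evolθ.measurable s
  have mkF := measurable_mulK mF
  have mU := measurable_speed (hS.meas_U₁ s) (hS.meas_U₂ s)
  have mV := measurable_speed (hS.meas_V₁ s) (hS.meas_V₂ s)
  have mg : Measurable fun p => grad s p * ‖Θ s p‖ₑ := (measurable_grad s).mul mΘ.enorm
  obtain ⟨hN, hc⟩ := (hS.velU s hsT).integral_adv_le hn (hS.meas_U₁ s) (hS.meas_U₂ s) mA mkF
    ((hbd s hsT).1.trans_lt hM) ha hX (hA s hsT) (hkF s hs) hi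
  have mk := measurable_absK
  have cA := measurable_wt_mul_enorm 1 mA
  have cΘ := measurable_wt_mul_enorm 1 mΘ
  have ckA := mk.mul cA
  have ckΘ := mk.mul cΘ
  have ckV := mk.mul mV
  have ckU := mk.mul mU
  have ckg := mk.mul mg
  have ckF := mk.mul mF.enorm
  have hAj : ∀ j ≤ 3, sob (n + j) (fun p => ‖A s p‖ₑ) ≤ ENNReal.ofReal a := fun j hj =>
    (sob_le_sob (by linarith) _).trans (hA s hsT)
  have hΘj : ∀ j ≤ 3, sob (n + j) (fun p => ‖Θ s p‖ₑ) ≤ ENNReal.ofReal θ := fun j hj =>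
    (sob_le_sob (by linarith) _).trans (hΘ s hsT)
  have bA := (sob_wt_mul n 1 _).le.trans (hAj 1 (by norm_num))
  have bΘ := (sob_wt_mul n 1 _).le.trans (hΘj 1 (by norm_num))
  have bkA : sob n (fun p => absK p * (wt 1 p * ‖A s p‖ₑ)) ≤ ENNReal.ofReal a := by
    refine (sob_absK_mul_le n _).trans ?_
    rw [sob_wt_mul, add_assoc]
    exact hAj (1 + 1) (by norm_num)
  have bkΘ : sob n (fun p => absK p * (wt 1 p * ‖Θ s p‖ₑ)) ≤ ENNReal.ofReal θ := by
    refine (sob_absK_mul_le n _).trans ?_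
    rw [sob_wt_mul, add_assoc]
    exact hΘj (1 + 1) (by norm_num)
  have bg := sob_grad_le_ofReal hs0 mΘ.enorm (hΘj 1 (by norm_num))
  have bkg : sob n (fun p => absK p * (grad s p * ‖Θ s p‖ₑ)) ≤
      ENNReal.ofReal (2 * (1 + s) * θ) := by
    refine (sob_absK_mul_le n _).trans (sob_grad_le_ofReal hs0 mΘ.enorm ?_)
    rw [add_assoc]
    exact hΘj (1 + 1) (by norm_num)
  have bkV : sob n (fun p => absK p * speed (V₁ s) (V₂ s) p) ≤ ENNReal.ofReal (2 * E) := by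
    refine (sob_mono_ae (hS.velV s hsT).absK_mul_speed_le).trans ?_
    rw [sob_const_mul _ (hS.evolω.measurable s).enorm, ENNReal.ofReal_mul (by norm_num)]
    have := hW s hs
    gcongr
    simp
  have bkU : sob n (fun p => absK p * speed (U₁ s) (U₂ s) p) ≤
      ENNReal.ofReal (6 / (1 + s) * a) := by
    refine (sob_mono_ae ((hS.velU s hsT).absK_mul_speed_le_decay hs0)).trans ?_
    refine sob_const_mul_le_ofReal (by positivity) (measurable_wt_mul_enorm 2 mA) ?_
    rw [sob_wt_mul]
    exact hAj 2 (by norm_num)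
  have bkF : sob n (fun p => absK p * ‖F s p‖ₑ) ≤ ENNReal.ofReal X := by
    refine le_trans (le_of_eq ?_) (hkF s hs)
    simp only [enorm_mulK]
  have h1s : 0 ≤ 2 * (1 + s) * θ := by positivity
  have x1 := measurable_conv ckA cΘ
  have x2 := measurable_conv cA ckΘ
  have x3 := measurable_conv ckV mg
  have x4 := measurable_conv mV ckg
  have y1 := measurable_conv ckU mF.enorm
  have y2 := measurable_conv ckV mF.enorm
  have y3 := measurable_conv mV ckF
  have hb := sob_add_le_ofReal (by positivity) (by positivity) (x1.add x2) (x3.add x4)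
    (sob_add_le_ofReal (by positivity) (by positivity) x1 x2
      (sob_conv_le_ofReal hn ha ckA cΘ bkA bΘ) (sob_conv_le_ofReal hn ha cA ckΘ bA bkΘ))
    (sob_add_le_ofReal (by positivity) (by positivity) x3 x4
      (sob_conv_le_ofReal hn (by positivity) ckV mg bkV bg)
      (sob_conv_le_ofReal hn hv mV ckg (hV s hs) bkg))
  have hY := sob_add_le_ofReal (by positivity) (by positivity) y1 (y2.add y3)
    (sob_conv_le_ofReal hn (by positivity) ckU mF.enorm bkU (hF s hs))
    (sob_add_le_ofReal (by positivity) (by positivity) y2 y3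
      (sob_conv_le_ofReal hn (by positivity) ckV mF.enorm bkV (hF s hs))
      (sob_conv_le_ofReal hn hv mV ckF (hV s hs) bkF))
  refine (integral_re_le hν (by positivity) (by positivity) hX mkF ((x1.add x2).add (x3.add x4))
    (y1.add (y2.add y3)) hi hBW hN hc (fun r => ?_) hb hY (hkF s hs)).trans ?_
  · have kU : ∀ {U : ℤ × ℝ → ℂ}, (∀ p, ‖U p‖ₑ ≤ speed (U₁ s) (U₂ s) p) →
        l2 (fun p => ‖mulK U p‖ₑ) < ∞ := fun hU => by
      refine lt_of_le_of_lt ((l2_mono fun p => ?_).trans ((l2_le_sob hn0 _).trans bkU))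
        ENNReal.ofReal_lt_top
      rw [enorm_mulK]
      exact mul_le_mul_right (hU p) _
    have hL := fst_mul_adv (t := s) (hS.meas_U₁ s) (hS.meas_U₂ s) mF
      ((hbd' s hsT).1.trans_lt hM') ((hbd' s hsT).2.1.trans_lt hM')
      (kU fun p => le_add_right le_rfl) (kU fun p => le_add_left le_rfl)
      (((l2_le_sob hn0 _).trans (hF s hs)).trans_lt ENNReal.ofReal_lt_top)
      (((l2_le_sob hn0 _).trans (hkF s hs)).trans_lt ENNReal.ofReal_lt_top) r
    have e : mulK (Bθ s) r - adv s (U₁ s) (U₂ s) (mulK (F s)) r =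
        (r.1 * adv s (neMode (U₁ s)) (neMode (U₂ s)) (Θ s) r +
          r.1 * adv s (V₁ s) (V₂ s) (Θ s) r) +
        (adv s (mulK (U₁ s)) (mulK (U₂ s)) (F s) r + r.1 * adv s (V₁ s) (V₂ s) (F s) r) := by
      rw [mulK, hS.srcθ s hsT]
      linear_combination hL
    have ek : ∀ z : ℂ, ‖(r.1 : ℂ) * z‖ₑ = absK r * ‖z‖ₑ := fun z => enorm_mulK (fun _ => z) r
    have t1 := ((ek _).le.trans (mul_le_mul_right
      ((hS.velU s hsT).enorm_adv_neMode_le (F := Θ s) r) _)).trans (absK_mul_conv_le cA cΘ r)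
    have t2 := ((ek _).le.trans (mul_le_mul_right
      ((hS.velV s hsT).enorm_adv_le_conv_grad (F := Θ s) r) _)).trans (absK_mul_conv_le mV mg r)
    have t3 := enorm_adv_le_grad_mul s (measurable_mulK (hS.meas_U₁ s))
      (measurable_mulK (hS.meas_U₂ s)) mF r
    have t4 := ((ek _).le.trans (mul_le_mul_right
      (enorm_adv_le_grad_mul s (hS.meas_V₁ s) (hS.meas_V₂ s) mF r) _)).trans
      ((mul_left_comm _ _ _).le.trans (mul_le_mul_right (absK_mul_conv_le mV mF.enorm r) _))
    rw [e]
    refine (enorm_add_le _ _).trans (add_le_add ((enorm_add_le _ _).trans (add_le_add t1 t2))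
      (((enorm_add_le _ _).trans (add_le_add t3 t4)).trans (le_of_eq ?_)))
    rw [funext (speed_mulK (U₁ s) (U₂ s))]
    exact (mul_add _ _ _).symm
  · have h3 : 2 * (1 + s) * θ ≤ 2 * (1 + T) * θ := by have := hsT.2; gcongr
    have h4 : algR n * ((2 * E + v) * (2 * (1 + s) * θ)) * X ≤
        algR n * ((2 * E + v) * (2 * (1 + T) * θ)) * X := by gcongr
    set q := algR n * (2 * E * Z + v * X) with hq
    set p := 6 * algR n * (a * Z) with hp
    have h5 : (algR n * (6 / (1 + s) * a * Z) + (algR n * (2 * E * Z) + algR n * (v * X))) ^ 2 /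
        (4 * ν) ≤ q ^ 2 / (2 * ν) + p ^ 2 / (2 * ν) * (1 / (1 + s) ^ 2) := by
      have e1 : algR n * (6 / (1 + s) * a * Z) + (algR n * (2 * E * Z) + algR n * (v * X)) =
          p / (1 + s) + q := by rw [hq, hp]; ring
      have e2 : q ^ 2 / (2 * ν) + p ^ 2 / (2 * ν) * (1 / (1 + s) ^ 2) =
          (2 * (p / (1 + s)) ^ 2 + 2 * q ^ 2) / (4 * ν) := by field_simp; ring
      rw [e1, e2]
      gcongr
      nlinarith [sq_nonneg (p / (1 + s) - q)]
    linarith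

end

end IsErrorSpec

/-! ### The bootstrap -/

/-- The continuity method: a bound which improves itself propagates. -/
lemma forall_lt_one_of_bootstrap {T : ℝ} {Φ : ℝ → ℝ} (hc : ContinuousOn Φ (Icc 0 T)) (h0 : Φ 0 < 1)
    (h : ∀ t ∈ Icc 0 T, (∀ s ∈ Icc 0 t, Φ s ≤ 1) → Φ t < 1) : ∀ t ∈ Icc 0 T, Φ t < 1 := by
  by_contra! hne
  obtain ⟨t₁, ht₁, h1⟩ := hne
  have hcl : IsClosed (Icc 0 T ∩ Φ ⁻¹' Ici 1) := hc.preimage_isClosed_of_isClosed isClosed_Icc isClosed_Ici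
  have hcp : IsCompact (Icc 0 T ∩ Φ ⁻¹' Ici 1) :=
    isCompact_Icc.of_isClosed_subset hcl inter_subset_left
  obtain ⟨τ, ⟨hτ, hτ1⟩, hmin⟩ := hcp.exists_isLeast ⟨t₁, ht₁, h1⟩
  have hτ1' : 1 ≤ Φ τ := hτ1
  have hlt : ∀ s ∈ Icc 0 τ, s < τ → Φ s < 1 := fun s hs hsτ => by
    by_contra! hs1
    exact absurd (hmin ⟨⟨hs.1, hs.2.trans hτ.2⟩, hs1⟩) (not_le.2 hsτ)
  have hle : Φ τ ≤ 1 := by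
    obtain ⟨s, hs, hs1⟩ := intermediate_value_Icc hτ.1 (hc.mono (Icc_subset_Icc_right hτ.2))
      ⟨h0.le, hτ1'⟩
    rcases hs.2.eq_or_lt with h2 | h2
    · rw [← h2, hs1]
    · exact absurd hs1 (hlt s hs h2).ne
  refine absurd (h τ hτ fun s hs => ?_) (not_lt.2 hτ1')
  rcases hs.2.eq_or_lt with h2 | h2
  · rw [h2]; exact hle
  · exact (hlt s hs h2).le

section Numerics

variable {κ e t K N c : ℝ}

/-- The amplitude of the data has to be small against the inverse of this constant; `N`, `K` and `c` are
the constants of the commutator estimate, of the algebra property and of the velocity bound. -/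
def smallC (N K c : ℝ) : ℝ := 2 * N + 64 * (K * (3 + c)) + 640 * (K ^ 2 * (1 + c) ^ 2)

lemma one_add_inv_le (hκ : 0 < κ) (hκ1 : κ ≤ 1) : 1 + κ⁻¹ ≤ 2 * κ⁻¹ := by
  have := (one_le_inv₀ hκ).2 hκ1
  linarith

lemma numerics_ω (hκ : 0 < κ) (hκ1 : κ ≤ 1) (he : 0 < e) (he1 : e ≤ 1) (hK : 0 ≤ K) (hN : 0 ≤ N)
    (hc : 0 ≤ c) (hsm : e * smallC N K c ≤ 1 / 4) (ht0 : 0 ≤ t) (ht : t ≤ κ⁻¹) :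
    2 * ((N * (e * κ ^ 2) * (e * κ ^ 4) ^ 2 +
      (K * (c * (e * κ ^ 4) * (2 * (1 + κ⁻¹) * (e * κ ^ 2))) + e * κ ^ 5 / 8) * (e * κ ^ 4) +
      (K * (c * (e * κ ^ 4) * (e * κ ^ 4))) ^ 2 / (4 * κ ^ 6)) * t + 0) < (e * κ ^ 4) ^ 2 := by
  have h1 := one_add_inv_le hκ hκ1
  have hpos : 0 < e ^ 2 * κ ^ 8 := by positivity
  calc _ ≤ 2 * ((N * (e * κ ^ 2) * (e * κ ^ 4) ^ 2 +
      (K * (c * (e * κ ^ 4) * (2 * (2 * κ⁻¹) * (e * κ ^ 2))) + e * κ ^ 5 / 8) * (e * κ ^ 4) +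
      (K * (c * (e * κ ^ 4) * (e * κ ^ 4))) ^ 2 / (4 * κ ^ 6)) * κ⁻¹ + 0) := by gcongr
    _ = e ^ 2 * κ ^ 8 * (1 / 4 + (e * (2 * N) * κ + 8 * e * (K * c) +
        e * (K ^ 2 * c ^ 2) / 2 * (e * κ))) := by field_simp; ring
    _ ≤ e ^ 2 * κ ^ 8 * (1 / 4 + (e * (2 * N) * 1 + 8 * e * (K * c) +
        e * (K ^ 2 * c ^ 2) / 2 * (1 * 1))) := by gcongr
    _ ≤ e ^ 2 * κ ^ 8 * (1 / 4 + e * smallC N K c) := by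
        have : e * (2 * N) * 1 + 8 * e * (K * c) + e * (K ^ 2 * c ^ 2) / 2 * (1 * 1) =
          e * (2 * N + 8 * (K * c) + K ^ 2 * c ^ 2 / 2) := by ring
        rw [this]
        gcongr
        unfold smallC
        have k1 := mul_nonneg hK hc
        have k2 : 0 ≤ K ^ 2 * c := by positivity
        have k3 : 0 ≤ K ^ 2 * c ^ 2 := by positivity
        nlinarith [sq_nonneg K]
    _ < e ^ 2 * κ ^ 8 * 1 := by gcongr; linarith
    _ = _ := by ring

lemma numerics_θ (hκ : 0 < κ) (hκ1 : κ ≤ 1) (he : 0 < e) (he1 : e ≤ 1) (hK : 0 ≤ K) (hN : 0 ≤ N)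
    (hc : 0 ≤ c) (hsm : e * smallC N K c ≤ 1 / 4) (ht0 : 0 ≤ t) (ht : t ≤ κ⁻¹) :
    2 * ((N * (e * κ ^ 2) * (e * κ ^ 6 / 2) ^ 2 +
      K * (c * (e * κ ^ 4) * (2 * (1 + κ⁻¹) * (e * κ ^ 4))) * (e * κ ^ 6 / 2) +
      (K * (c * (e * κ ^ 4) * (e * κ ^ 6 / 2))) ^ 2 / (4 * κ ^ 6)) * t +
      6 * (K * (e * κ ^ 2 * (e * κ ^ 4))) * (e * κ ^ 6 / 2)) < (e * κ ^ 6 / 2) ^ 2 := by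
  have h1 := one_add_inv_le hκ hκ1
  have hpos : 0 < (e * κ ^ 6 / 2) ^ 2 := by positivity
  calc _ ≤ 2 * ((N * (e * κ ^ 2) * (e * κ ^ 6 / 2) ^ 2 +
      K * (c * (e * κ ^ 4) * (2 * (2 * κ⁻¹) * (e * κ ^ 4))) * (e * κ ^ 6 / 2) +
      (K * (c * (e * κ ^ 4) * (e * κ ^ 6 / 2))) ^ 2 / (4 * κ ^ 6)) * κ⁻¹ +
      6 * (K * (e * κ ^ 2 * (e * κ ^ 4))) * (e * κ ^ 6 / 2)) := by gcongr
    _ = (e * κ ^ 6 / 2) ^ 2 * (e * (2 * N) * κ + 16 * e * (K * c) +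
        e * (K ^ 2 * c ^ 2) / 2 * (e * κ) + 24 * e * K) := by field_simp; ring
    _ ≤ (e * κ ^ 6 / 2) ^ 2 * (e * (2 * N) * 1 + 16 * e * (K * c) +
        e * (K ^ 2 * c ^ 2) / 2 * (1 * 1) + 24 * e * K) := by gcongr
    _ ≤ (e * κ ^ 6 / 2) ^ 2 * (e * smallC N K c) := by
        have : e * (2 * N) * 1 + 16 * e * (K * c) + e * (K ^ 2 * c ^ 2) / 2 * (1 * 1) + 24 * e * K =
          e * (2 * N + 16 * (K * c) + K ^ 2 * c ^ 2 / 2 + 24 * K) := by ring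
        rw [this]
        gcongr
        unfold smallC
        have k1 := mul_nonneg hK hc
        have k2 : 0 ≤ K ^ 2 * c := by positivity
        have k3 : 0 ≤ K ^ 2 * c ^ 2 := by positivity
        nlinarith [sq_nonneg K]
    _ < (e * κ ^ 6 / 2) ^ 2 * 1 := by gcongr; linarith
    _ = _ := by ring

lemma numerics_mulK (hκ : 0 < κ) (hκ1 : κ ≤ 1) (he : 0 < e) (he1 : e ≤ 1) (hK : 0 ≤ K) (hN : 0 ≤ N)
    (hc : 0 ≤ c) (hsm : e * smallC N K c ≤ 1 / 4) (ht0 : 0 ≤ t) (ht : t ≤ κ⁻¹) :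
    2 * ((N * (e * κ ^ 2) * (e * κ ^ 5 / 8) ^ 2 +
      (2 * (K * (e * κ ^ 2 * (e * κ ^ 4))) + K * ((2 * (e * κ ^ 4) + c * (e * κ ^ 4)) *
        (2 * (1 + κ⁻¹) * (e * κ ^ 4)))) * (e * κ ^ 5 / 8) +
      (K * (2 * (e * κ ^ 4) * (e * κ ^ 6 / 2) + c * (e * κ ^ 4) * (e * κ ^ 5 / 8))) ^ 2 /
        (2 * κ ^ 6)) * t + (6 * K * (e * κ ^ 2 * (e * κ ^ 6 / 2))) ^ 2 / (2 * κ ^ 6)) <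
      (e * κ ^ 5 / 8) ^ 2 := by
  have h1 := one_add_inv_le hκ hκ1
  have hpos : 0 < (e * κ ^ 5 / 8) ^ 2 := by positivity
  have h2 : e * κ ^ 6 / 2 ≤ e * κ ^ 5 / 2 := by
    have : κ ^ 6 ≤ κ ^ 5 := pow_le_pow_of_le_one hκ.le hκ1 (by norm_num)
    gcongr
  calc _ ≤ 2 * ((N * (e * κ ^ 2) * (e * κ ^ 5 / 8) ^ 2 +
      (2 * (K * (e * κ ^ 2 * (e * κ ^ 4))) + K * ((2 * (e * κ ^ 4) + c * (e * κ ^ 4)) *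
        (2 * (2 * κ⁻¹) * (e * κ ^ 4)))) * (e * κ ^ 5 / 8) +
      (K * (2 * (e * κ ^ 4) * (e * κ ^ 5 / 2) + c * (e * κ ^ 4) * (e * κ ^ 5))) ^ 2 /
        (2 * κ ^ 6)) * κ⁻¹ + (6 * K * (e * κ ^ 2 * (e * κ ^ 6 / 2))) ^ 2 / (2 * κ ^ 6)) := by
        gcongr
        exact div_le_self (by positivity) (by norm_num)
    _ = (e * κ ^ 5 / 8) ^ 2 * (e * (2 * N) * κ + 32 * e * K + 64 * e * (K * (2 + c)) * κ +
        64 * e * (K ^ 2 * (1 + c) ^ 2) * (e * κ) + 576 * e * K ^ 2 * e) := by field_simp; ring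
    _ ≤ (e * κ ^ 5 / 8) ^ 2 * (e * (2 * N) * 1 + 32 * e * K + 64 * e * (K * (2 + c)) * 1 +
        64 * e * (K ^ 2 * (1 + c) ^ 2) * (1 * 1) + 576 * e * K ^ 2 * 1) := by gcongr
    _ ≤ (e * κ ^ 5 / 8) ^ 2 * (e * smallC N K c) := by
        have : e * (2 * N) * 1 + 32 * e * K + 64 * e * (K * (2 + c)) * 1 +
          64 * e * (K ^ 2 * (1 + c) ^ 2) * (1 * 1) + 576 * e * K ^ 2 * 1 =
          e * (2 * N + 32 * K + 64 * (K * (2 + c)) + 64 * (K ^ 2 * (1 + c) ^ 2) + 576 * K ^ 2) := by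
          ring
        rw [this]
        gcongr
        unfold smallC
        have k1 := mul_nonneg hK hc
        have k2 : 0 ≤ K ^ 2 * c := by positivity
        have k3 : 0 ≤ K ^ 2 * c ^ 2 := by positivity
        nlinarith [sq_nonneg K]
    _ < (e * κ ^ 5 / 8) ^ 2 * 1 := by gcongr; linarith
    _ = _ := by ring

lemma numerics_speed (hκ : 0 < κ) (hκ1 : κ ≤ 1) (he : 0 < e) (he1 : e ≤ 1) (n : ℝ)
    (ht : t ≤ κ⁻¹) : 2 * (e * κ ^ 4) +
      2 ^ n * ((2 * (e * κ ^ 2 * (e * κ ^ 4)) + (e * κ ^ 4) ^ 2) * t) ≤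
      (2 + 3 * 2 ^ n) * (e * κ ^ 4) := by
  have h1 : (2 * (e * κ ^ 2 * (e * κ ^ 4)) + (e * κ ^ 4) ^ 2) * t ≤ 3 * (e * κ ^ 4) :=
    calc _ ≤ (2 * (e * κ ^ 2 * (e * κ ^ 4)) + (e * κ ^ 4) ^ 2) * κ⁻¹ := by gcongr
      _ = e * κ ^ 4 * (2 * (e * κ) + e * κ ^ 3) := by field_simp
      _ ≤ e * κ ^ 4 * (2 * (1 * 1) + 1 * 1 ^ 3) := by gcongr
      _ = _ := by ring
  have h2 := mul_le_mul_of_nonneg_left h1 (by positivity : (0 : ℝ) ≤ 2 ^ n)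
  linarith

end Numerics

/-- The bootstrap, with viscosity `κ ^ 6` on the time interval `[0, κ⁻¹]`: the three energies cannot
leave the region of size `e κ⁴`, `e κ⁶ / 2`, `e κ⁵ / 8`, because as long as they are in it the energy
estimates put them strictly inside. -/
lemma IsErrorSpec.bootstrap {n κ e : ℝ} {A Θ U₁ U₂ W F V₁ V₂ Bω Bθ : ℝ → ℤ × ℝ → ℂ}
    {hω hθ : ℝ → ℤ × ℝ → ℝ}
    (hS : IsErrorSpec (κ ^ 6) n κ⁻¹ A Θ U₁ U₂ W F V₁ V₂ Bω Bθ hω hθ) (hn : 1 < n) (hκ : 0 < κ)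
    (hκ1 : κ ≤ 1) (he : 0 < e) (he1 : e ≤ 1)
    (hsm : e * smallC (commR n) (algR n) (2 + 3 * 2 ^ n) ≤ 1 / 4)
    (hA : ∀ s ∈ Icc 0 κ⁻¹, sob (n + 3) (fun p => ‖A s p‖ₑ) ≤ ENNReal.ofReal (e * κ ^ 2))
    (hΘ : ∀ s ∈ Icc 0 κ⁻¹, sob (n + 3) (fun p => ‖Θ s p‖ₑ) ≤ ENNReal.ofReal (e * κ ^ 4)) :
    ∀ t ∈ Icc 0 κ⁻¹, sob n (fun p => ‖W t p‖ₑ) ≤ ENNReal.ofReal (e * κ ^ 4) ∧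
      sob n (fun p => ‖F t p‖ₑ) ≤ ENNReal.ofReal (e * κ ^ 6 / 2) ∧
      sob n (fun p => ‖mulK (F t) p‖ₑ) ≤ ENNReal.ofReal (e * κ ^ 5 / 8) := by
  have hT : 0 ≤ κ⁻¹ := by positivity
  have hν : 0 < κ ^ 6 := by positivity
  have iω := hS.integrable_sizeω hn hA hΘ
  have iθ := hS.integrable_sizeθ hn hA hΘ
  have ik := hS.integrable_mulK_sizeθ hn hν hT hA hΘ
  have mρ := measurable_jb_rpow n
  set E := e * κ ^ 4 with hE
  set Z := e * κ ^ 6 / 2 with hZ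
  set X := e * κ ^ 5 / 8 with hX
  have pE : 0 < E := by positivity
  have pZ : 0 < Z := by positivity
  have pX : 0 < X := by positivity
  have key : ∀ {G : ℝ → ℤ × ℝ → ℂ} {x t : ℝ}, 0 < x →
      Integrable (fun r => (jb r ^ n) ^ 2 * ‖G t r‖ ^ 2) freqVol → energy n G t / x ^ 2 ≤ 1 →
      sob n (fun p => ‖G t p‖ₑ) ≤ ENNReal.ofReal x := by
    intro G x t hx hi h
    rw [sob_enorm_eq hi]
    refine ENNReal.ofReal_le_ofReal (Real.sqrt_le_iff.2 ⟨hx.le, ?_⟩)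
    exact (div_le_one (by positivity)).1 h
  have conv : ∀ t ∈ Icc 0 κ⁻¹, max (energy n W t / E ^ 2)
      (max (energy n F t / Z ^ 2) (energy n (fun s => mulK (F s)) t / X ^ 2)) ≤ 1 →
      sob n (fun p => ‖W t p‖ₑ) ≤ ENNReal.ofReal E ∧ sob n (fun p => ‖F t p‖ₑ) ≤ ENNReal.ofReal Z ∧
      sob n (fun p => ‖mulK (F t) p‖ₑ) ≤ ENNReal.ofReal X := by
    intro t ht h
    rw [max_le_iff, max_le_iff] at h
    exact ⟨key pE (hS.evolω.integrable_norm_sq hν hT mρ iω ht) h.1,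
      key pZ (hS.evolθ.integrable_norm_sq hν hT mρ iθ ht) h.2.1,
      key (G := fun s => mulK (F s)) pX (hS.evolθ.mulK.integrable_norm_sq hν hT mρ ik ht) h.2.2⟩
  have z0 : ∀ {G : ℝ → ℤ × ℝ → ℂ}, (∀ r, G 0 r = 0) → energy n G 0 = 0 := fun h => by
    simp [energy, h]
  have hlt := forall_lt_one_of_bootstrap (T := κ⁻¹) (Φ := fun t => max (energy n W t / E ^ 2)
      (max (energy n F t / Z ^ 2) (energy n (fun s => mulK (F s)) t / X ^ 2)))
    (((hS.evolω.continuousOn_energy hν hT mρ iω).div_const _).sup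
      (((hS.evolθ.continuousOn_energy hν hT mρ iθ).div_const _).sup
        ((hS.evolθ.mulK.continuousOn_energy hν hT mρ ik).div_const _)))
    (by
      rw [z0 hS.evolω.init, z0 hS.evolθ.init, z0 hS.evolθ.mulK.init]
      simp) fun t ht hs => ?_
  · exact fun t ht => conv t ht (hlt t ht).le
  have hb := fun s (hst : s ∈ Icc 0 t) => conv s ⟨hst.1, hst.2.trans ht.2⟩ (hs s hst)
  have hK := algR_nonneg n
  have hN := commR_nonneg (n := n) (by linarith)
  have hc : (0 : ℝ) ≤ 2 + 3 * 2 ^ n := by positivity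
  have pa : 0 ≤ e * κ ^ 2 := by positivity
  have pθ : 0 ≤ e * κ ^ 4 := by positivity
  have pv : 0 ≤ (2 + 3 * 2 ^ n) * E := by positivity
  have hV : ∀ s ∈ Icc 0 t, sob n (speed (V₁ s) (V₂ s)) ≤ ENNReal.ofReal ((2 + 3 * 2 ^ n) * E) := by
    intro s hst
    have hsT : s ∈ Icc 0 κ⁻¹ := ⟨hst.1, hst.2.trans ht.2⟩
    refine (hS.sob_speed_le hn pa pE.le hA hsT hν.le
      fun s' hs' => (hb s' ⟨hs'.1, hs'.2.trans hst.2⟩).1).trans ?_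
    exact ENNReal.ofReal_le_ofReal (numerics_speed hκ hκ1 he he1 n hsT.2)
  have b1 := hS.energy_ω_le hn hν hT pa pE.le pX.le pv hA hΘ ht (fun s h => (hb s h).1)
    (fun s h => (hb s h).2.2) hV
  have b2 := hS.energy_θ_le hn hν hT pa pθ pZ.le pv hA hΘ ht (fun s h => (hb s h).2.1) hV
  have b3 := hS.energy_mulK_θ_le hn hν hT pa pθ pE.le pZ.le pX.le pv hA hΘ ht
    (fun s h => (hb s h).1) (fun s h => (hb s h).2.1) (fun s h => (hb s h).2.2) hV
  refine max_lt ?_ (max_lt ?_ ?_)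
  · exact (div_lt_one (by positivity)).2
      (b1.trans_lt (numerics_ω hκ hκ1 he he1 hK hN hc hsm ht.1 ht.2))
  · exact (div_lt_one (by positivity)).2
      (b2.trans_lt (numerics_θ hκ hκ1 he he1 hK hN hc hsm ht.1 ht.2))
  · exact (div_lt_one (by positivity)).2
      (b3.trans_lt (numerics_mulK hκ hκ1 he he1 hK hN hc hsm ht.1 ht.2))

/-! ### Norms and spectra -/

lemma le_ofReal_div_of_rpi_mul_le {x : ℝ≥0∞} {y : ℝ} (h : ENNReal.ofReal rpi * x ≤ ENNReal.ofReal y) :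
    x ≤ ENNReal.ofReal (y / rpi) := by
  have h0 := ENNReal.ofReal_pos.2 rpi_pos
  rw [ENNReal.ofReal_div_of_pos rpi_pos]
  exact (ENNReal.le_div_iff_mul_le (Or.inl h0.ne') (Or.inl ENNReal.ofReal_ne_top)).2 (by rwa [mul_comm])

lemma sob_sp_le_of_normΛ {f : Field} {s t y : ℝ} (hf : MemLp f 2 (volume : Measure Cyl))
    (h : normΛ s t f ≤ ENNReal.ofReal y) :
    sob s (fun p => ‖sp f t p‖ₑ) ≤ ENNReal.ofReal (y / rpi) := by
  rw [normΛ_eq hf] at h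
  exact le_ofReal_div_of_rpi_mul_le h

lemma sob_sp_le_of_normJxΛ {f : Field} {s t y : ℝ} (hf : MemLp f 2 (volume : Measure Cyl))
    (h : normJxΛ s t f ≤ ENNReal.ofReal y) :
    sob s (fun p => ‖sp f t p‖ₑ) ≤ ENNReal.ofReal (y / rpi) := by
  rw [normJxΛ_eq hf] at h
  refine le_trans (l2_mono fun p => ?_) (le_ofReal_div_of_rpi_mul_le h)
  have h1 : 1 ≤ ‖Real.sqrt (1 + (p.1 : ℝ) ^ 2)‖ₑ := by
    rw [Real.enorm_of_nonneg (Real.sqrt_nonneg _), ENNReal.one_le_ofReal]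
    exact Real.one_le_sqrt.2 (by nlinarith [sq_nonneg (p.1 : ℝ)])
  exact mul_le_mul_left (le_mul_of_one_le_left zero_le h1) _

lemma normΛ_le_of_sob {f : Field} {W : ℤ × ℝ → ℂ} {s t y : ℝ}
    (hf : MemLp f 2 (volume : Measure Cyl)) (hW : sp f t =ᵐ[freqVol] W)
    (h : sob s (fun p => ‖W p‖ₑ) ≤ ENNReal.ofReal y) : normΛ s t f ≤ ENNReal.ofReal (rpi * y) := by
  rw [normΛ_eq hf, ENNReal.ofReal_mul rpi_pos.le]
  gcongr
  exact (sob_congr_ae (hW.mono fun p hp => by simp only [hp])).le.trans h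

lemma normDxΛ_le_of_sob {f : Field} {W : ℤ × ℝ → ℂ} {s t y : ℝ}
    (hf : MemLp f 2 (volume : Measure Cyl)) (hW : sp f t =ᵐ[freqVol] W)
    (h : sob s (fun p => ‖mulK W p‖ₑ) ≤ ENNReal.ofReal y) :
    normDxΛ s t f ≤ ENNReal.ofReal (rpi * y) := by
  rw [normDxΛ_eq hf, ENNReal.ofReal_mul rpi_pos.le]
  gcongr
  refine le_trans (l2_mono_ae (hW.mono fun p hp => ?_)) h
  rw [hp]
  show _ ≤ wt s p * ‖mulK W p‖ₑ
  rw [enorm_mulK, absK, ← Real.norm_eq_abs, ofReal_norm, mul_assoc, mul_left_comm]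

end Couette

end

theorem proposition4p1 (m n : ℝ) (hn : 2 < n) (hm : n < m - 3) :
    ∃ δ₀ : ℝ, 0 < δ₀ ∧ ∀ δ : ℝ, 0 < δ → δ ≤ δ₀ →
      ∀ ν : ℝ, 0 < ν → ν ≤ 1 →
      ∀ (ωin θin : Couette.Field)
        (ωi θi : ℝ → Couette.Field) (ui : ℝ → Couette.VField)
        (ωe θe : ℝ → Couette.Field) (ue : ℝ → Couette.VField),
        Couette.IsIdealSolution ν (ν ^ (-(1 / 6) : ℝ)) ωin θin ωi θi ui →
        Couette.IsErrorSolution ν n (ν ^ (-(1 / 6) : ℝ)) ωi θi ui ωe θe ue →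
        (∀ t ∈ Set.Icc (0 : ℝ) (ν ^ (-(1 / 6) : ℝ)),
          Couette.normΛ m t (ωi t) ≤ ENNReal.ofReal (δ * ν ^ (1 / 3 : ℝ)) ∧
          Couette.normJxΛ m t (θi t) ≤ ENNReal.ofReal (δ * ν ^ (2 / 3 : ℝ))) →
        ∀ t ∈ Set.Icc (0 : ℝ) (ν ^ (-(1 / 6) : ℝ)),
          Couette.normΛ n t (ωe t) ≤ ENNReal.ofReal (δ * ν ^ (2 / 3 : ℝ)) ∧
          ENNReal.ofReal (ν ^ (1 / 6 : ℝ)) * Couette.normDxΛ n t (θe t)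
              + Couette.normΛ n t (θe t) ≤ ENNReal.ofReal (δ * ν) := by
  have hn1 : 1 < n := by linarith
  set C := Couette.smallC (Couette.commR n) (Couette.algR n) (2 + 3 * 2 ^ n) with hC
  have hC0 : 0 ≤ C := by
    have := Couette.algR_nonneg n
    have := Couette.commR_nonneg (n := n) (by linarith)
    rw [hC, Couette.smallC]
    positivity
  refine ⟨1 / (4 * (C + 1)), by positivity, fun δ hδ hδ0 ν hν hν1 ωin θin ωi θi ui ωe θe ue hi he
    hb => ?_⟩
  have hpi := Couette.rpi_pos
  have hδC : δ * (C + 1) ≤ 1 / 4 := by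
    calc δ * (C + 1) ≤ 1 / (4 * (C + 1)) * (C + 1) := by gcongr
      _ = 1 / 4 := by field_simp
  -- with `κ = ν^{1/6}` all powers of the viscosity are integral
  obtain ⟨κ, hκ, hκ1, rfl⟩ : ∃ κ : ℝ, 0 < κ ∧ κ ≤ 1 ∧ ν = κ ^ 6 :=
    ⟨ν ^ (1 / 6 : ℝ), by positivity, Real.rpow_le_one hν.le hν1 (by norm_num), by
      rw [← Real.rpow_natCast, ← Real.rpow_mul hν.le]; norm_num⟩
  have hpow : ∀ x y : ℝ, 6 * x = y → (κ ^ 6) ^ x = κ ^ y := fun x y h => by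
    rw [← Real.rpow_natCast κ 6, ← Real.rpow_mul hκ.le, ← h]; norm_num
  have k1 : (κ ^ 6) ^ (-(1 / 6) : ℝ) = κ⁻¹ := by
    rw [hpow _ (-1) (by norm_num), Real.rpow_neg_one]
  have k2 : (κ ^ 6) ^ (1 / 3 : ℝ) = κ ^ 2 := by
    rw [hpow _ (2 : ℕ) (by norm_num), Real.rpow_natCast]
  have k3 : (κ ^ 6) ^ (2 / 3 : ℝ) = κ ^ 4 := by
    rw [hpow _ (4 : ℕ) (by norm_num), Real.rpow_natCast]
  have k4 : (κ ^ 6) ^ (1 / 6 : ℝ) = κ := by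
    rw [hpow _ 1 (by norm_num), Real.rpow_one]
  rw [k1] at hi he hb ⊢
  rw [k2, k3] at hb
  rw [k3, k4]
  obtain ⟨W, F, Bω, Bθ, hω, hθ, hS, hsp⟩ := Couette.exists_isErrorSpec (by linarith) hν.le
    (by positivity) hi he
  have hmem : 0 ≤ n := by linarith
  -- the amplitude on the Fourier side, where norms are smaller by the factor `√(2π)`
  set e := δ / Couette.rpi with he_def
  have heδ : e ≤ δ := div_le_self hδ.le Couette.one_le_rpi
  have he0 : 0 < e := by positivity
  have hδ1 : δ ≤ 1 := by nlinarith
  intro t ht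
  obtain ⟨h1, h2, h3⟩ := hS.bootstrap hn1 hκ hκ1 he0 (heδ.trans hδ1)
    (le_trans (mul_le_mul_of_nonneg_right heδ hC0) (by linarith))
    (fun s hs => by
      have := Couette.sob_sp_le_of_normΛ (hi.cont_ω.1 s hs) (hb s hs).1
      rw [mul_div_right_comm] at this
      exact (Couette.sob_le_sob (by linarith) _).trans this)
    (fun s hs => by
      have := Couette.sob_sp_le_of_normJxΛ (hi.cont_θ.1 s hs) (hb s hs).2
      rw [mul_div_right_comm] at this
      exact (Couette.sob_le_sob (by linarith) _).trans this) t ht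
  have mω := (he.cont_ω.contL2 hmem).1 t ht
  have mθ := (he.cont_θ.contL2 hmem).1 t ht
  have re : Couette.rpi * e = δ := mul_div_cancel₀ _ hpi.ne'
  constructor
  · refine (Couette.normΛ_le_of_sob mω (hsp t ht).1 h1).trans (le_of_eq ?_)
    rw [← mul_assoc, re]
  · have g1 := Couette.normΛ_le_of_sob mθ (hsp t ht).2 h2
    have g2 := Couette.normDxΛ_le_of_sob mθ (hsp t ht).2 h3
    refine (add_le_add (mul_le_mul_right g2 _) g1).trans ?_
    rw [← ENNReal.ofReal_mul hκ.le, ← ENNReal.ofReal_add (by positivity) (by positivity)]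
    refine ENNReal.ofReal_le_ofReal ?_
    have e1 : κ * (Couette.rpi * (e * κ ^ 5 / 8)) + Couette.rpi * (e * κ ^ 6 / 2) =
        5 / 8 * (Couette.rpi * e * κ ^ 6) := by ring
    rw [e1, re]
    have : 0 ≤ δ * κ ^ 6 := by positivity
    linarith
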